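/- Let $k$ be a local field of characteristic $0$ (archimedean or not), $\psi$ a nontrivial continuous unitary additive character of $k$, and $n\ge 1$. Let $G=\mathrm{Sp}(2n,k)$ act on $W=k^n\oplus k^n$ with its standard symplectic basis $e_1,\dots,e_n,f_1,\dots,f_n$. Let $T$ be the diagonal torus, $B$ the Borel subgroup stabilizing the flag $\langle e_1\rangle\subset\langle e_1,e_2\rangle\subset\cdots\subset\langle e_1,\dots,e_n\rangle$, $B^-$ the opposite Borel subgroup, $\alpha_i=\epsilon_i-\epsilon_{i+1}$ ($i<n$, short) and $\alpha_n=2\epsilon_n$ (long) the simple roots, and $x_{\pm\alpha}$ the root homomorphisms of the standard pinning: for $\alpha=\alpha_i$ with $i<n$, $x_\alpha(t)=\mathrm{diag}(1+tE_{i,i+1},\,1-tE_{i+1,i})$; for $\alpha=\alpha_n$, $x_\alpha(t)=\begin{pmatrix}1&tE_{nn}\\0&1\end{pmatrix}$; and $x_{-\alpha}(t)={}^t x_\alpha(t)$. Weil's metaplectic group is the group of pairs $(g,M)$ with $g\in G$ and $M$ a unitary operator on $L^2(k^n)$ such that $M\rho(w)=\rho(gw)M$ for all $w\in W$, where $\rho$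 is the Schrödinger representation $(\rho(x,y)\varphi)(u)=\psi(u\cdot x-\tfrac12 x\cdot y)\varphi(u-y)$ of the Heisenberg group, of central character $\psi$. The eightfold metaplectic covering $\tilde G=\mathrm{Mp}(2n,k)\to G$ is the subgroup of it generated by its derived subgroup and the scalars $\mu_8$; it is the push-out along $\mu_2\subset\mu_8$ of the twofold metaplectic covering. Elements of the unipotent radicals of $B$ and $B^-$ are lifted to $\tilde G$ by the $B$-equivariant, respectively $B^-$-equivariant, homomorphic sections of the covering. For a simple root $\alpha$ let $\tilde w_\alpha\in\tilde G$ be the following lift of the simple reflection $w_\alpha$. If $\alpha$ is short, $\tilde w_\alpha$ is the element $x_\alpha(1)x_{-\alpha}(-1)x_\alpha(1)$ of $\tilde G$. If $\alpha$ is long, $\tilde w_\alpha$ is the preimage in $\tilde G$ of the matrix $x_\alpha(1)x_{-\alpha}(-1)x_\alpha(1)\in G$ that acts on $L^2(k^n)$ as the unitary Fourier transform $\varphi\mapsto\int_k\varphi(u_1,\dots,u_{n-1},v)\,\psi(u_nv)\,dv$ in the last variable ($dv$ the self-dual Haar measure). Then: 1. For every simple root $\alpha$, the element $\tilde w_\alpha$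 exists and is unique. 2. If $\alpha$ is long, $\tilde w_\alpha$ differs from the element $x_\alpha(1)x_{-\alpha}(-1)x_\alpha(1)$ of $\tilde G$ by a factor in $\mu_8$, and $\tilde w_\alpha^2=-1$, where $-1$ is the canonical element of $\mathrm{Mp}(2,k)$ for the factor $\mathrm{Sp}(2)$ of $\alpha$: it lies over $-1\in\mathrm{Sp}(2,k)$, and acts as $1$ on functions that are even, and as $-1$ on functions that are odd, in the last variable. 3. For simple roots $\alpha\ne\beta$ one has in $\tilde G$ the braid relation $\tilde w_\alpha\tilde w_\beta\tilde w_\alpha\cdots=\tilde w_\beta\tilde w_\alpha\tilde w_\beta\cdots$ with $m_{\alpha\beta}$ factors on each side, $(m_{\alpha\beta})$ being the Coxeter matrix. 4. Every element $w$ of the Weyl group $W_0=N_G(T)/T$ has a reduced decomposition $w=w_{\beta_1}\cdots w_{\beta_r}$ into simple reflections, and $\tilde w=\tilde w_{\beta_1}\cdots\tilde w_{\beta_r}\in\tilde G$ does not depend on the reduced decomposition chosen. 5. More generally, let $M$ be the standard Levi subgroup of $G$ attached to a set $\Delta$ of simple roots, and let $w\in W(M)=N_G(M)/M$. There is exactly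 one $w_0\in W_0$ that represents $w$ and maps $\Delta$ into $\Delta$, and the lift $\tilde w:=\tilde w_0\in\tilde G$ formed from a reduced decomposition of $w_0$ does not depend on that decomposition. -/

import Mathlib

open Matrix MeasureTheory

noncomputable section

namespace SpringerMp

/-! ### The symplectic group and its standard pinning

Matrices act on column vectors `w = (x, y)`, with `x i = w (Sum.inl i)` the coordinates along
`e_1, …, e_n` and `y i = w (Sum.inr i)` those along `f_1, …, f_n`; the form is
`⟨(x, y), (x', y')⟩ = x ⬝ y' - y ⬝ x'`. -/

/-- The symplectic group `Sp(2n, k)`. -/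
abbrev Sp (n : ℕ) (k : Type*) [Field k] : Type _ := Matrix.symplecticGroup (Fin n) k

section Pinning

variable {n : ℕ} {k : Type*} [Field k]

/-- The simple roots are `α_i = ε_i - ε_{i+1}` for `i < n` (short) and `α_n = 2 ε_n` (long).
They are indexed by `Fin n`; the last index is the long root. -/
def IsLong (i : Fin n) : Prop := (i : ℕ) + 1 = n

/-- The matrix `x_α(t)`, for the simple root `α` with index `i`. -/
def rootMatrix (i : Fin n) (t : k) : Matrix (Fin n ⊕ Fin n) (Fin n ⊕ Fin n) k :=
  if h : (i : ℕ) + 1 < n then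
    fromBlocks (1 + Matrix.single i ⟨i + 1, h⟩ t) 0 0 (1 - Matrix.single ⟨i + 1, h⟩ i t)
  else fromBlocks 1 (Matrix.single i i t) 0 1

theorem rootMatrix_mem (i : Fin n) (t : k) :
    rootMatrix i t ∈ Matrix.symplecticGroup (Fin n) k := by
  unfold rootMatrix
  split_ifs with h
  · have hne : (⟨i + 1, h⟩ : Fin n) ≠ i := by
      intro e; have := congrArg Fin.val e; simp at this
    rw [SymplecticGroup.fromBlocks_mem_iff]
    refine ⟨by simp, by simp, ?_⟩
    simp [Matrix.add_mul, Matrix.mul_sub, hne.symm]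
  · rw [SymplecticGroup.fromBlocks_mem_iff]
    refine ⟨by simp, by simp, by simp⟩

/-- The root homomorphism `x_α`, `α` the simple root with index `i`. -/
def xPos (i : Fin n) (t : k) : Sp n k := ⟨rootMatrix i t, rootMatrix_mem i t⟩

/-- The root homomorphism `x_{-α}`, where `x_{-α}(t)` is the transpose of `x_α(t)`. -/
def xNeg (i : Fin n) (t : k) : Sp n k :=
  ⟨(rootMatrix i t)ᵀ, SymplecticGroup.transpose_mem (rootMatrix_mem i t)⟩

/-- The representative `x_α(1) x_{-α}(-1) x_α(1)` in `Sp(2n, k)` of the simple reflection `w_α`. -/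
def simpleRep (i : Fin n) : Sp n k := xPos i 1 * xNeg i (-1) * xPos i 1

/-- The product of the representatives of the simple reflections in the word `l`. -/
def wordRep (k : Type*) [Field k] {n : ℕ} (l : List (Fin n)) : Sp n k :=
  (l.map simpleRep).prod

variable (n k) in
/-- The diagonal maximal torus `T(k)`. -/
def torus : Subgroup (Sp n k) where
  carrier := {g | ∀ a b, a ≠ b → g.1 a b = 0}
  one_mem' a b hab := Matrix.one_apply_ne hab
  mul_mem' {g h} hg hh a b hab := by
    change (g.1 * h.1) a b = 0
    rw [Matrix.mul_apply]
    refine Finset.sum_eq_zero fun c _ => ?_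
    by_cases hc : a = c
    · subst hc; rw [hh a b hab, mul_zero]
    · rw [hg a c hc, zero_mul]
  inv_mem' {g} hg a b hab := by
    have hd : g.1 = Matrix.diagonal fun c => g.1 c c := by
      ext c d
      by_cases h : c = d
      · subst h; simp
      · rw [hg c d h, Matrix.diagonal_apply_ne _ h]
    rw [SymplecticGroup.coe_inv', hd, Matrix.inv_diagonal, Matrix.diagonal_apply_ne _ hab]

/-- Position in the basis `e_1, …, e_n, f_n, …, f_1`. -/
def flagPos : Fin n ⊕ Fin n → ℤ
  | Sum.inl i => i
  | Sum.inr i => 2 * n - 1 - i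

/-- Position in the reversed basis `f_1, …, f_n, e_n, …, e_1`, up to a shift. -/
def flagPosOpp (a : Fin n ⊕ Fin n) : ℤ := -flagPos a

theorem flagPos_injective : Function.Injective (flagPos (n := n)) := by
  rintro (i | i) (j | j) h <;> simp only [flagPos] at h
  · exact congrArg _ (Fin.ext (by omega))
  · have := i.2; have := j.2; omega
  · have := i.2; have := j.2; omega
  · exact congrArg _ (Fin.ext (by omega))

theorem flagPosOpp_injective : Function.Injective (flagPosOpp (n := n)) :=
  fun _ _ h => flagPos_injective (neg_injective h)

variable (k) in
/-- The symplectic matrices that are upper triangular for the order of the basis given by `b`: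
for `b = flagPos` the standard Borel subgroup `B(k)`, and for `b = flagPosOpp` the opposite one. -/
def borel (b : Fin n ⊕ Fin n → ℤ) : Subgroup (Sp n k) where
  carrier := {g | g.1.BlockTriangular b}
  one_mem' := Matrix.blockTriangular_one
  mul_mem' hg hh := Matrix.BlockTriangular.mul hg hh
  inv_mem' {g} hg := by
    change (g⁻¹).1.BlockTriangular b
    rw [SymplecticGroup.coe_inv']
    let := Matrix.invertibleOfIsUnitDet _ (SymplecticGroup.symplectic_det g.2)
    exact Matrix.blockTriangular_inv_of_blockTriangular hg

theorem diag_mul_of_mem_borel {b : Fin n ⊕ Fin n → ℤ} (hb : Function.Injective b)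
    {g h : Sp n k} (hg : g ∈ borel k b) (hh : h ∈ borel k b) (a : Fin n ⊕ Fin n) :
    (g * h).1 a a = g.1 a a * h.1 a a := by
  change (g.1 * h.1) a a = _
  rw [Matrix.mul_apply]
  refine Finset.sum_eq_single a (fun c _ hc => ?_) (by simp)
  rcases lt_or_gt_of_ne (hb.ne hc) with h1 | h1
  · rw [hg h1, zero_mul]
  · rw [hh h1, mul_zero]

variable (k) in
/-- The unipotent radical of `borel k b`: triangular matrices with diagonal entries `1`. -/
def unipotent (b : Fin n ⊕ Fin n → ℤ) (hb : Function.Injective b) : Subgroup (Sp n k) where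
  carrier := {g | g ∈ borel k b ∧ ∀ a, g.1 a a = 1}
  one_mem' := ⟨one_mem _, fun a => Matrix.one_apply_eq a⟩
  mul_mem' {g h} hg hh := ⟨mul_mem hg.1 hh.1, fun a => by
    rw [diag_mul_of_mem_borel hb hg.1 hh.1, hg.2, hh.2, one_mul]⟩
  inv_mem' {g} hg := ⟨inv_mem hg.1, fun a => by
    have := diag_mul_of_mem_borel hb hg.1 (inv_mem hg.1) a
    rw [mul_inv_cancel, hg.2, one_mul] at this
    exact this.symm.trans (Matrix.one_apply_eq a)⟩

theorem rootMatrix_blockTriangular (i : Fin n) (t : k) :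
    (rootMatrix i t).BlockTriangular flagPos := by
  unfold rootMatrix
  split_ifs with h
  · have hne : (⟨i + 1, h⟩ : Fin n) ≠ i := by
      intro e; have := congrArg Fin.val e; simp at this
    rintro (a | a) (c | c) hac <;> simp only [flagPos] at hac <;>
      simp only [fromBlocks_apply₁₁, fromBlocks_apply₁₂, fromBlocks_apply₂₁, fromBlocks_apply₂₂,
        Matrix.zero_apply, Matrix.add_apply, Matrix.sub_apply]
    · have h1 : a ≠ c := by rintro rfl; omega
      have h2 : ¬(i = a ∧ (⟨i + 1, h⟩ : Fin n) = c) := by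
        rintro ⟨rfl, rfl⟩; push_cast at hac; omega
      simp [Matrix.one_apply_ne h1, h2]
    · have h1 : a ≠ c := by rintro rfl; omega
      have h2 : ¬((⟨i + 1, h⟩ : Fin n) = a ∧ i = c) := by
        rintro ⟨rfl, rfl⟩; push_cast at hac; omega
      simp [Matrix.one_apply_ne h1, h2]
  · rintro (a | a) (c | c) hac <;> simp only [flagPos] at hac <;>
      simp only [fromBlocks_apply₁₁, fromBlocks_apply₁₂, fromBlocks_apply₂₁, fromBlocks_apply₂₂,
        Matrix.zero_apply]
    · exact Matrix.one_apply_ne (by rintro rfl; omega)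
    · have := a.2; have := c.2; omega
    · exact Matrix.one_apply_ne (by rintro rfl; omega)

theorem rootMatrix_diag (i : Fin n) (t : k) (a : Fin n ⊕ Fin n) : rootMatrix i t a a = 1 := by
  unfold rootMatrix
  split_ifs with h
  · have hne : (⟨i + 1, h⟩ : Fin n) ≠ i := by
      intro e; have := congrArg Fin.val e; simp at this
    rcases a with a | a
    · have h2 : ¬(i = a ∧ (⟨i + 1, h⟩ : Fin n) = a) := by
        rintro ⟨rfl, e⟩; exact hne e
      simp [h2]
    · have h2 : ¬((⟨i + 1, h⟩ : Fin n) = a ∧ i = a) := by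
        rintro ⟨e, rfl⟩; exact hne e
      simp [h2]
  · rcases a with a | a <;> simp

theorem xPos_mem (i : Fin n) (t : k) : xPos i t ∈ unipotent k flagPos flagPos_injective :=
  ⟨rootMatrix_blockTriangular i t, rootMatrix_diag i t⟩

theorem xNeg_mem (i : Fin n) (t : k) : xNeg i t ∈ unipotent k flagPosOpp flagPosOpp_injective :=
  ⟨fun _ _ h => rootMatrix_blockTriangular i t (neg_lt_neg_iff.mp h), rootMatrix_diag i t⟩

variable (k) in
/-- The standard Levi subgroup `M(k)` attached to a set `Δ` of simple roots; it is generated by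
`T(k)` and the root subgroups of `±α`, `α ∈ Δ`. For `Δ = ∅` it is `T(k)`. -/
def levi (Δ : Set (Fin n)) : Subgroup (Sp n k) :=
  Subgroup.closure
    ((torus n k : Set (Sp n k)) ∪ {g | ∃ i ∈ Δ, ∃ t : k, g = xPos i t ∨ g = xNeg i t})

/-- The group `W(M) = N_G(M) / M`. -/
abbrev weyl (M : Subgroup (Sp n k)) : Type _ :=
  (Subgroup.normalizer (M : Set (Sp n k))) ⧸ M.subgroupOf (Subgroup.normalizer (M : Set (Sp n k)))

/-- `g ∈ N_G(M)`, and its class in `W(M)` is `w`. -/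
def Represents (M : Subgroup (Sp n k)) (g : Sp n k) (w : weyl M) : Prop :=
  ∃ h : g ∈ Subgroup.normalizer (M : Set (Sp n k)), (QuotientGroup.mk ⟨g, h⟩ : weyl M) = w

/-- `w` is the product in the Weyl group `N_G(T) / T` of the simple reflections in the word `l`. -/
def IsDecomposition (l : List (Fin n)) (w : weyl (torus n k)) : Prop :=
  Represents (torus n k) (wordRep k l) w

/-- `l` is a reduced decomposition of `w`: one of minimal length. -/
def IsReducedDecomposition (l : List (Fin n)) (w : weyl (torus n k)) : Prop :=
  IsDecomposition l w ∧ ∀ l', IsDecomposition l' w → l.length ≤ l'.length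

/-- `w₀` in the Weyl group represents `w ∈ W(M)`, where `M` is the Levi subgroup attached to `Δ`,
and `w₀` sends each simple root of `M` to a simple root of `M` (seen on root subgroups). -/
def IsLeviRepresentative (Δ : Set (Fin n)) (w₀ : weyl (torus n k)) (w : weyl (levi k Δ)) : Prop :=
  ∃ g : Sp n k, Represents (torus n k) g w₀ ∧ Represents (levi k Δ) g w ∧
    ∀ i ∈ Δ, ∃ j ∈ Δ,
      (fun x => g * x * g⁻¹) '' Set.range (xPos (k := k) i) = Set.range (xPos (k := k) j)

end Pinning

/-! ### The Schrödinger model and the metaplectic group -/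

section Metaplectic

variable {n : ℕ} {k : Type*} [NontriviallyNormedField k] [ProperSpace k] [MeasurableSpace k]
  [BorelSpace k]

/-- The Hilbert space `L²(kⁿ)`, with respect to a product of Haar measures. -/
abbrev L2 (n : ℕ) (k : Type*) [NontriviallyNormedField k] [ProperSpace k] [MeasurableSpace k]
    [BorelSpace k] : Type _ :=
  Lp ℂ 2 (Measure.pi fun _ : Fin n => (Measure.addHaar : Measure k))

/-- The function `u ↦ ψ(u ⬝ x - x ⬝ y / 2) f(u - y)`, where `w = (x, y)`. -/
def schrodingerFun (ψ : AddChar k Circle) (w : Fin n ⊕ Fin n → k) (f : (Fin n → k) → ℂ)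
    (u : Fin n → k) : ℂ :=
  (ψ (u ⬝ᵥ (w ∘ Sum.inl) - 2⁻¹ * ((w ∘ Sum.inl) ⬝ᵥ (w ∘ Sum.inr))) : ℂ) * f (u - w ∘ Sum.inr)

theorem schrodingerFun_memLp {ψ : AddChar k Circle} (hψ : Continuous ψ) (w : Fin n ⊕ Fin n → k)
    (f : L2 n k) :
    MemLp (schrodingerFun ψ w f) 2
      (Measure.pi fun _ : Fin n => (Measure.addHaar : Measure k)) := by
  have h1 : MemLp (fun u => f (u - w ∘ Sum.inr)) 2
      (Measure.pi fun _ : Fin n => (Measure.addHaar : Measure k)) :=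
    (Lp.memLp f).comp_measurePreserving (measurePreserving_sub_right _ (w ∘ Sum.inr))
  refine h1.of_le (AEStronglyMeasurable.mul ?_ h1.1) (Filter.Eventually.of_forall fun u => ?_)
  · refine Continuous.aestronglyMeasurable ?_
    refine continuous_subtype_val.comp (hψ.comp ?_)
    unfold dotProduct
    fun_prop
  · rw [schrodingerFun, norm_mul, Circle.norm_coe, one_mul]

/-- The Schrödinger representation of the Heisenberg group `W × k`, `W = k²ⁿ`, with group law
`(w, t)(w', t') = (w + w', t + t' + ⟨w, w'⟩ / 2)` and central character `ψ`: the operator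
attached to `(w, 0)`. -/
def schrodinger (ψ : AddChar k Circle) (hψ : Continuous ψ) (w : Fin n ⊕ Fin n → k) (f : L2 n k) :
    L2 n k :=
  (schrodingerFun_memLp hψ w f).toLp

variable (n) in
/-- Weil's metaplectic group, an extension of `Sp(2n, k)` by the unit circle: the pairs `(g, M)`
with `g ∈ Sp(2n, k)` and `M` a unitary operator on `L²(kⁿ)` such that
`M ∘ ρ(w) = ρ(g w) ∘ M` for all `w`, where `ρ` is the Schrödinger representation. -/
def weilGroup (ψ : AddChar k Circle) (hψ : Continuous ψ) :
    Subgroup (Sp n k × (L2 n k ≃ₗᵢ[ℂ] L2 n k)) where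
  carrier := {p | ∀ w f, p.2 (schrodinger ψ hψ w f)
    = schrodinger ψ hψ (p.1.1 *ᵥ w) (p.2 f)}
  one_mem' w f := by simp
  mul_mem' {p q} hp hq w f := by
    have hp' := hp (q.1.1 *ᵥ w) (q.2 f)
    have hq' := hq w f
    rw [← hq', Matrix.mulVec_mulVec] at hp'
    exact hp'
  inv_mem' {p} hp w f := by
    have hp' := hp ((p.1⁻¹).1 *ᵥ w) (p.2⁻¹ f)
    have h1 : p.1.1 * (p.1⁻¹).1 = 1 := by
      have := congrArg Subtype.val (mul_inv_cancel p.1)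
      exact this
    have h2 : p.2 (p.2⁻¹ f) = f := p.2.apply_symm_apply f
    rw [Matrix.mulVec_mulVec, h1, Matrix.one_mulVec, h2] at hp'
    have h3 := congrArg (p.2⁻¹ ·) hp'
    have h4 : ∀ x, p.2⁻¹ (p.2 x) = x := p.2.symm_apply_apply
    simp only [h4] at h3
    exact h3.symm

variable (n k) in
/-- Multiplication by a complex number of absolute value `1` on `L²(kⁿ)`. -/
def scalarOp (ζ : Circle) : L2 n k ≃ₗᵢ[ℂ] L2 n k where
  toFun f := (ζ : ℂ) • f
  invFun f := ((ζ⁻¹ : Circle) : ℂ) • f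
  map_add' f g := smul_add _ f g
  map_smul' c f := smul_comm _ c f
  left_inv f := by
    change ((ζ⁻¹ : Circle) : ℂ) • (ζ : ℂ) • f = f
    rw [smul_smul, ← Circle.coe_mul, inv_mul_cancel, Circle.coe_one, one_smul]
  right_inv f := by
    change (ζ : ℂ) • ((ζ⁻¹ : Circle) : ℂ) • f = f
    rw [smul_smul, ← Circle.coe_mul, mul_inv_cancel, Circle.coe_one, one_smul]
  norm_map' f := by
    change ‖(ζ : ℂ) • f‖ = ‖f‖
    rw [norm_smul, Circle.norm_coe, one_mul]

variable (n k) in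
/-- The central subgroup `μ₈`, of the pairs `(1, ζ)` with `ζ⁸ = 1`. -/
def mu8 : Subgroup (Sp n k × (L2 n k ≃ₗᵢ[ℂ] L2 n k)) where
  carrier := {p | ∃ ζ : Circle, ζ ^ 8 = 1 ∧ p = (1, scalarOp n k ζ)}
  one_mem' := ⟨1, one_pow 8, Prod.ext rfl (by ext1 f; simp [scalarOp])⟩
  mul_mem' := by
    rintro _ _ ⟨ζ, hζ, rfl⟩ ⟨ξ, hξ, rfl⟩
    refine ⟨ζ * ξ, by rw [mul_pow, hζ, hξ, one_mul], Prod.ext (one_mul _) ?_⟩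
    ext1 f
    change (ζ : ℂ) • (ξ : ℂ) • f = ((ζ * ξ : Circle) : ℂ) • f
    rw [smul_smul, Circle.coe_mul]
  inv_mem' := by
    rintro _ ⟨ζ, hζ, rfl⟩
    exact ⟨ζ⁻¹, by rw [inv_pow, hζ, inv_one], Prod.ext inv_one (by ext1 f; rfl)⟩

variable (n) in
/-- The eightfold metaplectic group `Mp(2n, k)`: the subgroup of Weil's group generated by `μ₈` and
the derived subgroup. The derived subgroup of Weil's group is the twofold metaplectic covering of
`Sp(2n, k)` (for `k` complex, where that covering splits, it is a copy of `Sp(2n, k)`), so this is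
the push-out of the twofold covering along `μ₂ ⊆ μ₈`. -/
def metaplectic (ψ : AddChar k Circle) (hψ : Continuous ψ) :
    Subgroup (Sp n k × (L2 n k ≃ₗᵢ[ℂ] L2 n k)) :=
  ⁅weilGroup n ψ hψ, weilGroup n ψ hψ⁆ ⊔ mu8 n k

variable {ψ : AddChar k Circle} {hψ : Continuous ψ}

/-- The covering map to `Sp(2n, k)`. -/
def proj (z : metaplectic n ψ hψ) : Sp n k := z.1.1

/-- The Weil representation `ω_ψ`. -/
def weilRep (z : metaplectic n ψ hψ) : L2 n k ≃ₗᵢ[ℂ] L2 n k := z.1.2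

/-- `s` is a `P(k)`-equivariant splitting over `U(k)` of the metaplectic covering
(conjugation by an element `p` of `P(k)` on the covering being that by any preimage of `p`). -/
def IsEquivariantSplitting (P U : Subgroup (Sp n k)) (s : U →* metaplectic n ψ hψ) : Prop :=
  (∀ u, proj (s u) = u) ∧
  ∀ p : metaplectic n ψ hψ, proj p ∈ P → ∀ u v : U, (v : Sp n k) = proj p * u * (proj p)⁻¹ →
    s v = p * s u * p⁻¹

/-- `z` is the element `x_α(1) x_{-α}(-1) x_α(1)` of the metaplectic group, where `x_{±α}` are
lifted by the equivariant splittings over the unipotent radicals of `B` and its opposite. -/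
def IsSpringerElement (i : Fin n) (z : metaplectic n ψ hψ) : Prop :=
  ∃ (s : unipotent k flagPos flagPos_injective →* metaplectic n ψ hψ)
    (s' : unipotent k flagPosOpp flagPosOpp_injective →* metaplectic n ψ hψ),
    IsEquivariantSplitting (borel k flagPos) _ s ∧
    IsEquivariantSplitting (borel k flagPosOpp) _ s' ∧
    z = s ⟨xPos i 1, xPos_mem i 1⟩ * s' ⟨xNeg i (-1), xNeg_mem i (-1)⟩ * s ⟨xPos i 1, xPos_mem i 1⟩

/-- The operator `M` is the unitary Fourier transform in the `i`-th variable,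
`(M f)(u) = ∫ f(…, v, …) ψ(u_i v) dv`. As `M` is unitary, `dv` is the self-dual Haar measure. -/
def IsPartialFourier (ψ : AddChar k Circle) (i : Fin n) (M : L2 n k ≃ₗᵢ[ℂ] L2 n k) : Prop :=
  ∃ ν : Measure k, ν.IsAddHaarMeasure ∧
    ∀ f : L2 n k, Integrable f (Measure.pi fun _ : Fin n => (Measure.addHaar : Measure k)) →
      M f =ᵐ[Measure.pi fun _ : Fin n => (Measure.addHaar : Measure k)]
        fun u => ∫ v, f (Function.update u i v) * (ψ (u i * v) : ℂ) ∂ν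

/-- `z` is the lift `w̃_α` of the simple reflection `w_α`, `α` the simple root with index `i`.
For `α` long, it is the preimage of `x_α(1) x_{-α}(-1) x_α(1)` that acts in the Schrödinger model
as the unitary Fourier transform (in the variable belonging to the `Sp(2)` of `α`). -/
def IsSimpleLift (i : Fin n) (z : metaplectic n ψ hψ) : Prop :=
  (¬ IsLong i → IsSpringerElement i z) ∧
  (IsLong i → proj z = simpleRep i ∧ IsPartialFourier ψ i (weilRep z))

/-- `z` is the canonical element `-1` of `Mp(2, k)`, for the factor `Sp(2)` in the `i`-th
coordinates: it lies over `-1 ∈ Sp(2, k)`, and it acts as `1` on functions that are even in the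
`i`-th variable and as `-1` on those that are odd in it. -/
def IsNegOne (i : Fin n) (z : metaplectic n ψ hψ) : Prop :=
  (proj z).1 =
    Matrix.diagonal (fun a => if a = Sum.inl i ∨ a = Sum.inr i then -1 else 1) ∧
  ∀ f : L2 n k,
    ((f =ᵐ[Measure.pi fun _ : Fin n => (Measure.addHaar : Measure k)]
        fun u => f (Function.update u i (-u i))) → weilRep z f = f) ∧
    ((f =ᵐ[Measure.pi fun _ : Fin n => (Measure.addHaar : Measure k)]
        fun u => -f (Function.update u i (-u i))) → weilRep z f = -f)

/-- The product of the lifts of the simple reflections in the word `l`. -/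
def wordLift (wt : Fin n → metaplectic n ψ hψ) (l : List (Fin n)) : metaplectic n ψ hψ :=
  (l.map wt).prod

end Metaplectic

end SpringerMp

end

noncomputable section

namespace SpringerMp

set_option linter.unusedSectionVars false

open Filter Topology
open scoped ENNReal NNReal ComplexConjugate

section OneVariable

variable {k : Type*} [NontriviallyNormedField k] [ProperSpace k] [MeasurableSpace k] [BorelSpace k]

/-- The Fourier transform on `k` for the character `ψ` and the measure `μ`. -/
def ft (ψ : AddChar k Circle) (μ : Measure k) (f : k → ℂ) (x : k) : ℂ :=
  ∫ v, f v * (ψ (x * v) : ℂ) ∂μ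

theorem continuous_addChar_mul {ψ : AddChar k Circle} (hψ : Continuous ψ) :
    Continuous fun p : k × k => (ψ (p.1 * p.2) : ℂ) :=
  continuous_subtype_val.comp (hψ.comp (continuous_fst.mul continuous_snd))

theorem continuous_addChar_mul_left {ψ : AddChar k Circle} (hψ : Continuous ψ) (x : k) :
    Continuous fun v : k => (ψ (x * v) : ℂ) :=
  continuous_subtype_val.comp (hψ.comp (continuous_const.mul continuous_id))

theorem integrable_mul_addChar {α : Type*} [MeasurableSpace α] {ν : Measure α} {f : α → ℂ}
    (hf : Integrable f ν) {χ : α → Circle} (hχ : AEStronglyMeasurable (fun v => (χ v : ℂ)) ν) :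
    Integrable (fun v => f v * (χ v : ℂ)) ν := by
  refine hf.mono (hf.1.mul hχ) (Eventually.of_forall fun v => ?_)
  simp [Circle.norm_coe]

variable {ψ : AddChar k Circle} (hψ : Continuous ψ) {μ : Measure k}

include hψ in
theorem integrable_ft_integrand {f : k → ℂ} (hf : Integrable f μ) (x : k) :
    Integrable (fun v => f v * (ψ (x * v) : ℂ)) μ :=
  integrable_mul_addChar hf (continuous_addChar_mul_left hψ x).aestronglyMeasurable

theorem norm_ft_le (f : k → ℂ) (x : k) : ‖ft ψ μ f x‖ ≤ ∫ v, ‖f v‖ ∂μ := by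
  refine (norm_integral_le_integral_norm _).trans_eq ?_
  simp [Circle.norm_coe]

include hψ in
theorem continuous_ft {f : k → ℂ} (hf : Integrable f μ) : Continuous (ft ψ μ f) := by
  refine continuous_of_dominated (bound := fun v => ‖f v‖) (fun x => ?_)
    (fun x => Eventually.of_forall fun v => by simp [Circle.norm_coe]) hf.norm (Eventually.of_forall fun v => ?_)
  · exact (integrable_ft_integrand hψ hf x).1
  · exact continuous_const.mul ((continuous_addChar_mul hψ).comp (continuous_id.prodMk continuous_const))

theorem ft_neg_char (f : k → ℂ) (x : k) : ft ψ⁻¹ μ f x = ft ψ μ f (-x) := by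
  simp only [ft, AddChar.inv_apply]
  congr 1; ext v; rw [← neg_mul]

theorem conj_ft (f : k → ℂ) (x : k) :
    conj (ft ψ μ f x) = ft ψ μ (fun v => conj (f v)) (-x) := by
  simp only [ft, ← integral_conj]
  congr 1; ext v
  rw [map_mul, neg_mul, AddChar.map_neg_eq_inv, Circle.coe_inv_eq_conj]

include hψ in
/-- The multiplication formula, with the kernel `ψ(ℓ(p) x)`. -/
theorem integral_kernel_swap {α : Type*} [MeasurableSpace α] {ν : Measure α} [SFinite ν]
    [SFinite μ] {ℓ : α → k} (hℓ : Measurable ℓ) {H : α → ℂ} {g : k → ℂ} (hH : Integrable H ν)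
    (hg : Integrable g μ) :
    ∫ x, (∫ p, H p * (ψ (x * ℓ p) : ℂ) ∂ν) * g x ∂μ = ∫ p, H p * ft ψ μ g (ℓ p) ∂ν := by
  have hm : Measurable fun q : k × α => (ψ (q.1 * ℓ q.2) : ℂ) :=
    (continuous_addChar_mul hψ).measurable.comp
      (measurable_fst.prodMk (hℓ.comp measurable_snd))
  have hI : Integrable (fun q : k × α => (g q.1 * H q.2) * (ψ (q.1 * ℓ q.2) : ℂ)) (μ.prod ν) :=
    integrable_mul_addChar (hg.mul_prod hH) hm.aestronglyMeasurable
  have h := integral_integral_swap (f := fun x p => (g x * H p) * (ψ (x * ℓ p) : ℂ)) hI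
  calc _ = ∫ x, ∫ p, (g x * H p) * (ψ (x * ℓ p) : ℂ) ∂ν ∂μ := by
        congr 1; ext x
        rw [mul_comm, ← integral_const_mul]
        congr 1; ext p; ring
    _ = _ := by
        rw [h]; congr 1; ext p
        rw [ft, ← integral_const_mul]
        congr 1; ext x; rw [mul_comm x]; ring

include hψ in
theorem integral_ft_mul [SFinite μ] {f g : k → ℂ} (hf : Integrable f μ) (hg : Integrable g μ) :
    ∫ x, ft ψ μ f x * g x ∂μ = ∫ x, f x * ft ψ μ g x ∂μ :=
  integral_kernel_swap hψ measurable_id hf hg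

variable [μ.IsAddHaarMeasure]

theorem ft_translate (f : k → ℂ) (t x : k) :
    ft ψ μ (fun v => f (v + t)) x = (ψ (-(x * t)) : ℂ) * ft ψ μ f x := by
  simp only [ft]
  rw [← integral_const_mul, ← integral_add_right_eq_self
    (fun v => (ψ (-(x * t)) : ℂ) * (f v * (ψ (x * v) : ℂ))) t]
  congr 1; ext v
  have : (ψ (x * v) : ℂ) = (ψ (-(x * t)) : ℂ) * (ψ (x * (v + t)) : ℂ) := by
    rw [← Circle.coe_mul, ← AddChar.map_add_eq_mul]; congr 2; ring
  rw [this]; ring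

theorem ft_even {f : k → ℂ} (hf : ∀ x, f (-x) = f x) (x : k) : ft ψ μ f (-x) = ft ψ μ f x := by
  simp only [ft]
  rw [← integral_neg_eq_self]
  congr 1; ext v; rw [hf]; congr 3; ring

variable (μ) in
/-- Multiplication by `a ≠ 0` multiplies a Haar measure by a constant. -/
theorem exists_map_mul_left_eq_smul {a : k} (ha : a ≠ 0) :
    ∃ c : ℝ≥0, 0 < c ∧ μ.map (a * ·) = c • μ := by
  let φ : k ≃ₜ+ k :=
    { toFun := (a * ·)
      invFun := (a⁻¹ * ·)
      left_inv := fun x => by simp [ha]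
      right_inv := fun x => by simp [ha]
      map_add' := mul_add a
      continuous_toFun := continuous_const.mul continuous_id
      continuous_invFun := continuous_const.mul continuous_id }
  have h := addEquivAddHaarChar_smul_map μ φ
  have hp := addEquivAddHaarChar_pos φ
  refine ⟨(addEquivAddHaarChar φ)⁻¹, inv_pos.2 hp, ?_⟩
  conv_rhs => rw [← h]
  rw [smul_smul, inv_mul_cancel₀ hp.ne', one_smul]
  rfl

theorem measure_ball_pow {c : k} (hc : 1 < ‖c‖) :
    ∃ M : ℝ≥0, ∀ (j : ℕ) (R : ℝ), μ (Metric.ball 0 (‖c‖ ^ j * R)) = M ^ j * μ (Metric.ball 0 R) := by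
  have hc0 : c ≠ 0 := by rintro rfl; simp at hc; linarith
  obtain ⟨m, hm, hmap⟩ := exists_map_mul_left_eq_smul μ hc0
  have hm0 : (m : ℝ≥0∞) ≠ 0 := by exact_mod_cast hm.ne'
  have key : ∀ R : ℝ, μ (Metric.ball 0 (‖c‖ * R)) = (m⁻¹ : ℝ≥0) * μ (Metric.ball 0 R) := by
    intro R
    have h1 : (c * ·) ⁻¹' Metric.ball (0 : k) (‖c‖ * R) = Metric.ball 0 R := by
      ext x
      simp [norm_pos_iff.2 hc0]
    have h2 : μ.map (c * ·) (Metric.ball 0 (‖c‖ * R)) = μ (Metric.ball 0 R) := by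
      rw [Measure.map_apply (by fun_prop) measurableSet_ball, h1]
    rw [hmap, Measure.smul_apply, ENNReal.smul_def, smul_eq_mul] at h2
    rw [← h2, ← mul_assoc, ENNReal.coe_inv hm.ne', ENNReal.inv_mul_cancel hm0 ENNReal.coe_ne_top,
      one_mul]
  refine ⟨m⁻¹, fun j => ?_⟩
  induction j with
  | zero => simp
  | succ j ih => intro R; rw [pow_succ', mul_assoc, key, ih]; rw [pow_succ']; ring

/-- Functions with enough polynomial decay are integrable. -/
theorem exists_pow_integrable :
    ∃ m : ℕ, ∀ (H : k → ℂ) (C R : ℝ), 0 < R → Continuous H →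
      (∀ y, R ≤ ‖y‖ → ‖H y‖ ≤ (C / ‖y‖) ^ m) → Integrable H μ := by
  obtain ⟨c, hc⟩ := NormedField.exists_one_lt_norm k
  obtain ⟨M, hM⟩ := measure_ball_pow (μ := μ) hc
  obtain ⟨m, hm⟩ : ∃ m : ℕ, 2 * (M : ℝ) < ‖c‖ ^ m := pow_unbounded_of_one_lt _ hc
  have hm' : (M : ℝ) / ‖c‖ ^ m < 1 / 2 := by
    rw [div_lt_iff₀ (by positivity)]; linarith
  refine ⟨m, fun H C R hR hH hdec => ?_⟩
  have hcpos : 0 < ‖c‖ := by linarith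
  set A : ℕ → Set k := fun j => Metric.ball 0 (‖c‖ ^ (j + 1) * R) \ Metric.ball 0 (‖c‖ ^ j * R)
  have hcov : (Set.univ : Set k) ⊆ Metric.ball 0 R ∪ ⋃ j, A j := by
    intro y _
    by_cases hy : ‖y‖ < R
    · left; simpa using hy
    · right
      obtain ⟨j, hj⟩ : ∃ j : ℕ, ‖y‖ / R < ‖c‖ ^ j := pow_unbounded_of_one_lt _ hc
      have hex : ∃ j : ℕ, ‖y‖ < ‖c‖ ^ j * R := ⟨j, by rwa [div_lt_iff₀ hR] at hj⟩
      classical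
      have h1 := Nat.find_spec hex
      have h0 : Nat.find hex ≠ 0 := by
        intro h; rw [h] at h1; simp at h1; exact hy h1
      obtain ⟨i, hi⟩ := Nat.exists_eq_succ_of_ne_zero h0
      have h2 := Nat.find_min hex (m := i) (by omega)
      rw [hi] at h1
      exact Set.mem_iUnion.2 ⟨i, by simpa using h1, by simpa using h2⟩
  have hfin : ∀ r : ℝ, μ (Metric.ball 0 r) < ∞ := fun r => measure_ball_lt_top
  refine ⟨hH.aestronglyMeasurable, ?_⟩
  rw [hasFiniteIntegral_iff_norm, ← setLIntegral_univ]
  refine (lintegral_mono_set hcov).trans_lt ((lintegral_union_le _ _ _).trans_lt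
    (ENNReal.add_lt_top.2 ⟨?_, ?_⟩))
  · have hK : IntegrableOn H (Metric.ball 0 R) μ :=
      (hH.continuousOn.integrableOn_compact (isCompact_closedBall 0 R)).mono_set
        Metric.ball_subset_closedBall
    have := hK.2
    rwa [hasFiniteIntegral_iff_norm] at this
  · refine (lintegral_iUnion_le _ _).trans_lt ?_
    set B := μ (Metric.ball 0 R)
    set D : ℝ := (|C| / R) ^ m
    have hterm : ∀ j, ∫⁻ y in A j, ENNReal.ofReal ‖H y‖ ∂μ
        ≤ ENNReal.ofReal ((1 / 2) ^ j) * (ENNReal.ofReal D * (M * B)) := by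
      intro j
      have hb : ∀ y ∈ A j, ENNReal.ofReal ‖H y‖ ≤ ENNReal.ofReal (D / (‖c‖ ^ m) ^ j) := by
        intro y hy
        have hy2 : ‖c‖ ^ j * R ≤ ‖y‖ := by simpa using hy.2
        have hRy : R ≤ ‖y‖ := le_trans (le_mul_of_one_le_left hR.le (one_le_pow₀ hc.le)) hy2
        refine ENNReal.ofReal_le_ofReal ((hdec y hRy).trans ?_)
        calc (C / ‖y‖) ^ m ≤ |(C / ‖y‖) ^ m| := le_abs_self _
          _ = (|C| / ‖y‖) ^ m := by rw [abs_pow, abs_div, abs_of_nonneg (norm_nonneg y)]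
          _ ≤ (|C| / (‖c‖ ^ j * R)) ^ m := by gcongr
          _ = D / (‖c‖ ^ m) ^ j := by
              simp only [D, div_pow, mul_pow, ← pow_mul, mul_comm m j]; field_simp
      calc ∫⁻ y in A j, ENNReal.ofReal ‖H y‖ ∂μ
          ≤ ∫⁻ y in A j, ENNReal.ofReal (D / (‖c‖ ^ m) ^ j) ∂μ :=
            setLIntegral_mono measurable_const hb
        _ = ENNReal.ofReal (D / (‖c‖ ^ m) ^ j) * μ (A j) := by rw [setLIntegral_const]
        _ ≤ ENNReal.ofReal (D / (‖c‖ ^ m) ^ j) * (M ^ (j + 1) * B) := by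
            rw [← hM]; gcongr; exact Set.sdiff_subset
        _ = ENNReal.ofReal (((M : ℝ) / ‖c‖ ^ m) ^ j) * (ENNReal.ofReal D * (M * B)) := by
            have e1 : D / (‖c‖ ^ m) ^ j = D * ((‖c‖ ^ m) ^ j)⁻¹ := div_eq_mul_inv _ _
            have e2 : ((M : ℝ) / ‖c‖ ^ m) ^ j = (M : ℝ) ^ j * ((‖c‖ ^ m) ^ j)⁻¹ := by
              rw [div_pow, div_eq_mul_inv]
            rw [e1, e2, ENNReal.ofReal_mul (by positivity), ENNReal.ofReal_mul (by positivity),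
              ENNReal.ofReal_pow M.coe_nonneg, ENNReal.ofReal_coe_nnreal, pow_succ]
            ring
        _ ≤ _ := by gcongr
    refine (ENNReal.tsum_le_tsum hterm).trans_lt ?_
    rw [ENNReal.tsum_mul_right]
    refine ENNReal.mul_lt_top ?_ (ENNReal.mul_lt_top ENNReal.ofReal_lt_top
      (ENNReal.mul_lt_top ENNReal.coe_lt_top (hfin R)))
    rw [← ENNReal.ofReal_tsum_of_nonneg (fun _ => by positivity) (summable_geometric_two)]
    exact ENNReal.ofReal_lt_top

end OneVariable

section OneVariable

variable {k : Type*} [NontriviallyNormedField k] [ProperSpace k] [MeasurableSpace k] [BorelSpace k]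

/-- Continuous compactly supported nonnegative even functions that are positive at `0`. -/
structure IsBump (g : k → ℝ) : Prop where
  continuous : Continuous g
  hasCompactSupport : HasCompactSupport g
  nonneg : ∀ x, 0 ≤ g x
  even : ∀ x, g (-x) = g x
  pos : 0 < g 0

/-- The self-convolution of a real function. -/
def selfConv (μ : Measure k) (g : k → ℝ) : k → ℝ :=
  convolution g g (ContinuousLinearMap.mul ℝ ℝ) μ

variable {ψ : AddChar k Circle} (hψ : Continuous ψ) {μ : Measure k} [μ.IsAddHaarMeasure]

theorem IsBump.integrable {g : k → ℝ} (hg : IsBump g) : Integrable g μ :=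
  hg.continuous.integrable_of_hasCompactSupport hg.hasCompactSupport

theorem IsBump.selfConv {g : k → ℝ} (hg : IsBump g) : IsBump (selfConv μ g) := by
  have hdef : ∀ x, SpringerMp.selfConv μ g x = ∫ t, g t * g (x - t) ∂μ := fun x => rfl
  refine ⟨?_, ?_, ?_, ?_, ?_⟩
  · exact hg.hasCompactSupport.continuous_convolution_right _ hg.integrable.locallyIntegrable
      hg.continuous
  · exact hg.hasCompactSupport.convolution _ hg.hasCompactSupport
  · intro x; rw [hdef]; exact integral_nonneg fun t => mul_nonneg (hg.nonneg _) (hg.nonneg _)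
  · intro x
    rw [hdef, hdef, ← integral_neg_eq_self]
    congr 1; ext t
    rw [hg.even, ← hg.even (x - t)]; congr 2; ring
  · rw [hdef]
    refine Continuous.integral_pos_of_hasCompactSupport_nonneg_nonzero (x := 0) ?_ ?_ ?_ ?_
    · exact hg.continuous.mul (hg.continuous.comp (continuous_const.sub continuous_id))
    · exact hg.hasCompactSupport.mul_right
    · exact fun t => mul_nonneg (hg.nonneg _) (hg.nonneg _)
    · simp [hg.pos.ne']

include hψ in
theorem ft_selfConv {g : k → ℝ} (hg : IsBump g) (y : k) :
    ft ψ μ (fun x => (selfConv μ g x : ℂ)) y = ft ψ μ (fun x => (g x : ℂ)) y ^ 2 := by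
  set h : k → ℂ := fun x => (g x : ℂ) * (ψ (y * x) : ℂ)
  have hI : Integrable h μ := integrable_ft_integrand hψ hg.integrable.ofReal y
  have h1 := integral_convolution (μ := μ) (ν := μ) (ContinuousLinearMap.mul ℂ ℂ) hI hI
  have h2 : ft ψ μ (fun x => (g x : ℂ)) y = ∫ x, h x ∂μ := rfl
  rw [h2, sq]
  refine Eq.trans ?_ h1
  unfold ft
  congr 1; ext x
  change ((∫ t, g t * g (x - t) ∂μ : ℝ) : ℂ) * _ = ∫ t, h t * h (x - t) ∂μ
  rw [← integral_complex_ofReal, ← integral_mul_const]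
  congr 1; ext t
  have : (ψ (y * x) : ℂ) = ψ (y * t) * ψ (y * (x - t)) := by
    rw [← Circle.coe_mul, ← AddChar.map_add_eq_mul]; congr 2; ring
  simp only [h, this]; push_cast; ring

theorem ft_eq_re {g : k → ℝ} (hg : ∀ x, g (-x) = g x) (y : k) :
    ft ψ μ (fun x => (g x : ℂ)) y = ((ft ψ μ (fun x => (g x : ℂ)) y).re : ℂ) := by
  refine (Complex.conj_eq_iff_re.1 ?_).symm
  rw [conj_ft, ft_even]
  · simp
  · intro x; simp [hg]

variable (k) in
/-- The tent function of the norm. -/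
def tent (x : k) : ℝ := max 0 (1 - ‖x‖)

theorem isBump_tent : IsBump (tent k) where
  continuous := by unfold tent; fun_prop
  hasCompactSupport := by
    refine HasCompactSupport.intro (isCompact_closedBall (0 : k) 1) fun x hx => ?_
    have : 1 < ‖x‖ := by simpa using hx
    exact max_eq_left (by linarith)
  nonneg x := le_max_left _ _
  even x := by simp [tent]
  pos := by simp [tent]

include hψ in
theorem ft_tent_decay (hψ₁ : ψ ≠ 1) : ∃ C R : ℝ, 0 < R ∧
    ∀ y : k, R ≤ ‖y‖ → ‖ft ψ μ (fun x => (tent k x : ℂ)) y‖ ≤ C / ‖y‖ := by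
  obtain ⟨s, hs⟩ := DFunLike.ne_iff.1 hψ₁
  have hs0 : s ≠ 0 := by rintro rfl; simp at hs
  set δ : ℝ := ‖(ψ s : ℂ) - 1‖
  have hδ : 0 < δ := norm_pos_iff.2 (sub_ne_zero.2 fun h => hs (by ext; simpa using h))
  set V : ℝ := μ.real (Metric.closedBall 0 2)
  have hf : Integrable (fun x : k => (tent k x : ℂ)) μ := isBump_tent.integrable.ofReal
  refine ⟨‖s‖ * V / δ, ‖s‖, norm_pos_iff.2 hs0, fun y hy => ?_⟩
  have hy0 : 0 < ‖y‖ := (norm_pos_iff.2 hs0).trans_le hy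
  have hyn : y ≠ 0 := norm_pos_iff.1 hy0
  set t : k := -(s / y)
  have ht : ‖t‖ = ‖s‖ / ‖y‖ := by simp [t]
  have ht1 : ‖t‖ ≤ 1 := by rw [ht]; exact (div_le_one hy0).2 hy
  have hyt : -(y * t) = s := by simp only [t]; field_simp
  have hft : Integrable (fun x : k => (tent k (x + t) : ℂ)) μ := hf.comp_add_right t
  have h1 : ((ψ s : ℂ) - 1) * ft ψ μ (fun x => (tent k x : ℂ)) y
      = ft ψ μ (fun x => (tent k (x + t) : ℂ) - tent k x) y := by
    have h2 := ft_translate (ψ := ψ) (μ := μ) (fun x => (tent k x : ℂ)) t y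
    rw [hyt] at h2
    rw [sub_mul, one_mul, ← h2]
    simp only [ft]
    rw [← integral_sub (integrable_ft_integrand hψ hft y) (integrable_ft_integrand hψ hf y)]
    congr 1; ext v; ring
  have hb : ∀ x : k, ‖(tent k (x + t) : ℂ) - tent k x‖
      ≤ (Metric.closedBall (0 : k) 2).indicator (fun _ => ‖t‖) x := by
    intro x
    rw [← Complex.ofReal_sub, Complex.norm_real]
    by_cases hx : x ∈ Metric.closedBall (0 : k) 2
    · rw [Set.indicator_of_mem hx, Real.norm_eq_abs]
      have := abs_norm_sub_norm_le (x + t) x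
      have e : x + t - x = t := by ring
      rw [e] at this
      unfold tent
      rw [max_comm, max_comm 0]
      refine (abs_max_sub_max_le_abs _ _ 0).trans ?_
      rwa [show (1 - ‖x + t‖) - (1 - ‖x‖) = -(‖x + t‖ - ‖x‖) by ring, abs_neg]
    · rw [Set.indicator_of_notMem hx]
      have hx2 : 2 < ‖x‖ := by simpa using hx
      have : ‖x‖ ≤ ‖x + t‖ + ‖t‖ := by
        have := norm_sub_le (x + t) t; simpa using this
      unfold tent
      rw [max_eq_left (by linarith), max_eq_left (by linarith)]; simp
  have h3 : ‖ft ψ μ (fun x => (tent k (x + t) : ℂ) - tent k x) y‖ ≤ V * ‖t‖ := by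
    refine (norm_ft_le _ _).trans ?_
    refine (integral_mono (hft.sub hf).norm ?_ hb).trans_eq ?_
    · exact (integrable_indicator_iff measurableSet_closedBall).2
        (integrableOn_const (isCompact_closedBall (0 : k) 2).measure_lt_top.ne)
    · rw [integral_indicator measurableSet_closedBall, setIntegral_const, smul_eq_mul]
  rw [← h1, norm_mul] at h3
  rw [ht] at h3
  rw [le_div_iff₀ hy0, le_div_iff₀ hδ]
  rw [mul_div_assoc', le_div_iff₀ hy0] at h3
  linarith

include hψ in
/-- There is a bump function with integrable nonnegative Fourier transform. -/
theorem exists_bump_ft_integrable (hψ₁ : ψ ≠ 1) : ∃ g G : k → ℝ, IsBump g ∧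
    (∀ x, ft ψ μ (fun v => (g v : ℂ)) x = (G x : ℂ)) ∧ (∀ x, 0 ≤ G x) ∧ Continuous G ∧
    Integrable G μ ∧ 0 < G 0 := by
  obtain ⟨m, hm⟩ := exists_pow_integrable (μ := μ)
  obtain ⟨C, R, hR, hdec⟩ := ft_tent_decay hψ (μ := μ) hψ₁
  let g : ℕ → k → ℝ := fun j => (selfConv μ)^[j] (tent k)
  have hg : ∀ j, IsBump (g j) := by
    intro j
    induction j with
    | zero => exact isBump_tent
    | succ j ih => simp only [g, Function.iterate_succ_apply']; exact ih.selfConv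
  have hft : ∀ j y, ft ψ μ (fun v => (g j v : ℂ)) y
      = ft ψ μ (fun v => (tent k v : ℂ)) y ^ (2 ^ j) := by
    intro j
    induction j with
    | zero => intro y; simp [g]
    | succ j ih =>
      intro y
      have : g (j + 1) = selfConv μ (g j) := by simp only [g, Function.iterate_succ_apply']
      rw [this, ft_selfConv hψ (hg j), ih, ← pow_mul, pow_succ]
  have hreal := ft_eq_re (ψ := ψ) (μ := μ) (isBump_tent (k := k)).even
  set T : k → ℝ := fun y => (ft ψ μ (fun v => (tent k v : ℂ)) y).re
  have hcont : Continuous (ft ψ μ (fun v => (tent k v : ℂ))) :=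
    continuous_ft hψ isBump_tent.integrable.ofReal
  have hTc : Continuous T := Complex.continuous_re.comp hcont
  have hle : m ≤ 2 ^ (m + 1) := (Nat.lt_two_pow_self).le.trans (Nat.pow_le_pow_right (by norm_num) (by omega))
  have hGr : ∀ y, ft ψ μ (fun v => (g (m + 1) v : ℂ)) y = ((T y ^ 2 ^ (m + 1) : ℝ) : ℂ) := by
    intro y; rw [hft, hreal y]; push_cast; rfl
  refine ⟨g (m + 1), fun y => T y ^ (2 ^ (m + 1)), hg _, hGr, fun y => ?_,
    hTc.pow _, ?_, ?_⟩
  · exact Even.pow_nonneg (by simp [Nat.even_pow]) _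
  · have hI : Integrable (fun y => ((T y ^ 2 ^ (m + 1) : ℝ) : ℂ)) μ := by
      refine hm _ |C| (max R |C|) (lt_max_of_lt_left hR) (Complex.continuous_ofReal.comp (hTc.pow _))
        fun y hy => ?_
      have hy0 : 0 < ‖y‖ := (lt_max_of_lt_left hR).trans_le hy
      have h1 := (hdec y ((le_max_left _ _).trans hy)).trans
        (div_le_div_of_nonneg_right (le_abs_self C) hy0.le)
      rw [← hGr, hft, norm_pow]
      calc _ ≤ (|C| / ‖y‖) ^ (2 ^ (m + 1)) := by gcongr
        _ ≤ _ := pow_le_pow_of_le_one (by positivity)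
          ((div_le_one hy0).2 ((le_max_right _ _).trans hy)) hle
    simpa only [RCLike.re_to_complex, Complex.ofReal_re] using hI.re
  · refine pow_pos ?_ _
    have : T 0 = ∫ v, tent k v ∂μ := by
      simp only [T, ft, zero_mul, AddChar.map_zero_eq_one, Circle.coe_one, mul_one]
      rw [integral_complex_ofReal, Complex.ofReal_re]
    rw [this]
    exact isBump_tent.continuous.integral_pos_of_hasCompactSupport_nonneg_nonzero
      isBump_tent.hasCompactSupport isBump_tent.nonneg isBump_tent.pos.ne'

end OneVariable

section OneVariable

variable {k : Type*} [NontriviallyNormedField k] [ProperSpace k] [MeasurableSpace k] [BorelSpace k]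
variable {ψ : AddChar k Circle} (hψ : Continuous ψ) {μ : Measure k} [μ.IsAddHaarMeasure]

/-- The correlation of `f` with its translates is continuous at `0`. -/
theorem tendsto_integral_mul_conj_sub {f : k → ℂ} (hf : MemLp f 2 μ) :
    (∃ C, ∀ r, ‖∫ s, f s * conj (f (s - r)) ∂μ‖ ≤ C) ∧ Tendsto (fun r => ∫ s, f s * conj (f (s - r)) ∂μ) (𝓝 0) (𝓝 (∫ s, f s * conj (f s) ∂μ)) := by
  have hmp : ∀ r : k, MeasurePreserving (fun s => s - r) μ μ := measurePreserving_sub_right μ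
  let τ : k → C(k, k) := fun r => ⟨fun s => s - r, by fun_prop⟩
  have hτ : Continuous τ := ContinuousMap.continuous_of_continuous_uncurry _
    (by simp only [τ, Function.uncurry_def]; exact continuous_snd.sub continuous_fst)
  set F : Lp ℂ 2 μ := hf.toLp
  have h1 : Tendsto (fun r => Lp.compMeasurePreserving (τ r) (hmp r) F) (𝓝 0)
      (𝓝 (Lp.compMeasurePreserving (τ 0) (hmp 0) F)) :=
    tendsto_const_nhds.compMeasurePreservingLp hτ.continuousAt hmp (hmp 0) (by norm_num)
  have h2 : Tendsto (fun r => inner ℂ (Lp.compMeasurePreserving (τ r) (hmp r) F) F) (𝓝 0)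
      (𝓝 (inner ℂ (Lp.compMeasurePreserving (τ 0) (hmp 0) F) F)) := h1.inner tendsto_const_nhds
  have h3 : ∀ r, inner ℂ (Lp.compMeasurePreserving (τ r) (hmp r) F) F
      = ∫ s, f s * conj (f (s - r)) ∂μ := by
    intro r
    rw [L2.inner_def]
    refine integral_congr_ae ?_
    have e1 := Lp.coeFn_compMeasurePreserving F (hmp r)
    have e2 := hf.coeFn_toLp
    have e3 := (hmp r).quasiMeasurePreserving.ae e2
    filter_upwards [e1, e2, e3] with s h1 h2 h3
    have h1' : (Lp.compMeasurePreserving (τ r) (hmp r) F : k → ℂ) s = F (s - r) := h1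
    rw [h1', h2, h3, RCLike.inner_apply]
  refine ⟨⟨‖F‖ * ‖F‖, fun r => ?_⟩, ?_⟩
  · rw [← h3]
    refine (norm_inner_le_norm _ _).trans_eq ?_
    rw [Lp.norm_compMeasurePreserving]
  · simp only [h3] at h2
    simpa using h2

include hψ in
theorem integral_ft_sq_mul {f : k → ℂ} (hf : Integrable f μ) {g : k → ℂ} (hg : Integrable g μ) :
    ∫ x, (ft ψ μ f x * conj (ft ψ μ f x)) * g x ∂μ
      = ∫ r, ft ψ μ g r * ∫ s, f s * conj (f (s - r)) ∂μ ∂μ := by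
  have hfc : Integrable (fun t => conj (f t)) μ := by
    refine hf.mono (RCLike.continuous_conj.comp_aestronglyMeasurable hf.1) ?_
    exact Eventually.of_forall fun t => by simp
  have hH : Integrable (fun p : k × k => f p.1 * conj (f p.2)) (μ.prod μ) := hf.mul_prod hfc
  have h1 := integral_kernel_swap hψ (ℓ := fun p : k × k => p.1 - p.2) (by fun_prop) hH hg
  have h2 : ∀ x, ∫ p : k × k, f p.1 * conj (f p.2) * (ψ (x * (p.1 - p.2)) : ℂ) ∂(μ.prod μ)
      = ft ψ μ f x * conj (ft ψ μ f x) := by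
    intro x
    rw [conj_ft]
    simp only [ft]
    rw [← integral_prod_mul]
    congr 1; ext p
    have : (ψ (x * (p.1 - p.2)) : ℂ) = ψ (x * p.1) * ψ (-x * p.2) := by
      rw [← Circle.coe_mul, ← AddChar.map_add_eq_mul]; congr 2; ring
    rw [this]; ring
  simp only [h2] at h1
  rw [h1]
  have hI : Integrable (fun p : k × k => f p.1 * conj (f p.2) * ft ψ μ g (p.1 - p.2)) (μ.prod μ) := by
    refine (hH.norm.mul_const (∫ v, ‖g v‖ ∂μ)).mono' ?_ (Eventually.of_forall fun p => ?_)
    · exact hH.1.mul (((continuous_ft hψ hg).comp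
        (continuous_fst.sub continuous_snd)).aestronglyMeasurable)
    · rw [norm_mul]; gcongr; exact norm_ft_le _ _
  have hmp : MeasurePreserving (fun p : k × k => (p.1, p.1 - p.2)) (μ.prod μ) (μ.prod μ) :=
    MeasurePreserving.skew_product (g := fun a b => a - b) (.id μ) (by fun_prop)
      (Eventually.of_forall fun a => (Measure.measurePreserving_sub_left μ a).map_eq)
  have hI' := hmp.integrable_comp_of_integrable hI
  have h3 := integral_map (μ := μ.prod μ) hmp.measurable.aemeasurable
    (by rw [hmp.map_eq]; exact hI.1)
  rw [hmp.map_eq] at h3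
  rw [h3]
  simp only [Function.comp_def, sub_sub_cancel] at hI' ⊢
  rw [integral_prod_symm _ hI']
  congr 1; ext r
  rw [← integral_const_mul]
  congr 1; ext s; ring

include hψ in
/-- **Plancherel's theorem** on `k`, up to the normalization of the measure. -/
theorem exists_plancherel (hψ₁ : ψ ≠ 1) : ∃ c : ℝ, 0 < c ∧ ∀ f : k → ℂ, Integrable f μ →
    MemLp f 2 μ → MemLp (ft ψ μ f) 2 μ ∧
      ∫ x, ‖ft ψ μ f x‖ ^ 2 ∂μ = c * ∫ x, ‖f x‖ ^ 2 ∂μ := by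
  obtain ⟨g, G, hg, hgG, hG0, hGc, hGi, hGp⟩ := exists_bump_ft_integrable hψ (μ := μ) hψ₁
  have hIG : 0 < ∫ x, G x ∂μ :=
    integral_pos_of_integrable_nonneg_nonzero hGc hGi hG0 hGp.ne'
  refine ⟨(∫ x, G x ∂μ) / g 0, div_pos hIG hg.pos, fun f hf hf2 => ?_⟩
  obtain ⟨a, ha0, ha1⟩ := NormedField.exists_norm_lt_one k
  have hane : a ≠ 0 := norm_pos_iff.1 ha0
  set Q : k → ℝ := fun x => ‖ft ψ μ f x‖ ^ 2
  set N : ℝ := ∫ x, ‖f x‖ ^ 2 ∂μ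
  have hQc : Continuous Q := (continuous_ft hψ hf).norm.pow 2
  have han : Tendsto (fun n : ℕ => a ^ n) atTop (𝓝 0) := tendsto_pow_atTop_nhds_zero_of_norm_lt_one ha1
  obtain ⟨M, hM⟩ := hg.continuous.bounded_above_of_compact_support hg.hasCompactSupport
  have hgM : ∀ x, g x ≤ M := fun x => (le_abs_self _).trans (hM x)
  -- the smoothed integrals
  have hint : ∀ n : ℕ, Integrable (fun x => g (a ^ n * x)) μ := fun n => by
    refine Continuous.integrable_of_hasCompactSupport (hg.continuous.comp (by fun_prop)) ?_
    exact hg.hasCompactSupport.comp_homeomorph (Homeomorph.mulLeft₀ (a ^ n) (pow_ne_zero n hane))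
  have hQi : ∀ n : ℕ, Integrable (fun x => Q x * g (a ^ n * x)) μ := fun n => by
    refine (hint n).bdd_mul (c := (∫ v, ‖f v‖ ∂μ) ^ 2) hQc.aestronglyMeasurable
      (Eventually.of_forall fun x => ?_)
    simp only [Q, norm_pow, norm_norm]
    gcongr; exact norm_ft_le _ _
  set A : k → ℂ := fun r => ∫ s, f s * conj (f (s - r)) ∂μ
  have hA0 : A 0 = (N : ℂ) := by
    simp only [A, sub_zero, N]
    rw [← integral_complex_ofReal]
    congr 1; ext s; rw [Complex.mul_conj, Complex.normSq_eq_norm_sq]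
  have hkey : ∀ n : ℕ, ((∫ x, Q x * g (a ^ n * x) ∂μ : ℝ) : ℂ)
      = ∫ r, (G r : ℂ) * A (a ^ n * r) ∂μ := by
    intro n
    have hne : a ^ n ≠ 0 := pow_ne_zero n hane
    obtain ⟨m, hm, hmap⟩ := exists_map_mul_left_eq_smul μ hne
    have hsub : ∀ F : k → ℂ, ∫ x, F (a ^ n * x) ∂μ = m • ∫ x, F x ∂μ := by
      intro F
      have := integral_map_equiv (μ := μ) (Homeomorph.mulLeft₀ (a ^ n) hne).toMeasurableEquiv F
      simp only [Homeomorph.toMeasurableEquiv_coe, Homeomorph.coe_mulLeft₀] at this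
      rw [← this, hmap, integral_smul_nnreal_measure]
    have h1 := integral_ft_sq_mul hψ hf (hint n).ofReal
    rw [← integral_complex_ofReal]
    have h2 : ∀ r, ft ψ μ (fun x => ((g (a ^ n * x) : ℝ) : ℂ)) (a ^ n * r) = m • (G r : ℂ) := by
      intro r
      rw [← hgG]
      simp only [ft]
      rw [← hsub]
      congr 1; ext x; congr 3; ring
    have h3 := hsub fun r => ft ψ μ (fun x => ((g (a ^ n * x) : ℝ) : ℂ)) r * A r
    simp only [h2] at h3
    replace h3 := h3.trans (congrArg (m • ·) h1.symm)
    simp only [smul_mul_assoc, NNReal.smul_def] at h3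
    rw [integral_smul, ← NNReal.smul_def, ← NNReal.smul_def] at h3
    have h4 := smul_right_injective ℂ hm.ne' h3
    rw [h4]
    congr 1; ext x
    simp only [Q]
    rw [Complex.mul_conj, Complex.normSq_eq_norm_sq]; push_cast; rfl
  obtain ⟨⟨C, hC⟩, hAt⟩ := tendsto_integral_mul_conj_sub hf2
  have hAt' : Tendsto A (𝓝 0) (𝓝 (N : ℂ)) := by
    rw [← hA0]; simpa [A] using hAt
  have hpt : ∀ x : k, Tendsto (fun n : ℕ => a ^ n * x) atTop (𝓝 0) := fun x => by
    simpa using han.mul_const x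
  have hAmeas : AEStronglyMeasurable A μ := by
    have : Integrable (fun p : k × k => f p.2 * conj (f (p.2 - p.1))) (μ.prod μ) := by
      have hfc : Integrable (fun t => conj (f t)) μ := by
        refine hf.mono (RCLike.continuous_conj.comp_aestronglyMeasurable hf.1) ?_
        exact Eventually.of_forall fun t => by simp
      have hH : Integrable (fun p : k × k => f p.1 * conj (f p.2)) (μ.prod μ) := hf.mul_prod hfc
      have hmp : MeasurePreserving (fun p : k × k => (p.1, p.1 - p.2)) (μ.prod μ) (μ.prod μ) :=
        MeasurePreserving.skew_product (g := fun a b => a - b) (.id μ) (by fun_prop)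
          (Eventually.of_forall fun a => (Measure.measurePreserving_sub_left μ a).map_eq)
      exact (hmp.integrable_comp_of_integrable hH).swap
    exact this.integral_prod_left.1
  have hlim : Tendsto (fun n : ℕ => ∫ x, Q x * g (a ^ n * x) ∂μ) atTop (𝓝 (N * ∫ x, G x ∂μ)) := by
    have h1 : Tendsto (fun n : ℕ => ∫ r, (G r : ℂ) * A (a ^ n * r) ∂μ) atTop
        (𝓝 (∫ r, (G r : ℂ) * (N : ℂ) ∂μ)) := by
      refine tendsto_integral_of_dominated_convergence (fun r => G r * C) (fun n => ?_)
        (hGi.mul_const C) (fun n => Eventually.of_forall fun r => ?_)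
        (Eventually.of_forall fun r => ?_)
      · obtain ⟨m, hm, hmap⟩ := exists_map_mul_left_eq_smul μ (pow_ne_zero n hane)
        refine hGi.ofReal.1.mul (AEStronglyMeasurable.comp_measurable (g := A)
          (f := fun r => a ^ n * r) ?_ (by fun_prop))
        rw [hmap]
        exact hAmeas.smul_measure m
      · rw [norm_mul, Complex.norm_real, Real.norm_of_nonneg (hG0 r)]
        exact mul_le_mul_of_nonneg_left (hC _) (hG0 r)
      · exact (hAt'.comp (hpt r)).const_mul _
    simp only [← hkey] at h1
    have h2 : ∫ r, (G r : ℂ) * (N : ℂ) ∂μ = ((N * ∫ x, G x ∂μ : ℝ) : ℂ) := by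
      rw [integral_mul_const, integral_complex_ofReal, mul_comm]; push_cast; rfl
    rw [h2] at h1
    exact (Complex.continuous_re.tendsto _).comp h1
  have hgl : ∀ x, Tendsto (fun n : ℕ => Q x * g (a ^ n * x)) atTop (𝓝 (Q x * g 0)) := fun x =>
    ((hg.continuous.tendsto 0).comp (hpt x)).const_mul _
  have hQ0 : ∀ x, 0 ≤ Q x := fun x => by positivity
  have hQI : Integrable (fun x => Q x * g 0) μ := by
    refine ⟨(hQc.mul continuous_const).aestronglyMeasurable, ?_⟩
    rw [hasFiniteIntegral_iff_ofReal (Eventually.of_forall fun x => mul_nonneg (hQ0 x) hg.pos.le)]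
    have h1 : ∀ n : ℕ, ∫⁻ x, ENNReal.ofReal (Q x * g (a ^ n * x)) ∂μ
        = ENNReal.ofReal (∫ x, Q x * g (a ^ n * x) ∂μ) := fun n =>
      (ofReal_integral_eq_lintegral_ofReal (hQi n)
        (Eventually.of_forall fun x => mul_nonneg (hQ0 x) (hg.nonneg _))).symm
    calc ∫⁻ x, ENNReal.ofReal (Q x * g 0) ∂μ
        = ∫⁻ x, liminf (fun n : ℕ => ENNReal.ofReal (Q x * g (a ^ n * x))) atTop ∂μ := by
          congr 1; ext x
          exact ((ENNReal.tendsto_ofReal (hgl x)).liminf_eq).symm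
      _ ≤ liminf (fun n : ℕ => ∫⁻ x, ENNReal.ofReal (Q x * g (a ^ n * x)) ∂μ) atTop :=
          lintegral_liminf_le fun n => by
            have := hg.continuous.measurable.comp (measurable_const_mul (a ^ n))
            exact (hQc.measurable.mul this).ennreal_ofReal
      _ = ENNReal.ofReal (N * ∫ x, G x ∂μ) := by
          simp only [h1]
          exact (ENNReal.tendsto_ofReal hlim).liminf_eq
      _ < ∞ := ENNReal.ofReal_lt_top
  have hQint : Integrable Q μ := by
    have := hQI.mul_const (g 0)⁻¹
    simpa [mul_assoc, mul_inv_cancel₀ hg.pos.ne'] using this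
  refine ⟨(memLp_two_iff_integrable_sq_norm (continuous_ft hψ hf).aestronglyMeasurable).2 hQint, ?_⟩
  have hlim2 : Tendsto (fun n : ℕ => ∫ x, Q x * g (a ^ n * x) ∂μ) atTop (𝓝 (∫ x, Q x * g 0 ∂μ)) := by
    refine tendsto_integral_of_dominated_convergence (fun x => Q x * M) (fun n => (hQi n).1)
      (hQint.mul_const M) (fun n => Eventually.of_forall fun x => ?_) (Eventually.of_forall hgl)
    rw [norm_mul, Real.norm_of_nonneg (hQ0 x)]
    exact mul_le_mul_of_nonneg_left (hM _) (hQ0 x)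
  have := tendsto_nhds_unique hlim2 hlim
  rw [integral_mul_const] at this
  rw [div_mul_eq_mul_div, eq_div_iff hg.pos.ne', this, mul_comm]

end OneVariable

section PartialFourier

variable {n : ℕ} {k : Type*} [NontriviallyNormedField k] [ProperSpace k] [MeasurableSpace k]
  [BorelSpace k]

variable (k) in
/-- The Haar measure on `k` used to define `L²(kⁿ)`. -/
abbrev haar : Measure k := Measure.addHaar

variable (n k) in
/-- The product Haar measure on `kⁿ`. -/
abbrev haarPi : Measure (Fin n → k) := Measure.pi fun _ : Fin n => (Measure.addHaar : Measure k)

variable {ψ : AddChar k Circle} (hψ : Continuous ψ)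

/-- `s • dv` is the self-dual measure for `ψ`. -/
def IsSelfDualScale (ψ : AddChar k Circle) (s : ℝ) : Prop :=
  0 < s ∧ ∀ f : k → ℂ, Integrable f (haar k) → MemLp f 2 (haar k) →
    MemLp (ft ψ (haar k) f) 2 (haar k) ∧
      ∫ x, ‖(s : ℂ) * ft ψ (haar k) f x‖ ^ 2 ∂(haar k) = ∫ x, ‖f x‖ ^ 2 ∂(haar k)

include hψ in
theorem exists_isSelfDualScale (hψ₁ : ψ ≠ 1) : ∃ s, IsSelfDualScale ψ s := by
  obtain ⟨c, hc, h⟩ := exists_plancherel hψ (μ := haar k) hψ₁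
  refine ⟨(√c)⁻¹, inv_pos.2 (Real.sqrt_pos.2 hc), fun f hf hf2 => ⟨(h f hf hf2).1, ?_⟩⟩
  have h1 : ∀ x, ‖(((√c)⁻¹ : ℝ) : ℂ) * ft ψ (haar k) f x‖ ^ 2 = c⁻¹ * ‖ft ψ (haar k) f x‖ ^ 2 := by
    intro x
    rw [norm_mul, mul_pow, Complex.norm_real, Real.norm_eq_abs, sq_abs, inv_pow, Real.sq_sqrt hc.le]
  simp only [h1]
  rw [integral_const_mul, (h f hf hf2).2, inv_mul_cancel_left₀ hc.ne']

theorem IsSelfDualScale.inv {s : ℝ} (h : IsSelfDualScale ψ s) : IsSelfDualScale ψ⁻¹ s := by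
  refine ⟨h.1, fun f hf hf2 => ⟨?_, ?_⟩⟩
  · have := (h.2 f hf hf2).1.comp_measurePreserving (Measure.measurePreserving_neg (haar k))
    convert this using 1
    ext x; exact ft_neg_char f x
  · simp only [ft_neg_char]
    rw [← (h.2 f hf hf2).2, integral_neg_eq_self (fun x => ‖(s : ℂ) * ft ψ (haar k) f x‖ ^ 2)]

/-- The Fourier transform in the `i`-th variable. -/
def pft (ψ : AddChar k Circle) (i : Fin n) (f : (Fin n → k) → ℂ) (u : Fin n → k) : ℂ :=
  ∫ v, f (Function.update u i v) * (ψ (u i * v) : ℂ) ∂(haar k)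

theorem pft_eq_ft (i : Fin n) (f : (Fin n → k) → ℂ) (u : Fin n → k) :
    pft ψ i f u = ft ψ (haar k) (fun v => f (Function.update u i v)) (u i) := rfl

theorem conj_pft (i : Fin n) (f : (Fin n → k) → ℂ) (u : Fin n → k) :
    conj (pft ψ i f u) = pft ψ⁻¹ i (fun x => conj (f x)) u := by
  rw [pft_eq_ft, conj_ft, pft_eq_ft, ft_neg_char]

theorem measurable_update_prod (i : Fin n) :
    Measurable fun p : (Fin n → k) × k => Function.update p.1 i p.2 :=
  (continuous_fst.update i continuous_snd).measurable

include hψ in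
theorem stronglyMeasurable_pft (i : Fin n) {f : (Fin n → k) → ℂ} (hf : StronglyMeasurable f) :
    StronglyMeasurable (pft ψ i f) := by
  refine StronglyMeasurable.integral_prod_right (ν := haar k)
    (f := fun (u : Fin n → k) (v : k) => f (Function.update u i v) * (ψ (u i * v) : ℂ)) ?_
  refine (hf.comp_measurable (measurable_update_prod i)).mul ?_
  refine ((continuous_addChar_mul hψ).comp (g := fun p : k × k => (ψ (p.1 * p.2) : ℂ))
    (f := fun p : (Fin n → k) × k => (p.1 i, p.2)) (by fun_prop)).stronglyMeasurable

/-- `kⁿ` as the product of the `i`-th factor and the others. -/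
theorem measurePreserving_insertNth {m : ℕ} (i : Fin (m + 1)) :
    MeasurePreserving (MeasurableEquiv.piFinSuccAbove (fun _ => k) i).symm
      ((haar k).prod (haarPi m k)) (haarPi (m + 1) k) :=
  (measurePreserving_piFinSuccAbove (fun _ => haar k) i).symm

theorem ae_slice {m : ℕ} (i : Fin (m + 1)) {P : (Fin (m + 1) → k) → Prop}
    (h : ∀ᵐ u ∂(haarPi (m + 1) k), P u) :
    ∀ᵐ y ∂(haarPi m k), ∀ᵐ t ∂(haar k), P (i.insertNth t y) := by
  have h1 := (measurePreserving_insertNth (k := k) i).quasiMeasurePreserving.ae h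
  have h2 := (Measure.measurePreserving_swap (μ := haarPi m k) (ν := haar k)).quasiMeasurePreserving.ae h1
  exact Measure.ae_ae_of_ae_prod h2

theorem ae_of_slice {m : ℕ} (i : Fin (m + 1)) {Q : (Fin m → k) → Prop}
    (h : ∀ᵐ y ∂(haarPi m k), Q y) :
    ∀ᵐ u ∂(haarPi (m + 1) k), Q fun j => u (i.succAbove j) := by
  have h1 := (Measure.quasiMeasurePreserving_snd (μ := haar k) (ν := haarPi m k)).ae h
  exact (measurePreserving_piFinSuccAbove (fun _ => haar k) i).quasiMeasurePreserving.ae h1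

theorem update_eq_insertNth {m : ℕ} (i : Fin (m + 1)) (u : Fin (m + 1) → k) (v : k) :
    Function.update u i v = i.insertNth v fun j => u (i.succAbove j) := by
  rw [← Fin.insertNth_removeNth]; rfl

theorem ae_update (i : Fin n) {P : (Fin n → k) → Prop} (h : ∀ᵐ u ∂(haarPi n k), P u) :
    ∀ᵐ u ∂(haarPi n k), ∀ᵐ v ∂(haar k), P (Function.update u i v) := by
  obtain ⟨m, rfl⟩ : ∃ m, n = m + 1 := ⟨n - 1, by have := i.2; omega⟩
  simp only [update_eq_insertNth]
  exact ae_of_slice i (ae_slice i h)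

theorem integrable_slice {m : ℕ} (i : Fin (m + 1)) {f : (Fin (m + 1) → k) → ℂ}
    (hf : Integrable f (haarPi (m + 1) k)) :
    ∀ᵐ y ∂(haarPi m k), Integrable (fun t => f (i.insertNth t y)) (haar k) := by
  have h1 := (measurePreserving_insertNth (k := k) i).integrable_comp_of_integrable hf
  exact h1.prod_left_ae

theorem integrable_update (i : Fin n) {f : (Fin n → k) → ℂ} (hf : Integrable f (haarPi n k)) :
    ∀ᵐ u ∂(haarPi n k), Integrable (fun v => f (Function.update u i v)) (haar k) := by
  obtain ⟨m, rfl⟩ : ∃ m, n = m + 1 := ⟨n - 1, by have := i.2; omega⟩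
  simp only [update_eq_insertNth]
  exact ae_of_slice i (integrable_slice i hf)

theorem pft_congr_ae (i : Fin n) {f g : (Fin n → k) → ℂ} (h : f =ᵐ[haarPi n k] g) :
    pft ψ i f =ᵐ[haarPi n k] pft ψ i g := by
  filter_upwards [ae_update i h] with u hu
  refine integral_congr_ae ?_
  filter_upwards [hu] with v hv
  rw [hv]

include hψ in
theorem pft_add (i : Fin n) {f g : (Fin n → k) → ℂ} (hf : Integrable f (haarPi n k))
    (hg : Integrable g (haarPi n k)) :
    pft ψ i (f + g) =ᵐ[haarPi n k] pft ψ i f + pft ψ i g := by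
  filter_upwards [integrable_update i hf, integrable_update i hg] with u hu hv
  simp only [pft, Pi.add_apply, add_mul]
  exact integral_add (integrable_ft_integrand hψ hu _) (integrable_ft_integrand hψ hv _)

theorem pft_smul (i : Fin n) (c : ℂ) (f : (Fin n → k) → ℂ) :
    pft ψ i (c • f) = c • pft ψ i f := by
  ext u
  simp only [pft, Pi.smul_apply, smul_eq_mul, mul_assoc]
  rw [integral_const_mul]

theorem lintegral_slice {m : ℕ} (i : Fin (m + 1)) {F : (Fin (m + 1) → k) → ℝ≥0∞}
    (hF : Measurable F) :
    ∫⁻ u, F u ∂(haarPi (m + 1) k) = ∫⁻ y, ∫⁻ t, F (i.insertNth t y) ∂(haar k) ∂(haarPi m k) := by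
  have h := (measurePreserving_insertNth (k := k) i).lintegral_comp hF
  rw [← h, lintegral_prod_symm']
  · rfl
  · exact hF.comp (MeasurableEquiv.measurable _)

theorem integral_slice {m : ℕ} (i : Fin (m + 1)) {F : (Fin (m + 1) → k) → ℂ}
    (hF : Integrable F (haarPi (m + 1) k)) :
    ∫ u, F u ∂(haarPi (m + 1) k) = ∫ y, ∫ t, F (i.insertNth t y) ∂(haar k) ∂(haarPi m k) := by
  have h := (measurePreserving_insertNth (k := k) i).integral_comp' F
  rw [← h, integral_prod_symm]
  · rfl
  · exact (measurePreserving_insertNth (k := k) i).integrable_comp_of_integrable hF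

theorem pft_insertNth {m : ℕ} (i : Fin (m + 1)) (f : (Fin (m + 1) → k) → ℂ) (t : k)
    (y : Fin m → k) :
    pft ψ i f (i.insertNth t y) = ft ψ (haar k) (fun v => f (i.insertNth v y)) t := by
  rw [pft_eq_ft]
  simp [update_eq_insertNth]

theorem memLp_two_iff_lintegral {α : Type*} [MeasurableSpace α] {ν : Measure α} {f : α → ℂ}
    (hf : AEStronglyMeasurable f ν) :
    MemLp f 2 ν ↔ ∫⁻ x, ENNReal.ofReal (‖f x‖ ^ 2) ∂ν < ∞ := by
  rw [memLp_two_iff_integrable_sq_norm hf]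
  exact ⟨fun h => (hasFiniteIntegral_iff_ofReal (Eventually.of_forall fun x => by positivity)).1 h.2,
    fun h => ⟨hf.norm.pow 2,
      (hasFiniteIntegral_iff_ofReal (Eventually.of_forall fun x => by positivity)).2 h⟩⟩

theorem IsSelfDualScale.lintegral_eq {s : ℝ} (hs : IsSelfDualScale ψ s) {f : k → ℂ}
    (hf : Integrable f (haar k)) (hf2 : MemLp f 2 (haar k)) :
    ∫⁻ x, ENNReal.ofReal (‖(s : ℂ) * ft ψ (haar k) f x‖ ^ 2) ∂(haar k)
      = ∫⁻ x, ENNReal.ofReal (‖f x‖ ^ 2) ∂(haar k) := by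
  obtain ⟨h1, h2⟩ := hs.2 f hf hf2
  have h3 := h1.const_mul (s : ℂ)
  rw [← ofReal_integral_eq_lintegral_ofReal ((memLp_two_iff_integrable_sq_norm h3.1).1 h3)
    (Eventually.of_forall fun x => by positivity), h2,
    ofReal_integral_eq_lintegral_ofReal ((memLp_two_iff_integrable_sq_norm hf2.1).1 hf2)
    (Eventually.of_forall fun x => by positivity)]

include hψ in
theorem lintegral_pft {s : ℝ} (hs : IsSelfDualScale ψ s) (i : Fin n) {f : (Fin n → k) → ℂ}
    (hfm : StronglyMeasurable f) (hf : Integrable f (haarPi n k)) (hf2 : MemLp f 2 (haarPi n k)) :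
    ∫⁻ u, ENNReal.ofReal (‖(s : ℂ) * pft ψ i f u‖ ^ 2) ∂(haarPi n k)
      = ∫⁻ u, ENNReal.ofReal (‖f u‖ ^ 2) ∂(haarPi n k) := by
  obtain ⟨m, rfl⟩ : ∃ m, n = m + 1 := ⟨n - 1, by have := i.2; omega⟩
  have hm1 : Measurable fun u => ENNReal.ofReal (‖f u‖ ^ 2) :=
    (hfm.norm.measurable.pow_const 2).ennreal_ofReal
  have hm2 : Measurable fun u => ENNReal.ofReal (‖(s : ℂ) * pft ψ i f u‖ ^ 2) :=
    (((stronglyMeasurable_pft hψ i hfm).const_mul (s : ℂ)).norm.measurable.pow_const 2).ennreal_ofReal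
  have hfin := (memLp_two_iff_lintegral hf2.1).1 hf2
  rw [lintegral_slice i hm1] at hfin ⊢
  rw [lintegral_slice i hm2]
  refine lintegral_congr_ae ?_
  have hmi : Measurable fun p : (Fin m → k) × k => (i.insertNth p.2 p.1 : Fin (m + 1) → k) :=
    (MeasurableEquiv.piFinSuccAbove (fun _ => k) i).symm.measurable.comp measurable_swap
  have hmy : Measurable fun y => ∫⁻ t, ENNReal.ofReal (‖f (i.insertNth t y)‖ ^ 2) ∂(haar k) :=
    Measurable.lintegral_prod_right' (f := fun p : (Fin m → k) × k => ENNReal.ofReal (‖f (i.insertNth p.2 p.1)‖ ^ 2)) (hm1.comp hmi)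
  filter_upwards [ae_lt_top hmy hfin.ne, integrable_slice i hf] with y hy1 hy2
  simp only [pft_insertNth]
  exact hs.lintegral_eq hy2 ((memLp_two_iff_lintegral hy2.1).2 hy1)

include hψ in
theorem memLp_pft {s : ℝ} (hs : IsSelfDualScale ψ s) (i : Fin n) {f : (Fin n → k) → ℂ}
    (hfm : StronglyMeasurable f) (hf : Integrable f (haarPi n k)) (hf2 : MemLp f 2 (haarPi n k)) :
    MemLp (fun u => (s : ℂ) * pft ψ i f u) 2 (haarPi n k) := by
  rw [memLp_two_iff_lintegral ((stronglyMeasurable_pft hψ i hfm).const_mul _).aestronglyMeasurable,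
    lintegral_pft hψ hs i hfm hf hf2]
  exact (memLp_two_iff_lintegral hf2.1).1 hf2

include hψ in
theorem integral_pft_mul {s : ℝ} (hs : IsSelfDualScale ψ s) (i : Fin n) {f g : (Fin n → k) → ℂ}
    (hfm : StronglyMeasurable f) (hf : Integrable f (haarPi n k)) (hf2 : MemLp f 2 (haarPi n k))
    (hgm : StronglyMeasurable g) (hg : Integrable g (haarPi n k)) (hg2 : MemLp g 2 (haarPi n k)) :
    ∫ u, ((s : ℂ) * pft ψ i f u) * g u ∂(haarPi n k)
      = ∫ u, f u * ((s : ℂ) * pft ψ i g u) ∂(haarPi n k) := by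
  have h1 := (memLp_pft hψ hs i hfm hf hf2).integrable_mul hg2
  have h2 := hf2.integrable_mul (memLp_pft hψ hs i hgm hg hg2)
  obtain ⟨m, rfl⟩ : ∃ m, n = m + 1 := ⟨n - 1, by have := i.2; omega⟩
  have h1' := integral_slice i h1
  have h2' := integral_slice i h2
  simp only [Pi.mul_apply] at h1' h2'
  rw [h1', h2']
  refine integral_congr_ae ?_
  filter_upwards [integrable_slice i hf, integrable_slice i hg] with y hy1 hy2
  simp only [pft_insertNth]
  have := integral_ft_mul hψ hy1 hy2
  simp only [mul_assoc, mul_left_comm _ (s : ℂ)]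
  rw [integral_const_mul, integral_const_mul, this]

end PartialFourier

section PartialFourierOperator

variable {n : ℕ} {k : Type*} [NontriviallyNormedField k] [ProperSpace k] [MeasurableSpace k]
  [BorelSpace k] {ψ : AddChar k Circle}

variable (n k) in
/-- The integrable elements of `L²(kⁿ)`. -/
def integrableL2 : Submodule ℂ (L2 n k) where
  carrier := {f | Integrable f (haarPi n k)}
  zero_mem' := (integrable_zero _ _ _).congr (Lp.coeFn_zero ℂ 2 (haarPi n k)).symm
  add_mem' {f g} hf hg := (Integrable.add hf hg).congr (Lp.coeFn_add f g).symm
  smul_mem' c f hf := (Integrable.smul c hf).congr (Lp.coeFn_smul c f).symm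

theorem dense_integrableL2 : DenseRange (integrableL2 n k).subtype := by
  have h : DenseRange ((↑) : Lp.simpleFunc ℂ 2 (haarPi n k) → L2 n k) :=
    Lp.simpleFunc.denseRange (by norm_num)
  refine h.mono ?_
  rintro _ ⟨f, rfl⟩
  refine ⟨⟨f, ?_⟩, rfl⟩
  have h1 := (SimpleFunc.memLp_iff_integrable (by norm_num) (by norm_num)).1 (Lp.simpleFunc.memLp f)
  exact h1.congr (Lp.simpleFunc.toSimpleFunc_eq_toFun f)

/-- The normalized partial Fourier transform on `L¹ ∩ L²`. -/
def pftLinear (hψ : Continuous ψ) {s : ℝ} (hs : IsSelfDualScale ψ s) (i : Fin n) :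
    integrableL2 n k →ₗ[ℂ] L2 n k where
  toFun f := (memLp_pft hψ hs i (Lp.stronglyMeasurable f.1) f.2 (Lp.memLp f.1)).toLp
  map_add' f g := by
    ext1
    refine (MemLp.coeFn_toLp _).trans (EventuallyEq.trans ?_ (Lp.coeFn_add _ _).symm)
    have h1 := pft_congr_ae (ψ := ψ) i (Lp.coeFn_add f.1 g.1)
    filter_upwards [h1, pft_add hψ i f.2 g.2,
      MemLp.coeFn_toLp (memLp_pft hψ hs i (Lp.stronglyMeasurable f.1) f.2 (Lp.memLp f.1)),
      MemLp.coeFn_toLp (memLp_pft hψ hs i (Lp.stronglyMeasurable g.1) g.2 (Lp.memLp g.1))]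
      with u h1 h2 h3 h4
    rw [Pi.add_apply, h3, h4]
    change (s : ℂ) * pft ψ i (f.1 + g.1 : L2 n k) u = _
    rw [h1, h2, Pi.add_apply, mul_add]
  map_smul' c f := by
    ext1
    refine (MemLp.coeFn_toLp _).trans (EventuallyEq.trans ?_ (Lp.coeFn_smul _ _).symm)
    have h1 := pft_congr_ae (ψ := ψ) i (Lp.coeFn_smul c f.1)
    filter_upwards [h1,
      MemLp.coeFn_toLp (memLp_pft hψ hs i (Lp.stronglyMeasurable f.1) f.2 (Lp.memLp f.1))]
      with u h1 h3
    rw [RingHom.id_apply, Pi.smul_apply, h3]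
    change (s : ℂ) * pft ψ i (c • f.1 : L2 n k) u = _
    rw [h1, pft_smul, Pi.smul_apply, smul_eq_mul, smul_eq_mul, mul_left_comm]

theorem norm_eq_of_lintegral_eq {α : Type*} [MeasurableSpace α] {ν : Measure α} {f g : Lp ℂ 2 ν}
    (h : ∫⁻ x, ENNReal.ofReal (‖f x‖ ^ 2) ∂ν = ∫⁻ x, ENNReal.ofReal (‖g x‖ ^ 2) ∂ν) :
    ‖f‖ = ‖g‖ := by
  have key : ∀ f : Lp ℂ 2 ν, ‖f‖ = ((∫⁻ x, ENNReal.ofReal (‖f x‖ ^ 2) ∂ν) ^ (1 / 2 : ℝ)).toReal := by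
    intro f
    rw [Lp.norm_def, eLpNorm_eq_lintegral_rpow_enorm_toReal (by norm_num) (by norm_num)]
    congr 2
    refine lintegral_congr fun x => ?_
    simp only [ENNReal.toReal_ofNat, ENNReal.rpow_ofNat]
    rw [ENNReal.ofReal_pow (norm_nonneg _), ofReal_norm]
  rw [key, key, h]

theorem norm_pftLinear (hψ : Continuous ψ) {s : ℝ} (hs : IsSelfDualScale ψ s) (i : Fin n)
    (f : integrableL2 n k) : ‖pftLinear hψ hs i f‖ = ‖(integrableL2 n k).subtype f‖ := by
  refine norm_eq_of_lintegral_eq ?_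
  refine Eq.trans ?_ (lintegral_pft hψ hs i (Lp.stronglyMeasurable f.1) f.2 (Lp.memLp f.1))
  refine lintegral_congr_ae ?_
  filter_upwards [MemLp.coeFn_toLp (memLp_pft hψ hs i (Lp.stronglyMeasurable f.1) f.2
    (Lp.memLp f.1))] with u hu
  exact congrArg (fun z : ℂ => ENNReal.ofReal (‖z‖ ^ 2)) hu

/-- The normalized partial Fourier transform, as a bounded operator on `L²(kⁿ)`. -/
def pftCLM (hψ : Continuous ψ) {s : ℝ} (hs : IsSelfDualScale ψ s) (i : Fin n) :
    L2 n k →L[ℂ] L2 n k :=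
  (pftLinear hψ hs i).extendOfNorm (integrableL2 n k).subtype

theorem pftCLM_apply (hψ : Continuous ψ) {s : ℝ} (hs : IsSelfDualScale ψ s) (i : Fin n)
    (f : integrableL2 n k) : pftCLM hψ hs i f = pftLinear hψ hs i f :=
  LinearMap.extendOfNorm_eq dense_integrableL2 ⟨1, fun f => by rw [norm_pftLinear, one_mul]⟩ f

theorem pftCLM_ae (hψ : Continuous ψ) {s : ℝ} (hs : IsSelfDualScale ψ s) (i : Fin n) {f : L2 n k}
    (hf : Integrable f (haarPi n k)) :
    pftCLM hψ hs i f =ᵐ[haarPi n k] fun u => (s : ℂ) * pft ψ i f u := by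
  rw [pftCLM_apply hψ hs i ⟨f, hf⟩]
  exact MemLp.coeFn_toLp (memLp_pft hψ hs i (Lp.stronglyMeasurable f) hf (Lp.memLp f))

theorem norm_pftCLM (hψ : Continuous ψ) {s : ℝ} (hs : IsSelfDualScale ψ s) (i : Fin n) (f : L2 n k) :
    ‖pftCLM hψ hs i f‖ = ‖f‖ := by
  refine dense_integrableL2.induction_on (p := fun f => ‖pftCLM hψ hs i f‖ = ‖f‖) f ?_ ?_
  · exact isClosed_eq (by fun_prop) continuous_norm
  · intro g; exact (congrArg norm (pftCLM_apply hψ hs i g)).trans (norm_pftLinear hψ hs i g)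

theorem inner_pftCLM (hψ : Continuous ψ) (hψ' : Continuous (ψ⁻¹ : AddChar k Circle)) {s : ℝ} (hs : IsSelfDualScale ψ s) (i : Fin n)
    (f g : L2 n k) : inner ℂ (pftCLM hψ hs i f) g = inner ℂ f (pftCLM hψ' hs.inv i g) := by
  refine dense_integrableL2.induction_on
    (p := fun f => inner ℂ (pftCLM hψ hs i f) g = inner ℂ f (pftCLM hψ' hs.inv i g)) f ?_ ?_
  · exact isClosed_eq (by fun_prop) (by fun_prop)
  intro f
  refine dense_integrableL2.induction_on
    (p := fun g => inner ℂ (pftCLM hψ hs i f) g = inner ℂ (f : L2 n k) (pftCLM hψ' hs.inv i g))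
    g ?_ ?_
  · exact isClosed_eq (by fun_prop) (by fun_prop)
  intro g
  have hfc : StronglyMeasurable fun u => conj (f.1 u) :=
    RCLike.continuous_conj.comp_stronglyMeasurable (Lp.stronglyMeasurable f.1)
  have hfi : Integrable (fun u => conj (f.1 u)) (haarPi n k) :=
    f.2.mono hfc.aestronglyMeasurable (Eventually.of_forall fun u => by simp)
  have hf2 : MemLp (fun u => conj (f.1 u)) 2 (haarPi n k) :=
    (Lp.memLp f.1).of_le hfc.aestronglyMeasurable (Eventually.of_forall fun u => by simp)
  have h := integral_pft_mul hψ' hs.inv i hfc hfi hf2 (Lp.stronglyMeasurable g.1) g.2 (Lp.memLp g.1)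
  rw [L2.inner_def, L2.inner_def]
  refine Eq.trans ?_ (h.trans ?_)
  · refine integral_congr_ae ?_
    filter_upwards [pftCLM_ae hψ hs i f.2] with u hu
    change inner ℂ (pftCLM hψ hs i f.1 u) (g.1 u) = _
    rw [hu, RCLike.inner_apply, map_mul, Complex.conj_ofReal, conj_pft, mul_comm]
  · refine integral_congr_ae ?_
    filter_upwards [pftCLM_ae hψ' hs.inv i g.2] with u hu
    change _ = inner ℂ (f.1 u) (pftCLM hψ' hs.inv i g.1 u)
    rw [hu, RCLike.inner_apply, mul_comm]

theorem pftCLM_inv_apply (hψ : Continuous ψ) (hψ' : Continuous (ψ⁻¹ : AddChar k Circle)) {s : ℝ}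
    (hs : IsSelfDualScale ψ s) (i : Fin n) (f : L2 n k) :
    pftCLM hψ' hs.inv i (pftCLM hψ hs i f) = f := by
  refine ext_inner_left ℂ fun g => ?_
  rw [← inner_pftCLM hψ hψ' hs i]
  have h : ∀ x y : L2 n k, inner ℂ (pftCLM hψ hs i x) (pftCLM hψ hs i y) = inner ℂ x y :=
    (LinearMap.norm_map_iff_inner_map_map (pftCLM hψ hs i)).1 (norm_pftCLM hψ hs i)
  exact h g f

theorem continuous_inv_char (hψ : Continuous ψ) : Continuous (ψ⁻¹ : AddChar k Circle) := by
  have : ⇑(ψ⁻¹ : AddChar k Circle) = fun x => ψ (-x) := by ext x; simp [AddChar.inv_apply]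
  rw [this]; exact hψ.comp continuous_neg

/-- The unitary partial Fourier transform in the `i`-th variable. -/
def fourierOp (hψ : Continuous ψ) {s : ℝ} (hs : IsSelfDualScale ψ s) (i : Fin n) :
    L2 n k ≃ₗᵢ[ℂ] L2 n k where
  toFun := pftCLM hψ hs i
  map_add' := map_add _
  map_smul' := map_smul _
  invFun := pftCLM (continuous_inv_char hψ) hs.inv i
  left_inv f := pftCLM_inv_apply hψ (continuous_inv_char hψ) hs i f
  right_inv f := by
    have h := pftCLM_inv_apply (continuous_inv_char hψ) (ψ := ψ⁻¹)
      (by rw [inv_inv]; exact hψ) hs.inv i f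
    simpa only [inv_inv] using h
  norm_map' := norm_pftCLM hψ hs i

variable (hψ : Continuous ψ) {s : ℝ} (hs : IsSelfDualScale ψ s) (i : Fin n)

theorem fourierOp_ae {f : L2 n k} (hf : Integrable f (haarPi n k)) :
    fourierOp hψ hs i f =ᵐ[haarPi n k] fun u => (s : ℂ) * pft ψ i f u :=
  pftCLM_ae hψ hs i hf

theorem fourierOp_symm_ae {f : L2 n k} (hf : Integrable f (haarPi n k)) :
    (fourierOp hψ hs i).symm f =ᵐ[haarPi n k] fun u => (s : ℂ) * pft ψ⁻¹ i f u :=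
  pftCLM_ae _ hs.inv i hf

theorem isPartialFourier_fourierOp : IsPartialFourier ψ i (fourierOp hψ hs i) := by
  have hs0 := hs.1
  refine ⟨ENNReal.ofReal s • Measure.addHaar, ?_, fun f hf => ?_⟩
  · exact Measure.IsAddHaarMeasure.smul _ (by simpa using hs0) ENNReal.ofReal_ne_top
  · refine (fourierOp_ae hψ hs i hf).trans (Eventually.of_forall fun u => ?_)
    change _ = ∫ v, _ ∂(ENNReal.ofReal s • Measure.addHaar)
    rw [integral_smul_measure, ENNReal.toReal_ofReal hs0.le, Complex.real_smul]
    rfl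

end PartialFourierOperator

section Operators

variable {n : ℕ} {k : Type*} [NontriviallyNormedField k] [ProperSpace k] [MeasurableSpace k]
  [BorelSpace k] {ψ : AddChar k Circle}

/-! ### Multiplication and substitution operators -/

theorem memLp_mulChar {χ : (Fin n → k) → Circle} (hχ : Continuous χ) (f : L2 n k) :
    MemLp (fun u => (χ u : ℂ) * f u) 2 (haarPi n k) :=
  (Lp.memLp f).of_le
    ((continuous_subtype_val.comp hχ).aestronglyMeasurable.mul (Lp.aestronglyMeasurable f))
    (Eventually.of_forall fun u => by simp [Circle.norm_coe])

/-- Multiplication by a continuous function with values in the circle. -/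
def mulOp (χ : (Fin n → k) → Circle) (hχ : Continuous χ) : L2 n k ≃ₗᵢ[ℂ] L2 n k where
  toFun f := (memLp_mulChar hχ f).toLp
  invFun f := (memLp_mulChar hχ.inv f).toLp
  map_add' f g := by
    ext1
    filter_upwards [(memLp_mulChar hχ (f + g)).coeFn_toLp, (memLp_mulChar hχ f).coeFn_toLp,
      (memLp_mulChar hχ g).coeFn_toLp, Lp.coeFn_add f g,
      Lp.coeFn_add (memLp_mulChar hχ f).toLp (memLp_mulChar hχ g).toLp] with u h1 h2 h3 h4 h5
    rw [h1, h5, Pi.add_apply, h2, h3, h4, Pi.add_apply, mul_add]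
  map_smul' c f := by
    ext1
    filter_upwards [(memLp_mulChar hχ (c • f)).coeFn_toLp, (memLp_mulChar hχ f).coeFn_toLp,
      Lp.coeFn_smul c f, Lp.coeFn_smul c (memLp_mulChar hχ f).toLp] with u h1 h2 h3 h4
    rw [RingHom.id_apply, h1, h4, Pi.smul_apply, h2, h3, Pi.smul_apply, smul_eq_mul, smul_eq_mul,
      mul_left_comm]
  left_inv f := by
    ext1
    filter_upwards [(memLp_mulChar hχ f).coeFn_toLp,
      (memLp_mulChar hχ.inv (memLp_mulChar hχ f).toLp).coeFn_toLp] with u h1 h2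
    rw [h2, h1, ← mul_assoc, Pi.inv_apply, ← Circle.coe_mul, inv_mul_cancel, Circle.coe_one, one_mul]
  right_inv f := by
    ext1
    filter_upwards [(memLp_mulChar hχ.inv f).coeFn_toLp,
      (memLp_mulChar hχ (memLp_mulChar hχ.inv f).toLp).coeFn_toLp] with u h1 h2
    rw [h2, h1, ← mul_assoc, Pi.inv_apply, ← Circle.coe_mul, mul_inv_cancel, Circle.coe_one, one_mul]
  norm_map' f := by
    refine norm_eq_of_lintegral_eq (lintegral_congr_ae ?_)
    filter_upwards [(memLp_mulChar hχ f).coeFn_toLp] with u h1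
    refine (congrArg (fun z : ℂ => ENNReal.ofReal (‖z‖ ^ 2)) h1).trans ?_
    rw [norm_mul, Circle.norm_coe, one_mul]

theorem mulOp_ae (χ : (Fin n → k) → Circle) (hχ : Continuous χ) (f : L2 n k) :
    mulOp χ hχ f =ᵐ[haarPi n k] fun u => (χ u : ℂ) * f u :=
  (memLp_mulChar hχ f).coeFn_toLp

theorem quasiMeasurePreserving_of_map {α : Type*} [MeasurableSpace α] {ν : Measure α} {T : α → α}
    (hT : Measurable T) {m : ℝ≥0} (h : ν.map T = m • ν) : Measure.QuasiMeasurePreserving T ν ν :=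
  ⟨hT, by rw [h]; exact Measure.smul_absolutelyContinuous⟩

theorem memLp_comp_of_map {T : (Fin n → k) → (Fin n → k)} (hT : Measurable T) {m : ℝ≥0}
    (h : (haarPi n k).map T = m • haarPi n k) (f : L2 n k) (c : ℂ) :
    MemLp (fun u => c * f (T u)) 2 (haarPi n k) := by
  refine MemLp.const_mul (f := fun u => f (T u)) ?_ c
  have h1 : MemLp f 2 ((haarPi n k).map T) := by
    rw [h]; exact (Lp.memLp f).smul_measure ENNReal.coe_ne_top
  exact h1.comp_of_map hT.aemeasurable

theorem map_symm_eq_inv_smul (T : (Fin n → k) ≃ᵐ (Fin n → k)) {m : ℝ≥0} (hm : 0 < m)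
    (h : (haarPi n k).map T = m • haarPi n k) :
    (haarPi n k).map T.symm = m⁻¹ • haarPi n k := by
  have h1 : haarPi n k = m⁻¹ • (haarPi n k).map T := by
    rw [h, smul_smul, inv_mul_cancel₀ hm.ne', one_smul]
  conv_lhs => rw [h1]
  rw [Measure.map_smul, T.map_symm_map]

/-- The unitary operator `f ↦ m^(-1/2) f ∘ T` for a map `T` that scales the measure by `m`. -/
def compOp (T : (Fin n → k) ≃ᵐ (Fin n → k)) {m : ℝ≥0} (hm : 0 < m)
    (h : (haarPi n k).map T = m • haarPi n k) : L2 n k ≃ₗᵢ[ℂ] L2 n k where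
  toFun f := (memLp_comp_of_map T.measurable h f ((√(m : ℝ))⁻¹ : ℝ)).toLp
  invFun f := (memLp_comp_of_map T.symm.measurable (map_symm_eq_inv_smul T hm h) f (√(m : ℝ) : ℝ)).toLp
  map_add' f g := by
    have hq := quasiMeasurePreserving_of_map T.measurable h
    ext1
    filter_upwards [MemLp.coeFn_toLp (memLp_comp_of_map T.measurable h (f + g) ((√(m : ℝ))⁻¹ : ℝ)),
      MemLp.coeFn_toLp (memLp_comp_of_map T.measurable h f ((√(m : ℝ))⁻¹ : ℝ)),
      MemLp.coeFn_toLp (memLp_comp_of_map T.measurable h g ((√(m : ℝ))⁻¹ : ℝ)),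
      hq.ae (Lp.coeFn_add f g),
      Lp.coeFn_add (memLp_comp_of_map T.measurable h f ((√(m : ℝ))⁻¹ : ℝ)).toLp
        (memLp_comp_of_map T.measurable h g ((√(m : ℝ))⁻¹ : ℝ)).toLp] with u h1 h2 h3 h4 h5
    rw [h1, h5, Pi.add_apply, h2, h3, h4, Pi.add_apply, mul_add]
  map_smul' c f := by
    have hq := quasiMeasurePreserving_of_map T.measurable h
    ext1
    filter_upwards [MemLp.coeFn_toLp (memLp_comp_of_map T.measurable h (c • f) ((√(m : ℝ))⁻¹ : ℝ)),
      MemLp.coeFn_toLp (memLp_comp_of_map T.measurable h f ((√(m : ℝ))⁻¹ : ℝ)),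
      hq.ae (Lp.coeFn_smul c f),
      Lp.coeFn_smul c (memLp_comp_of_map T.measurable h f ((√(m : ℝ))⁻¹ : ℝ)).toLp]
      with u h1 h2 h3 h4
    rw [RingHom.id_apply, h1, h4, Pi.smul_apply, h2, h3, Pi.smul_apply, smul_eq_mul, smul_eq_mul,
      mul_left_comm]
  left_inv f := by
    have h' := map_symm_eq_inv_smul T hm h
    have hq := quasiMeasurePreserving_of_map T.symm.measurable h'
    have hs : (√(m : ℝ)) ≠ 0 := (Real.sqrt_pos.2 (by exact_mod_cast hm)).ne'
    ext1
    filter_upwards [MemLp.coeFn_toLp (memLp_comp_of_map T.symm.measurable h'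
        (memLp_comp_of_map T.measurable h f ((√(m : ℝ))⁻¹ : ℝ)).toLp (√(m : ℝ) : ℝ)),
      hq.ae (MemLp.coeFn_toLp (memLp_comp_of_map T.measurable h f ((√(m : ℝ))⁻¹ : ℝ)))]
      with u h1 h2
    rw [h1, h2, T.apply_symm_apply, ← mul_assoc, ← Complex.ofReal_mul, mul_inv_cancel₀ hs,
      Complex.ofReal_one, one_mul]
  right_inv f := by
    have h' := map_symm_eq_inv_smul T hm h
    have hq := quasiMeasurePreserving_of_map T.measurable h
    have hs : (√(m : ℝ)) ≠ 0 := (Real.sqrt_pos.2 (by exact_mod_cast hm)).ne'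
    ext1
    filter_upwards [MemLp.coeFn_toLp (memLp_comp_of_map T.measurable h
        (memLp_comp_of_map T.symm.measurable h' f (√(m : ℝ) : ℝ)).toLp ((√(m : ℝ))⁻¹ : ℝ)),
      hq.ae (MemLp.coeFn_toLp (memLp_comp_of_map T.symm.measurable h' f (√(m : ℝ) : ℝ)))]
      with u h1 h2
    rw [h1, h2, T.symm_apply_apply, ← mul_assoc, ← Complex.ofReal_mul, inv_mul_cancel₀ hs,
      Complex.ofReal_one, one_mul]
  norm_map' f := by
    refine norm_eq_of_lintegral_eq ?_
    have h1 : ∫⁻ u, ENNReal.ofReal (‖f u‖ ^ 2) ∂((haarPi n k).map T)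
        = ∫⁻ u, ENNReal.ofReal (‖f (T u)‖ ^ 2) ∂(haarPi n k) := lintegral_map_equiv _ T
    rw [h, lintegral_smul_measure] at h1
    have h2 : ∫⁻ u, ENNReal.ofReal (‖f u‖ ^ 2) ∂(haarPi n k)
        = ∫⁻ u, (m⁻¹ : ℝ≥0) * ENNReal.ofReal (‖f (T u)‖ ^ 2) ∂(haarPi n k) := by
      rw [lintegral_const_mul' _ _ ENNReal.coe_ne_top, ← h1, ENNReal.smul_def, smul_eq_mul,
        ← mul_assoc, ← ENNReal.coe_mul, inv_mul_cancel₀ hm.ne', ENNReal.coe_one, one_mul]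
    rw [h2]
    refine lintegral_congr_ae ?_
    filter_upwards [MemLp.coeFn_toLp (memLp_comp_of_map T.measurable h f ((√(m : ℝ))⁻¹ : ℝ))]
      with u hu
    refine (congrArg (fun z : ℂ => ENNReal.ofReal (‖z‖ ^ 2)) hu).trans ?_
    rw [norm_mul, mul_pow, Complex.norm_real, Real.norm_eq_abs, sq_abs, inv_pow,
      Real.sq_sqrt m.coe_nonneg, ENNReal.ofReal_mul (by positivity)]
    congr 1
    rw [← NNReal.coe_inv, ENNReal.ofReal_coe_nnreal]

theorem compOp_ae (T : (Fin n → k) ≃ᵐ (Fin n → k)) {m : ℝ≥0} (hm : 0 < m)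
    (h : (haarPi n k).map T = m • haarPi n k) (f : L2 n k) :
    compOp T hm h f =ᵐ[haarPi n k] fun u => (((√(m : ℝ))⁻¹ : ℝ) : ℂ) * f (T u) :=
  MemLp.coeFn_toLp (memLp_comp_of_map T.measurable h f ((√(m : ℝ))⁻¹ : ℝ))

/-- The substitution operator of a measure preserving map. -/
def substOp (T : (Fin n → k) ≃ᵐ (Fin n → k)) (h : MeasurePreserving T (haarPi n k) (haarPi n k)) :
    L2 n k ≃ₗᵢ[ℂ] L2 n k :=
  compOp T one_pos (by rw [h.map_eq, one_smul])

theorem substOp_ae (T : (Fin n → k) ≃ᵐ (Fin n → k))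
    (h : MeasurePreserving T (haarPi n k) (haarPi n k)) (f : L2 n k) :
    substOp T h f =ᵐ[haarPi n k] fun u => f (T u) := by
  refine (compOp_ae T one_pos (by rw [h.map_eq, one_smul]) f).trans (Eventually.of_forall fun u => ?_)
  simp

theorem continuous_schrodingerChar (hψ : Continuous ψ) (w : Fin n ⊕ Fin n → k) :
    Continuous fun u : Fin n → k =>
      ψ (u ⬝ᵥ (w ∘ Sum.inl) - 2⁻¹ * ((w ∘ Sum.inl) ⬝ᵥ (w ∘ Sum.inr))) := by
  refine hψ.comp ?_
  unfold dotProduct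
  fun_prop

/-- The Schrödinger operators, as unitary operators. -/
def schrodingerOp (hψ : Continuous ψ) (w : Fin n ⊕ Fin n → k) : L2 n k ≃ₗᵢ[ℂ] L2 n k :=
  (substOp (MeasurableEquiv.subRight (w ∘ Sum.inr)) (measurePreserving_sub_right _ _)).trans
    (mulOp (fun u => ψ (u ⬝ᵥ (w ∘ Sum.inl) - 2⁻¹ * ((w ∘ Sum.inl) ⬝ᵥ (w ∘ Sum.inr))))
      (continuous_schrodingerChar hψ w))

theorem schrodinger_ae (hψ : Continuous ψ) (w : Fin n ⊕ Fin n → k) (f : L2 n k) :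
    schrodinger ψ hψ w f =ᵐ[haarPi n k] schrodingerFun ψ w f :=
  MemLp.coeFn_toLp _

theorem schrodingerOp_apply (hψ : Continuous ψ) (w : Fin n ⊕ Fin n → k) (f : L2 n k) :
    schrodingerOp hψ w f = schrodinger ψ hψ w f := by
  ext1
  refine (mulOp_ae _ (continuous_schrodingerChar hψ w) _).trans (EventuallyEq.trans ?_ (schrodinger_ae hψ w f).symm)
  filter_upwards [substOp_ae (MeasurableEquiv.subRight (w ∘ Sum.inr))
    (measurePreserving_sub_right _ _) f] with u hu
  exact congrArg (fun z : ℂ =>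
    (ψ (u ⬝ᵥ (w ∘ Sum.inl) - 2⁻¹ * ((w ∘ Sum.inl) ⬝ᵥ (w ∘ Sum.inr))) : ℂ) * z) hu

end Operators

section FourierRelations

variable {n : ℕ} {k : Type*} [NontriviallyNormedField k] [ProperSpace k] [MeasurableSpace k]
  [BorelSpace k] {ψ : AddChar k Circle} (hψ : Continuous ψ) {s : ℝ} (hs : IsSelfDualScale ψ s)

/-- Two unitary operators that agree on integrable functions are equal. -/
theorem ext_integrable {M N : L2 n k ≃ₗᵢ[ℂ] L2 n k}
    (h : ∀ f : L2 n k, Integrable f (haarPi n k) → M f = N f) : M = N := by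
  ext1 f
  refine dense_integrableL2.induction_on (p := fun f => M f = N f) f ?_ fun g => h _ g.2
  exact isClosed_eq M.continuous N.continuous

theorem mem_weilGroup_of_integrable {g : Sp n k} {M : L2 n k ≃ₗᵢ[ℂ] L2 n k}
    (h : ∀ w (f : L2 n k), Integrable f (haarPi n k) →
      M (schrodinger ψ hψ w f) = schrodinger ψ hψ (g.1 *ᵥ w) (M f)) :
    (g, M) ∈ weilGroup n ψ hψ := by
  intro w
  have h1 : (schrodingerOp hψ w).trans M = M.trans (schrodingerOp hψ (g.1 *ᵥ w)) := by
    refine ext_integrable fun f hf => ?_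
    have := h w f hf
    rw [← schrodingerOp_apply, ← schrodingerOp_apply] at this
    exact this
  intro f
  have := DFunLike.congr_fun h1 f
  rw [← schrodingerOp_apply, ← schrodingerOp_apply]
  exact this

/-! ### Reflections and the square of the Fourier transform -/

/-- The reflection `u_i ↦ -u_i`. -/
def reflect (i : Fin n) : (Fin n → k) ≃ᵐ (Fin n → k) where
  toFun u := Function.update u i (-u i)
  invFun u := Function.update u i (-u i)
  left_inv u := by simp
  right_inv u := by simp
  measurable_toFun := (continuous_id.update i (continuous_apply i).neg).measurable
  measurable_invFun := (continuous_id.update i (continuous_apply i).neg).measurable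

theorem reflect_apply (i : Fin n) (u : Fin n → k) : reflect i u = Function.update u i (-u i) := rfl

theorem measurePreserving_reflect (i : Fin n) :
    MeasurePreserving (reflect i) (haarPi n k) (haarPi n k) := by
  have h := measurePreserving_pi (fun _ : Fin n => haar k) (fun _ : Fin n => haar k)
    (f := fun j x => if j = i then -x else x) (fun j => by
      by_cases hj : j = i
      · simp only [hj, if_true]; exact Measure.measurePreserving_neg _
      · simp only [hj, if_false]; exact MeasurePreserving.id _)
  convert h using 1
  ext u j
  by_cases hj : j = i
  · subst hj; simp [reflect_apply]
  · simp [reflect_apply, hj]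

/-- The parity operator in the `i`-th variable. -/
def parityOp (i : Fin n) : L2 n k ≃ₗᵢ[ℂ] L2 n k := substOp (reflect i) (measurePreserving_reflect i)

theorem parityOp_ae (i : Fin n) (f : L2 n k) :
    parityOp i f =ᵐ[haarPi n k] fun u => f (Function.update u i (-u i)) :=
  substOp_ae _ (measurePreserving_reflect i) f

theorem parityOp_parityOp (i : Fin n) (f : L2 n k) : parityOp i (parityOp i f) = f := by
  ext1
  filter_upwards [parityOp_ae i (parityOp i f),
    (measurePreserving_reflect i).quasiMeasurePreserving.ae (parityOp_ae i f)] with u h1 h2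
  rw [h1]
  rw [reflect_apply] at h2
  rw [h2]; simp

theorem pft_inv_eq (i : Fin n) (f : (Fin n → k) → ℂ) (u : Fin n → k) :
    pft ψ⁻¹ i f u = pft ψ i f (Function.update u i (-u i)) := by
  rw [pft_eq_ft, ft_neg_char, pft_eq_ft]; simp

theorem fourierOp_symm_eq (i : Fin n) (f : L2 n k) :
    (fourierOp hψ hs i).symm f = parityOp i (fourierOp hψ hs i f) := by
  have : (fourierOp hψ hs i).symm = (fourierOp hψ hs i).trans (parityOp i) := by
    refine ext_integrable fun f hf => ?_
    ext1
    filter_upwards [fourierOp_symm_ae hψ hs i hf, parityOp_ae i (fourierOp hψ hs i f),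
      (measurePreserving_reflect i).quasiMeasurePreserving.ae (fourierOp_ae hψ hs i hf)] with u h1 h2 h3
    rw [h1]
    refine Eq.trans ?_ h2.symm
    rw [reflect_apply] at h3
    rw [h3, pft_inv_eq]
  exact DFunLike.congr_fun this f

theorem fourierOp_fourierOp (i : Fin n) (f : L2 n k) :
    fourierOp hψ hs i (fourierOp hψ hs i f) = parityOp i f := by
  have h := fourierOp_symm_eq hψ hs i (fourierOp hψ hs i f)
  rw [LinearIsometryEquiv.symm_apply_apply] at h
  conv_rhs => rw [h]
  rw [parityOp_parityOp]

/-! ### The Fourier transform and the Schrödinger representation -/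

/-- The symplectic matrix `e_i ↦ -f_i`, `f_i ↦ e_i`. -/
def fourierMatrix (i : Fin n) : Matrix (Fin n ⊕ Fin n) (Fin n ⊕ Fin n) k :=
  fromBlocks (1 - Matrix.single i i 1) (Matrix.single i i 1) (-Matrix.single i i 1)
    (1 - Matrix.single i i 1)

theorem fourierMatrix_mem (i : Fin n) :
    fourierMatrix i ∈ Matrix.symplecticGroup (Fin n) k := by
  unfold fourierMatrix
  rw [SymplecticGroup.fromBlocks_mem_iff]
  refine ⟨?_, ?_, ?_⟩ <;> simp [Matrix.sub_mul, Matrix.mul_sub]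

/-- `fourierMatrix i` as an element of the symplectic group. -/
def fourierSp (i : Fin n) : Sp n k := ⟨fourierMatrix i, fourierMatrix_mem i⟩

theorem fourierSp_mulVec_inl (i : Fin n) (w : Fin n ⊕ Fin n → k) :
    ((fourierSp i).1 *ᵥ w) ∘ Sum.inl = Function.update (w ∘ Sum.inl) i (w (Sum.inr i)) := by
  ext j
  simp only [fourierSp, fourierMatrix, Function.comp_apply]
  rw [fromBlocks_mulVec]
  by_cases hj : j = i
  · subst hj; simp [Matrix.sub_mulVec, Matrix.single_mulVec]
  · simp [Matrix.sub_mulVec, Matrix.single_mulVec, hj]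

theorem fourierSp_mulVec_inr (i : Fin n) (w : Fin n ⊕ Fin n → k) :
    ((fourierSp i).1 *ᵥ w) ∘ Sum.inr = Function.update (w ∘ Sum.inr) i (-w (Sum.inl i)) := by
  ext j
  simp only [fourierSp, fourierMatrix, Function.comp_apply]
  rw [fromBlocks_mulVec]
  by_cases hj : j = i
  · subst hj; simp [Matrix.sub_mulVec, Matrix.neg_mulVec, Matrix.single_mulVec]
  · simp [Matrix.sub_mulVec, Matrix.neg_mulVec, Matrix.single_mulVec, hj]

theorem update_dotProduct' (u x : Fin n → k) (i : Fin n) (v : k) :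
    Function.update u i v ⬝ᵥ x = u ⬝ᵥ x + (v - u i) * x i := by
  have : Function.update u i v = u + Pi.single i (v - u i) := by
    ext j
    by_cases hj : j = i
    · subst hj; simp
    · simp [hj]
  rw [this, add_dotProduct, single_dotProduct]

theorem pft_schrodingerFun [CharZero k] (i : Fin n) (w : Fin n ⊕ Fin n → k) (f : (Fin n → k) → ℂ)
    (u : Fin n → k) :
    pft ψ i (schrodingerFun ψ w f) u = schrodingerFun ψ ((fourierSp i).1 *ᵥ w) (pft ψ i f) u := by
  simp only [schrodingerFun, fourierSp_mulVec_inl, fourierSp_mulVec_inr]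
  set x := w ∘ Sum.inl
  set y := w ∘ Sum.inr
  have hx : w (Sum.inl i) = x i := rfl
  have hy : w (Sum.inr i) = y i := rfl
  rw [hx, hy]
  simp only [pft]
  rw [← integral_add_right_eq_self _ (y i), ← integral_const_mul]
  congr 1; ext v
  have e1 : Function.update u i (v + y i) - y
      = Function.update (u - Function.update y i (-x i)) i v := by
    ext j
    by_cases hj : j = i
    · subst hj; simp
    · simp [hj]
  change (ψ (Function.update u i (v + y i) ⬝ᵥ x - 2⁻¹ * x ⬝ᵥ y) : ℂ)
    * f (Function.update u i (v + y i) - y) * (ψ (u i * (v + y i)) : ℂ) = _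
  rw [e1]
  have e2 : (ψ (Function.update u i (v + y i) ⬝ᵥ x - 2⁻¹ * x ⬝ᵥ y) : ℂ) * (ψ (u i * (v + y i)) : ℂ)
      = (ψ (u ⬝ᵥ Function.update x i (y i)
          - 2⁻¹ * Function.update x i (y i) ⬝ᵥ Function.update y i (-x i)) : ℂ)
        * (ψ ((u - Function.update y i (-x i)) i * v) : ℂ) := by
    rw [← Circle.coe_mul, ← Circle.coe_mul, ← AddChar.map_add_eq_mul, ← AddChar.map_add_eq_mul]
    congr 2
    rw [dotProduct_comm u (Function.update x i (y i))]
    simp only [update_dotProduct', dotProduct_comm _ (Function.update y i (-x i)), Pi.sub_apply,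
      Function.update_self]
    rw [dotProduct_comm x u, dotProduct_comm y (Function.update x i (y i)), update_dotProduct']
    field_simp
    ring
  linear_combination (f (Function.update (u - Function.update y i (-x i)) i v)) * e2

theorem schrodingerFun_congr_ae (w : Fin n ⊕ Fin n → k) {f g : (Fin n → k) → ℂ}
    (h : f =ᵐ[haarPi n k] g) : schrodingerFun ψ w f =ᵐ[haarPi n k] schrodingerFun ψ w g := by
  filter_upwards [(measurePreserving_sub_right (haarPi n k) (w ∘ Sum.inr)).quasiMeasurePreserving.ae h]
    with u hu
  simp only [schrodingerFun, hu]

theorem integrable_schrodinger (w : Fin n ⊕ Fin n → k) {f : L2 n k} (hf : Integrable f (haarPi n k)) :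
    Integrable (schrodinger ψ hψ w f) (haarPi n k) := by
  refine Integrable.congr ?_ (schrodinger_ae hψ w f).symm
  have h1 := (measurePreserving_sub_right (haarPi n k) (w ∘ Sum.inr)).integrable_comp_of_integrable hf
  have h2 := (continuous_subtype_val.comp
    (continuous_schrodingerChar hψ w)).aestronglyMeasurable (μ := haarPi n k)
  refine h1.mono (h2.mul h1.1) (Eventually.of_forall fun u => ?_)
  rw [schrodingerFun, norm_mul, Circle.norm_coe, one_mul]
  rfl

theorem fourierOp_mem [CharZero k] (i : Fin n) :
    (fourierSp i, fourierOp hψ hs i) ∈ weilGroup n ψ hψ := by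
  refine mem_weilGroup_of_integrable hψ fun w f hf => ?_
  ext1
  refine (fourierOp_ae hψ hs i (integrable_schrodinger hψ w hf)).trans ?_
  refine EventuallyEq.trans ?_ (schrodinger_ae hψ _ _).symm
  refine EventuallyEq.trans ?_ (schrodingerFun_congr_ae _ (fourierOp_ae hψ hs i hf)).symm
  filter_upwards [pft_congr_ae (ψ := ψ) i (schrodinger_ae hψ w f)] with u hu
  rw [hu, pft_schrodingerFun]
  simp only [schrodingerFun]
  ring

/-! ### Tensor products of functions of one variable -/

/-- The function `u ↦ ∏ f_j(u_j)`. -/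
def tens (f : Fin n → k → ℂ) (u : Fin n → k) : ℂ := ∏ j, f j (u j)

theorem tens_update_left (f : Fin n → k → ℂ) (i : Fin n) (g : k → ℂ) (u : Fin n → k) :
    tens (Function.update f i g) u = g (u i) * ∏ j ∈ Finset.univ.erase i, f j (u j) := by
  rw [tens, ← Finset.mul_prod_erase _ _ (Finset.mem_univ i)]
  simp only [Function.update_self]
  congr 1
  exact Finset.prod_congr rfl fun j hj => by rw [Function.update_of_ne (Finset.ne_of_mem_erase hj)]

theorem tens_update_right (f : Fin n → k → ℂ) (i : Fin n) (u : Fin n → k) (v : k) :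
    tens f (Function.update u i v) = f i v * ∏ j ∈ Finset.univ.erase i, f j (u j) := by
  rw [tens, ← Finset.mul_prod_erase _ _ (Finset.mem_univ i)]
  simp only [Function.update_self]
  congr 1
  exact Finset.prod_congr rfl fun j hj => by rw [Function.update_of_ne (Finset.ne_of_mem_erase hj)]

theorem pft_tens (f : Fin n → k → ℂ) (i : Fin n) :
    pft ψ i (tens f) = tens (Function.update f i (ft ψ (haar k) (f i))) := by
  ext u
  rw [tens_update_left, pft]
  simp only [tens_update_right, mul_right_comm]
  rw [integral_mul_const]
  rfl

theorem integrable_tens {f : Fin n → k → ℂ} (hf : ∀ j, Integrable (f j) (haar k)) :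
    Integrable (tens f) (haarPi n k) :=
  Integrable.fintype_prod hf

theorem memLp_tens {f : Fin n → k → ℂ} (hf : ∀ j, Integrable (f j) (haar k))
    (hf2 : ∀ j, MemLp (f j) 2 (haar k)) : MemLp (tens f) 2 (haarPi n k) := by
  rw [memLp_two_iff_integrable_sq_norm (integrable_tens hf).1]
  have : (fun u => ‖tens f u‖ ^ 2) = fun u : Fin n → k => ∏ j, ‖f j (u j)‖ ^ 2 := by
    ext u; rw [tens, norm_prod, Finset.prod_pow]
  rw [this]
  exact Integrable.fintype_prod (f := fun j x => ‖f j x‖ ^ 2)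
    fun j => (memLp_two_iff_integrable_sq_norm (hf j).1).1 (hf2 j)

/-! ### A self-dual function -/

/-- A nonnegative even continuous function that is its own Fourier transform. -/
structure IsSelfDual (ψ : AddChar k Circle) (s : ℝ) (h : k → ℝ) : Prop where
  continuous : Continuous h
  nonneg : ∀ x, 0 ≤ h x
  even : ∀ x, h (-x) = h x
  pos : 0 < h 0
  integrable : Integrable h (haar k)
  memLp : MemLp h 2 (haar k)
  fourier : ∀ x, (s : ℂ) * ft ψ (haar k) (fun v => (h v : ℂ)) x = h x

include hψ in
theorem exists_isSelfDual (hψ₁ : ψ ≠ 1) (hs : IsSelfDualScale ψ s) : ∃ h, IsSelfDual ψ s h := by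
  obtain ⟨g, G, hg, hgG, hG0, hGc, hGi, hGp⟩ := exists_bump_ft_integrable hψ (μ := haar k) hψ₁
  have hs0 := hs.1
  have hGe : ∀ x, G (-x) = G x := fun x => by
    have h1 := ft_even (ψ := ψ) (μ := haar k) (f := fun v => (g v : ℂ)) (fun v => by rw [hg.even]) x
    rw [hgG, hgG] at h1
    exact_mod_cast h1
  have hg2 : MemLp g 2 (haar k) := hg.continuous.memLp_of_hasCompactSupport hg.hasCompactSupport
  have hg2c : MemLp (fun v => (g v : ℂ)) 2 (haar k) := hg2.ofReal
  have hGic : Integrable (fun v => (G v : ℂ)) (haar k) := hGi.ofReal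
  have hG2c : MemLp (fun v => (G v : ℂ)) 2 (haar k) := by
    have h1 := (hs.2 _ hg.integrable.ofReal hg2c).1
    exact h1.ae_eq (Eventually.of_forall hgG)
  have hG2 : MemLp G 2 (haar k) := by simpa using hG2c.re
  set H : k → ℝ := fun x => s ^ 2 * (ft ψ (haar k) (fun v => (G v : ℂ)) x).re with hH
  have hft : ∀ x, ft ψ (haar k) (fun v => (G v : ℂ)) x
      = (((ft ψ (haar k) (fun v => (G v : ℂ)) x).re : ℝ) : ℂ) := fun x => ft_eq_re hGe x
  have hHc : Continuous H := continuous_const.mul (Complex.continuous_re.comp (continuous_ft hψ hGic))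
  have hfG2 := (hs.2 _ hGic hG2c).1
  have hH2 : MemLp H 2 (haar k) := hfG2.re.const_mul (s ^ 2)
  have e1 : ∫ x, H x ^ 2 ∂(haar k) = s ^ 2 * ∫ x, G x ^ 2 ∂(haar k) := by
    have h1 := (hs.2 _ hGic hG2c).2
    have h2 : ∀ x, H x ^ 2 = s ^ 2 * ‖(s : ℂ) * ft ψ (haar k) (fun v => (G v : ℂ)) x‖ ^ 2 := by
      intro x
      rw [hft x, norm_mul, Complex.norm_real, Complex.norm_real, hH, mul_pow, Real.norm_eq_abs,
        Real.norm_eq_abs, mul_pow, sq_abs, sq_abs]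
      ring
    simp only [h2]
    rw [integral_const_mul, h1]
    simp
  have e2 : ∫ x, g x ^ 2 ∂(haar k) = s ^ 2 * ∫ x, G x ^ 2 ∂(haar k) := by
    have h1 := (hs.2 _ hg.integrable.ofReal hg2c).2
    have h2 : ∀ x, ‖(s : ℂ) * ft ψ (haar k) (fun v => (g v : ℂ)) x‖ = ‖(s : ℂ) * (G x : ℂ)‖ :=
      fun x => by rw [hgG]
    erw [funext fun x => congrArg (· ^ 2) (h2 x)] at h1
    simp only [norm_mul, Complex.norm_real, Real.norm_eq_abs, mul_pow, sq_abs] at h1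
    rw [integral_const_mul] at h1
    refine Eq.trans ?_ h1.symm
    congr 1; ext x
    exact ((congrArg (· ^ 2) (Complex.norm_real (g x))).trans (sq_abs (g x))).symm
  have e3 : ∫ x, g x * H x ∂(haar k) = s ^ 2 * ∫ x, G x ^ 2 ∂(haar k) := by
    have h1 := integral_ft_mul hψ (μ := haar k) (f := fun v => (g v : ℂ)) (g := fun v => (G v : ℂ))
      hg.integrable.ofReal hGic
    have h2 : ∫ x, g x * H x ∂(haar k)
        = s ^ 2 * ∫ x, g x * (ft ψ (haar k) (fun v => (G v : ℂ)) x).re ∂(haar k) := by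
      rw [← integral_const_mul]; congr 1; ext x; rw [hH]; ring
    rw [h2]
    congr 1
    have h3 : ((∫ x, G x ^ 2 ∂(haar k) : ℝ) : ℂ)
        = ((∫ x, g x * (ft ψ (haar k) (fun v => (G v : ℂ)) x).re ∂(haar k) : ℝ) : ℂ) := by
      refine (integral_ofReal (𝕜 := ℂ)).symm.trans (Eq.trans ?_ (integral_ofReal (𝕜 := ℂ)))
      refine Eq.trans ?_ (h1.trans ?_)
      · congr 1; ext x; rw [hgG]
        exact (Complex.ofReal_pow (G x) 2).trans (sq _)
      · congr 1; ext x; rw [hft x]; push_cast; simp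
    exact_mod_cast h3.symm
  have hgH : ∀ x, g x = H x := by
    have i1 : Integrable (fun x => g x ^ 2) (haar k) := by simpa using hg2.integrable_norm_pow (by norm_num)
    have i2 : Integrable (fun x => H x ^ 2) (haar k) := by simpa using hH2.integrable_norm_pow (by norm_num)
    have i3 : Integrable (fun x => g x * H x) (haar k) := hg2.integrable_mul hH2
    have e4 : ∫ x, (g x - H x) ^ 2 ∂(haar k) = 0 := by
      have h1 : ∀ x, (g x - H x) ^ 2 = g x ^ 2 - 2 * (g x * H x) + H x ^ 2 := fun x => by ring
      simp only [h1]
      have i5 : Integrable (fun x => g x ^ 2 - 2 * (g x * H x)) (haar k) := i1.sub (i3.const_mul 2)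
      rw [integral_add i5 i2, integral_sub i1 (i3.const_mul 2), integral_const_mul, e1, e2, e3]
      ring
    have i4 : Integrable (fun x => (g x - H x) ^ 2) (haar k) := by
      simpa using (hg2.sub hH2).integrable_norm_pow (by norm_num)
    have h2 := (integral_eq_zero_iff_of_nonneg (fun x => sq_nonneg _) i4).1 e4
    have h3 : (fun x => (g x - H x) ^ 2) = 0 :=
      Continuous.ae_eq_iff_eq (haar k) ((hg.continuous.sub hHc).pow 2) continuous_const |>.1 h2
    intro x
    have := congrFun h3 x
    simpa [sub_eq_zero] using this
  refine ⟨fun x => g x + s * G x, hg.continuous.add (continuous_const.mul hGc),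
    fun x => add_nonneg (hg.nonneg x) (mul_nonneg hs0.le (hG0 x)),
    fun x => by rw [hg.even, hGe], add_pos_of_pos_of_nonneg hg.pos (mul_nonneg hs0.le (hG0 0)),
    hg.integrable.add (hGi.const_mul s), hg2.add (hG2.const_mul s), fun x => ?_⟩
  have h5 : ft ψ (haar k) (fun v => ((g v + s * G v : ℝ) : ℂ)) x
      = ft ψ (haar k) (fun v => (g v : ℂ)) x + s * ft ψ (haar k) (fun v => (G v : ℂ)) x := by
    simp only [ft]
    rw [← integral_const_mul, ← integral_add]
    · congr 1; ext v; push_cast; ring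
    · exact integrable_ft_integrand hψ hg.integrable.ofReal x
    · exact (integrable_ft_integrand hψ hGic x).const_mul _
  rw [h5, hgG, hft x, hgH x, hH]
  push_cast
  ring

/-- The product of copies of a function of one variable, as an element of `L²(kⁿ)`. -/
def tensL2 (f : Fin n → k → ℂ) (hf : ∀ j, Integrable (f j) (haar k))
    (hf2 : ∀ j, MemLp (f j) 2 (haar k)) : L2 n k := (memLp_tens hf hf2).toLp

theorem tensL2_ae {f : Fin n → k → ℂ} (hf : ∀ j, Integrable (f j) (haar k))
    (hf2 : ∀ j, MemLp (f j) 2 (haar k)) : tensL2 f hf hf2 =ᵐ[haarPi n k] tens f :=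
  MemLp.coeFn_toLp _

theorem fourierOp_ae_of_ae {f : L2 n k} {g : (Fin n → k) → ℂ} (i : Fin n)
    (hg : Integrable g (haarPi n k)) (h : f =ᵐ[haarPi n k] g) :
    fourierOp hψ hs i f =ᵐ[haarPi n k] fun u => (s : ℂ) * pft ψ i g u := by
  refine (fourierOp_ae hψ hs i (hg.congr h.symm)).trans ?_
  filter_upwards [pft_congr_ae (ψ := ψ) i h] with u hu
  rw [hu]

variable (n) in
/-- The vector `⊗ h`. -/
def vac {h : k → ℝ} (hh : IsSelfDual ψ s h) : L2 n k :=
  tensL2 (fun _ v => (h v : ℂ)) (fun _ => hh.integrable.ofReal) (fun _ => hh.memLp.ofReal)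

theorem vac_ae {h : k → ℝ} (hh : IsSelfDual ψ s h) :
    vac n hh =ᵐ[haarPi n k] fun u => ((∏ j, h (u j) : ℝ) : ℂ) := by
  refine (tensL2_ae _ _).trans (Eventually.of_forall fun u => ?_)
  simp [tens]

theorem vac_ne_zero {h : k → ℝ} (hh : IsSelfDual ψ s h) : vac n hh ≠ 0 := by
  intro e
  have h1 : (fun u : Fin n → k => ∏ j, h (u j)) =ᵐ[haarPi n k] fun _ => 0 := by
    filter_upwards [vac_ae hh, Lp.coeFn_zero ℂ 2 (haarPi n k)] with u h2 h3
    rw [e, h3] at h2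
    exact Complex.ofReal_eq_zero.1 h2.symm
  have h2 := (Continuous.ae_eq_iff_eq (haarPi n k)
    (continuous_finsetProd _ fun j _ => hh.continuous.comp (continuous_apply j))
    continuous_const).1 h1
  exact (Finset.prod_pos fun j _ => hh.pos).ne' (congrFun h2 0)

theorem fourierOp_vac {h : k → ℝ} (hh : IsSelfDual ψ s h) (i : Fin n) :
    fourierOp hψ hs i (vac n hh) = vac n hh := by
  ext1
  refine (fourierOp_ae_of_ae hψ hs i (integrable_tens fun _ => hh.integrable.ofReal)
    (tensL2_ae _ _)).trans (EventuallyEq.trans (Eventually.of_forall fun u => ?_) (tensL2_ae _ _).symm)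
  simp only [pft_tens, tens_update_left]
  rw [← mul_assoc, tens, ← Finset.mul_prod_erase _ _ (Finset.mem_univ i)]
  exact congrArg (· * _) (hh.fourier (u i))

end FourierRelations

section Schur

open BoundedContinuousFunction

variable {n : ℕ} {k : Type*} [NontriviallyNormedField k] [ProperSpace k] [MeasurableSpace k]
  [BorelSpace k] {ψ : AddChar k Circle} (hψ : Continuous ψ)

theorem continuous_dotChar (hψ : Continuous ψ) (x : Fin n → k) :
    Continuous fun u : Fin n → k => (ψ (u ⬝ᵥ x) : ℂ) := by
  refine continuous_subtype_val.comp (hψ.comp ?_)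
  unfold dotProduct
  fun_prop

/-- The character `u ↦ ψ(u ⬝ x)` as a bounded continuous function. -/
def dotChar (hψ : Continuous ψ) (x : Fin n → k) : (Fin n → k) →ᵇ ℂ :=
  BoundedContinuousFunction.ofNormedAddCommGroup (fun u => (ψ (u ⬝ᵥ x) : ℂ))
    (continuous_dotChar hψ x) 1 fun _ => (Circle.norm_coe _).le

theorem dotChar_apply (x u : Fin n → k) : dotChar hψ x u = (ψ (u ⬝ᵥ x) : ℂ) := rfl

theorem mem_closure_dotChar {g : (Fin n → k) →ᵇ ℂ}
    (hg : g ∈ Submonoid.closure (Set.range (dotChar (n := n) hψ) ∪ star (Set.range (dotChar hψ)))) :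
    g ∈ Set.range (dotChar (n := n) hψ) := by
  induction hg using Submonoid.closure_induction with
  | mem x hx =>
    rcases hx with hx | ⟨y, hy⟩
    · exact hx
    · refine ⟨-y, ?_⟩
      rw [← star_star x, ← hy]
      ext u
      simp only [dotChar_apply, BoundedContinuousFunction.star_apply, dotProduct_neg,
        AddChar.map_neg_eq_inv, Circle.coe_inv_eq_conj]
      rfl
  | one => exact ⟨0, by ext u; simp [dotChar_apply]⟩
  | mul x y _ _ hx hy =>
    obtain ⟨a, rfl⟩ := hx
    obtain ⟨b, rfl⟩ := hy
    refine ⟨a + b, ?_⟩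
    ext u
    simp [dotChar_apply, dotProduct_add, AddChar.map_add_eq_mul]

include hψ in
/-- A finite measure on `kⁿ` is determined by its Fourier transform. -/
theorem measure_ext_of_char (hψ₁ : ψ ≠ 1) {P P' : Measure (Fin n → k)} [IsFiniteMeasure P]
    [IsFiniteMeasure P']
    (h : ∀ x, ∫ u, (ψ (u ⬝ᵥ x) : ℂ) ∂P = ∫ u, (ψ (u ⬝ᵥ x) : ℂ) ∂P') : P = P' := by
  refine ext_of_forall_mem_subalgebra_integral_eq_of_pseudoEMetric_complete_countable
    (A := StarAlgebra.adjoin ℂ (Set.range (dotChar (n := n) hψ))) ?_ ?_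
  · intro v v' hvv
    obtain ⟨i, hi⟩ := Function.ne_iff.1 hvv
    obtain ⟨s, hs⟩ := DFunLike.ne_iff.1 hψ₁
    have hi' : v i - v' i ≠ 0 := sub_ne_zero.2 hi
    refine ⟨_, ⟨_, ⟨dotChar hψ (Pi.single i (s / (v i - v' i))),
      StarAlgebra.subset_adjoin ℂ _ ⟨_, rfl⟩, rfl⟩, rfl⟩, fun e => hs ?_⟩
    have e1 : (ψ (v ⬝ᵥ Pi.single i (s / (v i - v' i))) : ℂ)
        = (ψ (v' ⬝ᵥ Pi.single i (s / (v i - v' i))) : ℂ) := e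
    have e2 := Circle.ext e1
    rw [dotProduct_single, dotProduct_single] at e2
    have e3 : s = v i * (s / (v i - v' i)) + -(v' i * (s / (v i - v' i))) := by
      field_simp
      ring
    rw [e3, AddChar.map_add_eq_mul, e2, ← AddChar.map_add_eq_mul, add_neg_cancel]
    simp
  · intro g hg
    have h1 : g ∈ Submodule.span ℂ (Set.range (dotChar (n := n) hψ)) := by
      have h2 : g ∈ Subalgebra.toSubmodule
        (StarAlgebra.adjoin ℂ (Set.range (dotChar (n := n) hψ))).toSubalgebra := hg
      rw [StarAlgebra.adjoin_eq_span] at h2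
      exact Submodule.span_mono (fun x hx => mem_closure_dotChar hψ hx) h2
    induction h1 using Submodule.span_induction with
    | mem x hx => obtain ⟨y, rfl⟩ := hx; exact h y
    | zero => simp
    | add x y hx hy e1 e2 =>
      have hm : ∀ z ∈ Submodule.span ℂ (Set.range (dotChar (n := n) hψ)),
          z ∈ StarAlgebra.adjoin ℂ (Set.range (dotChar (n := n) hψ)) := by
        intro z hz
        have : Submodule.span ℂ (Set.range (dotChar (n := n) hψ)) ≤ Subalgebra.toSubmodule
          (StarAlgebra.adjoin ℂ (Set.range (dotChar (n := n) hψ))).toSubalgebra :=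
          Submodule.span_le.2 (StarAlgebra.subset_adjoin ℂ _)
        exact this hz
      simp only [BoundedContinuousFunction.coe_add, Pi.add_apply]
      rw [integral_add (x.integrable P) (y.integrable P),
        integral_add (x.integrable P') (y.integrable P'), e1 (hm x hx), e2 (hm y hy)]
    | smul c x hx e1 =>
      have hm : x ∈ StarAlgebra.adjoin ℂ (Set.range (dotChar (n := n) hψ)) := by
        have : Submodule.span ℂ (Set.range (dotChar (n := n) hψ)) ≤ Subalgebra.toSubmodule
          (StarAlgebra.adjoin ℂ (Set.range (dotChar (n := n) hψ))).toSubalgebra :=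
          Submodule.span_le.2 (StarAlgebra.subset_adjoin ℂ _)
        exact this hx
      simp only [BoundedContinuousFunction.coe_smul, smul_eq_mul]
      rw [integral_const_mul, integral_const_mul, e1 hm]

theorem isFiniteMeasure_withDensity_toNNReal {α : Type*} [MeasurableSpace α] {ν : Measure α}
    {D : α → ℝ} (hD : Integrable D ν) :
    IsFiniteMeasure (ν.withDensity fun u => ((D u).toNNReal : ℝ≥0∞)) :=
  isFiniteMeasure_withDensity (ne_of_lt hD.lintegral_lt_top)

include hψ in
theorem ae_zero_of_char_real (hψ₁ : ψ ≠ 1) {D : (Fin n → k) → ℝ} (hD : Integrable D (haarPi n k))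
    (h : ∀ x, ∫ u, (D u : ℂ) * (ψ (u ⬝ᵥ x) : ℂ) ∂(haarPi n k) = 0) :
    D =ᵐ[haarPi n k] 0 := by
  have i1 := isFiniteMeasure_withDensity_toNNReal hD
  have i2 := isFiniteMeasure_withDensity_toNNReal hD.neg
  have m1 : AEMeasurable (fun u => (D u).toNNReal) (haarPi n k) := hD.1.aemeasurable.real_toNNReal
  have m2 : AEMeasurable (fun u => (-D u).toNNReal) (haarPi n k) :=
    hD.neg.1.aemeasurable.real_toNNReal
  have key : (haarPi n k).withDensity (fun u => ((D u).toNNReal : ℝ≥0∞))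
      = (haarPi n k).withDensity (fun u => (((-D) u).toNNReal : ℝ≥0∞)) := by
    refine measure_ext_of_char hψ hψ₁ fun x => ?_
    have e1 := integral_withDensity_eq_integral_smul₀ m1 fun u => (ψ (u ⬝ᵥ x) : ℂ)
    have e2 := integral_withDensity_eq_integral_smul₀ m2 fun u => (ψ (u ⬝ᵥ x) : ℂ)
    refine e1.trans (Eq.trans ?_ e2.symm)
    have hsm : ∀ (r : ℝ≥0) (z : ℂ), r • z = ((r : ℝ) : ℂ) * z := fun r z => by
      rw [NNReal.smul_def, Complex.real_smul]
    have hI : ∀ {E : (Fin n → k) → ℝ}, Integrable E (haarPi n k) →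
        Integrable (fun u => (E u).toNNReal • (ψ (u ⬝ᵥ x) : ℂ)) (haarPi n k) := by
      intro E hE
      simp only [hsm]
      exact integrable_mul_addChar hE.real_toNNReal.ofReal
        (continuous_dotChar hψ x).aestronglyMeasurable
    refine sub_eq_zero.1 ((integral_sub (hI hD) (hI hD.neg)).symm.trans ((h x).symm.trans ?_).symm)
    congr 1; ext u
    symm
    simp only [hsm, ← sub_mul, Real.coe_toNNReal', Pi.neg_apply]
    rw [← Complex.ofReal_sub, max_zero_sub_max_neg_zero_eq_self]
  have m1' := m1.coe_nnreal_ennreal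
  have m2' := m2.coe_nnreal_ennreal
  have h2 := (withDensity_eq_iff m1' m2' (ne_of_lt hD.lintegral_lt_top)).1 key
  filter_upwards [h2] with u hu
  have hu' : (D u).toNNReal = (-D u).toNNReal := ENNReal.coe_injective hu
  rcases le_total 0 (D u) with h0 | h0
  · rw [Real.toNNReal_of_nonpos (neg_nonpos.2 h0), Real.toNNReal_eq_zero] at hu'
    exact le_antisymm hu' h0
  · rw [Real.toNNReal_of_nonpos h0, eq_comm, Real.toNNReal_eq_zero] at hu'
    exact le_antisymm h0 (neg_nonpos.1 hu')

include hψ in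
/-- An integrable function on `kⁿ` whose Fourier transform vanishes is zero. -/
theorem ae_zero_of_char (hψ₁ : ψ ≠ 1) {D : (Fin n → k) → ℂ} (hD : Integrable D (haarPi n k))
    (h : ∀ x, ∫ u, D u * (ψ (u ⬝ᵥ x) : ℂ) ∂(haarPi n k) = 0) : D =ᵐ[haarPi n k] 0 := by
  have hc : ∀ x, ∫ u, conj (D u) * (ψ (u ⬝ᵥ x) : ℂ) ∂(haarPi n k) = 0 := by
    intro x
    have h1 := congrArg conj (h (-x))
    rw [← integral_conj, map_zero] at h1
    rw [← h1]
    congr 1; ext u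
    rw [map_mul, dotProduct_neg, AddChar.map_neg_eq_inv, Circle.coe_inv_eq_conj, Complex.conj_conj]
  have hDc : Integrable (fun u => conj (D u)) (haarPi n k) := by
    refine hD.mono (RCLike.continuous_conj.comp_aestronglyMeasurable hD.1) ?_
    exact Eventually.of_forall fun t => by simp
  have hm := fun x => (continuous_dotChar hψ x).aestronglyMeasurable (μ := haarPi n k)
  have hre := ae_zero_of_char_real hψ hψ₁ hD.re fun x => by
    have e : ∀ u, (((RCLike.re (D u) : ℝ) : ℂ)) * (ψ (u ⬝ᵥ x) : ℂ)
        = 2⁻¹ * (D u * (ψ (u ⬝ᵥ x) : ℂ) + conj (D u) * (ψ (u ⬝ᵥ x) : ℂ)) := fun u => by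
      rw [← add_mul, Complex.add_conj]; simp; ring
    simp only [e]
    rw [integral_const_mul, integral_add (integrable_mul_addChar hD (hm x))
      (integrable_mul_addChar hDc (hm x)), h, hc]
    simp
  have him := ae_zero_of_char_real hψ hψ₁ hD.im fun x => by
    have e : ∀ u, (((RCLike.im (D u) : ℝ) : ℂ)) * (ψ (u ⬝ᵥ x) : ℂ)
        = (2 * Complex.I)⁻¹ * (D u * (ψ (u ⬝ᵥ x) : ℂ) - conj (D u) * (ψ (u ⬝ᵥ x) : ℂ)) := fun u => by
      rw [← sub_mul, Complex.sub_conj]; field_simp; simp [mul_comm]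
    simp only [e]
    rw [integral_const_mul, integral_sub (integrable_mul_addChar hD (hm x))
      (integrable_mul_addChar hDc (hm x)), h, hc]
    simp
  filter_upwards [hre, him] with u h1 h2
  exact Complex.ext h1 h2

theorem schrodinger_inl_ae (x : Fin n → k) (f : L2 n k) :
    schrodinger ψ hψ (Sum.elim x 0) f =ᵐ[haarPi n k] fun u => (ψ (u ⬝ᵥ x) : ℂ) * f u := by
  refine (schrodinger_ae hψ _ f).trans (Eventually.of_forall fun u => ?_)
  have e1 : (Sum.elim x (0 : Fin n → k)) ∘ Sum.inl = x := rfl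
  have e2 : (Sum.elim x (0 : Fin n → k)) ∘ Sum.inr = 0 := rfl
  simp only [schrodingerFun, e1, e2, dotProduct_zero, mul_zero, sub_zero]

theorem schrodinger_inr_ae (y : Fin n → k) (f : L2 n k) :
    schrodinger ψ hψ (Sum.elim 0 y) f =ᵐ[haarPi n k] fun u => f (u - y) := by
  refine (schrodinger_ae hψ _ f).trans (Eventually.of_forall fun u => ?_)
  have e1 : (Sum.elim (0 : Fin n → k) y) ∘ Sum.inl = 0 := rfl
  have e2 : (Sum.elim (0 : Fin n → k) y) ∘ Sum.inr = y := rfl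
  simp only [schrodingerFun, e1, e2, dotProduct_zero, zero_dotProduct, mul_zero, sub_zero,
    AddChar.map_zero_eq_one, Circle.coe_one, one_mul]

/-- A function invariant under all translations up to null sets is almost everywhere constant. -/
theorem ae_const_of_translation_invariant {m : (Fin n → k) → ℂ} (hm : Measurable m)
    (h : ∀ y, ∀ᵐ u ∂(haarPi n k), m (u - y) = m u) : ∃ c, m =ᵐ[haarPi n k] fun _ => c := by
  have hs : MeasurableSet {p : (Fin n → k) × (Fin n → k) | m (p.2 - p.1) = m p.2} :=
    measurableSet_eq_fun (hm.comp (measurable_snd.sub measurable_fst)) (hm.comp measurable_snd)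
  have h1 := (Measure.ae_ae_comm (μ := haarPi n k) (ν := haarPi n k)
    (p := fun y u => m (u - y) = m u) hs).1 (Eventually.of_forall h)
  obtain ⟨u, hu⟩ := h1.exists
  refine ⟨m u, ?_⟩
  have h2 := (Measure.measurePreserving_sub_left (haarPi n k) u).quasiMeasurePreserving.ae hu
  filter_upwards [h2] with y hy
  simpa using hy

variable (n k) in
theorem exists_pos_L2 : ∃ f : L2 n k, ∃ g : (Fin n → k) → ℝ, (∀ u, 0 < g u) ∧ Measurable g ∧
    f =ᵐ[haarPi n k] fun u => (g u : ℂ) := by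
  obtain ⟨g, hg, hgm, hgi⟩ := exists_pos_lintegral_lt_of_sigmaFinite (haarPi n k) one_ne_zero
  have hm : MemLp (fun u => ((√(g u) : ℝ) : ℂ)) 2 (haarPi n k) := by
    rw [memLp_two_iff_lintegral (by fun_prop)]
    refine lt_of_eq_of_lt (lintegral_congr fun u => ?_) (hgi.trans ENNReal.one_lt_top)
    rw [Complex.norm_real, Real.norm_eq_abs, sq_abs, Real.sq_sqrt (g u).coe_nonneg,
      ENNReal.ofReal_coe_nnreal]
  exact ⟨hm.toLp, _, fun u => Real.sqrt_pos.2 (by exact_mod_cast hg u), by fun_prop, hm.coeFn_toLp⟩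

theorem integrable_conj_mul (f g : L2 n k) :
    Integrable (fun u => conj (f u) * g u) (haarPi n k) := by
  have := L2.integrable_inner (𝕜 := ℂ) f g
  refine this.congr (Eventually.of_forall fun u => ?_)
  simp [mul_comm]

/-- A unitary operator that commutes with the Schrödinger representation is a scalar. -/
theorem eq_scalarOp_of_commute (hψ₁ : ψ ≠ 1) {M : L2 n k ≃ₗᵢ[ℂ] L2 n k}
    (hM : ∀ w f, M (schrodinger ψ hψ w f) = schrodinger ψ hψ w (M f)) :
    ∃ ζ, M = scalarOp n k ζ := by
  have key : ∀ f h : L2 n k, (fun u => conj (h u) * M f u)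
      =ᵐ[haarPi n k] fun u => conj (M.symm h u) * f u := by
    intro f h
    have h1 := ae_zero_of_char hψ hψ₁ ((integrable_conj_mul h (M f)).sub
      (integrable_conj_mul (M.symm h) f)) fun x => by
        have hm := (continuous_dotChar hψ x).aestronglyMeasurable (μ := haarPi n k)
        have e1 : ∀ a b : L2 n k, inner ℂ a (schrodinger ψ hψ (Sum.elim x 0) b)
            = ∫ u, (conj (a u) * b u) * (ψ (u ⬝ᵥ x) : ℂ) ∂(haarPi n k) := by
          intro a b
          rw [L2.inner_def]
          refine integral_congr_ae ?_
          filter_upwards [schrodinger_inl_ae hψ x b] with u hu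
          rw [hu, RCLike.inner_apply]; ring
        simp only [Pi.sub_apply, sub_mul]
        rw [integral_sub (integrable_mul_addChar (integrable_conj_mul h (M f)) hm)
          (integrable_mul_addChar (integrable_conj_mul (M.symm h) f) hm), ← e1, ← e1, ← hM,
          sub_eq_zero]
        have h2 := M.inner_map_map (M.symm h) (schrodinger ψ hψ (Sum.elim x 0) f)
        rw [M.apply_symm_apply] at h2
        exact h2
    filter_upwards [h1] with u hu
    exact sub_eq_zero.1 hu
  obtain ⟨f₀, g, hg, hgm, hf₀⟩ := exists_pos_L2 n k
  set m : (Fin n → k) → ℂ := fun u => M f₀ u / (g u : ℂ) with hmdef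
  have hg' : ∀ u, (g u : ℂ) ≠ 0 := fun u => by exact_mod_cast (hg u).ne'
  have hmm : Measurable m :=
    (Lp.stronglyMeasurable (M f₀)).measurable.div (Complex.measurable_ofReal.comp hgm)
  have hMm : ∀ f : L2 n k, M f =ᵐ[haarPi n k] fun u => m u * f u := by
    intro f
    filter_upwards [key f f₀, key f₀ f₀, hf₀] with u h1 h2 h3
    rw [h3, Complex.conj_ofReal] at h1 h2
    have h4 : conj (M.symm f₀ u) = M f₀ u := mul_right_cancel₀ (hg' u) (by rw [← h2, mul_comm])
    rw [h4] at h1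
    rw [hmdef, div_mul_eq_mul_div, ← h1, mul_div_cancel_left₀ _ (hg' u)]
  obtain ⟨c, hc⟩ := ae_const_of_translation_invariant hmm fun y => by
    have e1 := hMm (schrodinger ψ hψ (Sum.elim 0 y) f₀)
    rw [hM] at e1
    have hq := (measurePreserving_sub_right (haarPi n k) y).quasiMeasurePreserving
    filter_upwards [e1, schrodinger_inr_ae hψ y f₀, schrodinger_inr_ae hψ y (M f₀),
      hq.ae (hMm f₀), hq.ae hf₀] with u h1 h2 h3 h4 h5
    rw [h3, h2, h4, h5] at h1
    exact mul_right_cancel₀ (hg' _) h1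
  have hMc : ∀ f, M f = c • f := by
    intro f
    ext1
    filter_upwards [hMm f, hc, Lp.coeFn_smul c f] with u h1 h2 h3
    rw [h1, h2, h3, Pi.smul_apply, smul_eq_mul]
  have hf0 : f₀ ≠ 0 := by
    intro e
    have : ∀ᵐ u ∂(haarPi n k), False := by
      filter_upwards [hf₀, Lp.coeFn_zero ℂ 2 (haarPi n k)] with u h1 h2
      rw [e, h2] at h1
      exact hg' u h1.symm
    obtain ⟨_, h⟩ := this.exists
    exact h
  have hc1 : ‖c‖ = 1 := by
    have h1 := M.norm_map f₀
    rw [hMc, norm_smul] at h1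
    exact mul_right_cancel₀ (norm_ne_zero_iff.2 hf0) (by rw [h1, one_mul])
  refine ⟨⟨c, mem_sphere_zero_iff_norm.2 hc1⟩, ?_⟩
  ext1 f
  exact hMc f

theorem scalarOp_mul (ζ ξ : Circle) : scalarOp n k (ζ * ξ) = scalarOp n k ζ * scalarOp n k ξ := by
  ext1 f
  change ((ζ * ξ : Circle) : ℂ) • f = (ζ : ℂ) • (ξ : ℂ) • f
  rw [smul_smul, Circle.coe_mul]

theorem scalarOp_one : scalarOp n k 1 = 1 := by
  ext1 f
  exact one_smul ℂ f

theorem scalarOp_mem (ζ : Circle) : ((1 : Sp n k), scalarOp n k ζ) ∈ weilGroup n ψ hψ := by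
  intro w f
  change (ζ : ℂ) • schrodinger ψ hψ w f = schrodinger ψ hψ ((1 : Matrix _ _ k) *ᵥ w) ((ζ : ℂ) • f)
  rw [Matrix.one_mulVec, ← schrodingerOp_apply, ← schrodingerOp_apply, map_smul]

/-- Two elements of Weil's group over the same symplectic matrix differ by a scalar. -/
theorem exists_scalarOp_of_fst_eq (hψ₁ : ψ ≠ 1) {p q : Sp n k × (L2 n k ≃ₗᵢ[ℂ] L2 n k)}
    (hp : p ∈ weilGroup n ψ hψ) (hq : q ∈ weilGroup n ψ hψ) (h : p.1 = q.1) :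
    ∃ ζ, p.2 = scalarOp n k ζ * q.2 := by
  have h1 := mul_mem hp (inv_mem hq)
  have h2 : (p * q⁻¹).1 = 1 := by rw [Prod.fst_mul, Prod.fst_inv, h, mul_inv_cancel]
  obtain ⟨ζ, hζ⟩ := eq_scalarOp_of_commute hψ hψ₁ (M := (p * q⁻¹).2) fun w f => by
    have h3 := h1 w f
    rw [h2] at h3
    change _ = schrodinger ψ hψ ((1 : Matrix _ _ k) *ᵥ w) _ at h3
    rwa [Matrix.one_mulVec] at h3
  refine ⟨ζ, ?_⟩
  rw [← hζ, Prod.snd_mul, Prod.snd_inv, inv_mul_cancel_right]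

theorem scalarOp_comm (ζ : Circle) (M : L2 n k ≃ₗᵢ[ℂ] L2 n k) :
    scalarOp n k ζ * M = M * scalarOp n k ζ := by
  ext1 f
  change (ζ : ℂ) • M f = M ((ζ : ℂ) • f)
  rw [map_smul]

theorem scalarOp_injective : Function.Injective (scalarOp n k) := by
  intro ζ ξ h
  obtain ⟨f, g, hg, -, hf⟩ := exists_pos_L2 n k
  have hf0 : f ≠ 0 := by
    intro e
    have : ∀ᵐ u ∂(haarPi n k), False := by
      filter_upwards [hf, Lp.coeFn_zero ℂ 2 (haarPi n k)] with u h1 h2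
      rw [e, h2] at h1
      exact (hg u).ne' (Complex.ofReal_eq_zero.1 h1.symm)
    obtain ⟨_, h⟩ := this.exists
    exact h
  have h1 : (ζ : ℂ) • f = (ξ : ℂ) • f := DFunLike.congr_fun h f
  exact Circle.ext (smul_left_injective ℂ hf0 h1)

end Schur

section Siegel

open scoped commutatorElement

/-! ### The Siegel parabolic subgroup and its action -/

section Algebra

variable {n : ℕ} {k : Type*} [Field k]

variable (n k) in
/-- The Siegel parabolic subgroup, of the block upper triangular symplectic matrices. -/
def siegel : Subgroup (Sp n k) where
  carrier := {g | g.1.toBlocks₂₁ = 0}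
  one_mem' := by
    change (1 : Matrix (Fin n ⊕ Fin n) (Fin n ⊕ Fin n) k).toBlocks₂₁ = 0
    rw [← fromBlocks_one, toBlocks_fromBlocks₂₁]
  mul_mem' {g h} hg hh := by
    change (g.1 * h.1).toBlocks₂₁ = 0
    have hg' : g.1.toBlocks₂₁ = 0 := hg
    have hh' : h.1.toBlocks₂₁ = 0 := hh
    rw [← fromBlocks_toBlocks g.1, ← fromBlocks_toBlocks h.1, hg', hh', fromBlocks_multiply,
      toBlocks_fromBlocks₂₁]
    simp
  inv_mem' {g} hg := by
    change (g⁻¹).1.toBlocks₂₁ = 0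
    have hg' : g.1.toBlocks₂₁ = 0 := hg
    rw [SymplecticGroup.coe_inv, ← fromBlocks_toBlocks g.1, hg']
    simp [J, fromBlocks_transpose, fromBlocks_multiply, fromBlocks_neg]

theorem siegel_eq {g : Sp n k} (hg : g ∈ siegel n k) :
    g.1 = fromBlocks g.1.toBlocks₁₁ g.1.toBlocks₁₂ 0 g.1.toBlocks₂₂ := by
  have hg' : g.1.toBlocks₂₁ = 0 := hg
  conv_lhs => rw [← fromBlocks_toBlocks g.1, hg']

theorem siegel_transpose_mul {g : Sp n k} (hg : g ∈ siegel n k) :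
    g.1.toBlocks₁₁ᵀ * g.1.toBlocks₂₂ = 1 := by
  have h := g.2
  rw [siegel_eq hg, SymplecticGroup.fromBlocks_mem_iff] at h
  simpa using h.2.2

theorem siegel_mul_transpose {g : Sp n k} (hg : g ∈ siegel n k) :
    g.1.toBlocks₂₂ * g.1.toBlocks₁₁ᵀ = 1 :=
  mul_eq_one_comm.1 (siegel_transpose_mul hg)

theorem siegel_transpose_mul' {g : Sp n k} (hg : g ∈ siegel n k) :
    g.1.toBlocks₂₂ᵀ * g.1.toBlocks₁₁ = 1 := by
  have := congrArg transpose (siegel_transpose_mul hg)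
  simpa using this

theorem siegel_isSymm {g : Sp n k} (hg : g ∈ siegel n k) :
    (g.1.toBlocks₁₂ * g.1.toBlocks₁₁ᵀ).IsSymm := by
  have h := g.2
  rw [siegel_eq hg, SymplecticGroup.fromBlocks_mem_iff] at h
  set A := g.1.toBlocks₁₁
  set B := g.1.toBlocks₁₂
  set D := g.1.toBlocks₂₂
  have e1 : A * Dᵀ = 1 := mul_eq_one_comm.1 (siegel_transpose_mul' hg)
  have e2 : D * Aᵀ = 1 := siegel_mul_transpose hg
  have h2 : Bᵀ * D = Dᵀ * B := h.2.1
  change (B * Aᵀ)ᵀ = B * Aᵀ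
  calc (B * Aᵀ)ᵀ = A * (Bᵀ * (D * Aᵀ)) := by rw [e2]; simp
    _ = A * (Bᵀ * D) * Aᵀ := by simp only [Matrix.mul_assoc]
    _ = A * Dᵀ * (B * Aᵀ) := by rw [h2]; simp only [Matrix.mul_assoc]
    _ = B * Aᵀ := by rw [e1, Matrix.one_mul]

theorem siegel_mul₁₁ {g h : Sp n k} (hg : g ∈ siegel n k) (hh : h ∈ siegel n k) :
    (g * h).1.toBlocks₁₁ = g.1.toBlocks₁₁ * h.1.toBlocks₁₁ := by
  change (g.1 * h.1).toBlocks₁₁ = _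
  conv_lhs => rw [siegel_eq hg, siegel_eq hh, fromBlocks_multiply, toBlocks_fromBlocks₁₁]
  simp

theorem siegel_mul₁₂ {g h : Sp n k} (hg : g ∈ siegel n k) (hh : h ∈ siegel n k) :
    (g * h).1.toBlocks₁₂ = g.1.toBlocks₁₁ * h.1.toBlocks₁₂ + g.1.toBlocks₁₂ * h.1.toBlocks₂₂ := by
  change (g.1 * h.1).toBlocks₁₂ = _
  conv_lhs => rw [siegel_eq hg, siegel_eq hh, fromBlocks_multiply, toBlocks_fromBlocks₁₂]

/-- The matrix of the quadratic form attached to an element of the Siegel parabolic. -/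
def siegelForm (g : Sp n k) : Matrix (Fin n) (Fin n) k := g.1.toBlocks₁₂ * g.1.toBlocks₁₁ᵀ

theorem siegelForm_mul {g h : Sp n k} (hg : g ∈ siegel n k) (hh : h ∈ siegel n k) :
    siegelForm (g * h) = siegelForm g
      + g.1.toBlocks₁₁ * siegelForm h * g.1.toBlocks₁₁ᵀ := by
  rw [siegelForm, siegel_mul₁₁ hg hh, siegel_mul₁₂ hg hh, transpose_mul, Matrix.add_mul,
    siegelForm, siegelForm, add_comm]
  congr 1
  · calc _ = g.1.toBlocks₁₂ * (h.1.toBlocks₂₂ * h.1.toBlocks₁₁ᵀ) * g.1.toBlocks₁₁ᵀ := by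
          simp only [Matrix.mul_assoc]
      _ = _ := by rw [siegel_mul_transpose hh, Matrix.mul_one]
  · simp only [Matrix.mul_assoc]

end Algebra

variable {n : ℕ} {k : Type*} [NontriviallyNormedField k] [ProperSpace k] [MeasurableSpace k]
  [BorelSpace k] {ψ : AddChar k Circle} (hψ : Continuous ψ)

theorem continuous_quadChar (hψ : Continuous ψ) (S : Matrix (Fin n) (Fin n) k) :
    Continuous fun u : Fin n → k => ψ (2⁻¹ * (u ⬝ᵥ S *ᵥ u)) := by
  refine hψ.comp ?_
  unfold dotProduct mulVec dotProduct
  fun_prop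

/-- Multiplication by `ψ(uᵀ S u / 2)`. -/
def quadOp (S : Matrix (Fin n) (Fin n) k) : L2 n k ≃ₗᵢ[ℂ] L2 n k :=
  mulOp _ (continuous_quadChar hψ S)

/-- The substitution `u ↦ Aᵀ u` attached to an element of the Siegel parabolic. -/
def siegelSubst (g : siegel n k) : (Fin n → k) ≃ₜ+ (Fin n → k) where
  toFun u := (g.1.1.toBlocks₁₁)ᵀ *ᵥ u
  invFun u := g.1.1.toBlocks₂₂ *ᵥ u
  left_inv u := by simp [siegel_mul_transpose g.2]
  right_inv u := by simp [siegel_transpose_mul g.2]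
  map_add' u v := mulVec_add _ _ _
  continuous_toFun := by
    exact continuous_const.matrix_mulVec continuous_id
  continuous_invFun := by
    exact continuous_const.matrix_mulVec continuous_id

theorem siegelSubst_apply (g : siegel n k) (u : Fin n → k) :
    siegelSubst g u = (g.1.1.toBlocks₁₁)ᵀ *ᵥ u := rfl

theorem siegelSubst_mul (g h : siegel n k) :
    siegelSubst (g * h) = (siegelSubst g).trans (siegelSubst h) := by
  ext u : 1
  change ((g * h : siegel n k).1.1.toBlocks₁₁)ᵀ *ᵥ u
    = (h.1.1.toBlocks₁₁)ᵀ *ᵥ ((g.1.1.toBlocks₁₁)ᵀ *ᵥ u)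
  rw [Matrix.mulVec_mulVec, ← transpose_mul, ← siegel_mul₁₁ g.2 h.2]
  rfl

/-- The factor by which `u ↦ Aᵀ u` scales measures. -/
def siegelScale (g : siegel n k) : ℝ≥0 := (addEquivAddHaarChar (siegelSubst g))⁻¹

theorem siegelScale_pos (g : siegel n k) : 0 < siegelScale g :=
  inv_pos.2 (addEquivAddHaarChar_pos _)

theorem siegelScale_mul (g h : siegel n k) :
    siegelScale (g * h) = siegelScale g * siegelScale h := by
  rw [siegelScale, siegelSubst_mul, addEquivAddHaarChar_trans, mul_inv]
  rfl

theorem map_siegelSubst (g : siegel n k) :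
    (haarPi n k).map (siegelSubst g).toHomeomorph.toMeasurableEquiv
      = siegelScale g • haarPi n k := by
  have h := addEquivAddHaarChar_smul_map (haarPi n k) (siegelSubst g)
  conv_rhs => rw [← h]
  rw [smul_smul, siegelScale, inv_mul_cancel₀ (addEquivAddHaarChar_pos _).ne', one_smul]
  rfl

/-- The operator `f(u) ↦ c ψ(uᵀ B Aᵀ u / 2) f(Aᵀ u)` attached to `[[A, B], [0, D]]`. -/
def siegelOp (g : siegel n k) : L2 n k ≃ₗᵢ[ℂ] L2 n k :=
  (compOp _ (siegelScale_pos g) (map_siegelSubst g)).trans (quadOp hψ (siegelForm g.1))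

theorem quasiMeasurePreserving_siegelSubst (g : siegel n k) :
    Measure.QuasiMeasurePreserving (siegelSubst g) (haarPi n k) (haarPi n k) :=
  quasiMeasurePreserving_of_map (siegelSubst g).toHomeomorph.toMeasurableEquiv.measurable
    (map_siegelSubst g)

theorem siegelOp_ae (g : siegel n k) (f : L2 n k) :
    siegelOp hψ g f =ᵐ[haarPi n k] fun u => (ψ (2⁻¹ * (u ⬝ᵥ siegelForm g.1 *ᵥ u)) : ℂ)
      * ((((√(siegelScale g : ℝ))⁻¹ : ℝ) : ℂ) * f ((g.1.1.toBlocks₁₁)ᵀ *ᵥ u)) := by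
  refine (mulOp_ae _ (continuous_quadChar hψ (siegelForm g.1)) _).trans ?_
  filter_upwards [compOp_ae _ (siegelScale_pos g) (map_siegelSubst g) f] with u hu
  exact congrArg (fun z : ℂ => (ψ (2⁻¹ * (u ⬝ᵥ siegelForm g.1 *ᵥ u)) : ℂ) * z) hu

theorem siegelOp_mul (g h : siegel n k) :
    siegelOp hψ (g * h) = siegelOp hψ g * siegelOp hψ h := by
  ext1 f
  ext1
  refine (siegelOp_ae hψ (g * h) f).trans (EventuallyEq.trans ?_ (siegelOp_ae hψ g _).symm)
  filter_upwards [(quasiMeasurePreserving_siegelSubst g).ae (siegelOp_ae hψ h f)] with u hu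
  rw [siegelSubst_apply] at hu
  refine Eq.trans ?_ (congrArg (fun z : ℂ => (ψ (2⁻¹ * (u ⬝ᵥ siegelForm g.1 *ᵥ u)) : ℂ)
      * ((((√(siegelScale g : ℝ))⁻¹ : ℝ) : ℂ) * z)) hu).symm
  have e1 : (h.1.1.toBlocks₁₁)ᵀ *ᵥ ((g.1.1.toBlocks₁₁)ᵀ *ᵥ u)
      = ((g * h).1.1.toBlocks₁₁)ᵀ *ᵥ u := by
    rw [Matrix.mulVec_mulVec, ← transpose_mul, ← siegel_mul₁₁ g.2 h.2]
    rfl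
  have e2 : u ⬝ᵥ siegelForm (g * h).1 *ᵥ u = u ⬝ᵥ siegelForm g.1 *ᵥ u
      + ((g.1.1.toBlocks₁₁)ᵀ *ᵥ u) ⬝ᵥ siegelForm h.1 *ᵥ ((g.1.1.toBlocks₁₁)ᵀ *ᵥ u) := by
    rw [show (g * h).1 = g.1 * h.1 from rfl, siegelForm_mul g.2 h.2, Matrix.add_mulVec,
      dotProduct_add, ← Matrix.mulVec_mulVec, ← Matrix.mulVec_mulVec,
      dotProduct_mulVec u g.1.1.toBlocks₁₁, ← mulVec_transpose]
  rw [e1, e2, siegelScale_mul, mul_add, AddChar.map_add_eq_mul, Circle.coe_mul, NNReal.coe_mul,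
    Real.sqrt_mul (siegelScale g).coe_nonneg, mul_inv, Complex.ofReal_mul]
  ring

/-- The action of the Siegel parabolic on `L²(kⁿ)`, together with the projection. -/
def siegelHom : siegel n k →* Sp n k × (L2 n k ≃ₗᵢ[ℂ] L2 n k) :=
  MonoidHom.mk' (fun g => (g.1, siegelOp hψ g)) fun g h =>
    Prod.ext rfl (siegelOp_mul hψ g h)

theorem siegelHom_mem [CharZero k] (g : siegel n k) : siegelHom hψ g ∈ weilGroup n ψ hψ := by
  intro w f
  ext1
  refine (siegelOp_ae hψ g _).trans (EventuallyEq.trans ?_ (schrodinger_ae hψ _ _).symm)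
  refine EventuallyEq.trans ?_ (schrodingerFun_congr_ae _ (siegelOp_ae hψ g f)).symm
  filter_upwards [(quasiMeasurePreserving_siegelSubst g).ae (schrodinger_ae hψ w f)] with u hu
  rw [siegelSubst_apply] at hu
  rw [hu]
  set x := w ∘ Sum.inl with hx
  set y := w ∘ Sum.inr with hy
  have hw : w = Sum.elim x y := by ext (i | i) <;> rfl
  set A := g.1.1.toBlocks₁₁ with hA
  set B := g.1.1.toBlocks₁₂ with hB
  set D := g.1.1.toBlocks₂₂ with hD
  have hg : (siegelHom hψ g).1.1 *ᵥ w = Sum.elim (A *ᵥ x + B *ᵥ y) (D *ᵥ y) := by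
    change g.1.1 *ᵥ w = _
    rw [siegel_eq g.2, hw, fromBlocks_mulVec]
    simp
    rfl
  rw [hg]
  have hr : (Sum.elim (A *ᵥ x + B *ᵥ y) (D *ᵥ y)) ∘ Sum.inr = D *ᵥ y := rfl
  have hl : (Sum.elim (A *ᵥ x + B *ᵥ y) (D *ᵥ y)) ∘ Sum.inl = A *ᵥ x + B *ᵥ y := rfl
  simp only [schrodingerFun, hr, hl]
  have e1 : Aᵀ *ᵥ (u - D *ᵥ y) = Aᵀ *ᵥ u - y := by
    rw [Matrix.mulVec_sub, Matrix.mulVec_mulVec, siegel_transpose_mul g.2, Matrix.one_mulVec]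
  rw [e1]
  have t1 : Aᵀ *ᵥ u ⬝ᵥ x = u ⬝ᵥ A *ᵥ x := by rw [mulVec_transpose, dotProduct_mulVec]
  have t2 : A *ᵥ x ⬝ᵥ D *ᵥ y = x ⬝ᵥ y := by
    rw [dotProduct_mulVec, ← mulVec_transpose, Matrix.mulVec_mulVec, siegel_transpose_mul' g.2,
      Matrix.one_mulVec]
  have t3 : siegelForm g.1 *ᵥ (D *ᵥ y) = B *ᵥ y := by
    rw [Matrix.mulVec_mulVec, siegelForm, Matrix.mul_assoc, siegel_transpose_mul g.2, Matrix.mul_one]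
  have t4 : D *ᵥ y ⬝ᵥ siegelForm g.1 *ᵥ u = B *ᵥ y ⬝ᵥ u := by
    rw [dotProduct_mulVec, ← mulVec_transpose,
      show (siegelForm g.1)ᵀ = siegelForm g.1 from siegel_isSymm g.2, t3]
  have t5 : B *ᵥ y ⬝ᵥ u = u ⬝ᵥ B *ᵥ y := dotProduct_comm _ _
  have t6 : D *ᵥ y ⬝ᵥ B *ᵥ y = B *ᵥ y ⬝ᵥ D *ᵥ y := dotProduct_comm _ _
  have e2 : (ψ (2⁻¹ * (u ⬝ᵥ siegelForm g.1 *ᵥ u)) : ℂ) * (ψ (Aᵀ *ᵥ u ⬝ᵥ x - 2⁻¹ * x ⬝ᵥ y) : ℂ)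
      = (ψ (u ⬝ᵥ (A *ᵥ x + B *ᵥ y) - 2⁻¹ * (A *ᵥ x + B *ᵥ y) ⬝ᵥ D *ᵥ y) : ℂ)
        * (ψ (2⁻¹ * ((u - D *ᵥ y) ⬝ᵥ siegelForm g.1 *ᵥ (u - D *ᵥ y))) : ℂ) := by
    rw [← Circle.coe_mul, ← Circle.coe_mul, ← AddChar.map_add_eq_mul, ← AddChar.map_add_eq_mul]
    congr 2
    rw [Matrix.mulVec_sub, sub_dotProduct, dotProduct_sub, dotProduct_sub, t3, t4, add_dotProduct,
      dotProduct_add, t1, t2, t5, t6]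
    field_simp
    ring
  linear_combination ((((√(siegelScale g : ℝ))⁻¹ : ℝ) : ℂ) * f (Aᵀ *ᵥ u - y)) * e2

/-! ### Elements of the Siegel parabolic -/

/-- The element `[[1, S], [0, 1]]`. -/
def nSp (S : Matrix (Fin n) (Fin n) k) (hS : S.IsSymm) : siegel n k :=
  ⟨⟨fromBlocks 1 S 0 1, by
    rw [SymplecticGroup.fromBlocks_mem_iff]
    exact ⟨by simp, by simp [hS.eq], by simp⟩⟩, by
    change (fromBlocks 1 S 0 1).toBlocks₂₁ = 0
    simp⟩

/-- The element `[[A, 0], [0, A⁻ᵀ]]`. -/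
def mSp : GL (Fin n) k →* siegel n k :=
  MonoidHom.mk' (fun A => ⟨⟨fromBlocks A.1 0 0 (A⁻¹.1)ᵀ, by
    rw [SymplecticGroup.fromBlocks_mem_iff]
    refine ⟨by simp, by simp, ?_⟩
    rw [← transpose_mul, ← Units.val_mul, inv_mul_cancel]
    simp⟩, by
    change (fromBlocks A.1 0 0 (A⁻¹.1)ᵀ).toBlocks₂₁ = 0
    simp⟩) fun A B => by
      refine Subtype.ext (Subtype.ext ?_)
      change fromBlocks (A * B).1 0 0 ((A * B)⁻¹.1)ᵀ
        = fromBlocks A.1 0 0 (A⁻¹.1)ᵀ * fromBlocks B.1 0 0 (B⁻¹.1)ᵀ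
      rw [fromBlocks_multiply]
      simp [_root_.mul_inv_rev, transpose_mul]

theorem mSp_coe (A : GL (Fin n) k) :
    ((mSp A).1.1 : Matrix (Fin n ⊕ Fin n) (Fin n ⊕ Fin n) k) = fromBlocks A.1 0 0 (A⁻¹.1)ᵀ := rfl

theorem siegel_eq_mul (g : siegel n k) : ∃ A : GL (Fin n) k, A.1 = g.1.1.toBlocks₁₁ ∧
    g = nSp (siegelForm g.1) (siegel_isSymm g.2) * mSp A := by
  have e1 := siegel_transpose_mul' g.2
  have e2 := mul_eq_one_comm.1 e1
  refine ⟨⟨g.1.1.toBlocks₁₁, g.1.1.toBlocks₂₂ᵀ, e2, e1⟩, rfl, ?_⟩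
  refine Subtype.ext (Subtype.ext ?_)
  change g.1.1 = fromBlocks 1 (siegelForm g.1) 0 1 * fromBlocks g.1.1.toBlocks₁₁ 0 0 g.1.1.toBlocks₂₂ᵀᵀ
  rw [fromBlocks_multiply, siegelForm]
  conv_lhs => rw [siegel_eq g.2]
  congr 1
  · simp
  · simp [Matrix.mul_assoc, siegel_transpose_mul g.2]
  · simp
  · simp

/-- The scalar matrix `2` as an element of the general linear group. -/
def twoGL (n : ℕ) (k : Type*) [Field k] [CharZero k] : GL (Fin n) k :=
  ⟨diagonal fun _ => 2, diagonal fun _ => 2⁻¹, by simp [diagonal_mul_diagonal],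
    by simp [diagonal_mul_diagonal]⟩

theorem nSp_eq_commutator [CharZero k] (S : Matrix (Fin n) (Fin n) k) (hS : S.IsSymm) :
    nSp S hS = ⁅mSp (twoGL n k), nSp ((3 : k)⁻¹ • S) (hS.smul _)⁆ := by
  rw [commutatorElement_def, eq_mul_inv_iff_mul_eq, eq_mul_inv_iff_mul_eq]
  refine Subtype.ext (Subtype.ext ?_)
  change fromBlocks 1 S 0 1 * fromBlocks 1 ((3 : k)⁻¹ • S) 0 1
      * fromBlocks (diagonal fun _ => 2) 0 0 (diagonal fun _ => 2⁻¹)ᵀ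
    = fromBlocks (diagonal fun _ => 2) 0 0 (diagonal fun _ => 2⁻¹)ᵀ
      * fromBlocks 1 ((3 : k)⁻¹ • S) 0 1
  rw [fromBlocks_multiply, fromBlocks_multiply, fromBlocks_multiply]
  congr 1
  · simp
  · ext a b
    simp [diagonal_mul, mul_diagonal]
    field_simp
    norm_num
  · simp
  · simp

theorem siegelHom_nSp_mem [CharZero k] (S : Matrix (Fin n) (Fin n) k) (hS : S.IsSymm) :
    siegelHom hψ (nSp S hS) ∈ ⁅weilGroup n ψ hψ, weilGroup n ψ hψ⁆ := by
  rw [nSp_eq_commutator, map_commutatorElement]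
  exact Subgroup.commutator_mem_commutator (siegelHom_mem hψ _) (siegelHom_mem hψ _)

/-- The diagonal matrix with entry `c` at `i` and `1` elsewhere. -/
def diagGL {n : ℕ} {k : Type*} [Field k] (i : Fin n) (c : kˣ) : GL (Fin n) k :=
  ⟨diagonal (Function.update 1 i (c : k)), diagonal (Function.update 1 i ((c⁻¹ : kˣ) : k)), by
    rw [diagonal_mul_diagonal, ← diagonal_one]; congr 1; ext a
    by_cases h : a = i <;> simp [h], by
    rw [diagonal_mul_diagonal, ← diagonal_one]; congr 1; ext a
    by_cases h : a = i <;> simp [h]⟩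

/-- The permutation matrix of a transposition. -/
def swapGL {n : ℕ} {k : Type*} [Field k] (i j : Fin n) : GL (Fin n) k :=
  ⟨Matrix.of fun a b => if Equiv.swap i j a = b then 1 else 0,
    Matrix.of fun a b => if Equiv.swap i j a = b then 1 else 0, by
    ext a b; simp only [Matrix.mul_apply, Matrix.of_apply]; rw [Finset.sum_eq_single (Equiv.swap i j a)] <;>
      simp +contextual [Matrix.one_apply, eq_comm], by
    ext a b; simp only [Matrix.mul_apply, Matrix.of_apply]; rw [Finset.sum_eq_single (Equiv.swap i j a)] <;>
      simp +contextual [Matrix.one_apply, eq_comm]⟩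

theorem transvection_eq_commutator [CharZero k] {i j : Fin n} (hij : i ≠ j) (c : k) :
    SpecialLinearGroup.toGL (SpecialLinearGroup.transvection hij c)
      = ⁅diagGL i (Units.mk0 (2 : k) two_ne_zero),
          SpecialLinearGroup.toGL (SpecialLinearGroup.transvection hij c)⁆ := by
  rw [commutatorElement_def, eq_mul_inv_iff_mul_eq, eq_mul_inv_iff_mul_eq]
  refine Units.ext ?_
  change transvection i j c * transvection i j c * diagonal (Function.update 1 i 2)
    = diagonal (Function.update 1 i 2) * transvection i j c
  rw [transvection_mul_transvection_same _ _ hij]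
  ext a b
  rw [mul_diagonal, diagonal_mul]
  simp only [transvection, Matrix.add_apply, Matrix.one_apply, Matrix.single_apply,
    Function.update_apply, Pi.one_apply]
  by_cases h1 : i = a
  · subst h1
    by_cases h2 : i = b
    · subst h2; simp [hij.symm]
    · by_cases h3 : j = b
      · subst h3; simp [hij, hij.symm]; ring
      · simp [h2, h3, Ne.symm h2]
  · by_cases h2 : a = b
    · subst h2; simp [h1, Ne.symm h1]
    · simp [h1, h2]

theorem diag2n_eq_commutator {i j : Fin n} (hij : i ≠ j) {c : k} (hc : c ≠ 0) :
    SpecialLinearGroup.toGL (SpecialLinearGroup.diag2n hij c hc)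
      = ⁅diagGL i (Units.mk0 c hc), swapGL i j⁆ := by
  rw [commutatorElement_def, eq_mul_inv_iff_mul_eq, eq_mul_inv_iff_mul_eq]
  refine Units.ext ?_
  change (SpecialLinearGroup.diag2n hij c hc).1
      * (Matrix.of fun a b => if Equiv.swap i j a = b then 1 else 0)
      * diagonal (Function.update 1 i c)
    = diagonal (Function.update 1 i c) * (Matrix.of fun a b => if Equiv.swap i j a = b then 1 else 0)
  rw [SpecialLinearGroup.diag2n_coe]
  ext a b
  rw [mul_diagonal, diagonal_mul, diagonal_mul]
  simp only [Matrix.of_apply, Function.update_apply, Pi.one_apply]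
  by_cases hb : Equiv.swap i j a = b
  · subst hb
    by_cases h1 : a = i
    · subst h1; simp [hij.symm]
    · by_cases h2 : a = j
      · subst h2; simp [hij.symm, hc]
      · simp [h1, h2, Equiv.swap_apply_of_ne_of_ne h1 h2]
  · simp [hb]

theorem siegelHom_mSp_mem [CharZero k] (A : SpecialLinearGroup (Fin n) k) :
    siegelHom hψ (mSp (SpecialLinearGroup.toGL A)) ∈ ⁅weilGroup n ψ hψ, weilGroup n ψ hψ⁆ := by
  have hcomm : ∀ A B C : GL (Fin n) k, A = ⁅B, C⁆ →
      siegelHom hψ (mSp A) ∈ ⁅weilGroup n ψ hψ, weilGroup n ψ hψ⁆ := by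
    rintro A B C rfl
    rw [map_commutatorElement, map_commutatorElement]
    exact Subgroup.commutator_mem_commutator (siegelHom_mem hψ _) (siegelHom_mem hψ _)
  rcases subsingleton_or_nontrivial (Fin n) with h | h
  · have : A = 1 := by
      have hd := A.2
      refine Subtype.ext (Matrix.ext fun i j => ?_)
      obtain rfl := Subsingleton.elim i j
      have : Unique (Fin n) := uniqueOfSubsingleton i
      rw [det_unique] at hd
      rw [Subsingleton.elim i default, hd]
      exact (Matrix.one_apply_eq _).symm
    rw [this]; simp only [map_one]; exact one_mem _
  · refine SpecialLinearGroup.diagonal_transvection_induction'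
      (fun A => siegelHom hψ (mSp (SpecialLinearGroup.toGL A))
        ∈ ⁅weilGroup n ψ hψ, weilGroup n ψ hψ⁆) A ?_ ?_ ?_
    · exact fun i j hij c hc => hcomm _ _ _ (diag2n_eq_commutator hij hc)
    · exact fun i j hij a => hcomm _ _ _ (transvection_eq_commutator hij a)
    · intro A B hA hB
      rw [map_mul, map_mul, map_mul]
      exact mul_mem hA hB

theorem siegelHom_mem_of_det [CharZero k] {g : siegel n k} (hg : g.1.1.toBlocks₁₁.det = 1) :
    siegelHom hψ g ∈ ⁅weilGroup n ψ hψ, weilGroup n ψ hψ⁆ := by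
  obtain ⟨A, hA, h⟩ := siegel_eq_mul g
  rw [h, map_mul]
  refine mul_mem (siegelHom_nSp_mem hψ _ _) ?_
  have : A = SpecialLinearGroup.toGL ⟨A.1, by rw [hA, hg]⟩ := Units.ext rfl
  rw [this]
  exact siegelHom_mSp_mem hψ _

end Siegel

section WeilIndex

variable {n : ℕ} {k : Type*} [NontriviallyNormedField k] [ProperSpace k] [MeasurableSpace k]
  [BorelSpace k] {ψ : AddChar k Circle} (hψ : Continuous ψ) {s : ℝ} (hs : IsSelfDualScale ψ s)

/-! ### Quadratic characters -/

theorem nSp_mul (S T : Matrix (Fin n) (Fin n) k) (hS : S.IsSymm) (hT : T.IsSymm) :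
    nSp S hS * nSp T hT = nSp (S + T) (hS.add hT) := by
  refine Subtype.ext (Subtype.ext ?_)
  change fromBlocks 1 S 0 1 * fromBlocks 1 T 0 1 = fromBlocks 1 (S + T) 0 1
  rw [fromBlocks_multiply]
  simp [add_comm]

theorem nSp_zero : nSp (0 : Matrix (Fin n) (Fin n) k) isSymm_zero = 1 := by
  refine Subtype.ext (Subtype.ext ?_)
  change fromBlocks 1 0 0 1 = 1
  simp

theorem nSp_inv (S : Matrix (Fin n) (Fin n) k) (hS : S.IsSymm) :
    (nSp S hS)⁻¹ = nSp (-S) hS.neg := by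
  rw [inv_eq_iff_mul_eq_one, nSp_mul]
  simp only [add_neg_cancel]
  exact nSp_zero

theorem siegelForm_nSp (S : Matrix (Fin n) (Fin n) k) (hS : S.IsSymm) :
    siegelForm (nSp S hS).1 = S := by
  change (fromBlocks 1 S 0 1).toBlocks₁₂ * (fromBlocks 1 S 0 1).toBlocks₁₁ᵀ = S
  simp

theorem siegelScale_nSp (S : Matrix (Fin n) (Fin n) k) (hS : S.IsSymm) :
    siegelScale (nSp S hS) = 1 := by
  have : siegelSubst (nSp S hS) = ContinuousAddEquiv.refl _ := by
    ext u : 1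
    change ((fromBlocks 1 S 0 1).toBlocks₁₁)ᵀ *ᵥ u = u
    simp
  rw [siegelScale, this, addEquivAddHaarChar_refl, inv_one]

theorem nSp_ae (S : Matrix (Fin n) (Fin n) k) (hS : S.IsSymm) (f : L2 n k) :
    siegelOp hψ (nSp S hS) f =ᵐ[haarPi n k] fun u => (ψ (2⁻¹ * (u ⬝ᵥ S *ᵥ u)) : ℂ) * f u := by
  refine (siegelOp_ae hψ _ f).trans (Eventually.of_forall fun u => ?_)
  have h1 : (nSp S hS).1.1.toBlocks₁₁ = 1 := toBlocks_fromBlocks₁₁ _ _ _ _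
  simp only [siegelForm_nSp, siegelScale_nSp, h1]
  simp

/-- The quadratic character `v ↦ ψ(t v² / 2)`. -/
def chi (ψ : AddChar k Circle) (t v : k) : Circle := ψ (2⁻¹ * (t * v ^ 2))

theorem continuous_chi (hψ : Continuous ψ) (t : k) : Continuous fun v => (chi ψ t v : ℂ) := by
  refine continuous_subtype_val.comp (hψ.comp ?_)
  fun_prop

theorem isSymm_single (i : Fin n) (t : k) : (Matrix.single i i t).IsSymm := by
  ext a b
  rw [transpose_apply, Matrix.single_apply, Matrix.single_apply]
  simp [and_comm]

/-- The element `x_{2ε_i}(t)` of Weil's group. -/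
def quadEl (i : Fin n) (t : k) : Sp n k × (L2 n k ≃ₗᵢ[ℂ] L2 n k) :=
  siegelHom hψ (nSp (Matrix.single i i t) (isSymm_single i t))

/-- The partial Fourier transform in Weil's group. -/
def fourierEl (i : Fin n) : Sp n k × (L2 n k ≃ₗᵢ[ℂ] L2 n k) := (fourierSp i, fourierOp hψ hs i)

theorem quadEl_inv (i : Fin n) (t : k) : (quadEl hψ i t)⁻¹ = quadEl hψ i (-t) := by
  rw [quadEl, ← map_inv, nSp_inv, quadEl]
  congr 1
  refine Subtype.ext (Subtype.ext ?_)
  change fromBlocks 1 _ 0 1 = fromBlocks 1 _ 0 1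
  congr 1
  ext a b
  simp [Matrix.single_apply]
  split_ifs <;> simp

theorem quadEl_ae (i : Fin n) (t : k) (f : L2 n k) :
    (quadEl hψ i t).2 f =ᵐ[haarPi n k] fun u => (chi ψ t (u i) : ℂ) * f u := by
  refine (nSp_ae hψ _ (isSymm_single i t) f).trans (Eventually.of_forall fun u => ?_)
  have : u ⬝ᵥ (Matrix.single i i t) *ᵥ u = t * u i ^ 2 := by
    rw [Matrix.single_mulVec, ← Pi.single, dotProduct_single]; ring
  simp only [this, chi]

theorem quadEl_ae_tens {i : Fin n} {t : k} {f : L2 n k} {g : Fin n → k → ℂ}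
    (hf : f =ᵐ[haarPi n k] tens g) :
    (quadEl hψ i t).2 f =ᵐ[haarPi n k]
      tens (Function.update g i fun v => (chi ψ t v : ℂ) * g i v) := by
  filter_upwards [quadEl_ae hψ i t f, hf] with u h1 h2
  rw [h1, h2, tens_update_left, tens, ← Finset.mul_prod_erase _ _ (Finset.mem_univ i), mul_assoc]

theorem tens_update_smul (g : Fin n → k → ℂ) (i : Fin n) (c : ℂ) (f : k → ℂ) (u : Fin n → k) :
    tens (Function.update g i fun v => c * f v) u = c * tens (Function.update g i f) u := by
  rw [tens_update_left, tens_update_left, mul_assoc]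

theorem fourierEl_ae_tens {i : Fin n} {f : L2 n k} {g : Fin n → k → ℂ}
    (hf : f =ᵐ[haarPi n k] tens g) (hg : ∀ j, Integrable (g j) (haar k)) :
    (fourierEl hψ hs i).2 f =ᵐ[haarPi n k]
      tens (Function.update g i fun v => (s : ℂ) * ft ψ (haar k) (g i) v) := by
  refine (fourierOp_ae_of_ae hψ hs i (integrable_tens hg) hf).trans
    (Eventually.of_forall fun u => ?_)
  simp only [pft_tens]
  rw [tens_update_smul]

theorem quadEl_mem [CharZero k] (i : Fin n) (t : k) : quadEl hψ i t ∈ weilGroup n ψ hψ :=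
  siegelHom_mem hψ _

theorem fourierEl_mem [CharZero k] (i : Fin n) : fourierEl hψ hs i ∈ weilGroup n ψ hψ :=
  fourierOp_mem hψ hs i

theorem nSp_coe (S : Matrix (Fin n) (Fin n) k) (hS : S.IsSymm) :
    ((nSp S hS).1.1 : Matrix (Fin n ⊕ Fin n) (Fin n ⊕ Fin n) k) = fromBlocks 1 S 0 1 := rfl

theorem quad_fourier_quad (i : Fin n) :
    (quadEl hψ i 1 * fourierEl hψ hs i * quadEl hψ i 1).1
      = (fourierEl hψ hs i * quadEl hψ i (-1) * fourierEl hψ hs i).1 := by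
  refine Subtype.ext ?_
  change fromBlocks 1 (Matrix.single i i 1) 0 1 * fourierMatrix i
      * fromBlocks 1 (Matrix.single i i 1) 0 1
    = fourierMatrix i * fromBlocks 1 (Matrix.single i i (-1)) 0 1 * fourierMatrix i
  rw [fourierMatrix]
  simp only [fromBlocks_multiply]
  have hneg : Matrix.single i i (-1 : k) = -Matrix.single i i 1 := by
    ext a b; simp [Matrix.single_apply]; split_ifs <;> simp
  rw [hneg]
  congr 1 <;> simp [Matrix.mul_sub, Matrix.sub_mul, Matrix.add_mul]

/-- `γ` relates the Fourier transforms of `h` times the quadratic characters. -/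
def IsWeilIndex (ψ : AddChar k Circle) (s : ℝ) (h : k → ℝ) (γ : Circle) : Prop :=
  ∀ x, (chi ψ 1 x : ℂ) * ((s : ℂ) * ft ψ (haar k) (fun v => (chi ψ 1 v : ℂ) * (h v : ℂ)) x)
    = (γ : ℂ) * ((s : ℂ) * ft ψ (haar k) (fun v => (chi ψ (-1) v : ℂ) * (h v : ℂ)) x)

include hψ in
theorem integrable_chi_mul {h : k → ℝ} (hh : IsSelfDual ψ s h) (t : k) :
    Integrable (fun v => (chi ψ t v : ℂ) * (h v : ℂ)) (haar k) := by
  have := integrable_mul_addChar (hh.integrable.ofReal (𝕜 := ℂ)) (continuous_chi hψ t).aestronglyMeasurable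
  exact this.congr (Eventually.of_forall fun v => mul_comm _ _)

include hψ in
theorem memLp_chi_mul {h : k → ℝ} (hh : IsSelfDual ψ s h) (t : k) :
    MemLp (fun v => (chi ψ t v : ℂ) * (h v : ℂ)) 2 (haar k) :=
  (hh.memLp.ofReal (K := ℂ)).of_le (integrable_chi_mul hψ hh t).1
    (Eventually.of_forall fun u => by rw [norm_mul, Circle.norm_coe, one_mul]; rfl)

include hψ hs in
theorem isWeilIndex_unique {h : k → ℝ} (hh : IsSelfDual ψ s h) {γ γ' : Circle}
    (h1 : IsWeilIndex ψ s h γ) (h2 : IsWeilIndex ψ s h γ') : γ = γ' := by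
  by_contra hne
  have h3 : ∀ x, (s : ℂ) * ft ψ (haar k) (fun v => (chi ψ (-1) v : ℂ) * (h v : ℂ)) x = 0 := by
    intro x
    have h4 := (h1 x).symm.trans (h2 x)
    by_contra h5
    exact hne (Circle.ext (mul_right_cancel₀ h5 h4))
  have h4 := (hs.2 _ (integrable_chi_mul hψ hh (-1)) (memLp_chi_mul hψ hh (-1))).2
  simp only [h3] at h4
  have h5 : ∫ x, h x ^ 2 ∂(haar k) = 0 := by
    have : ∀ x, ‖(chi ψ (-1) x : ℂ) * (h x : ℂ)‖ ^ 2 = h x ^ 2 := fun x => by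
      rw [norm_mul, Circle.norm_coe, one_mul, Complex.norm_real, Real.norm_eq_abs, sq_abs]
    simp only [this] at h4
    rw [← h4]; simp
  have h6 : Integrable (fun x => h x ^ 2) (haar k) := by
    simpa using hh.memLp.integrable_norm_pow (by norm_num)
  have h7 := integral_pos_of_integrable_nonneg_nonzero (μ := haar k) (f := fun x => h x ^ 2) (x := 0)
    (hh.continuous.pow 2) h6 (fun x => sq_nonneg _) (pow_ne_zero 2 hh.pos.ne')
  exact h7.ne' h5

theorem tens_update_eq_of_ae {g : Fin n → k → ℂ} {i : Fin n} {a b : k → ℂ}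
    (hg : ∀ j, Continuous (g j)) (hg0 : ∀ j, g j 0 ≠ 0) (ha : Continuous a) (hb : Continuous b)
    (h : tens (Function.update g i a) =ᵐ[haarPi n k] tens (Function.update g i b)) : a = b := by
  have hc : ∀ {c : k → ℂ}, Continuous c → Continuous (tens (Function.update g i c)) := by
    intro c hc
    refine continuous_finsetProd _ fun j _ => ?_
    refine Continuous.comp ?_ (continuous_apply j)
    by_cases hj : j = i
    · subst hj; simpa using hc
    · simpa [hj] using hg j
  have h1 := ((hc ha).ae_eq_iff_eq (haarPi n k) (hc hb)).1 h
  ext x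
  have h2 := congrFun h1 (Function.update 0 i x)
  rw [tens_update_left, tens_update_left, Function.update_self] at h2
  refine mul_right_cancel₀ (Finset.prod_ne_zero_iff.2 fun j hj => ?_) h2
  rw [Function.update_of_ne (Finset.ne_of_mem_erase hj)]
  exact hg0 j

theorem exists_weilIndex [CharZero k] (hψ₁ : ψ ≠ 1) {h : k → ℝ} (hh : IsSelfDual ψ s h)
    (i : Fin n) : ∃ γ, IsWeilIndex ψ s h γ ∧
      quadEl hψ i 1 * fourierEl hψ hs i * quadEl hψ i 1
        = (1, scalarOp n k γ) * (fourierEl hψ hs i * quadEl hψ i (-1) * fourierEl hψ hs i) := by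
  have hq := quadEl_mem hψ i (1 : k)
  have hq' := quadEl_mem hψ i (-1 : k)
  have hF := fourierEl_mem hψ hs i
  obtain ⟨γ, hγ⟩ := exists_scalarOp_of_fst_eq hψ hψ₁ (mul_mem (mul_mem hq hF) hq)
    (mul_mem (mul_mem hF hq') hF) (quad_fourier_quad hψ hs i)
  have hrel : quadEl hψ i 1 * fourierEl hψ hs i * quadEl hψ i 1
        = (1, scalarOp n k γ) * (fourierEl hψ hs i * quadEl hψ i (-1) * fourierEl hψ hs i) :=
    Prod.ext ((quad_fourier_quad hψ hs i).trans (one_mul _).symm) hγ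
  refine ⟨γ, ?_, hrel⟩
  set g : Fin n → k → ℂ := fun _ v => (h v : ℂ) with hg
  have hgi : ∀ j, Integrable (g j) (haar k) := fun _ => hh.integrable.ofReal
  have hv : vac n hh =ᵐ[haarPi n k] tens g := tensL2_ae _ _
  have hupd : ∀ t : k, ∀ j, Integrable (Function.update g i (fun v => (chi ψ t v : ℂ) * g i v) j)
      (haar k) := by
    intro t j
    by_cases hj : j = i
    · subst hj; simpa using integrable_chi_mul hψ hh t
    · simpa [hj] using hgi j
  have e1 : (quadEl hψ i 1).2 ((fourierEl hψ hs i).2 ((quadEl hψ i 1).2 (vac n hh)))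
      = (γ : ℂ) • (fourierEl hψ hs i).2 ((quadEl hψ i (-1)).2 (vac n hh)) := by
    have h1 := DFunLike.congr_fun hγ (vac n hh)
    have h2 : (fourierEl hψ hs i).2 (vac n hh) = vac n hh := fourierOp_vac hψ hs hh i
    conv_rhs => rw [← h2]
    exact h1
  have a1 := quadEl_ae_tens hψ (t := 1) (fourierEl_ae_tens hψ hs (quadEl_ae_tens hψ (i := i) (t := 1) hv)
    (hupd 1) (i := i)) (i := i)
  have a2 := fourierEl_ae_tens hψ hs (quadEl_ae_tens hψ (i := i) (t := -1) hv) (hupd (-1)) (i := i)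
  rw [e1] at a1
  simp only [Function.update_idem, Function.update_self] at a1 a2
  have a3 : tens (Function.update g i fun x => (chi ψ 1 x : ℂ) *
        ((s : ℂ) * ft ψ (haar k) (fun v => (chi ψ 1 v : ℂ) * g i v) x)) =ᵐ[haarPi n k]
      tens (Function.update g i fun x => (γ : ℂ) *
        ((s : ℂ) * ft ψ (haar k) (fun v => (chi ψ (-1) v : ℂ) * g i v) x)) := by
    filter_upwards [a1, a2, Lp.coeFn_smul (γ : ℂ)
      ((fourierEl hψ hs i).2 ((quadEl hψ i (-1)).2 (vac n hh)))] with u h1 h2 h3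
    rw [← h1, h3, Pi.smul_apply, h2, smul_eq_mul, ← tens_update_smul]
  have hcf : ∀ t : k, Continuous (ft ψ (haar k) (fun v => (chi ψ t v : ℂ) * g i v)) := fun t =>
    continuous_ft hψ (integrable_chi_mul hψ hh t)
  have a4 := tens_update_eq_of_ae (g := g) (i := i)
    (fun j => Complex.continuous_ofReal.comp hh.continuous)
    (fun j => by simpa [hg] using hh.pos.ne')
    ((continuous_chi hψ 1).mul (continuous_const.mul (hcf 1)))
    (continuous_const.mul (continuous_const.mul (hcf (-1)))) a3
  exact congrFun a4

end WeilIndex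

section FullFourier

variable {n : ℕ} {k : Type*} [NontriviallyNormedField k] [ProperSpace k] [MeasurableSpace k]
  [BorelSpace k] {ψ : AddChar k Circle} (hψ : Continuous ψ) {s : ℝ} (hs : IsSelfDualScale ψ s)

/-! ### Commutation relations -/

theorem eq_of_fst_eq_of_apply_eq (hψ₁ : ψ ≠ 1) {p q : Sp n k × (L2 n k ≃ₗᵢ[ℂ] L2 n k)}
    (hp : p ∈ weilGroup n ψ hψ) (hq : q ∈ weilGroup n ψ hψ) (h : p.1 = q.1) {f : L2 n k}
    (hf : f ≠ 0) (hpq : p.2 f = q.2 f) : p = q := by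
  obtain ⟨ζ, hζ⟩ := exists_scalarOp_of_fst_eq hψ hψ₁ hp hq h
  refine Prod.ext h ?_
  have h1 : (ζ : ℂ) • q.2 f = (1 : ℂ) • q.2 f := by
    rw [one_smul]
    exact (DFunLike.congr_fun hζ f).symm.trans hpq
  have h2 : q.2 f ≠ 0 := fun e => hf ((map_eq_zero_iff q.2 q.2.injective).1 e)
  have h3 : ζ = 1 := Circle.ext (smul_left_injective ℂ h2 h1)
  rw [hζ, h3, scalarOp_one, one_mul]

theorem fourierEl_vac {h : k → ℝ} (hh : IsSelfDual ψ s h) (i : Fin n) :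
    (fourierEl hψ hs i).2 (vac n hh) = vac n hh := fourierOp_vac hψ hs hh i

theorem single_eq_diagonal (i : Fin n) (t : k) :
    Matrix.single i i t = diagonal (Pi.single i t) := by
  ext a b
  rw [Matrix.single_apply, diagonal_apply]
  by_cases h1 : a = b
  · subst h1; by_cases h2 : a = i
    · simp [h2]
    · simp [h2, Ne.symm h2]
  · simp only [h1, if_false]; rw [if_neg]; rintro ⟨rfl, rfl⟩; exact h1 rfl

theorem fourierMatrix_eq (i : Fin n) : fourierMatrix (k := k) i
    = fromBlocks (diagonal (1 - Pi.single i 1)) (diagonal (Pi.single i 1))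
        (diagonal (-Pi.single i 1)) (diagonal (1 - Pi.single i 1)) := by
  rw [fourierMatrix, single_eq_diagonal, ← diagonal_one]
  congr 1
  · rw [diagonal_sub]; rfl
  · exact diagonal_neg _
  · rw [diagonal_sub]; rfl

theorem commute_fourierSp (i j : Fin n) : Commute (fourierSp (k := k) i) (fourierSp j) := by
  refine Subtype.ext ?_
  change fourierMatrix i * fourierMatrix j = fourierMatrix j * fourierMatrix i
  rw [fourierMatrix_eq, fourierMatrix_eq]
  simp only [fromBlocks_multiply, diagonal_mul_diagonal, diagonal_add]
  congr 2 <;> ext a <;> simp <;> ring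

theorem commute_fourierEl [CharZero k] (hψ₁ : ψ ≠ 1) (i j : Fin n) :
    Commute (fourierEl hψ hs i) (fourierEl hψ hs j) := by
  obtain ⟨h, hh⟩ := exists_isSelfDual hψ hψ₁ hs
  refine eq_of_fst_eq_of_apply_eq hψ hψ₁ (mul_mem (fourierEl_mem hψ hs i) (fourierEl_mem hψ hs j))
    (mul_mem (fourierEl_mem hψ hs j) (fourierEl_mem hψ hs i)) (commute_fourierSp i j)
    (vac_ne_zero hh) ?_
  change (fourierEl hψ hs i).2 ((fourierEl hψ hs j).2 _)
    = (fourierEl hψ hs j).2 ((fourierEl hψ hs i).2 _)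
  simp only [fourierEl_vac]

theorem commute_quad_fourier [CharZero k] (hψ₁ : ψ ≠ 1) {i j : Fin n} (hij : i ≠ j) (t : k) :
    Commute (quadEl hψ i t) (fourierEl hψ hs j) := by
  obtain ⟨h, hh⟩ := exists_isSelfDual hψ hψ₁ hs
  refine eq_of_fst_eq_of_apply_eq hψ hψ₁ (mul_mem (quadEl_mem hψ i t) (fourierEl_mem hψ hs j))
    (mul_mem (fourierEl_mem hψ hs j) (quadEl_mem hψ i t)) ?_ (vac_ne_zero hh) ?_
  · refine Subtype.ext ?_
    change fromBlocks 1 (Matrix.single i i t) 0 1 * fourierMatrix j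
      = fourierMatrix j * fromBlocks 1 (Matrix.single i i t) 0 1
    rw [fourierMatrix]
    simp only [fromBlocks_multiply]
    congr 1 <;> simp [Matrix.mul_sub, Matrix.sub_mul, hij, hij.symm]
    rw [add_comm]
  · change (quadEl hψ i t).2 ((fourierEl hψ hs j).2 _)
      = (fourierEl hψ hs j).2 ((quadEl hψ i t).2 _)
    rw [fourierEl_vac]
    set g : Fin n → k → ℂ := fun _ v => (h v : ℂ) with hg
    have hv : vac n hh =ᵐ[haarPi n k] tens g := tensL2_ae _ _
    have h1 := quadEl_ae_tens hψ (i := i) (t := t) hv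
    ext1
    refine h1.trans (EventuallyEq.trans ?_ (fourierEl_ae_tens hψ hs h1 (i := j) ?_).symm)
    · refine Eventually.of_forall fun u => ?_
      congr 1
      rw [eq_comm, Function.update_eq_self_iff]
      rw [Function.update_of_ne hij.symm]
      ext x
      exact hh.fourier x
    · intro l
      by_cases hl : l = i
      · subst hl; simpa using integrable_chi_mul hψ hh t
      · simpa [hl, hg] using hh.integrable.ofReal (𝕜 := ℂ)

theorem commute_quadEl (i j : Fin n) (t t' : k) : Commute (quadEl hψ i t) (quadEl hψ j t') := by
  rw [Commute, SemiconjBy, quadEl, quadEl, ← map_mul, ← map_mul, nSp_mul, nSp_mul]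
  congr 1
  exact Subtype.ext (Subtype.ext (by simp only [nSp_coe, add_comm]))

theorem prod_relation {G ι : Type*} [Group G] {Q F : ι → G} {c : G} (hc : ∀ x, Commute c x)
    (hrel : ∀ i, Q i * F i * Q i = c * (F i * (Q i)⁻¹ * F i)) (hQ : ∀ i j, Commute (Q i) (Q j))
    (hF : ∀ i j, Commute (F i) (F j)) (hQF : ∀ i j, i ≠ j → Commute (Q i) (F j)) :
    ∀ l : List ι, l.Nodup → (l.map Q).prod * (l.map F).prod * (l.map Q).prod
      = c ^ l.length * ((l.map F).prod * ((l.map Q).prod)⁻¹ * (l.map F).prod) := by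
  intro l
  induction l with
  | nil => simp
  | cons i l ih =>
    intro hl
    rw [List.nodup_cons] at hl
    have ih := ih hl.2
    simp only [List.map_cons, List.prod_cons, List.length_cons]
    set QL := (l.map Q).prod
    set FL := (l.map F).prod
    have c1 : Commute QL (F i) := by
      refine (Commute.list_prod_left _ _ fun x hx => ?_)
      obtain ⟨j, hj, rfl⟩ := List.mem_map.1 hx
      exact hQF j i fun e => hl.1 (e ▸ hj)
    have c2 : Commute (Q i) QL := by
      refine (Commute.list_prod_right _ _ fun x hx => ?_)
      obtain ⟨j, hj, rfl⟩ := List.mem_map.1 hx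
      exact hQ i j
    have c3 : Commute (Q i) FL := by
      refine (Commute.list_prod_right _ _ fun x hx => ?_)
      obtain ⟨j, hj, rfl⟩ := List.mem_map.1 hx
      exact hQF i j fun e => hl.1 (e ▸ hj)
    have c4 : Commute (F i) FL := by
      refine (Commute.list_prod_right _ _ fun x hx => ?_)
      obtain ⟨j, hj, rfl⟩ := List.mem_map.1 hx
      exact hF i j
    calc Q i * QL * (F i * FL) * (Q i * QL) = Q i * (QL * F i) * (FL * Q i) * QL := by group
      _ = Q i * (F i * QL) * (Q i * FL) * QL := by rw [c1.eq, ← c3.eq]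
      _ = Q i * F i * (QL * Q i) * FL * QL := by group
      _ = Q i * F i * (Q i * QL) * FL * QL := by rw [← c2.eq]
      _ = (Q i * F i * Q i) * (QL * FL * QL) := by group
      _ = c * (F i * (Q i)⁻¹ * F i) * (c ^ l.length * (FL * QL⁻¹ * FL)) := by rw [hrel, ih]
      _ = c ^ (l.length + 1) * ((F i * (Q i)⁻¹ * F i) * (FL * QL⁻¹ * FL)) := by
        have h1 := ((hc (F i * (Q i)⁻¹ * F i)).pow_left l.length).symm.eq
        set Y := F i * (Q i)⁻¹ * F i
        rw [pow_succ', mul_assoc c Y, ← mul_assoc Y, h1]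
        group
      _ = c ^ (l.length + 1) * (F i * FL * (Q i * QL)⁻¹ * (F i * FL)) := by
        congr 1
        calc F i * (Q i)⁻¹ * F i * (FL * QL⁻¹ * FL)
            = F i * (Q i)⁻¹ * (F i * FL) * (QL⁻¹ * FL) := by group
          _ = F i * ((Q i)⁻¹ * FL) * (F i * QL⁻¹) * FL := by rw [c4.eq]; group
          _ = F i * (FL * (Q i)⁻¹) * (QL⁻¹ * F i) * FL := by
            rw [c3.inv_left.eq, c1.inv_left.eq]
          _ = F i * FL * ((Q i)⁻¹ * QL⁻¹) * (F i * FL) := by group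
          _ = F i * FL * (Q i * QL)⁻¹ * (F i * FL) := by
            rw [c2.eq, _root_.mul_inv_rev]

/-! ### The full Fourier transform -/

variable (n) in
/-- The Fourier transform in all variables, as an element of Weil's group. -/
def fullFourier : Sp n k × (L2 n k ≃ₗᵢ[ℂ] L2 n k) :=
  ((List.finRange n).map (fourierEl hψ hs)).prod

theorem fullFourier_mem [CharZero k] : fullFourier n hψ hs ∈ weilGroup n ψ hψ := by
  refine list_prod_mem fun x hx => ?_
  obtain ⟨i, -, rfl⟩ := List.mem_map.1 hx
  exact fourierEl_mem hψ hs i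

theorem fullFourier_vac {h : k → ℝ} (hh : IsSelfDual ψ s h) :
    (fullFourier n hψ hs).2 (vac n hh) = vac n hh := by
  rw [fullFourier]
  induction List.finRange n with
  | nil => rfl
  | cons i l ih =>
    rw [List.map_cons, List.prod_cons]
    exact (congrArg (fourierEl hψ hs i).2 ih).trans (fourierEl_vac hψ hs hh i)

theorem prod_fourierEl_fst (l : List (Fin n)) (hl : l.Nodup) :
    (((l.map (fourierEl hψ hs)).prod).1).1
      = fromBlocks (diagonal fun a => if a ∈ l then 0 else 1) (diagonal fun a => if a ∈ l then 1 else 0)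
        (diagonal fun a => if a ∈ l then -1 else 0) (diagonal fun a => if a ∈ l then 0 else 1) := by
  induction l with
  | nil => simp
  | cons i l ih =>
    rw [List.nodup_cons] at hl
    rw [List.map_cons, List.prod_cons]
    change fourierMatrix i * (((l.map (fourierEl hψ hs)).prod).1).1 = _
    rw [ih hl.2, fourierMatrix_eq]
    simp only [fromBlocks_multiply, diagonal_mul_diagonal, diagonal_add]
    congr 2 <;> ext a <;> by_cases h1 : a = i
    all_goals first
      | (subst h1; simp [hl.1])
      | simp [h1]

theorem fullFourier_fst : (fullFourier n hψ hs).1.1 = fromBlocks 0 1 (-1) 0 := by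
  rw [fullFourier, prod_fourierEl_fst hψ hs _ (List.nodup_finRange n)]
  simp only [List.mem_finRange, if_true]
  rw [diagonal_zero, diagonal_one, ← diagonal_neg]
  rfl

theorem prod_nSp (l : List (Fin n)) (hl : l.Nodup) (t : k) :
    (l.map fun i => nSp (Matrix.single i i t) (isSymm_single i t)).prod
      = nSp (diagonal fun a => if a ∈ l then t else 0) (isSymm_diagonal _) := by
  induction l with
  | nil =>
    refine Subtype.ext (Subtype.ext ?_)
    simp only [nSp_coe]
    simp
  | cons i l ih =>
    rw [List.nodup_cons] at hl
    rw [List.map_cons, List.prod_cons, ih hl.2, nSp_mul]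
    refine Subtype.ext (Subtype.ext ?_)
    simp only [nSp_coe, single_eq_diagonal, diagonal_add]
    congr 2; ext a
    by_cases h1 : a = i
    · subst h1; simp [hl.1]
    · simp [h1]

theorem prod_quadEl (t : k) :
    ((List.finRange n).map fun i => quadEl hψ i t).prod
      = siegelHom hψ (nSp (diagonal fun _ => t) (isSymm_diagonal _)) := by
  have h := congrArg (siegelHom hψ) (prod_nSp (List.finRange n) (List.nodup_finRange n) t)
  simp only [List.mem_finRange, if_true] at h
  rw [← h, map_list_prod, List.map_map]
  rfl

theorem mSp_ae (A : GL (Fin n) k) (f : L2 n k) :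
    siegelOp hψ (mSp A) f =ᵐ[haarPi n k]
      fun u => (((√(siegelScale (mSp A) : ℝ))⁻¹ : ℝ) : ℂ) * f (A.1ᵀ *ᵥ u) := by
  refine (siegelOp_ae hψ _ f).trans (Eventually.of_forall fun u => ?_)
  have h1 : (mSp A).1.1.toBlocks₁₁ = A.1 := toBlocks_fromBlocks₁₁ _ _ _ _
  have h2 : siegelForm (mSp A).1 = 0 := by
    change (fromBlocks A.1 0 0 (A⁻¹.1)ᵀ).toBlocks₁₂ * _ = 0
    simp
  simp only [h1, h2]
  simp

theorem inner_mSp_vac_ne_zero {h : k → ℝ} (hh : IsSelfDual ψ s h) (A : GL (Fin n) k) :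
    inner ℂ (siegelOp hψ (mSp A) (vac n hh)) (vac n hh) ≠ 0 := by
  set H : (Fin n → k) → ℝ := fun u => ∏ j, h (u j) with hH
  have hHc : Continuous H := continuous_finsetProd _ fun j _ => hh.continuous.comp (continuous_apply j)
  have hH0 : ∀ u, 0 ≤ H u := fun u => Finset.prod_nonneg fun j _ => hh.nonneg _
  set c : ℝ := (√(siegelScale (mSp A) : ℝ))⁻¹ with hc
  have hc0 : 0 < c := inv_pos.2 (Real.sqrt_pos.2 (by exact_mod_cast siegelScale_pos (mSp A)))
  have hAc : Continuous fun u : Fin n → k => A.1ᵀ *ᵥ u := continuous_const.matrix_mulVec continuous_id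
  have hq : ∀ᵐ u ∂(haarPi n k), vac n hh (A.1ᵀ *ᵥ u) = (H (A.1ᵀ *ᵥ u) : ℂ) := by
    have := (quasiMeasurePreserving_siegelSubst (mSp A)).ae (vac_ae hh)
    simpa only [siegelSubst_apply, show (mSp A).1.1.toBlocks₁₁ = A.1 from toBlocks_fromBlocks₁₁ _ _ _ _]
      using this
  have hae : (fun u => inner ℂ (siegelOp hψ (mSp A) (vac n hh) u) (vac n hh u)) =ᵐ[haarPi n k]
      fun u => ((c * H (A.1ᵀ *ᵥ u) * H u : ℝ) : ℂ) := by
    filter_upwards [mSp_ae hψ A (vac n hh), hq, vac_ae hh] with u h1 h2 h3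
    rw [h1, h2, h3, RCLike.inner_apply, ← Complex.ofReal_mul, Complex.conj_ofReal, ← Complex.ofReal_mul,
      mul_comm]
  rw [L2.inner_def, integral_congr_ae hae]
  have hi : Integrable (fun u => c * H (A.1ᵀ *ᵥ u) * H u) (haarPi n k) := by
    have h1 := (L2.integrable_inner (𝕜 := ℂ) (siegelOp hψ (mSp A) (vac n hh)) (vac n hh)).congr hae
    simpa using h1.re
  rw [integral_complex_ofReal]
  have hp : ∀ u, 0 ≤ c * H (A.1ᵀ *ᵥ u) * H u := fun u =>
    mul_nonneg (mul_nonneg hc0.le (hH0 _)) (hH0 _)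
  have := integral_pos_of_integrable_nonneg_nonzero (μ := haarPi n k)
    (f := fun u => c * H (A.1ᵀ *ᵥ u) * H u) (x := 0)
    ((continuous_const.mul (hHc.comp hAc)).mul hHc) hi hp (by
      have h0 : 0 < H 0 := Finset.prod_pos fun j _ => hh.pos
      rw [Matrix.mulVec_zero]
      exact (mul_pos (mul_pos hc0 h0) h0).ne')
  exact_mod_cast this.ne'

end FullFourier

section FourSquares

variable {n : ℕ} {k : Type*} [NontriviallyNormedField k] [ProperSpace k] [MeasurableSpace k]
  [BorelSpace k] {ψ : AddChar k Circle} (hψ : Continuous ψ) {s : ℝ} (hs : IsSelfDualScale ψ s)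

/-! ### The Weil index when `-1` is a sum of four squares -/

/-- The scalar `ζ` in Weil's group. -/
def scalarEl (n : ℕ) (k : Type*) [NontriviallyNormedField k] [ProperSpace k] [MeasurableSpace k]
    [BorelSpace k] (ζ : Circle) : Sp n k × (L2 n k ≃ₗᵢ[ℂ] L2 n k) := (1, scalarOp n k ζ)

theorem scalarEl_mul (ζ ξ : Circle) : scalarEl n k (ζ * ξ) = scalarEl n k ζ * scalarEl n k ξ :=
  Prod.ext (one_mul 1).symm (scalarOp_mul ζ ξ)

theorem scalarEl_one : scalarEl n k 1 = 1 := Prod.ext rfl scalarOp_one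

theorem scalarEl_pow (ζ : Circle) (m : ℕ) : scalarEl n k (ζ ^ m) = scalarEl n k ζ ^ m := by
  induction m with
  | zero => rw [pow_zero, pow_zero, scalarEl_one]
  | succ m ih => rw [pow_succ, pow_succ, scalarEl_mul, ih]

theorem commute_scalarEl (ζ : Circle) (p : Sp n k × (L2 n k ≃ₗᵢ[ℂ] L2 n k)) :
    Commute (scalarEl n k ζ) p :=
  Prod.ext ((one_mul _).trans (mul_one _).symm) (scalarOp_comm ζ p.2)

theorem scalarEl_injective : Function.Injective (scalarEl n k) := fun _ _ h =>
  scalarOp_injective (congrArg Prod.snd h)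

theorem quad_fourier_rel [CharZero k] (hψ₁ : ψ ≠ 1) {h : k → ℝ} (hh : IsSelfDual ψ s h) {γ : Circle}
    (hγ : IsWeilIndex ψ s h γ) (i : Fin n) :
    quadEl hψ i 1 * fourierEl hψ hs i * quadEl hψ i 1
      = scalarEl n k γ * (fourierEl hψ hs i * (quadEl hψ i 1)⁻¹ * fourierEl hψ hs i) := by
  obtain ⟨γ', h1, h2⟩ := exists_weilIndex hψ hs hψ₁ hh i
  rw [quadEl_inv, isWeilIndex_unique hψ hs hh hγ h1]
  exact h2

theorem full_quad_fourier_rel [CharZero k] (hψ₁ : ψ ≠ 1) {h : k → ℝ} (hh : IsSelfDual ψ s h)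
    {γ : Circle} (hγ : IsWeilIndex ψ s h γ) :
    siegelHom hψ (nSp (diagonal fun _ => 1) (isSymm_diagonal _)) * fullFourier n hψ hs
        * siegelHom hψ (nSp (diagonal fun _ => 1) (isSymm_diagonal _))
      = scalarEl n k γ ^ n * (fullFourier n hψ hs
        * (siegelHom hψ (nSp (diagonal fun _ => 1) (isSymm_diagonal _)))⁻¹ * fullFourier n hψ hs) := by
  have := prod_relation (commute_scalarEl γ) (quad_fourier_rel hψ hs hψ₁ hh hγ)
    (fun i j => commute_quadEl hψ i j 1 1) (commute_fourierEl hψ hs hψ₁)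
    (fun i j hij => commute_quad_fourier hψ hs hψ₁ hij 1) (List.finRange n) (List.nodup_finRange n)
  rw [prod_quadEl, List.length_finRange] at this
  exact this

/-- Conjugation by a matrix `A` with `A Aᵀ = -1` inverts the full Fourier transform. -/
theorem conj_fullFourier [CharZero k] (hψ₁ : ψ ≠ 1) (A : GL (Fin n) k) (hA : A.1 * A.1ᵀ = -1) :
    siegelHom hψ (mSp A) * fullFourier n hψ hs * (siegelHom hψ (mSp A))⁻¹
      = (fullFourier n hψ hs)⁻¹ := by
  obtain ⟨h, hh⟩ := exists_isSelfDual hψ hψ₁ hs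
  set P := siegelHom hψ (mSp A) with hP
  set F := fullFourier n hψ hs with hF
  have hPm : P ∈ weilGroup n ψ hψ := siegelHom_mem hψ _
  have hFm : F ∈ weilGroup n ψ hψ := fullFourier_mem hψ hs
  have hAi : (A⁻¹.1)ᵀ = -A.1 := by
    have h1 : A.1ᵀ * A.1 = -1 := by
      have : A.1 * (-A.1ᵀ) = 1 := by rw [Matrix.mul_neg, hA, neg_neg]
      have := mul_eq_one_comm.1 this
      rwa [Matrix.neg_mul, neg_eq_iff_eq_neg] at this
    have h2 : A⁻¹.1 = -A.1ᵀ := by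
      have h3 : (-A.1ᵀ) * A.1 = 1 := by rw [Matrix.neg_mul, h1, neg_neg]
      calc A⁻¹.1 = (-A.1ᵀ) * A.1 * A⁻¹.1 := by rw [h3, Matrix.one_mul]
        _ = -A.1ᵀ := by rw [Matrix.mul_assoc, ← Units.val_mul, mul_inv_cancel, Units.val_one, Matrix.mul_one]
    rw [h2]; simp
  have hfst : (P * F * P⁻¹).1 = (F⁻¹).1 := by
    rw [Prod.fst_mul, Prod.fst_mul, Prod.fst_inv, Prod.fst_inv, mul_inv_eq_iff_eq_mul,
      eq_inv_mul_iff_mul_eq]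
    refine Subtype.ext ?_
    change F.1.1 * (fromBlocks A.1 0 0 (A⁻¹.1)ᵀ * F.1.1) = fromBlocks A.1 0 0 (A⁻¹.1)ᵀ
    rw [hF, fullFourier_fst, hAi]
    simp [fromBlocks_multiply]
  obtain ⟨c, hc⟩ := exists_scalarOp_of_fst_eq hψ hψ₁ (mul_mem (mul_mem hPm hFm) (inv_mem hPm))
    (inv_mem hFm) hfst
  have hFv : F.2 (vac n hh) = vac n hh := fullFourier_vac hψ hs hh
  have hFv' : (F⁻¹).2 (vac n hh) = vac n hh := by
    conv_lhs => rw [← hFv]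
    exact F.2.symm_apply_apply _
  set f := (P⁻¹).2 (vac n hh) with hf
  have e1 : F.2 f = (c : ℂ) • f := by
    have h1 := DFunLike.congr_fun hc (vac n hh)
    have h2 : P.2 (F.2 f) = (c : ℂ) • (F⁻¹).2 (vac n hh) := h1
    rw [hFv'] at h2
    have h3 := congrArg (P⁻¹).2 h2
    rw [map_smul] at h3
    exact (P.2.symm_apply_apply (F.2 f)).symm.trans h3
  have e2 : inner ℂ f (vac n hh) ≠ 0 := by
    have h1 : (P⁻¹) = siegelHom hψ (mSp A⁻¹) := by rw [map_inv, map_inv]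
    rw [hf, h1]
    exact inner_mSp_vac_ne_zero hψ hh _
  have e3 : inner ℂ (F.2 f) (F.2 (vac n hh)) = inner ℂ f (vac n hh) := F.2.inner_map_map _ _
  rw [e1, hFv, inner_smul_left] at e3
  have e4 : conj (c : ℂ) = 1 := mul_right_cancel₀ e2 (by rw [e3, one_mul])
  have e5 : c = 1 := by
    refine Circle.ext ?_
    rw [← Complex.conj_conj (c : ℂ), e4, map_one]; rfl
  refine Prod.ext hfst ?_
  rw [hc, e5, scalarOp_one, one_mul]

include hψ hs in
theorem weilIndex_pow_of_matrix [CharZero k] (hψ₁ : ψ ≠ 1) {h : k → ℝ} (hh : IsSelfDual ψ s h)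
    {γ : Circle} (hγ : IsWeilIndex ψ s h γ) (A : GL (Fin n) k) (hA : A.1 * A.1ᵀ = -1) :
    γ ^ (2 * n) = 1 := by
  have hrel := full_quad_fourier_rel (n := n) hψ hs hψ₁ hh hγ
  have hPF := conj_fullFourier hψ hs hψ₁ A hA
  have hPN : siegelHom hψ (mSp A) * siegelHom hψ (nSp (diagonal fun _ => 1) (isSymm_diagonal _))
      * (siegelHom hψ (mSp A))⁻¹
      = (siegelHom hψ (nSp (diagonal fun _ => 1) (isSymm_diagonal _)))⁻¹ := by
    rw [mul_inv_eq_iff_eq_mul, ← map_inv, ← map_mul, ← map_mul, nSp_inv]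
    congr 1
    refine Subtype.ext (Subtype.ext ?_)
    change fromBlocks A.1 0 0 (A⁻¹.1)ᵀ * fromBlocks 1 (diagonal fun _ => 1) 0 1
      = fromBlocks 1 (-diagonal fun _ => 1) 0 1 * fromBlocks A.1 0 0 (A⁻¹.1)ᵀ
    simp only [fromBlocks_multiply, diagonal_one]
    have h1 : A.1 = -(A⁻¹.1)ᵀ := by
      have h2 : A.1ᵀ * (A⁻¹.1)ᵀ = 1 := by
        rw [← transpose_mul, ← Units.val_mul, inv_mul_cancel]; simp
      calc A.1 = A.1 * (A.1ᵀ * (A⁻¹.1)ᵀ) := by rw [h2, Matrix.mul_one]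
        _ = -(A⁻¹.1)ᵀ := by rw [← Matrix.mul_assoc, hA, Matrix.neg_mul, Matrix.one_mul]
    simp only [Matrix.mul_one, Matrix.mul_zero, Matrix.zero_mul, Matrix.one_mul, add_zero,
      zero_add, Matrix.neg_mul]
    rw [← h1]
  set P := siegelHom hψ (mSp A)
  set F := fullFourier n hψ hs
  set N := siegelHom hψ (nSp (diagonal fun _ : Fin n => (1 : k)) (isSymm_diagonal _))
  set C := scalarEl n k γ ^ n with hC
  have hCc : ∀ x, Commute C x := fun x => (commute_scalarEl γ x).pow_left n
  have h1 : P * (N * F * N) * P⁻¹ = P * (C * (F * N⁻¹ * F)) * P⁻¹ := by rw [hrel]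
  have hPN' : P * N⁻¹ * P⁻¹ = N := by
    have := congrArg (·⁻¹) hPN
    simpa [mul_assoc] using this
  have h2 : P * (N * F * N) * P⁻¹ = N⁻¹ * F⁻¹ * N⁻¹ := by
    rw [← hPN, ← hPF]; group
  have h3 : P * (C * (F * N⁻¹ * F)) * P⁻¹ = C * (F⁻¹ * N * F⁻¹) := by
    rw [← hPF, ← mul_assoc P C, ← (hCc P).eq]
    conv_rhs => rw [← hPN']
    group
  rw [h2, h3] at h1
  have h4 : N * F * N = C⁻¹ * (F * N⁻¹ * F) := by
    have := congrArg (·⁻¹) h1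
    simp only [_root_.mul_inv_rev, inv_inv] at this
    rw [mul_assoc, this, ← ((hCc _).inv_left).eq]
    group
  have h5 : C * C = 1 := by
    rw [hrel] at h4
    have := mul_right_cancel h4
    rw [eq_inv_iff_mul_eq_one] at this
    exact this
  rw [hC, ← scalarEl_pow, ← scalarEl_mul, ← scalarEl_one] at h5
  have := scalarEl_injective h5
  rw [two_mul, pow_add, this]

include hψ in
/-- If `-1` is a sum of four squares, the Weil index is an eighth root of unity. -/
theorem weilIndex_pow_eight_of_four_squares [CharZero k] (hψ₁ : ψ ≠ 1) (hs : IsSelfDualScale ψ s)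
    {h : k → ℝ}
    (hh : IsSelfDual ψ s h) {γ : Circle} (hγ : IsWeilIndex ψ s h γ) {a b c d : k}
    (habcd : a ^ 2 + b ^ 2 + c ^ 2 + d ^ 2 = -1) : γ ^ 8 = 1 := by
  set Q : Matrix (Fin 4) (Fin 4) k := !![a, b, c, d; -b, a, -d, c; -c, d, a, -b; -d, -c, b, a]
    with hQ
  have h1 : Q * Qᵀ = -1 := by
    ext i j
    fin_cases i <;> fin_cases j <;> simp [hQ, Matrix.mul_apply, Fin.sum_univ_four] <;>
      first
        | linear_combination habcd
        | ring
  have h2 : Q * (-Qᵀ) = 1 := by rw [Matrix.mul_neg, h1, neg_neg]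
  have h3 := mul_eq_one_comm.1 h2
  exact weilIndex_pow_of_matrix hψ hs hψ₁ hh hγ ⟨Q, -Qᵀ, h2, h3⟩ h1

end FourSquares

section Dichotomy

variable {k : Type*} [NontriviallyNormedField k] [ProperSpace k]

/-- In a field with bounded natural numbers, `-1` is a sum of four squares. -/
theorem neg_one_sum_four_squares_of_bounded (hb : ∀ m : ℕ, ‖(m : k)‖ ≤ 1) :
    ∃ a b c d : k, a ^ 2 + b ^ 2 + c ^ 2 + d ^ 2 = -1 := by
  have hm : ∀ m : ℕ, (m : k) ∈ Metric.closedBall (0 : k) 1 := fun m => by simpa using hb m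
  obtain ⟨x, -, φ, hφ, hx⟩ := (isCompact_closedBall (0 : k) 1).tendsto_subseq hm
  have h0 : Tendsto (fun m => ((φ (m + 1) - φ m : ℕ) : k)) atTop (𝓝 0) := by
    have h1 := (hx.comp (tendsto_add_atTop_nat 1)).sub hx
    rw [sub_self] at h1
    refine h1.congr fun m => ?_
    simp only [Function.comp_apply]
    rw [Nat.cast_sub (hφ.monotone (Nat.le_succ m))]
  have h1 : ∀ m, 1 ≤ φ (m + 1) - φ m := fun m => by
    have := hφ (Nat.lt_succ_self m); simp only [Nat.succ_eq_add_one] at this; omega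
  set K : Set (k × k × k × k) := Metric.closedBall 0 1 ×ˢ Metric.closedBall 0 1 ×ˢ
    Metric.closedBall 0 1 ×ˢ Metric.closedBall 0 1 with hK
  have hKc : IsCompact K := (isCompact_closedBall _ _).prod ((isCompact_closedBall _ _).prod
    ((isCompact_closedBall _ _).prod (isCompact_closedBall _ _)))
  set q : k × k × k × k → k := fun p => p.1 ^ 2 + p.2.1 ^ 2 + p.2.2.1 ^ 2 + p.2.2.2 ^ 2 with hq
  have hqc : Continuous q := by rw [hq]; fun_prop
  have h2 : Tendsto (fun m => ((φ (m + 1) - φ m : ℕ) : k) - 1) atTop (𝓝 (-1)) := by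
    simpa using h0.sub_const 1
  have h3 : (-1 : k) ∈ q '' K := by
    refine (hKc.image hqc).isClosed.mem_of_tendsto h2 (Eventually.of_forall fun m => ?_)
    obtain ⟨a, b, c, d, h⟩ := Nat.sum_four_squares (φ (m + 1) - φ m - 1)
    refine ⟨(a, b, c, d), ⟨hm a, hm b, hm c, hm d⟩, ?_⟩
    have h4 : ((φ (m + 1) - φ m : ℕ) : k) - 1 = ((φ (m + 1) - φ m - 1 : ℕ) : k) := by
      rw [Nat.cast_sub (h1 m)]; simp
    rw [h4, ← h, hq]
    push_cast
    rfl
  obtain ⟨⟨a, b, c, d⟩, -, h⟩ := h3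
  exact ⟨a, b, c, d, h⟩

/-- If the natural numbers are unbounded, then the field contains `ℝ`. -/
theorem exists_real_hom [CharZero k] (hb : ¬ ∀ m : ℕ, ‖(m : k)‖ ≤ 1) :
    ∃ f : ℝ →+* k, Continuous f := by
  set v : AbsoluteValue ℚ ℝ :=
    (NormedField.toAbsoluteValue k).comp (f := Rat.castHom k) (Rat.castHom k).injective with hv
  have hve : ∀ q : ℚ, v q = ‖(q : k)‖ := fun q => rfl
  have h1 : ¬ ∀ m : ℕ, v m ≤ 1 := by simpa [hve] using hb
  obtain ⟨c, hc, h2⟩ :=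
    AbsoluteValue.isEquiv_iff_exists_rpow_eq.1 (Rat.AbsoluteValue.equiv_real_of_unbounded h1)
  have h3 : ∀ q : ℚ, ‖(q : k)‖ = ‖q‖ ^ c⁻¹ := fun q => by
    have h4 := congrFun h2 q
    simp only [hve, Rat.AbsoluteValue.real_eq_abs] at h4
    have h5 : ‖q‖ = ‖(q : k)‖ ^ c := by
      rw [h4, Rat.cast_abs, ← Rat.norm_cast_real, Real.norm_eq_abs]
    rw [h5, ← Real.rpow_mul (norm_nonneg _), mul_inv_cancel₀ hc.ne', Real.rpow_one]
  have h4 : UniformContinuous (Rat.castHom k) := by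
    refine uniformContinuous_of_continuousAt_zero _ ?_
    change Tendsto (fun q : ℚ => (q : k)) (𝓝 0) (𝓝 ((0 : ℚ) : k))
    rw [Rat.cast_zero, tendsto_zero_iff_norm_tendsto_zero]
    simp_rw [h3]
    have h5 : Tendsto (fun q : ℚ => ‖q‖) (𝓝 0) (𝓝 0) := tendsto_norm_zero
    have h6 := h5.rpow_const (p := c⁻¹) (Or.inr (inv_nonneg.2 hc.le))
    rwa [Real.zero_rpow (inv_ne_zero hc.ne')] at h6
  exact ⟨IsDenseInducing.extendRingHom (i := Rat.castHom ℝ)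
    Rat.isUniformEmbedding_coe_real.isUniformInducing Rat.denseRange_cast h4,
    (uniformContinuous_uniformly_extend Rat.isUniformEmbedding_coe_real.isUniformInducing
      Rat.denseRange_cast h4).continuous⟩

variable (k) in
/-- In a local field of characteristic zero other than `ℝ`, `-1` is a sum of four squares. -/
theorem four_squares_or_real [CharZero k] :
    (∃ a b c d : k, a ^ 2 + b ^ 2 + c ^ 2 + d ^ 2 = -1) ∨
      ∃ e : ℝ ≃+* k, Continuous e ∧ Continuous e.symm := by
  by_cases hb : ∀ m : ℕ, ‖(m : k)‖ ≤ 1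
  · exact Or.inl (neg_one_sum_four_squares_of_bounded hb)
  obtain ⟨f, hf⟩ := exists_real_hom hb
  let _ : Algebra ℝ k := f.toAlgebra
  have : ContinuousSMul ℝ k := ⟨by
    change Continuous fun p : ℝ × k => f p.1 * p.2
    fun_prop⟩
  have hfd : FiniteDimensional ℝ k := FiniteDimensional.of_locallyCompactSpace ℝ
  rcases Real.nonempty_algEquiv_or k with ⟨⟨e⟩⟩ | ⟨⟨e⟩⟩
  · refine Or.inr ⟨e.symm.toRingEquiv, ?_, ?_⟩
    · exact LinearMap.continuous_of_finiteDimensional e.symm.toLinearMap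
    · exact LinearMap.continuous_of_finiteDimensional e.toLinearMap
  · refine Or.inl ⟨e.symm Complex.I, 0, 0, 0, ?_⟩
    rw [← map_pow, Complex.I_sq]
    simp

end Dichotomy

section RealCharacter

/-- A continuous homomorphism from the additive group of `ℝ` to the circle is an exponential. -/
theorem exists_exp_of_continuous (χ : AddChar ℝ Circle) (hχ : Continuous χ) :
    ∃ a : ℝ, ∀ x, (χ x : ℂ) = Complex.exp (Complex.I * a * x) := by
  set f : ℝ → ℂ := fun x => (χ x : ℂ) with hf
  have hfc : Continuous f := continuous_subtype_val.comp hχ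
  have hfa : ∀ x y, f (x + y) = f x * f y := fun x y => by
    rw [hf]; simp only; rw [AddChar.map_add_eq_mul, Circle.coe_mul]
  have hf0 : f 0 = 1 := by rw [hf]; simp
  set F : ℝ → ℂ := fun x => ∫ t in (0 : ℝ)..x, f t with hF
  have hFd : ∀ x, HasDerivAt F (f x) x := fun x =>
    intervalIntegral.integral_hasDerivAt_right (hfc.intervalIntegrable _ _)
      (hfc.stronglyMeasurableAtFilter _ _) hfc.continuousAt
  obtain ⟨δ, hδ⟩ : ∃ δ, F δ ≠ 0 := by
    by_contra! h
    have h1 : HasDerivAt F 0 0 := by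
      have : F = fun _ => 0 := funext h
      rw [this]; exact hasDerivAt_const _ _
    have := (hFd 0).unique h1
    rw [hf0] at this
    exact one_ne_zero this
  have h1 : ∀ x, f x = (F (x + δ) - F x) * (F δ)⁻¹ := fun x => by
    rw [eq_mul_inv_iff_mul_eq₀ hδ, hF]
    simp only
    rw [intervalIntegral.integral_interval_sub_left (hfc.intervalIntegrable _ _)
      (hfc.intervalIntegrable _ _), ← intervalIntegral.integral_const_mul]
    simp_rw [← hfa]
    rw [intervalIntegral.integral_comp_add_left (fun t => f t)]
    simp
  have hfd : ∀ x, HasDerivAt f ((f (x + δ) - f x) * (F δ)⁻¹) x := fun x => by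
    have h2 : HasDerivAt (fun x => (F (x + δ) - F x) * (F δ)⁻¹)
        ((f (x + δ) - f x) * (F δ)⁻¹) x :=
      (((hFd (x + δ)).comp_add_const x δ).sub (hFd x)).mul_const _
    exact h2.congr_of_eventuallyEq (Eventually.of_forall h1)
  set c : ℂ := (f δ - 1) * (F δ)⁻¹ with hc
  have hfd' : ∀ x, HasDerivAt f (c * f x) x := fun x => by
    have h2 := hfd x
    rw [hfa] at h2
    have h3 : c * f x = (f x * f δ - f x) * (F δ)⁻¹ := by rw [hc]; ring
    rw [h3]; exact h2
  have h2 : ∀ x, f x = Complex.exp (c * x) := by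
    have h3 : ∀ x, HasDerivAt (fun x : ℝ => f x * Complex.exp (-(c * x))) 0 x := fun x => by
      have h4 : HasDerivAt (fun x : ℝ => -(c * (x : ℂ))) (-(c * 1)) x :=
        ((Complex.ofRealCLM.hasDerivAt (x := x)).const_mul c).neg
      have h5 := (hfd' x).mul h4.cexp
      refine h5.congr_deriv ?_
      ring
    intro x
    have h4 := is_const_of_deriv_eq_zero (fun x => (h3 x).differentiableAt)
      (fun x => (h3 x).deriv) x 0
    simp only [hf0, Complex.ofReal_zero, mul_zero, neg_zero, Complex.exp_zero, mul_one] at h4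
    rw [Complex.exp_neg, mul_inv_eq_one₀ (Complex.exp_ne_zero _)] at h4
    exact h4
  have h3 : c.re = 0 := by
    have h4 : ‖f 1‖ = 1 := Circle.norm_coe _
    rw [h2, Complex.norm_exp, Real.exp_eq_one_iff] at h4
    simpa using h4
  refine ⟨c.im, fun x => ?_⟩
  rw [← hf] at *
  have h4 : c = Complex.I * c.im := by
    apply Complex.ext <;> simp [h3]
  rw [← h4]
  exact h2 x

end RealCharacter

section WeilIndexReal

variable {k : Type*} [NontriviallyNormedField k] [ProperSpace k] [MeasurableSpace k]
  [BorelSpace k]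

theorem exists_integral_eq_real (e : ℝ ≃+* k) (he : Continuous e) (he' : Continuous e.symm) :
    ∃ c : ℝ, 0 < c ∧ (∀ f : k → ℂ, ∫ v, f v ∂(haar k) = c * ∫ t, f (e t)) ∧
      (∀ f : k → ℂ, Integrable (fun t => f (e t)) → Integrable f (haar k)) := by
  let E : ℝ ≃ₜ k := ⟨e.toEquiv, he, he'⟩
  have h1 : (Measure.map e (volume : Measure ℝ)).IsAddHaarMeasure :=
    AddEquiv.isAddHaarMeasure_map volume e.toAddEquiv he he'
  have hc := Measure.isAddLeftInvariant_eq_smul (haar k) (Measure.map e (volume : Measure ℝ))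
  have hc0 := Measure.addHaarScalarFactor_pos_of_isAddHaarMeasure (haar k)
    (Measure.map e (volume : Measure ℝ))
  set c := Measure.addHaarScalarFactor (haar k) (Measure.map e (volume : Measure ℝ))
  have h2 : Measure.map e (volume : Measure ℝ) = Measure.map E.toMeasurableEquiv volume := rfl
  refine ⟨c, hc0, fun f => ?_, fun f hf => ?_⟩
  · rw [hc, integral_smul_nnreal_measure, h2, MeasureTheory.integral_map_equiv]
    rfl
  · rw [hc]
    refine Integrable.smul_measure_nnreal ?_
    rw [h2, MeasureTheory.integrable_map_equiv]
    exact hf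

theorem weilIndex_real_aux {a : ℝ} (ha : a ≠ 0) {γ : ℂ}
    (h : ((Real.pi : ℂ) / ((((|a| : ℝ) : ℂ) - Complex.I * a) / 2)) ^ (1 / 2 : ℂ)
      = γ * ((Real.pi : ℂ) / ((((|a| : ℝ) : ℂ) + Complex.I * a) / 2)) ^ (1 / 2 : ℂ)) : γ ^ 8 = 1 := by
  have hsq : ∀ z : ℂ, (z ^ (1 / 2 : ℂ)) ^ 2 = z := fun z => by
    have := Complex.cpow_nat_inv_pow z (n := 2) two_ne_zero
    rw [one_div]; exact_mod_cast this
  have h1 := congrArg (· ^ 2) h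
  simp only [mul_pow, hsq] at h1
  have hpi : (Real.pi : ℂ) ≠ 0 := by exact_mod_cast Real.pi_ne_zero
  have hI : ∀ ε : ℂ, (ε = 1 ∨ ε = -1) → ((|a| : ℝ) : ℂ) + ε * (Complex.I * a) ≠ 0 := by
    intro ε hε h0
    have h2 := congrArg Complex.re h0
    rcases hε with rfl | rfl <;> simp [ha] at h2
  have hp : ((|a| : ℝ) : ℂ) + Complex.I * a ≠ 0 := by simpa using hI 1 (Or.inl rfl)
  have hm : ((|a| : ℝ) : ℂ) - Complex.I * a ≠ 0 := by
    have := hI (-1) (Or.inr rfl); intro h0; apply this; rw [← h0]; ring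
  have h2 : ((|a| : ℝ) : ℂ) + Complex.I * a = γ ^ 2 * (((|a| : ℝ) : ℂ) - Complex.I * a) := by
    field_simp at h1
    linear_combination h1
  have habs : ((|a| : ℝ) : ℂ) ^ 2 = (a : ℂ) ^ 2 := by
    rw [← Complex.ofReal_pow, sq_abs, Complex.ofReal_pow]
  have h3 : (γ ^ 4 + 1) * (((|a| : ℝ) : ℂ) - Complex.I * a) ^ 2 = 0 := by
    have h4 := congrArg (· ^ 2) h2
    simp only [mul_pow] at h4
    linear_combination (-1 : ℂ) * h4 + 2 * habs + (2 * (a : ℂ) ^ 2) * Complex.I_sq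
  have h4 : γ ^ 4 = -1 := by
    rcases mul_eq_zero.1 h3 with h5 | h5
    · exact eq_neg_of_add_eq_zero_left h5
    · exact absurd (pow_eq_zero_iff two_ne_zero |>.1 h5) hm
  calc γ ^ 8 = (γ ^ 4) ^ 2 := by ring
    _ = 1 := by rw [h4]; norm_num

variable {ψ : AddChar k Circle} (hψ : Continuous ψ) {s : ℝ} (hs : IsSelfDualScale ψ s)

include hψ hs in
/-- Over `ℝ` the Gaussian is a self-dual function, with Weil index an eighth root of unity. -/
theorem exists_weilIndex_real [CharZero k] (hψ₁ : ψ ≠ 1) (e : ℝ ≃+* k) (he : Continuous e)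
    (he' : Continuous e.symm) :
    ∃ (h : k → ℝ) (γ : Circle), IsSelfDual ψ s h ∧ IsWeilIndex ψ s h γ ∧ γ ^ 8 = 1 := by
  let χ : AddChar ℝ Circle := ⟨fun t => ψ (e t), by simp, fun x y => by
    rw [map_add, AddChar.map_add_eq_mul]⟩
  obtain ⟨a, ha⟩ := exists_exp_of_continuous χ (hψ.comp he)
  replace ha : ∀ t, (ψ (e t) : ℂ) = Complex.exp (Complex.I * a * t) := ha
  have ha0 : a ≠ 0 := by
    rintro rfl
    apply hψ₁
    ext x
    obtain ⟨t, rfl⟩ := e.surjective x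
    rw [ha]; simp
  obtain ⟨c, hc, hint, hintg⟩ := exists_integral_eq_real e he he'
  set h : k → ℝ := fun v => Real.exp (-(|a| / 2) * (e.symm v) ^ 2) with hh
  have hhe : ∀ t : ℝ, (h (e t) : ℂ) = Complex.exp (-((|a| / 2 : ℝ) : ℂ) * (t : ℂ) ^ 2) := by
    intro t
    simp only [hh, RingEquiv.symm_apply_apply]
    push_cast
    ring_nf
  have hb : 0 < |a| / 2 := by positivity
  have hgi : ∀ b : ℝ, 0 < b → Integrable (fun v => Real.exp (-b * (e.symm v) ^ 2)) (haar k) := by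
    intro b hb
    have h1 : Integrable (fun v => ((Real.exp (-b * (e.symm v) ^ 2) : ℝ) : ℂ)) (haar k) := by
      apply hintg
      simp only [RingEquiv.symm_apply_apply]
      exact (integrable_exp_neg_mul_sq hb).ofReal
    exact h1.re
  have hhc : Continuous h := by rw [hh]; fun_prop
  have hhi : Integrable h (haar k) := hgi _ hb
  have hhsq : ∀ v, h v ^ 2 = Real.exp (-|a| * (e.symm v) ^ 2) := fun v => by
    rw [hh]; simp only; rw [← Real.exp_nat_mul]; congr 1; push_cast; ring
  have hh2 : MemLp h 2 (haar k) := by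
    rw [memLp_two_iff_integrable_sq hhc.aestronglyMeasurable]
    simp_rw [hhsq]
    exact hgi _ (by positivity)
  have hre : (0 : ℝ) < (((|a| / 2 : ℝ) : ℂ)).re := by simpa using hb
  obtain ⟨κ, hκ0, hκ⟩ : ∃ κ : ℝ, 0 < κ ∧
      ∀ x, (s : ℂ) * ft ψ (haar k) (fun v => (h v : ℂ)) x = κ * h x := by
    refine ⟨s * c * √(2 * Real.pi / |a|), by have := hs.1; positivity, fun x => ?_⟩
    obtain ⟨y, rfl⟩ := e.surjective x
    rw [ft, hint]
    have h1 : ∀ t : ℝ, (h (e t) : ℂ) * (ψ (e y * e t) : ℂ)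
        = Complex.exp (Complex.I * (a * y : ℝ) * t)
          * Complex.exp (-((|a| / 2 : ℝ) : ℂ) * (t : ℂ) ^ 2) := fun t => by
      rw [hhe, ← map_mul, ha, mul_comm]
      push_cast; ring_nf
    simp_rw [h1]
    rw [fourierIntegral_gaussian hre, hhe]
    have h2 : ((Real.pi : ℂ) / ((|a| / 2 : ℝ) : ℂ)) ^ (1 / 2 : ℂ)
        = ((√(2 * Real.pi / |a|) : ℝ) : ℂ) := by
      rw [Real.sqrt_eq_rpow, Complex.ofReal_cpow (by positivity)]
      push_cast
      congr 1
      field_simp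
    have h3 : -(((a * y : ℝ)) : ℂ) ^ 2 / (4 * ((|a| / 2 : ℝ) : ℂ))
        = -((|a| / 2 : ℝ) : ℂ) * (y : ℂ) ^ 2 := by
      have h4 : -(a * y) ^ 2 / (4 * (|a| / 2)) = -(|a| / 2) * y ^ 2 := by
        have := sq_abs a
        have h5 : |a| ≠ 0 := by simpa using ha0
        field_simp
        rw [← this]; ring
      exact_mod_cast congrArg (fun r : ℝ => (r : ℂ)) h4
    rw [h2, h3]
    push_cast
    ring
  have hκ1 : κ = 1 := by
    have h1 := (hs.2 _ hhi.ofReal hh2.ofReal).2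
    have h0 : ∀ x, ‖(κ : ℂ) * (h x : ℂ)‖ ^ 2 = κ ^ 2 * h x ^ 2 := fun x => by
      rw [norm_mul, mul_pow, Complex.norm_real, Complex.norm_real, Real.norm_eq_abs,
        Real.norm_eq_abs, sq_abs, sq_abs]
    have h00 : ∀ x, ‖(h x : ℂ)‖ ^ 2 = h x ^ 2 := fun x => by
      rw [Complex.norm_real, Real.norm_eq_abs, sq_abs]
    replace h1 : ∫ x, ‖(s : ℂ) * ft ψ (haar k) (fun v => (h v : ℂ)) x‖ ^ 2 ∂(haar k)
        = ∫ x, ‖(h x : ℂ)‖ ^ 2 ∂(haar k) := h1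
    simp_rw [hκ, h0, h00] at h1
    rw [integral_const_mul] at h1
    have h2 : 0 < ∫ x, h x ^ 2 ∂(haar k) := by
      rw [integral_pos_iff_support_of_nonneg (fun x => sq_nonneg _)
        ((memLp_two_iff_integrable_sq hhc.aestronglyMeasurable).1 hh2)]
      have : (Function.support fun x => h x ^ 2) = Set.univ := by
        ext v; simp [hh, Real.exp_ne_zero]
      rw [this]
      exact Measure.measure_univ_pos.2 (NeZero.ne _)
    have h3 : κ ^ 2 = 1 := mul_right_cancel₀ h2.ne' (by rw [one_mul]; exact h1)
    nlinarith
  have hsd : IsSelfDual ψ s h :=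
    { continuous := hhc
      nonneg := fun x => (Real.exp_pos _).le
      even := fun x => by simp [hh]
      pos := Real.exp_pos _
      integrable := hhi
      memLp := hh2
      fourier := fun x => by rw [hκ, hκ1]; simp }
  obtain ⟨γ, hγ, -⟩ := exists_weilIndex (n := 1) hψ hs hψ₁ hsd 0
  refine ⟨h, γ, hsd, hγ, ?_⟩
  have h0 := hγ 0
  have hev : ∀ ε : ℝ, ft ψ (haar k) (fun v => (chi ψ (e ε) v : ℂ) * (h v : ℂ)) 0
      = c * ((Real.pi : ℂ) / ((((|a| : ℝ) : ℂ) - ε * (Complex.I * a)) / 2)) ^ (1 / 2 : ℂ) := by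
    intro ε
    rw [ft, hint]
    have h1 : ∀ t : ℝ, (chi ψ (e ε) (e t) : ℂ) * (h (e t) : ℂ) * (ψ (0 * e t) : ℂ)
        = Complex.exp (-((((|a| : ℝ) : ℂ) - ε * (Complex.I * a)) / 2) * (t : ℂ) ^ 2) := fun t => by
      have h2 : (2⁻¹ * (e ε * e t ^ 2) : k) = e (2⁻¹ * (ε * t ^ 2)) := by
        simp only [map_mul, map_inv₀, map_ofNat, map_pow]
      rw [hhe, zero_mul, AddChar.map_zero_eq_one, Circle.coe_one, mul_one, chi, h2, ha,
        ← Complex.exp_add]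
      congr 1
      push_cast
      ring
    simp_rw [h1]
    rw [integral_gaussian_complex]
    simp [ha0]
  have e1 := hev 1
  have e2 := hev (-1)
  rw [map_neg, map_one] at e2
  rw [map_one] at e1
  rw [e1, e2] at h0
  have h1 : (chi ψ 1 0 : ℂ) = 1 := by simp [chi]
  have hsc : ((s : ℂ) * (c : ℂ)) ≠ 0 := mul_ne_zero
    (by exact_mod_cast hs.1.ne') (by exact_mod_cast hc.ne')
  have h2 := weilIndex_real_aux ha0 (γ := (γ : ℂ)) (by
    rw [h1] at h0
    push_cast at h0
    refine mul_left_cancel₀ hsc ?_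
    simp only [one_mul, neg_mul, sub_neg_eq_add] at h0
    linear_combination h0)
  exact Circle.ext (by rw [Circle.coe_pow, h2, Circle.coe_one])

include hψ hs in
/-- There is a self-dual function, and its Weil index is an eighth root of unity. -/
theorem exists_weilIndex_pow_eight [CharZero k] (hψ₁ : ψ ≠ 1) :
    ∃ (h : k → ℝ) (γ : Circle), IsSelfDual ψ s h ∧ IsWeilIndex ψ s h γ ∧ γ ^ 8 = 1 := by
  rcases four_squares_or_real k with ⟨a, b, c, d, habcd⟩ | ⟨e, he, he'⟩
  · obtain ⟨h, hh⟩ := exists_isSelfDual hψ hψ₁ hs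
    obtain ⟨γ, hγ, -⟩ := exists_weilIndex (n := 1) hψ hs hψ₁ hh 0
    exact ⟨h, γ, hh, hγ, weilIndex_pow_eight_of_four_squares hψ hψ₁ hs hh hγ habcd⟩
  · exact exists_weilIndex_real hψ hs hψ₁ e he he'

end WeilIndexReal

section RootElements

open scoped commutatorElement

variable {n : ℕ} {k : Type*} [NontriviallyNormedField k] [ProperSpace k] [MeasurableSpace k]
  [BorelSpace k]

theorem rootMatrix_mul (i : Fin n) (t r : k) :
    rootMatrix i t * rootMatrix i r = rootMatrix i (t + r) := by
  unfold rootMatrix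
  split_ifs with h
  · have hne : (⟨i + 1, h⟩ : Fin n) ≠ i := by
      intro e; have := congrArg Fin.val e; simp at this
    rw [fromBlocks_multiply]
    congr 1
    · simp [Matrix.add_mul, Matrix.mul_add, hne, Matrix.single_add]; abel
    · simp
    · simp
    · simp [Matrix.sub_mul, Matrix.mul_sub, hne.symm, Matrix.single_add]; abel
  · rw [fromBlocks_multiply]
    simp [Matrix.single_add, add_comm]

theorem xPos_add (i : Fin n) (t r : k) : xPos i (t + r) = xPos i t * xPos i r :=
  Subtype.ext (rootMatrix_mul i t r).symm

theorem xNeg_add (i : Fin n) (t r : k) : xNeg i (t + r) = xNeg i t * xNeg i r := by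
  refine Subtype.ext ?_
  change (rootMatrix i (t + r))ᵀ = (rootMatrix i t)ᵀ * (rootMatrix i r)ᵀ
  rw [← transpose_mul, rootMatrix_mul, add_comm]

/-- The element of the torus with entry `c` at `e_i` and `c⁻¹` at `f_i`. -/
def cochar (i : Fin n) (c : kˣ) : Sp n k := (mSp (diagGL i c)).1

theorem cochar_coe (i : Fin n) (c : kˣ) : (cochar i c).1 =
    fromBlocks (diagonal (Function.update 1 i (c : k))) 0 0
      (diagonal (Function.update 1 i ((c⁻¹ : kˣ) : k))) := by
  rw [cochar, mSp_coe]
  change fromBlocks _ 0 0 ((diagonal _)ᵀ) = _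
  rw [diagonal_transpose]
  rfl

theorem diagonal_mul_single' (d : Fin n → k) (a b : Fin n) (t : k) :
    diagonal d * Matrix.single a b t = Matrix.single a b (d a * t) := by
  ext x y
  rw [diagonal_mul, Matrix.single_apply, Matrix.single_apply]
  split_ifs with h
  · rw [h.1]
  · rw [mul_zero]

theorem single_mul_diagonal' (d : Fin n → k) (a b : Fin n) (t : k) :
    Matrix.single a b t * diagonal d = Matrix.single a b (t * d b) := by
  ext x y
  rw [mul_diagonal, Matrix.single_apply, Matrix.single_apply]
  split_ifs with h
  · rw [h.2]
  · rw [zero_mul]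

theorem cochar_mul_xPos (i : Fin n) (c : kˣ) :
    ∃ q : k, (q = c ∨ q = c ^ 2) ∧ ∀ r, cochar i c * xPos i r = xPos i (q * r) * cochar i c := by
  by_cases h : (i : ℕ) + 1 < n
  · have hne : (⟨i + 1, h⟩ : Fin n) ≠ i := by
      intro e; have := congrArg Fin.val e; simp at this
    refine ⟨c, Or.inl rfl, fun r => Subtype.ext ?_⟩
    change (cochar i c).1 * rootMatrix i r = rootMatrix i (c * r) * (cochar i c).1
    rw [cochar_coe, rootMatrix, rootMatrix, dif_pos h, dif_pos h, fromBlocks_multiply,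
      fromBlocks_multiply]
    congr 1
    · simp [Matrix.mul_add, Matrix.add_mul, diagonal_mul_single', single_mul_diagonal', hne]
    · simp
    · simp
    · simp [Matrix.mul_sub, Matrix.sub_mul, diagonal_mul_single', single_mul_diagonal', hne]
      field_simp
  · refine ⟨c ^ 2, Or.inr rfl, fun r => Subtype.ext ?_⟩
    change (cochar i c).1 * rootMatrix i r = rootMatrix i (c ^ 2 * r) * (cochar i c).1
    rw [cochar_coe, rootMatrix, rootMatrix, dif_neg h, dif_neg h, fromBlocks_multiply,
      fromBlocks_multiply]
    congr 1
    · simp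
    · simp [diagonal_mul_single', single_mul_diagonal']
      congr 1
      field_simp
    · simp
    · simp

theorem cochar_transpose (i : Fin n) (c : kˣ) : (cochar i c).1ᵀ = (cochar i c).1 := by
  rw [cochar_coe, fromBlocks_transpose]; simp

variable [CharZero k]

theorem xPos_eq_commutator (i : Fin n) (t : k) : ∃ v : k, xPos i t
    = ⁅cochar i (Units.mk0 (2 : k) two_ne_zero) * cochar i (Units.mk0 (2 : k) two_ne_zero), xPos i v⁆ := by
  obtain ⟨q, hq, h⟩ := cochar_mul_xPos i (Units.mk0 (2 : k) two_ne_zero)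
  have hq1 : q ^ 2 - 1 ≠ 0 := by
    rcases hq with rfl | rfl <;> norm_num
  set c := cochar i (Units.mk0 (2 : k) two_ne_zero)
  refine ⟨t / (q ^ 2 - 1), ?_⟩
  have h2 : ∀ r, c * c * xPos i r = xPos i (q * (q * r)) * (c * c) := fun r => by
    rw [mul_assoc, h, ← mul_assoc, h, mul_assoc]
  rw [commutatorElement_def, eq_mul_inv_iff_mul_eq, eq_mul_inv_iff_mul_eq, h2, ← xPos_add]
  congr 2
  field_simp
  ring

theorem xNeg_eq_commutator (i : Fin n) (t : k) : ∃ v : k, xNeg i t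
    = ⁅(cochar i (Units.mk0 (2 : k) two_ne_zero) * cochar i (Units.mk0 (2 : k) two_ne_zero))⁻¹, xNeg i v⁆ := by
  obtain ⟨q, hq, h⟩ := cochar_mul_xPos i (Units.mk0 (2 : k) two_ne_zero)
  have hq1 : q ^ 2 - 1 ≠ 0 := by
    rcases hq with rfl | rfl <;> norm_num
  set c := cochar i (Units.mk0 (2 : k) two_ne_zero) with hc
  have h' : ∀ r, xNeg i r * c = c * xNeg i (q * r) := fun r => by
    have h1 := congrArg (fun g : Sp n k => g.1ᵀ) (h r)
    change (c.1 * rootMatrix i r)ᵀ = (rootMatrix i (q * r) * c.1)ᵀ at h1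
    rw [transpose_mul, transpose_mul, hc, cochar_transpose] at h1
    exact Subtype.ext h1
  refine ⟨t / (q ^ 2 - 1), ?_⟩
  have h2 : ∀ r, xNeg i r * (c * c) = c * c * xNeg i (q * (q * r)) := fun r => by
    rw [← mul_assoc, h', mul_assoc, h', ← mul_assoc]
  rw [commutatorElement_def, inv_inv, eq_mul_inv_iff_mul_eq, ← xNeg_add, mul_assoc,
    eq_inv_mul_iff_mul_eq, h2]
  congr 2
  field_simp
  ring

theorem cochar_mem_borel (i : Fin n) (c : kˣ) (b : Fin n ⊕ Fin n → ℤ) :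
    cochar i c ∈ borel k b := by
  intro x y hxy
  have hne : x ≠ y := by rintro rfl; exact lt_irrefl _ hxy
  rw [cochar_coe]
  rcases x with x | x <;> rcases y with y | y
  · exact diagonal_apply_ne _ fun e => hne (congrArg _ e)
  · rfl
  · rfl
  · exact diagonal_apply_ne _ fun e => hne (congrArg _ e)

theorem borel_le_siegel : borel k flagPos ≤ siegel n k := by
  intro g hg
  ext a b
  refine hg ?_
  have := a.2; have := b.2
  simp only [flagPos]; omega

theorem det_of_unipotent {g : Sp n k} (hg : g ∈ unipotent k flagPos flagPos_injective) :
    g.1.toBlocks₁₁.det = 1 := by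
  rw [det_of_isUpperTriangular]
  · exact Finset.prod_eq_one fun a _ => hg.2 _
  · intro a b hab
    refine hg.1 ?_
    simp only [flagPos, id] at *
    exact_mod_cast hab

/-- The symplectic matrix `e_i ↦ -f_i`, `f_i ↦ e_i` for all `i`. -/
def fullSp : Sp n k := ⟨fromBlocks 0 1 (-1) 0, by
  rw [SymplecticGroup.fromBlocks_mem_iff]; simp⟩

theorem fullSp_inv : (fullSp⁻¹ : Sp n k).1 = fromBlocks 0 (-1) 1 0 := by
  have : (fullSp : Sp n k)⁻¹ = ⟨fromBlocks 0 (-1) 1 0, by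
      rw [SymplecticGroup.fromBlocks_mem_iff]; simp⟩ := by
    rw [inv_eq_iff_mul_eq_one]
    refine Subtype.ext ?_
    change fromBlocks 0 1 (-1) 0 * fromBlocks 0 (-1) 1 0 = 1
    rw [fromBlocks_multiply]
    simp
  rw [this]

theorem fullSp_conj (g : Sp n k) : ((fullSp⁻¹ : Sp n k) * g * fullSp).1
    = fromBlocks g.1.toBlocks₂₂ (-g.1.toBlocks₂₁) (-g.1.toBlocks₁₂) g.1.toBlocks₁₁ := by
  change (fullSp⁻¹ : Sp n k).1 * g.1 * fromBlocks 0 1 (-1) 0 = _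
  rw [fullSp_inv]
  conv_lhs => rw [← fromBlocks_toBlocks g.1]
  rw [fromBlocks_multiply, fromBlocks_multiply]
  simp

theorem conj_borelOpp_mem {g : Sp n k} (hg : g ∈ borel k flagPosOpp) :
    fullSp⁻¹ * g * fullSp ∈ siegel n k := by
  change ((fullSp⁻¹ : Sp n k) * g * fullSp).1.toBlocks₂₁ = 0
  rw [fullSp_conj, toBlocks_fromBlocks₂₁, neg_eq_zero]
  ext a b
  refine hg ?_
  have := a.2; have := b.2
  simp only [flagPosOpp, flagPos]; omega

theorem det_of_unipotentOpp {g : Sp n k} (hg : g ∈ unipotent k flagPosOpp flagPosOpp_injective) :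
    ((fullSp⁻¹ : Sp n k) * g * fullSp).1.toBlocks₁₁.det = 1 := by
  rw [fullSp_conj, toBlocks_fromBlocks₁₁, det_of_isUpperTriangular]
  · exact Finset.prod_eq_one fun a _ => hg.2 _
  · intro a b hab
    refine hg.1 ?_
    simp only [flagPosOpp, flagPos, id] at *
    have : (b : ℕ) < a := hab
    omega

theorem cochar_mul_self (i : Fin n) (c : kˣ) :
    cochar i c * cochar i c = ⁅cochar i c, fullSp⁆ := by
  rw [commutatorElement_def, mul_assoc, mul_assoc]
  congr 1
  rw [← mul_assoc, eq_mul_inv_iff_mul_eq, eq_mul_inv_iff_mul_eq]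
  refine Subtype.ext ?_
  change (cochar i c).1 * fromBlocks 0 1 (-1) 0 * (cochar i c).1 = fromBlocks 0 1 (-1) 0
  rw [cochar_coe, fromBlocks_multiply, fromBlocks_multiply]
  have h1 : ∀ x y : k, x * y = 1 → (Function.update (1 : Fin n → k) i x)
      * (Function.update (1 : Fin n → k) i y) = 1 := fun x y hxy => by
    ext a
    by_cases ha : a = i
    · subst ha; simp [hxy]
    · simp [ha]
  have h2 := h1 c (c⁻¹ : kˣ) (by simp)
  have h3 := h1 (c⁻¹ : kˣ) c (by simp)
  generalize Function.update (1 : Fin n → k) i (c : k) = p at *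
  generalize Function.update (1 : Fin n → k) i ((c⁻¹ : kˣ) : k) = q at *
  simp only [Matrix.mul_one, Matrix.mul_zero, zero_add, Matrix.zero_mul, add_zero, Matrix.mul_neg,
    Matrix.neg_mul, diagonal_mul_diagonal', neg_zero]
  congr

end RootElements

section Splittings

open scoped commutatorElement

variable {n : ℕ} {k : Type*} [NontriviallyNormedField k] [ProperSpace k] [MeasurableSpace k]
  [BorelSpace k] {ψ : AddChar k Circle} (hψ : Continuous ψ) {s : ℝ} (hs : IsSelfDualScale ψ s)

theorem mu8_le : mu8 n k ≤ weilGroup n ψ hψ := by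
  rintro _ ⟨ζ, -, rfl⟩
  exact scalarOp_mem hψ ζ

theorem metaplectic_le : metaplectic n ψ hψ ≤ weilGroup n ψ hψ :=
  sup_le (Subgroup.commutator_le.2 fun _ ha _ hb => mul_mem (mul_mem (mul_mem ha hb) (inv_mem ha))
    (inv_mem hb)) (mu8_le hψ)

theorem derived_le : ⁅weilGroup n ψ hψ, weilGroup n ψ hψ⁆ ≤ metaplectic n ψ hψ := le_sup_left

theorem conj_mem_derived {a x : Sp n k × (L2 n k ≃ₗᵢ[ℂ] L2 n k)} (ha : a ∈ weilGroup n ψ hψ)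
    (hx : x ∈ ⁅weilGroup n ψ hψ, weilGroup n ψ hψ⁆) :
    a * x * a⁻¹ ∈ ⁅weilGroup n ψ hψ, weilGroup n ψ hψ⁆ := by
  have h1 : x ∈ weilGroup n ψ hψ := metaplectic_le hψ (derived_le hψ hx)
  have h2 : a * x * a⁻¹ = ⁅a, x⁆ * x := by rw [commutatorElement_def]; group
  rw [h2]
  exact mul_mem (Subgroup.commutator_mem_commutator ha h1) hx

theorem exists_scalarEl_of_fst_eq (hψ₁ : ψ ≠ 1) {p q : Sp n k × (L2 n k ≃ₗᵢ[ℂ] L2 n k)}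
    (hp : p ∈ weilGroup n ψ hψ) (hq : q ∈ weilGroup n ψ hψ) (h : p.1 = q.1) :
    ∃ ζ, p = scalarEl n k ζ * q := by
  obtain ⟨ζ, hζ⟩ := exists_scalarOp_of_fst_eq hψ hψ₁ hp hq h
  exact ⟨ζ, Prod.ext (by rw [h]; exact (one_mul _).symm) hζ⟩

theorem conj_central_mul {G : Type*} [Group G] {c : G} (hc : ∀ x, Commute c x) (a b : G) :
    c * a * b * (c * a)⁻¹ = a * b * a⁻¹ := by
  have h : c * a * b * (c * a)⁻¹ = c * (a * b * a⁻¹) * c⁻¹ := by group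
  rw [h, (hc _).eq, mul_inv_cancel_right]

theorem commutator_eq_of_fst_eq (hψ₁ : ψ ≠ 1) {a b a' b' : Sp n k × (L2 n k ≃ₗᵢ[ℂ] L2 n k)}
    (ha : a ∈ weilGroup n ψ hψ) (hb : b ∈ weilGroup n ψ hψ) (ha' : a' ∈ weilGroup n ψ hψ)
    (hb' : b' ∈ weilGroup n ψ hψ) (h1 : a.1 = a'.1) (h2 : b.1 = b'.1) : ⁅a, b⁆ = ⁅a', b'⁆ := by
  obtain ⟨ζ, rfl⟩ := exists_scalarEl_of_fst_eq hψ hψ₁ ha ha' h1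
  obtain ⟨ξ, rfl⟩ := exists_scalarEl_of_fst_eq hψ hψ₁ hb hb' h2
  have h3 : a' * (scalarEl n k ξ * b') * a'⁻¹ * (scalarEl n k ξ * b')⁻¹
      = a' * scalarEl n k ξ * (b' * a'⁻¹ * b'⁻¹) * (scalarEl n k ξ)⁻¹ := by group
  have h4 : scalarEl n k ξ * a' * (b' * a'⁻¹ * b'⁻¹) * (scalarEl n k ξ)⁻¹
      = scalarEl n k ξ * (a' * b' * a'⁻¹ * b'⁻¹) * (scalarEl n k ξ)⁻¹ := by group
  rw [commutatorElement_def, commutatorElement_def, conj_central_mul (commute_scalarEl ζ), h3,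
    ← (commute_scalarEl ξ a').eq, h4, (commute_scalarEl ξ _).eq, mul_inv_cancel_right]

/-- The value of an equivariant splitting on a commutator with an element of the parabolic. -/
theorem IsEquivariantSplitting.eq_commutator {hψ : Continuous ψ} (hψ₁ : ψ ≠ 1)
    {P U : Subgroup (Sp n k)}
    {σ : U →* metaplectic n ψ hψ} (hσ : IsEquivariantSplitting P U σ)
    {p : metaplectic n ψ hψ} (hp : proj p ∈ P) {u v : U}
    (huv : (u : Sp n k) = ⁅proj p, (v : Sp n k)⁆) {a b : Sp n k × (L2 n k ≃ₗᵢ[ℂ] L2 n k)}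
    (ha : a ∈ weilGroup n ψ hψ) (hb : b ∈ weilGroup n ψ hψ) (ha1 : a.1 = proj p)
    (hb1 : b.1 = v) : (σ u).1 = ⁅a, b⁆ := by
  have h1 : ((u * v : U) : Sp n k) = proj p * v * (proj p)⁻¹ := by
    change (u : Sp n k) * v = _
    rw [huv, commutatorElement_def, inv_mul_cancel_right]
  have h2 := hσ.2 p hp v (u * v) h1
  rw [map_mul, ← eq_mul_inv_iff_mul_eq] at h2
  have h3 : (σ u).1 = ⁅p.1, (σ v).1⁆ := congrArg Subtype.val h2
  rw [h3]
  exact commutator_eq_of_fst_eq hψ hψ₁ (metaplectic_le hψ p.2) (metaplectic_le hψ (σ v).2) ha hb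
    ha1.symm ((hσ.1 v).trans hb1.symm)

/-- Equivariant splittings from conjugates of the action of the Siegel parabolic. -/
theorem exists_equivariantSplitting [CharZero k] (hψ₁ : ψ ≠ 1)
    {F : Sp n k × (L2 n k ≃ₗᵢ[ℂ] L2 n k)} (hF : F ∈ weilGroup n ψ hψ) {P U : Subgroup (Sp n k)}
    (hP : ∀ g ∈ P, F.1⁻¹ * g * F.1 ∈ siegel n k)
    (hUP : U ≤ P)
    (hU : ∀ g ∈ U, (F.1⁻¹ * g * F.1).1.toBlocks₁₁.det = 1) :
    ∃ σ : U →* metaplectic n ψ hψ, IsEquivariantSplitting P U σ := by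
  let τ : P →* siegel n k := MonoidHom.mk' (fun g => ⟨F.1⁻¹ * g * F.1, hP _ g.2⟩) fun g h =>
    Subtype.ext (by
      change F.1⁻¹ * (g.1 * h.1) * F.1 = F.1⁻¹ * g.1 * F.1 * (F.1⁻¹ * h.1 * F.1)
      group)
  have hproj : ∀ g : P, (F * siegelHom hψ (τ g) * F⁻¹).1 = g := fun g => by
    change F.1 * (F.1⁻¹ * g.1 * F.1) * F.1⁻¹ = g.1
    group
  let σ : U →* metaplectic n ψ hψ := MonoidHom.mk'
    (fun g => ⟨F * siegelHom hψ (τ ⟨g, hUP g.2⟩) * F⁻¹,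
      derived_le hψ (conj_mem_derived hψ hF (siegelHom_mem_of_det hψ (hU g g.2)))⟩)
    fun g h => Subtype.ext (by
      have : (⟨(g * h : U), hUP (g * h).2⟩ : P) = ⟨g, hUP g.2⟩ * ⟨h, hUP h.2⟩ := rfl
      change F * siegelHom hψ (τ ⟨(g * h : U), hUP (g * h).2⟩) * F⁻¹
        = F * siegelHom hψ (τ ⟨g, hUP g.2⟩) * F⁻¹ * (F * siegelHom hψ (τ ⟨h, hUP h.2⟩) * F⁻¹)
      rw [this, map_mul, map_mul]
      group)
  refine ⟨σ, fun u => hproj ⟨u, hUP u.2⟩, fun p hp u v huv => Subtype.ext ?_⟩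
  obtain ⟨ζ, hζ⟩ := exists_scalarEl_of_fst_eq hψ hψ₁ (metaplectic_le hψ p.2)
    (mul_mem (mul_mem hF (siegelHom_mem hψ (τ ⟨proj p, hp⟩))) (inv_mem hF))
    (hproj ⟨proj p, hp⟩).symm
  have hv : (⟨v, hUP v.2⟩ : P) = ⟨proj p, hp⟩ * ⟨u, hUP u.2⟩ * ⟨proj p, hp⟩⁻¹ := Subtype.ext huv
  change F * siegelHom hψ (τ ⟨v, hUP v.2⟩) * F⁻¹
    = p.1 * (F * siegelHom hψ (τ ⟨u, hUP u.2⟩) * F⁻¹) * p.1⁻¹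
  rw [hζ, conj_central_mul (commute_scalarEl ζ), hv]
  simp only [map_mul, map_inv]
  group

end Splittings

section LiftMatrices

open scoped commutatorElement

variable {n : ℕ} {k : Type*} [NontriviallyNormedField k] [ProperSpace k] [MeasurableSpace k]
  [BorelSpace k] [CharZero k]

theorem IsLong.not_lt {i : Fin n} (hi : IsLong i) : ¬ (i : ℕ) + 1 < n := by
  unfold IsLong at hi; omega

theorem lt_of_not_isLong {i : Fin n} (hi : ¬ IsLong i) : (i : ℕ) + 1 < n := by
  have := i.2; unfold IsLong at hi; omega

theorem xPos_eq_nSp {i : Fin n} (hi : IsLong i) (t : k) :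
    xPos i t = (nSp (Matrix.single i i t) (isSymm_single i t)).1 :=
  Subtype.ext (by
    change rootMatrix i t = fromBlocks 1 (Matrix.single i i t) 0 1
    rw [rootMatrix, dif_neg hi.not_lt])

theorem xNeg_mul_fourierSp {i : Fin n} (hi : IsLong i) (t : k) :
    xNeg i t * fourierSp i
      = fourierSp i * (nSp (Matrix.single i i (-t)) (isSymm_single i (-t))).1 := by
  refine Subtype.ext ?_
  change (rootMatrix i t)ᵀ * fourierMatrix i
    = fourierMatrix i * fromBlocks 1 (Matrix.single i i (-t)) 0 1
  rw [rootMatrix, dif_neg hi.not_lt, fromBlocks_transpose, fourierMatrix, fromBlocks_multiply,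
    fromBlocks_multiply]
  congr 1
  · simp
  · simp [Matrix.sub_mul]
  · simp [Matrix.mul_sub]
  · simp [← Matrix.single_neg]

theorem cochar_fourierSp (i : Fin n) (c : kˣ) :
    (cochar i c)⁻¹ * fourierSp i = fourierSp i * cochar i c := by
  rw [inv_mul_eq_iff_eq_mul]
  refine Subtype.ext ?_
  change fourierMatrix i = (cochar i c).1 * (fourierMatrix i * (cochar i c).1)
  rw [cochar_coe, fourierMatrix_eq, fromBlocks_multiply, fromBlocks_multiply]
  simp only [diagonal_mul_diagonal, Matrix.mul_zero, Matrix.zero_mul, add_zero, zero_add]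
  congr 2 <;> ext a <;> by_cases ha : a = i <;> simp [ha]

theorem simpleRep_eq_fourierSp {i : Fin n}
    (hi : IsLong i) :
    (simpleRep i : Sp n k) = fourierSp i := by
  have h1 : xNeg i (-1 : k) = fourierSp i * xPos i 1 * (fourierSp i)⁻¹ := by
    rw [eq_mul_inv_iff_mul_eq, xNeg_mul_fourierSp hi, xPos_eq_nSp hi]
    simp only [neg_neg]
  have h2 : xPos i (1 : k) * fourierSp i * xPos i 1
      = fourierSp i * (xPos i (-1)) * fourierSp i := by
    rw [xPos_eq_nSp hi, xPos_eq_nSp hi]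
    refine Subtype.ext ?_
    change fromBlocks 1 (Matrix.single i i 1) 0 1 * fourierMatrix i
      * fromBlocks 1 (Matrix.single i i 1) 0 1
      = fourierMatrix i * fromBlocks 1 (Matrix.single i i (-1)) 0 1 * fourierMatrix i
    rw [fourierMatrix]
    simp only [fromBlocks_multiply]
    congr 1 <;> simp [Matrix.sub_mul, Matrix.mul_sub, Matrix.add_mul, ← Matrix.single_neg]
  have h3 : xPos i (-1 : k) * xPos i 1 = 1 := by
    rw [← xPos_add, neg_add_cancel]
    exact Subtype.ext (by
      change rootMatrix i 0 = 1
      rw [rootMatrix, dif_neg hi.not_lt]; simp)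
  rw [simpleRep, h1, ← mul_assoc, ← mul_assoc, h2, mul_inv_cancel_right, mul_assoc, h3, mul_one]

/-- The block of the representative of a short simple reflection. -/
theorem simpleRep_short {i : Fin n} (h : (i : ℕ) + 1 < n) : (simpleRep i : Sp n k).1 =
    fromBlocks (1 - Matrix.single i i 1 - Matrix.single ⟨i + 1, h⟩ ⟨i + 1, h⟩ 1
        + Matrix.single i ⟨i + 1, h⟩ 1 - Matrix.single ⟨i + 1, h⟩ i 1) 0 0
      (1 - Matrix.single i i 1 - Matrix.single ⟨i + 1, h⟩ ⟨i + 1, h⟩ 1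
        + Matrix.single i ⟨i + 1, h⟩ 1 - Matrix.single ⟨i + 1, h⟩ i 1) := by
  have hne : (⟨i + 1, h⟩ : Fin n) ≠ i := by
    intro e; have := congrArg Fin.val e; simp at this
  change rootMatrix i 1 * (rootMatrix i (-1))ᵀ * rootMatrix i 1 = _
  rw [rootMatrix, rootMatrix, dif_pos h, dif_pos h, fromBlocks_transpose, fromBlocks_multiply,
    fromBlocks_multiply]
  congr 1
  · simp [Matrix.add_mul, Matrix.mul_add, hne, ← Matrix.single_neg]
    abel
  · simp
  · simp
  · simp [Matrix.sub_mul, Matrix.mul_sub, Matrix.mul_add, Matrix.add_mul, hne.symm, ← Matrix.single_neg]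
    abel

theorem simpleRep_mem_siegel {i : Fin n} (hi : ¬ IsLong i) : (simpleRep i : Sp n k) ∈ siegel n k := by
  change (simpleRep i : Sp n k).1.toBlocks₂₁ = 0
  rw [simpleRep_short (lt_of_not_isLong hi), toBlocks_fromBlocks₂₁]

theorem xNeg_mem_siegel {i : Fin n} (hi : ¬ IsLong i) (t : k) : xNeg i t ∈ siegel n k := by
  change (rootMatrix i t)ᵀ.toBlocks₂₁ = 0
  rw [rootMatrix, dif_pos (lt_of_not_isLong hi), fromBlocks_transpose, toBlocks_fromBlocks₂₁]
  simp

theorem xPos_mem_siegel (i : Fin n) (t : k) : xPos i t ∈ siegel n k :=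
  borel_le_siegel (xPos_mem i t).1

end LiftMatrices

section Lifts

open scoped commutatorElement

variable {n : ℕ} {k : Type*} [NontriviallyNormedField k] [ProperSpace k] [MeasurableSpace k]
  [BorelSpace k] [CharZero k] {ψ : AddChar k Circle} (hψ : Continuous ψ) {s : ℝ}
  (hs : IsSelfDualScale ψ s)

theorem fullFourier_fst' : (fullFourier n hψ hs).1 = fullSp := Subtype.ext (fullFourier_fst hψ hs)

include hs in
theorem exists_metaplectic_cochar (i : Fin n) (c : kˣ) :
    ∃ p : metaplectic n ψ hψ, proj p = cochar i c * cochar i c := by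
  refine ⟨⟨⁅siegelHom hψ (mSp (diagGL i c)), fullFourier n hψ hs⁆, derived_le hψ
    (Subgroup.commutator_mem_commutator (siegelHom_mem hψ _) (fullFourier_mem hψ hs))⟩, ?_⟩
  rw [cochar_mul_self, ← fullFourier_fst' hψ hs]
  rfl

include hs in
theorem exists_isSpringerElement (hψ₁ : ψ ≠ 1) (i : Fin n) :
    ∃ z : metaplectic n ψ hψ, IsSpringerElement i z := by
  obtain ⟨σ, hσ⟩ := exists_equivariantSplitting hψ hψ₁ (one_mem (weilGroup n ψ hψ))
    (P := borel k flagPos) (U := unipotent k flagPos flagPos_injective)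
    (fun g hg => by
      rw [Prod.fst_one, inv_one, one_mul, mul_one]; exact borel_le_siegel hg)
    (fun g hg => hg.1)
    (fun g hg => by
      rw [Prod.fst_one, inv_one, one_mul, mul_one]; exact det_of_unipotent hg)
  obtain ⟨σ', hσ'⟩ := exists_equivariantSplitting hψ hψ₁ (fullFourier_mem (n := n) hψ hs)
    (P := borel k flagPosOpp) (U := unipotent k flagPosOpp flagPosOpp_injective)
    (fun g hg => by
      rw [fullFourier_fst']; exact conj_borelOpp_mem hg)
    (fun g hg => hg.1)
    (fun g hg => by
      rw [fullFourier_fst']; exact det_of_unipotentOpp hg)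
  exact ⟨_, σ, σ', hσ, hσ', rfl⟩

include hs in
theorem splitting_xPos (hψ₁ : ψ ≠ 1)
    {σ : unipotent k flagPos flagPos_injective →* metaplectic n ψ hψ}
    (hσ : IsEquivariantSplitting (borel k flagPos) _ σ) (i : Fin n) (t : k) :
    (σ ⟨xPos i t, xPos_mem i t⟩).1 = siegelHom hψ ⟨xPos i t, xPos_mem_siegel i t⟩ := by
  obtain ⟨v, hv⟩ := xPos_eq_commutator i t
  obtain ⟨p, hp⟩ := exists_metaplectic_cochar hψ hs i (Units.mk0 (2 : k) two_ne_zero)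
  set c := mSp (diagGL i (Units.mk0 (2 : k) two_ne_zero)) with hc
  have h1 := hσ.eq_commutator hψ₁ (p := p) (u := ⟨xPos i t, xPos_mem i t⟩)
    (v := ⟨xPos i v, xPos_mem i v⟩)
    (by rw [hp]; exact mul_mem (cochar_mem_borel _ _ _) (cochar_mem_borel _ _ _))
    (by rw [hp]; exact hv) (a := siegelHom hψ (c * c))
    (b := siegelHom hψ ⟨xPos i v, xPos_mem_siegel i v⟩) (siegelHom_mem hψ _) (siegelHom_mem hψ _)
    (by rw [hp]; rfl) rfl
  rw [h1, ← map_commutatorElement]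
  congr 1
  exact Subtype.ext hv.symm

include hs in
theorem splitting_xNeg_short (hψ₁ : ψ ≠ 1)
    {σ : unipotent k flagPosOpp flagPosOpp_injective →* metaplectic n ψ hψ}
    (hσ : IsEquivariantSplitting (borel k flagPosOpp) _ σ) {i : Fin n} (hi : ¬ IsLong i) (t : k) :
    (σ ⟨xNeg i t, xNeg_mem i t⟩).1 = siegelHom hψ ⟨xNeg i t, xNeg_mem_siegel hi t⟩ := by
  obtain ⟨v, hv⟩ := xNeg_eq_commutator i t
  obtain ⟨p, hp⟩ := exists_metaplectic_cochar hψ hs i (Units.mk0 (2 : k) two_ne_zero)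
  set c := mSp (diagGL i (Units.mk0 (2 : k) two_ne_zero)) with hc
  have hp' : proj p⁻¹ = (cochar i (Units.mk0 (2 : k) two_ne_zero)
      * cochar i (Units.mk0 (2 : k) two_ne_zero))⁻¹ := by rw [← hp]; rfl
  have h1 := hσ.eq_commutator hψ₁ (p := p⁻¹) (u := ⟨xNeg i t, xNeg_mem i t⟩)
    (v := ⟨xNeg i v, xNeg_mem i v⟩)
    (by rw [hp']; exact inv_mem (mul_mem (cochar_mem_borel _ _ _) (cochar_mem_borel _ _ _)))
    (by rw [hp']; exact hv) (a := siegelHom hψ (c * c)⁻¹)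
    (b := siegelHom hψ ⟨xNeg i v, xNeg_mem_siegel hi v⟩) (siegelHom_mem hψ _) (siegelHom_mem hψ _)
    (by rw [hp']; rfl) rfl
  rw [h1, ← map_commutatorElement]
  congr 1
  exact Subtype.ext hv.symm

include hs in
theorem splitting_xNeg_long (hψ₁ : ψ ≠ 1)
    {σ : unipotent k flagPosOpp flagPosOpp_injective →* metaplectic n ψ hψ}
    (hσ : IsEquivariantSplitting (borel k flagPosOpp) _ σ) {i : Fin n} (hi : IsLong i) (t : k) :
    (σ ⟨xNeg i t, xNeg_mem i t⟩).1
      = fourierEl hψ hs i * quadEl hψ i (-t) * (fourierEl hψ hs i)⁻¹ := by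
  obtain ⟨v, hv⟩ := xNeg_eq_commutator i t
  obtain ⟨p, hp⟩ := exists_metaplectic_cochar hψ hs i (Units.mk0 (2 : k) two_ne_zero)
  set c := mSp (diagGL i (Units.mk0 (2 : k) two_ne_zero)) with hc
  have hp' : proj p⁻¹ = (cochar i (Units.mk0 (2 : k) two_ne_zero)
      * cochar i (Units.mk0 (2 : k) two_ne_zero))⁻¹ := by rw [← hp]; rfl
  have hx : ∀ r : k, (fourierEl hψ hs i * quadEl hψ i (-r) * (fourierEl hψ hs i)⁻¹).1
      = xNeg i r := fun r => by
    change fourierSp i * (nSp _ (isSymm_single i (-r))).1 * (fourierSp i)⁻¹ = _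
    rw [← xNeg_mul_fourierSp hi, mul_inv_cancel_right]
  have hcc : (fourierEl hψ hs i * siegelHom hψ (c * c) * (fourierEl hψ hs i)⁻¹).1
      = (cochar i (Units.mk0 (2 : k) two_ne_zero)
      * cochar i (Units.mk0 (2 : k) two_ne_zero))⁻¹ := by
    change fourierSp i * (cochar i _ * cochar i _) * (fourierSp i)⁻¹ = _
    rw [← mul_assoc, ← cochar_fourierSp, mul_assoc (cochar i _)⁻¹, ← cochar_fourierSp,
      ← mul_assoc, mul_inv_cancel_right, _root_.mul_inv_rev]
  have hF := fourierEl_mem hψ hs i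
  have h1 := hσ.eq_commutator hψ₁ (p := p⁻¹) (u := ⟨xNeg i t, xNeg_mem i t⟩)
    (v := ⟨xNeg i v, xNeg_mem i v⟩)
    (by rw [hp']; exact inv_mem (mul_mem (cochar_mem_borel _ _ _) (cochar_mem_borel _ _ _)))
    (by rw [hp']; exact hv)
    (mul_mem (mul_mem hF (siegelHom_mem hψ (c * c))) (inv_mem hF))
    (mul_mem (mul_mem hF (quadEl_mem hψ i (-v))) (inv_mem hF))
    (by rw [hp', hcc]) (hx v)
  have h2 : ∀ a b g : Sp n k × (L2 n k ≃ₗᵢ[ℂ] L2 n k), ⁅g * a * g⁻¹, g * b * g⁻¹⁆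
      = g * ⁅a, b⁆ * g⁻¹ := fun a b g => by
    simp only [commutatorElement_def]; group
  rw [h1, h2, quadEl, quadEl, ← map_commutatorElement]
  congr 3
  refine Subtype.ext ?_
  have h3 := congrArg Prod.fst h1
  have h4 : (σ ⟨xNeg i t, xNeg_mem i t⟩).1.1 = xNeg i t := hσ.1 _
  rw [h4, h2, ← hx t] at h3
  have h5 := mul_left_cancel (mul_right_cancel h3)
  exact h5.symm

include hs in
theorem IsSpringerElement.eq_short (hψ₁ : ψ ≠ 1) {i : Fin n} (hi : ¬ IsLong i)
    {z : metaplectic n ψ hψ} (hz : IsSpringerElement i z) :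
    z.1 = siegelHom hψ ⟨simpleRep i, simpleRep_mem_siegel hi⟩ := by
  obtain ⟨σ, σ', hσ, hσ', rfl⟩ := hz
  change (σ _).1 * (σ' _).1 * (σ _).1 = _
  rw [splitting_xPos hψ hs hψ₁ hσ, splitting_xNeg_short hψ hs hψ₁ hσ' hi, ← map_mul, ← map_mul]
  rfl

theorem IsSpringerElement.eq_long (hψ₁ : ψ ≠ 1) {i : Fin n} (hi : IsLong i) {h : k → ℝ}
    (hh : IsSelfDual ψ s h) {γ : Circle} (hγ : IsWeilIndex ψ s h γ)
    {z : metaplectic n ψ hψ} (hz : IsSpringerElement i z) :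
    z.1 = scalarEl n k γ * fourierEl hψ hs i := by
  obtain ⟨σ, σ', hσ, hσ', rfl⟩ := hz
  change (σ _).1 * (σ' _).1 * (σ _).1 = _
  have h1 : siegelHom hψ ⟨xPos i 1, xPos_mem_siegel i 1⟩ = quadEl hψ i 1 := by
    rw [quadEl]
    congr 1
    exact Subtype.ext (xPos_eq_nSp hi 1)
  rw [splitting_xPos hψ hs hψ₁ hσ, splitting_xNeg_long hψ hs hψ₁ hσ' hi, h1, neg_neg]
  have h2 := quad_fourier_rel hψ hs hψ₁ hh hγ i
  set N := quadEl hψ i (1 : k)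
  set F := fourierEl hψ hs i
  have h3 : N * (F * N * F⁻¹) * N = N * F * N * (F⁻¹ * N) := by group
  rw [h3, h2]
  group

/-- The lift of a simple reflection. -/
def simpleLift (i : Fin n) : Sp n k × (L2 n k ≃ₗᵢ[ℂ] L2 n k) :=
  open scoped Classical in
  if hi : IsLong i then fourierEl hψ hs i
  else siegelHom hψ ⟨simpleRep i, simpleRep_mem_siegel hi⟩

theorem simpleLift_fst (i : Fin n) : (simpleLift hψ hs i).1 = simpleRep i := by
  unfold simpleLift
  split_ifs with hi
  · exact (simpleRep_eq_fourierSp hi).symm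
  · rfl

theorem simpleLift_mem (hψ₁ : ψ ≠ 1) (i : Fin n) :
    simpleLift hψ hs i ∈ metaplectic n ψ hψ := by
  obtain ⟨z, hz⟩ := exists_isSpringerElement hψ hs hψ₁ i
  unfold simpleLift
  split_ifs with hi
  · obtain ⟨h, γ, hh, hγ, h8⟩ := exists_weilIndex_pow_eight hψ hs hψ₁
    have h1 := hz.eq_long hψ hs hψ₁ hi hh hγ
    rw [← inv_mul_eq_iff_eq_mul] at h1
    rw [← h1]
    refine mul_mem (inv_mem (Subgroup.mem_sup_right ⟨γ, h8, rfl⟩)) z.2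
  · rw [← hz.eq_short hψ hs hψ₁ hi]
    exact z.2

theorem isSimpleLift_simpleLift (hψ₁ : ψ ≠ 1) (i : Fin n) :
    IsSimpleLift i (⟨simpleLift hψ hs i, simpleLift_mem hψ hs hψ₁ i⟩ : metaplectic n ψ hψ) := by
  refine ⟨fun hi => ?_, fun hi => ⟨simpleLift_fst hψ hs i, ?_⟩⟩
  · obtain ⟨z, hz⟩ := exists_isSpringerElement hψ hs hψ₁ i
    have h1 := hz.eq_short hψ hs hψ₁ hi
    have h2 : z = ⟨simpleLift hψ hs i, simpleLift_mem hψ hs hψ₁ i⟩ := by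
      refine Subtype.ext ?_
      rw [h1]
      change _ = simpleLift hψ hs i
      rw [simpleLift, dif_neg hi]
    rwa [← h2]
  · change IsPartialFourier ψ i (simpleLift hψ hs i).2
    rw [simpleLift, dif_pos hi]
    exact isPartialFourier_fourierOp hψ hs i

theorem IsSimpleLift.eq (hψ₁ : ψ ≠ 1) {i : Fin n} {z : metaplectic n ψ hψ}
    (hz : IsSimpleLift i z) : z.1 = simpleLift hψ hs i := by
  by_cases hi : IsLong i
  · obtain ⟨h1, ν, hν, h2⟩ := hz.2 hi
    obtain ⟨h, hh⟩ := exists_isSelfDual hψ hψ₁ hs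
    rw [simpleLift, dif_pos hi]
    have h1' : z.1.1 = (fourierEl hψ hs i).1 := h1.trans (simpleRep_eq_fourierSp hi)
    refine eq_of_fst_eq_of_apply_eq hψ hψ₁ (metaplectic_le hψ z.2) (fourierEl_mem hψ hs i) h1'
      (vac_ne_zero hh) ?_
    have hvi : Integrable (vac n hh) (haarPi n k) :=
      (integrable_tens fun _ => hh.integrable.ofReal).congr (tensL2_ae _ _).symm
    have hc := Measure.isAddLeftInvariant_eq_smul ν (haar k)
    have hc0 := Measure.addHaarScalarFactor_pos_of_isAddHaarMeasure ν (haar k)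
    set c := Measure.addHaarScalarFactor ν (haar k)
    have h3 : z.1.2 (vac n hh) = (((c : ℝ) / s : ℝ) : ℂ) • (fourierEl hψ hs i).2 (vac n hh) := by
      ext1
      filter_upwards [h2 _ hvi, Lp.coeFn_smul ((((c : ℝ) / s : ℝ) : ℂ))
        ((fourierEl hψ hs i).2 (vac n hh)), fourierOp_ae hψ hs i hvi] with u h4 h5 h6
      refine Eq.trans h4 (Eq.trans ?_ h5.symm)
      rw [Pi.smul_apply]
      refine Eq.trans ?_ (congrArg (fun z : ℂ => (((c : ℝ) / s : ℝ) : ℂ) • z) h6).symm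
      rw [hc, integral_smul_nnreal_measure, pft, smul_eq_mul, ← mul_assoc, ← Complex.ofReal_mul,
        div_mul_cancel₀ _ hs.1.ne']
      rfl
    rw [fourierEl_vac] at h3 ⊢
    have h4 : ‖z.1.2 (vac n hh)‖ = ‖vac n hh‖ := z.1.2.norm_map _
    rw [h3, norm_smul, Complex.norm_real, Real.norm_eq_abs, abs_of_pos (div_pos (NNReal.coe_pos.2 hc0) hs.1)] at h4
    have h5 : (c : ℝ) / s = 1 :=
      mul_right_cancel₀ (norm_ne_zero_iff.2 (vac_ne_zero hh)) (by rw [h4, one_mul])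
    rw [h3, h5, Complex.ofReal_one, one_smul]
  · rw [(hz.1 hi).eq_short hψ hs hψ₁ hi, simpleLift, dif_neg hi]

end Lifts

/-! ### Signed permutations and monomial matrices -/

section SignedPermutations

variable {n : ℕ}

theorem flagPos_inl (i : Fin n) : flagPos (Sum.inl i : Fin n ⊕ Fin n) = i := rfl

theorem flagPos_inr (i : Fin n) : flagPos (Sum.inr i : Fin n ⊕ Fin n) = 2 * n - 1 - i := rfl

theorem flagPos_nonneg (a : Fin n ⊕ Fin n) : 0 ≤ flagPos a := by
  rcases a with a | a <;> simp only [flagPos] <;> have := a.2 <;> omega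

theorem flagPos_lt (a : Fin n ⊕ Fin n) : flagPos a < 2 * n := by
  rcases a with a | a <;> simp only [flagPos] <;> have := a.2 <;> omega

theorem flagPos_swap (a : Fin n ⊕ Fin n) : flagPos a.swap = 2 * n - 1 - flagPos a := by
  rcases a with a | a <;> simp [flagPos]

theorem exists_flagPos_eq {p : ℤ} (h0 : 0 ≤ p) (h1 : p < 2 * n) :
    ∃ a : Fin n ⊕ Fin n, flagPos a = p := by
  by_cases h : p < n
  · exact ⟨Sum.inl ⟨p.toNat, by omega⟩, by simp only [flagPos]; omega⟩
  · exact ⟨Sum.inr ⟨(2 * n - 1 - p).toNat, by omega⟩, by simp only [flagPos]; omega⟩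

/-- The position after the `i`-th one. -/
def nextElt (i : Fin n) : Fin n ⊕ Fin n :=
  if h : (i : ℕ) + 1 < n then Sum.inl ⟨i + 1, h⟩ else Sum.inr i

theorem flagPos_nextElt (i : Fin n) : flagPos (nextElt i) = i + 1 := by
  unfold nextElt
  have := i.2
  split_ifs with h <;> simp only [flagPos]
  · push_cast; rfl
  · omega

/-- The signed reflection exchanging `x` with `y` and `x.swap` with `y.swap`. -/
def reflFun (x y a : Fin n ⊕ Fin n) : Fin n ⊕ Fin n :=
  if a = x then y else if a = y then x else if a = x.swap then y.swap
  else if a = y.swap then x.swap else a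

theorem swap_ne (a : Fin n ⊕ Fin n) : a.swap ≠ a := by
  rcases a with a | a <;> simp

theorem reflFun_involutive (x y : Fin n ⊕ Fin n) : Function.Involutive (reflFun x y) := by
  intro a
  have h1 : ∀ b c : Fin n ⊕ Fin n, b.swap = c.swap → b = c := fun b c h => by
    simpa using congrArg Sum.swap h
  have h2 : ∀ b : Fin n ⊕ Fin n, b.swap.swap = b := Sum.swap_swap
  have h3 := swap_ne x
  have h4 := swap_ne y
  unfold reflFun
  grind

/-- `reflFun` as a permutation. -/
def refl (x y : Fin n ⊕ Fin n) : Equiv.Perm (Fin n ⊕ Fin n) := (reflFun_involutive x y).toPerm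

theorem refl_apply (x y a : Fin n ⊕ Fin n) : refl x y a = reflFun x y a := rfl

theorem refl_mul_self (x y : Fin n ⊕ Fin n) : refl x y * refl x y = 1 :=
  Equiv.ext (reflFun_involutive x y)

theorem refl_comm (x y : Fin n ⊕ Fin n) : refl x y = refl y x := by
  ext1 a
  have h1 : ∀ b c : Fin n ⊕ Fin n, b.swap = c.swap → b = c := fun b c h => by
    simpa using congrArg Sum.swap h
  simp only [refl_apply]
  unfold reflFun
  grind

theorem refl_swap_swap (x y : Fin n ⊕ Fin n) : refl x.swap y.swap = refl x y := by
  ext1 a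
  have h1 : ∀ b c : Fin n ⊕ Fin n, b.swap = c.swap → b = c := fun b c h => by
    simpa using congrArg Sum.swap h
  have h2 : ∀ b : Fin n ⊕ Fin n, b.swap.swap = b := Sum.swap_swap
  have h3 := swap_ne x
  have h4 := swap_ne y
  simp only [refl_apply]
  unfold reflFun
  grind

/-- The permutations of the basis that preserve the pairs `{e_i, f_i}`. -/
def IsSigned (w : Equiv.Perm (Fin n ⊕ Fin n)) : Prop := ∀ a, w a.swap = (w a).swap

theorem IsSigned.mul {v w : Equiv.Perm (Fin n ⊕ Fin n)} (hv : IsSigned v) (hw : IsSigned w) :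
    IsSigned (v * w) := fun a => by
  rw [Equiv.Perm.mul_apply, Equiv.Perm.mul_apply, hw, hv]

theorem isSigned_refl (x y : Fin n ⊕ Fin n) : IsSigned (refl x y) := by
  intro a
  have h1 : ∀ b c : Fin n ⊕ Fin n, b.swap = c.swap → b = c := fun b c h => by
    simpa using congrArg Sum.swap h
  have h2 : ∀ b : Fin n ⊕ Fin n, b.swap.swap = b := Sum.swap_swap
  have h3 := swap_ne x
  have h4 := swap_ne y
  simp only [refl_apply]
  unfold reflFun
  grind

theorem IsSigned.mul_refl {w : Equiv.Perm (Fin n ⊕ Fin n)} (hw : IsSigned w)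
    (x y : Fin n ⊕ Fin n) : w * refl x y = refl (w x) (w y) * w := by
  ext1 a
  simp only [Equiv.Perm.mul_apply, refl_apply]
  unfold reflFun
  have h1 : ∀ b, (w a = w b) = (a = b) := fun b => by rw [EmbeddingLike.apply_eq_iff_eq]
  rw [← hw x, ← hw y]
  simp only [h1]
  split_ifs <;> rfl

/-- The permutation of the basis attached to a simple reflection. -/
def simplePerm (i : Fin n) : Equiv.Perm (Fin n ⊕ Fin n) := refl (Sum.inl i) (nextElt i)

theorem flagPos_simplePerm (i : Fin n) (a : Fin n ⊕ Fin n) : flagPos (simplePerm i a) =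
    if flagPos a = i ∨ flagPos a = 2 * n - 2 - i then flagPos a + 1
    else if flagPos a = i + 1 ∨ flagPos a = 2 * n - 1 - i then flagPos a - 1 else flagPos a := by
  have h1 : ∀ b c : Fin n ⊕ Fin n, b = c ↔ flagPos b = flagPos c :=
    fun b c => flagPos_injective.eq_iff.symm
  have hi := i.2
  have h2 : flagPos (Sum.inl i : Fin n ⊕ Fin n) = i := rfl
  have h3 := flagPos_nextElt i
  rw [simplePerm, refl_apply, reflFun]
  simp only [h1, flagPos_swap, h2, h3]
  split_ifs <;> (try simp only [flagPos_swap, h2, h3]) <;> omega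

/-- The sign of the representative of a simple reflection. -/
def simpleSign (i : Fin n) (a : Fin n ⊕ Fin n) : ℤˣ :=
  if flagPos a = i ∨ (flagPos a = 2 * n - 1 - i ∧ (i : ℕ) + 1 < n) then -1 else 1

/-- The permutation of the basis attached to a word. -/
def wordPerm (l : List (Fin n)) : Equiv.Perm (Fin n ⊕ Fin n) := (l.map simplePerm).prod

theorem wordPerm_nil : wordPerm ([] : List (Fin n)) = 1 := rfl

theorem wordPerm_cons (i : Fin n) (l : List (Fin n)) :
    wordPerm (i :: l) = simplePerm i * wordPerm l := by
  simp [wordPerm]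

theorem wordPerm_append (l l' : List (Fin n)) :
    wordPerm (l ++ l') = wordPerm l * wordPerm l' := by
  simp [wordPerm]

theorem isSigned_wordPerm (l : List (Fin n)) : IsSigned (wordPerm l) := by
  induction l with
  | nil => exact fun _ => rfl
  | cons i l ih => rw [wordPerm_cons]; exact (isSigned_refl _ _).mul ih

/-- The signs of the representative of a word. -/
def wordSign : List (Fin n) → Fin n ⊕ Fin n → ℤˣ
  | [], _ => 1
  | i :: l, a => simpleSign i (wordPerm l a) * wordSign l a

variable {k : Type*} [Field k]

/-- The matrix sending the basis vector `a` to `ε a` times the basis vector `w a`. -/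
def signedMatrix (k : Type*) [Field k] (w : Equiv.Perm (Fin n ⊕ Fin n)) (ε : Fin n ⊕ Fin n → ℤˣ) :
    Matrix (Fin n ⊕ Fin n) (Fin n ⊕ Fin n) k :=
  Matrix.of fun b a => if w a = b then (((ε a : ℤˣ) : ℤ) : k) else 0

theorem signedMatrix_mul (v w : Equiv.Perm (Fin n ⊕ Fin n)) (δ ε : Fin n ⊕ Fin n → ℤˣ) :
    signedMatrix k v δ * signedMatrix k w ε
      = signedMatrix k (v * w) fun a => δ (w a) * ε a := by
  ext b a
  simp only [signedMatrix, Matrix.mul_apply, Matrix.of_apply, Equiv.Perm.mul_apply]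
  rw [Finset.sum_eq_single (w a)]
  · by_cases h : v (w a) = b
    · simp [h]
    · simp [h]
  · intro c _ hc
    rw [if_neg (Ne.symm hc), mul_zero]
  · simp

theorem signedMatrix_one : signedMatrix k (1 : Equiv.Perm (Fin n ⊕ Fin n)) (fun _ => 1) = 1 := by
  ext b a
  simp [signedMatrix, Matrix.one_apply, eq_comm]

end SignedPermutations

section WordMatrix

variable {n : ℕ} {k : Type*} [NontriviallyNormedField k] [ProperSpace k] [MeasurableSpace k]
  [BorelSpace k] [CharZero k]

set_option linter.unusedSimpArgs false in
theorem simpleRep_eq_signedMatrix (i : Fin n) :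
    (simpleRep i : Sp n k).1 = signedMatrix k (simplePerm i) (simpleSign i) := by
  have hi := i.2
  have e1 : ∀ {a b : Fin n ⊕ Fin n}, flagPos a = flagPos b → a = b := fun h => flagPos_injective h
  by_cases h : (i : ℕ) + 1 < n
  · rw [simpleRep_short h]
    obtain ⟨j, hj⟩ : ∃ j : Fin n, j = ⟨i + 1, h⟩ := ⟨_, rfl⟩
    rw [← hj]
    have hj' : (j : ℕ) = i + 1 := by rw [hj]
    have hij : i ≠ j := by intro e; rw [← e] at hj'; omega
    ext b a
    change _ = if simplePerm i a = b then _ else _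
    rcases a with a | a
    · by_cases h1 : a = i
      · subst h1
        have h3 : simplePerm a (Sum.inl a) = Sum.inl j := e1 (by
          rw [flagPos_simplePerm, flagPos_inl, flagPos_inl, if_pos (Or.inl rfl)]; omega)
        have h4 : simpleSign a (Sum.inl a) = -1 := if_pos (Or.inl rfl)
        rw [h3, h4]
        rcases b with b | b
        · by_cases hb : b = a
          · subst hb; simp [hij, hij.symm]
          · by_cases hb' : b = j <;> simp [Matrix.single_apply, Matrix.one_apply, hb, hb', hij,
              hij.symm, eq_comm (b := b)]
        · simp
      · by_cases h2 : a = j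
        · subst h2
          have h3 : simplePerm i (Sum.inl a) = Sum.inl i := e1 (by
            rw [flagPos_simplePerm, flagPos_inl, flagPos_inl, if_neg (by omega), if_pos (by omega)]
            omega)
          have h4 : simpleSign i (Sum.inl a) = 1 := if_neg (by rw [flagPos_inl]; omega)
          rw [h3, h4]
          rcases b with b | b
          · by_cases hb : b = a
            · subst hb; simp [hij, hij.symm]
            · by_cases hb' : b = i <;> simp [Matrix.single_apply, Matrix.one_apply, hb, hb', hij,
                hij.symm, eq_comm (b := b)]
          · simp
        · have h1' : (a : ℕ) ≠ i := fun e => h1 (Fin.ext e)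
          have h2' : (a : ℕ) ≠ j := fun e => h2 (Fin.ext e)
          have ha := a.2
          have h3 : simplePerm i (Sum.inl a) = Sum.inl a := e1 (by
            rw [flagPos_simplePerm, flagPos_inl, if_neg (by omega), if_neg (by omega)])
          have h4 : simpleSign i (Sum.inl a) = 1 := if_neg (by rw [flagPos_inl]; omega)
          rw [h3, h4]
          rcases b with b | b
          · simp [Matrix.single_apply, Matrix.one_apply, h1, h2, Ne.symm h1, Ne.symm h2, eq_comm]
          · simp
    · by_cases h1 : a = i
      · subst h1
        have h3 : simplePerm a (Sum.inr a) = Sum.inr j := e1 (by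
          rw [flagPos_simplePerm, flagPos_inr, flagPos_inr, if_neg (by omega), if_pos (by omega)]
          omega)
        have h4 : simpleSign a (Sum.inr a) = -1 := if_pos (Or.inr ⟨rfl, h⟩)
        rw [h3, h4]
        rcases b with b | b
        · simp
        · by_cases hb : b = a
          · subst hb; simp [hij, hij.symm]
          · by_cases hb' : b = j <;> simp [Matrix.single_apply, Matrix.one_apply, hb, hb', hij,
              hij.symm, eq_comm (b := b)]
      · by_cases h2 : a = j
        · subst h2
          have h3 : simplePerm i (Sum.inr a) = Sum.inr i := e1 (by
            rw [flagPos_simplePerm, flagPos_inr, flagPos_inr, if_pos (by omega)]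
            omega)
          have h4 : simpleSign i (Sum.inr a) = 1 := if_neg (by rw [flagPos_inr]; omega)
          rw [h3, h4]
          rcases b with b | b
          · simp
          · by_cases hb : b = a
            · subst hb; simp [hij, hij.symm]
            · by_cases hb' : b = i <;> simp [Matrix.single_apply, Matrix.one_apply, hb, hb', hij,
                hij.symm, eq_comm (b := b)]
        · have h1' : (a : ℕ) ≠ i := fun e => h1 (Fin.ext e)
          have h2' : (a : ℕ) ≠ j := fun e => h2 (Fin.ext e)
          have ha := a.2
          have h3 : simplePerm i (Sum.inr a) = Sum.inr a := e1 (by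
            rw [flagPos_simplePerm, flagPos_inr, if_neg (by omega), if_neg (by omega)])
          have h4 : simpleSign i (Sum.inr a) = 1 := if_neg (by rw [flagPos_inr]; omega)
          rw [h3, h4]
          rcases b with b | b
          · simp
          · simp [Matrix.single_apply, Matrix.one_apply, h1, h2, Ne.symm h1, Ne.symm h2, eq_comm]
  · have h' : IsLong i := by unfold IsLong; omega
    rw [simpleRep_eq_fourierSp h']
    change fourierMatrix i = _
    rw [fourierMatrix]
    ext b a
    change _ = if simplePerm i a = b then _ else _
    by_cases h1 : a = Sum.inl i
    · subst h1
      have h3 : simplePerm i (Sum.inl i) = Sum.inr i := e1 (by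
        rw [flagPos_simplePerm, flagPos_inl, flagPos_inr, if_pos (Or.inl rfl)]; omega)
      have h4 : simpleSign i (Sum.inl i) = -1 := if_pos (Or.inl rfl)
      rw [h3, h4]
      rcases b with b | b <;> by_cases hb : b = i <;>
        simp [Matrix.single_apply, Matrix.one_apply, hb, eq_comm (b := b)]
    · by_cases h2 : a = Sum.inr i
      · subst h2
        have h3 : simplePerm i (Sum.inr i) = Sum.inl i := e1 (by
          rw [flagPos_simplePerm, flagPos_inl, flagPos_inr, if_neg (by omega), if_pos (by omega)]
          omega)
        have h4 : simpleSign i (Sum.inr i) = 1 := if_neg (by rw [flagPos_inr]; omega)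
        rw [h3, h4]
        rcases b with b | b <;> by_cases hb : b = i <;>
          simp [Matrix.single_apply, Matrix.one_apply, hb, eq_comm (b := b)]
      · have h5 : flagPos a ≠ i := fun e => h1 (e1 e)
        have h6 : flagPos a ≠ 2 * n - 1 - i := fun e => h2 (e1 e)
        have h3 : simplePerm i a = a := e1 (by
          rw [flagPos_simplePerm, if_neg (by omega), if_neg (by omega)])
        have h4 : simpleSign i a = 1 := if_neg (by omega)
        rw [h3, h4]
        rcases a with a | a <;> rcases b with b | b
        · have ha : a ≠ i := fun e => h1 (congrArg _ e)
          simp [Matrix.single_apply, Matrix.one_apply, Ne.symm ha, eq_comm]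
        · have ha : a ≠ i := fun e => h1 (congrArg _ e)
          simp [Matrix.single_apply, Ne.symm ha]
        · have ha : a ≠ i := fun e => h2 (congrArg _ e)
          simp [Matrix.single_apply, Ne.symm ha]
        · have ha : a ≠ i := fun e => h2 (congrArg _ e)
          simp [Matrix.single_apply, Matrix.one_apply, Ne.symm ha, eq_comm]

theorem wordRep_eq_signedMatrix (l : List (Fin n)) :
    (wordRep k l).1 = signedMatrix k (wordPerm l) (wordSign l) := by
  induction l with
  | nil => exact signedMatrix_one.symm
  | cons i l ih =>
    have h1 : wordRep k (i :: l) = simpleRep i * wordRep k l := by simp [wordRep]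
    rw [h1, wordPerm_cons]
    change (simpleRep i : Sp n k).1 * (wordRep k l).1 = _
    rw [ih, simpleRep_eq_signedMatrix, signedMatrix_mul]
    rfl

theorem wordRep_eq_of {l l' : List (Fin n)} (h : wordPerm l = wordPerm l')
    (h' : wordSign l = wordSign l') : wordRep k l = wordRep k l' :=
  Subtype.ext (by rw [wordRep_eq_signedMatrix, wordRep_eq_signedMatrix, h, h'])

end WordMatrix

/-! ### Reduced words and the signs of their representatives -/

section ReducedWords

variable {n : ℕ}

/-- Each letter of the word, from the right, adds to the inversions of the permutation. -/
def IsAscending : List (Fin n) → Prop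
  | [] => True
  | i :: l => flagPos ((wordPerm l).symm (Sum.inl i)) < flagPos ((wordPerm l).symm (nextElt i))
      ∧ IsAscending l

/-- A word of minimal length with given permutation. -/
def IsReducedWord (l : List (Fin n)) : Prop :=
  ∀ l', wordPerm l' = wordPerm l → l.length ≤ l'.length

theorem simplePerm_eq_refl_of_lt {j : Fin n} {x y : Fin n ⊕ Fin n} (h : flagPos x < flagPos y)
    (h' : flagPos (simplePerm j y) < flagPos (simplePerm j x)) : simplePerm j = refl x y := by
  have hj := j.2
  have hx := flagPos_nonneg x
  have hy := flagPos_lt y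
  rw [flagPos_simplePerm, flagPos_simplePerm] at h'
  have h1 : (flagPos x = j ∧ flagPos y = j + 1) ∨
      (flagPos x = 2 * n - 2 - j ∧ flagPos y = 2 * n - 1 - j) := by
    split_ifs at h' <;> omega
  rcases h1 with ⟨hx, hy⟩ | ⟨hx, hy⟩
  · have e1 : x = Sum.inl j := flagPos_injective hx
    have e2 : y = nextElt j := flagPos_injective (hy.trans (flagPos_nextElt j).symm)
    rw [e1, e2, simplePerm]
  · have e1 : x = (nextElt j).swap := flagPos_injective (by
      rw [hx, flagPos_swap, flagPos_nextElt]; ring)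
    have e2 : y = (Sum.inl j : Fin n ⊕ Fin n).swap := flagPos_injective (by
      rw [hy, flagPos_swap, flagPos_inl])
    rw [e1, e2, refl_swap_swap, refl_comm, simplePerm]

theorem exists_of_inversion (l : List (Fin n)) {q p : Fin n ⊕ Fin n} (h : flagPos q < flagPos p)
    (h' : flagPos (wordPerm l p) < flagPos (wordPerm l q)) :
    ∃ l₁ j l₂, l = l₁ ++ j :: l₂ ∧ simplePerm j = refl (wordPerm l₂ q) (wordPerm l₂ p) := by
  induction l with
  | nil => exact absurd h' (not_lt.2 h.le)
  | cons j l ih =>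
    by_cases h1 : flagPos (wordPerm l p) < flagPos (wordPerm l q)
    · obtain ⟨l₁, i, l₂, rfl, h2⟩ := ih h1
      exact ⟨j :: l₁, i, l₂, rfl, h2⟩
    · refine ⟨[], j, l, rfl, simplePerm_eq_refl_of_lt ?_ ?_⟩
      · refine lt_of_le_of_ne (not_lt.1 h1) fun e => ?_
        have := (wordPerm l).injective (flagPos_injective e)
        rw [this] at h
        exact lt_irrefl _ h
      · rw [wordPerm_cons] at h'
        exact h'

theorem IsReducedWord.tail {i : Fin n} {l : List (Fin n)} (h : IsReducedWord (i :: l)) :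
    IsReducedWord l := fun l' hl' => by
  have := h (i :: l') (by rw [wordPerm_cons, wordPerm_cons, hl'])
  simpa using this

theorem IsReducedWord.lt {i : Fin n} {l : List (Fin n)} (h : IsReducedWord (i :: l)) :
    flagPos ((wordPerm l).symm (Sum.inl i)) < flagPos ((wordPerm l).symm (nextElt i)) := by
  by_contra hcon
  set w := wordPerm l with hw
  set p := w.symm (Sum.inl i) with hp
  set q := w.symm (nextElt i) with hq
  have hwp : w p = Sum.inl i := w.apply_symm_apply _
  have hwq : w q = nextElt i := w.apply_symm_apply _
  have hne : flagPos q ≠ flagPos p := fun e => by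
    have h1 := congrArg w (flagPos_injective e)
    rw [hwp, hwq] at h1
    have h2 := congrArg flagPos h1
    rw [flagPos_nextElt, flagPos_inl] at h2
    omega
  obtain ⟨l₁, j, l₂, hl, h2⟩ := exists_of_inversion l (q := q) (p := p)
    (lt_of_le_of_ne (not_lt.1 hcon) hne)
    (by rw [← hw, hwp, hwq, flagPos_nextElt, flagPos_inl]; omega)
  have h3 : wordPerm (l₁ ++ l₂) = wordPerm (i :: l) := by
    have h4 : simplePerm i * w = w * refl q p := by
      rw [(isSigned_wordPerm l).mul_refl, ← hw, hwp, hwq, refl_comm, simplePerm]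
    have h5 : w = wordPerm l₁ * (simplePerm j * wordPerm l₂) := by
      rw [hw, hl, wordPerm_append, wordPerm_cons]
    rw [wordPerm_cons, ← hw, h4, h5, mul_assoc, mul_assoc, (isSigned_wordPerm l₂).mul_refl, ← h2,
      ← mul_assoc (simplePerm j), simplePerm, refl_mul_self, one_mul, wordPerm_append]
  have h4 := h _ h3
  rw [hl] at h4
  simp only [List.length_cons, List.length_append] at h4
  omega

theorem IsReducedWord.isAscending : ∀ {l : List (Fin n)}, IsReducedWord l → IsAscending l
  | [], _ => trivial
  | _ :: _, h => ⟨h.lt, h.tail.isAscending⟩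

theorem card_flagPos_lt (w : Equiv.Perm (Fin n ⊕ Fin n)) {m : ℕ} (hm : m ≤ 2 * n) :
    (Finset.univ.filter fun b => flagPos (w b) < m).card = m := by
  have h1 : ((Finset.univ.filter fun b => flagPos (w b) < m).image fun b => flagPos (w b))
      = Finset.Ico 0 (m : ℤ) := by
    ext p
    simp only [Finset.mem_image, Finset.mem_filter, Finset.mem_univ, true_and, Finset.mem_Ico]
    constructor
    · rintro ⟨b, hb, rfl⟩
      exact ⟨flagPos_nonneg _, hb⟩
    · rintro ⟨h0, h2⟩
      obtain ⟨a, ha⟩ := exists_flagPos_eq (n := n) h0 (by omega)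
      exact ⟨w.symm a, by rw [w.apply_symm_apply, ha]; exact h2, by rw [w.apply_symm_apply, ha]⟩
  have h2 := congrArg Finset.card h1
  rw [Finset.card_image_of_injective _ (show Function.Injective fun b => flagPos (w b) from
    flagPos_injective.comp w.injective), Int.card_Ico] at h2
  simpa using h2

/-- The inversions of `w` to the right of `a`. -/
def invRight (w : Equiv.Perm (Fin n ⊕ Fin n)) (a : Fin n ⊕ Fin n) : Finset (Fin n ⊕ Fin n) :=
  Finset.univ.filter fun b => flagPos a < flagPos b ∧ flagPos (w b) < flagPos (w a)

/-- The inversions of `w` to the left of `a`. -/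
def invLeft (w : Equiv.Perm (Fin n ⊕ Fin n)) (a : Fin n ⊕ Fin n) : Finset (Fin n ⊕ Fin n) :=
  Finset.univ.filter fun b => flagPos b < flagPos a ∧ flagPos (w a) < flagPos (w b)

/-- The sign of the column of `e_j` in the representative of a reduced word with permutation `w`. -/
def reducedSign (w : Equiv.Perm (Fin n ⊕ Fin n)) (j : Fin n) : ℤˣ :=
  if flagPos (w (Sum.inl j)) < n then (-1) ^ (invRight w (Sum.inl j)).card
  else (-1) ^ (n - j + (invLeft w (Sum.inl j)).card)

theorem reducedSign_mul {w : Equiv.Perm (Fin n ⊕ Fin n)} (hw : IsSigned w) {i : Fin n}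
    (h : flagPos (w.symm (Sum.inl i)) < flagPos (w.symm (nextElt i))) (j : Fin n) :
    reducedSign (simplePerm i * w) j = simpleSign i (w (Sum.inl j)) * reducedSign w j := by
  set a : Fin n ⊕ Fin n := Sum.inl j with ha
  have hi := i.2
  have hj := j.2
  have haj : flagPos a = j := rfl
  set b₀ := w.symm (nextElt i) with hb₀
  set a₀ := w.symm (Sum.inl i) with ha₀
  have hb1 : ∀ b, flagPos (w b) = i + 1 ↔ flagPos b = flagPos b₀ := fun b => by
    rw [flagPos_injective.eq_iff, hb₀, Equiv.eq_symm_apply, ← flagPos_injective.eq_iff,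
      flagPos_nextElt]
  have ha1 : ∀ b, flagPos (w b) = i ↔ flagPos b = flagPos a₀ := fun b => by
    rw [flagPos_injective.eq_iff, ha₀, Equiv.eq_symm_apply, ← flagPos_injective.eq_iff,
      flagPos_inl]
  have hb2 : ∀ b, flagPos (w b) = 2 * n - 2 - i ↔ flagPos b = 2 * n - 1 - flagPos b₀ := fun b => by
    have h1 := hb1 b.swap
    rw [hw, flagPos_swap, flagPos_swap] at h1
    omega
  have ha2 : ∀ b, flagPos (w b) = 2 * n - 1 - i ↔ flagPos b = 2 * n - 1 - flagPos a₀ := fun b => by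
    have h1 := ha1 b.swap
    rw [hw, flagPos_swap, flagPos_swap] at h1
    omega
  have hpos : ∀ b, flagPos ((simplePerm i * w) b) = if flagPos (w b) = i ∨
      flagPos (w b) = 2 * n - 2 - i then flagPos (w b) + 1
      else if flagPos (w b) = i + 1 ∨ flagPos (w b) = 2 * n - 1 - i then flagPos (w b) - 1
      else flagPos (w b) := fun b => flagPos_simplePerm i (w b)
  have hinj : ∀ b, flagPos (w b) = flagPos (w a) ↔ flagPos b = flagPos a := fun b => by
    rw [flagPos_injective.eq_iff, flagPos_injective.eq_iff, w.injective.eq_iff]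
  have hR : ∀ v : Equiv.Perm (Fin n ⊕ Fin n), ∀ b, b ∈ invRight v a ↔
      flagPos a < flagPos b ∧ flagPos (v b) < flagPos (v a) := fun v b => by
    simp [invRight]
  have hL : ∀ v : Equiv.Perm (Fin n ⊕ Fin n), ∀ b, b ∈ invLeft v a ↔
      flagPos b < flagPos a ∧ flagPos (v a) < flagPos (v b) := fun v b => by
    simp [invLeft]
  have ha1a := ha1 a
  have ha2a := ha2 a
  have hb1a := hb1 a
  have hb2a := hb2 a
  unfold reducedSign simpleSign
  rw [← ha]
  by_cases hlong : (i : ℕ) + 1 < n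
  · by_cases c1 : flagPos (w a) = i
    · have e : invRight (simplePerm i * w) a = insert b₀ (invRight w a) := by
        ext b
        rw [Finset.mem_insert, hR, hR, hpos, hpos, ← flagPos_injective.eq_iff]
        have h1 := hb1 b; have h2 := hinj b
        split_ifs <;> omega
      have hn : b₀ ∉ invRight w a := by
        rw [hR, (hb1 b₀).2 rfl]; omega
      rw [e, Finset.card_insert_of_notMem hn, hpos, if_pos (Or.inl c1), if_pos (by omega),
        if_pos (Or.inl c1), if_pos (by omega), pow_succ, mul_comm]
    · by_cases c2 : flagPos (w a) = 2 * n - 1 - i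
      · have e : invLeft (simplePerm i * w) a = insert b₀.swap (invLeft w a) := by
          ext b
          rw [Finset.mem_insert, hL, hL, hpos, hpos, ← flagPos_injective.eq_iff, flagPos_swap]
          have h1 := hb2 b; have h2 := hinj b
          split_ifs <;> omega
        have hn : b₀.swap ∉ invLeft w a := by
          rw [hL, (hb2 _).2 (flagPos_swap b₀), flagPos_swap]; omega
        rw [e, Finset.card_insert_of_notMem hn, hpos, if_neg (by omega), if_pos (by omega),
          if_neg (by omega), ← add_assoc, pow_succ, mul_comm]
      · rw [if_neg (show ¬ (flagPos (w a) = i ∨ (flagPos (w a) = 2 * n - 1 - i ∧ (i : ℕ) + 1 < n))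
          by omega), one_mul, hpos]
        by_cases hn : flagPos (w a) < n
        · have e1 : invRight (simplePerm i * w) a = invRight w a := by
            ext b
            rw [hR, hR, hpos, hpos]
            have h1 := hb1 b; have h2 := hinj b; have h3 := ha1 b
            split_ifs <;> omega
          rw [e1, if_pos hn, if_pos (by split_ifs <;> omega)]
        · have e2 : invLeft (simplePerm i * w) a = invLeft w a := by
            ext b
            rw [hL, hL, hpos, hpos]
            have h1 := ha2 b; have h2 := hinj b; have h3 := hb2 b
            split_ifs <;> omega
          rw [e2, if_neg hn, if_neg (by split_ifs <;> omega)]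
  · have hin : (i : ℤ) = n - 1 := by omega
    have hsb : flagPos b₀ = 2 * n - 1 - flagPos a₀ := by
      rw [← ha2, (hb1 b₀).2 rfl]; omega
    by_cases c1 : flagPos (w a) = i
    · have hpa : flagPos ((simplePerm i * w) a) = i + 1 := by rw [hpos, if_pos (Or.inl c1), c1]
      have hcount : (invRight w a).card + 1 = n - j + (invLeft (simplePerm i * w) a).card := by
        have k1 := card_flagPos_lt w (m := n - 1) (by omega)
        have k2 : (Finset.univ.filter fun b : Fin n ⊕ Fin n => flagPos b < (j : ℕ)).card = j :=
          card_flagPos_lt (1 : Equiv.Perm (Fin n ⊕ Fin n)) (by omega)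
        have k3 : (Finset.univ.filter fun b => flagPos (w b) < (n - 1 : ℕ))
            = invRight w a ∪ Finset.univ.filter
              fun b => flagPos b < flagPos a ∧ flagPos (w b) < (n - 1 : ℕ) := by
          ext b
          have h1 := hinj b
          rw [Finset.mem_union, hR]
          simp only [Finset.mem_filter, Finset.mem_univ, true_and]
          omega
        have k4 : (Finset.univ.filter fun b : Fin n ⊕ Fin n => flagPos b < (j : ℕ))
            = invLeft (simplePerm i * w) a ∪ Finset.univ.filter
              fun b => flagPos b < flagPos a ∧ flagPos (w b) < (n - 1 : ℕ) := by
          ext b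
          have h1 := hinj b
          have h2 := hb1 b
          rw [Finset.mem_union, hL, hpa, hpos]
          simp only [Finset.mem_filter, Finset.mem_univ, true_and]
          split_ifs <;> omega
        rw [k3, Finset.card_union_of_disjoint] at k1
        · rw [k4, Finset.card_union_of_disjoint] at k2
          · omega
          · refine Finset.disjoint_left.2 fun b hb hb' => ?_
            rw [hL, hpa, hpos] at hb
            simp only [Finset.mem_filter, Finset.mem_univ, true_and] at hb'
            split_ifs at hb <;> omega
        · refine Finset.disjoint_left.2 fun b hb hb' => ?_
          rw [hR] at hb
          simp only [Finset.mem_filter, Finset.mem_univ, true_and] at hb'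
          omega
      rw [hpa, if_neg (by omega), if_pos (Or.inl c1), if_pos (by omega), ← hcount, pow_succ,
        mul_comm]
    · have c2 : flagPos (w a) ≠ n := fun e => by omega
      rw [if_neg (show ¬ (flagPos (w a) = i ∨ (flagPos (w a) = 2 * n - 1 - i ∧ (i : ℕ) + 1 < n))
        by omega), one_mul]
      have hpa : flagPos ((simplePerm i * w) a) = flagPos (w a) := by
        rw [hpos, if_neg (by omega), if_neg (by omega)]
      have e1 : invRight (simplePerm i * w) a = invRight w a := by
        ext b
        rw [hR, hR, hpa, hpos]
        split_ifs <;> omega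
      have e2 : invLeft (simplePerm i * w) a = invLeft w a := by
        ext b
        rw [hL, hL, hpa, hpos]
        split_ifs <;> omega
      rw [hpa, e1, e2]

theorem reducedSign_one (j : Fin n) : reducedSign (1 : Equiv.Perm (Fin n ⊕ Fin n)) j = 1 := by
  have h : invRight (1 : Equiv.Perm (Fin n ⊕ Fin n)) (Sum.inl j) = ∅ := by
    ext b
    rw [invRight, Finset.mem_filter, Equiv.Perm.one_apply, Equiv.Perm.one_apply]
    exact ⟨fun h => absurd h.2.1 (not_lt.2 h.2.2.le), fun h => absurd h (Finset.notMem_empty b)⟩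
  have hj := j.2
  rw [reducedSign, if_pos (by rw [Equiv.Perm.one_apply, flagPos_inl]; omega), h,
    Finset.card_empty, pow_zero]

theorem IsAscending.wordSign_inl : ∀ {l : List (Fin n)}, IsAscending l → ∀ j,
    wordSign l (Sum.inl j) = reducedSign (wordPerm l) j
  | [], _, j => (reducedSign_one j).symm
  | i :: l, h, j => by
    rw [wordPerm_cons, reducedSign_mul (isSigned_wordPerm l) h.1, ← h.2.wordSign_inl j]
    rfl

/-- The sign `1` on the first half of the basis and `-1` on the second one. -/
def side (a : Fin n ⊕ Fin n) : ℤˣ := if flagPos a < n then 1 else -1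

theorem side_mul_self (a : Fin n ⊕ Fin n) : side a * side a = 1 := by
  unfold side
  split_ifs <;> rfl

theorem simpleSign_swap (i : Fin n) (a : Fin n ⊕ Fin n) :
    simpleSign i a.swap = simpleSign i a * (side a * side (simplePerm i a)) := by
  have hi := i.2
  unfold simpleSign side
  rw [flagPos_simplePerm, flagPos_swap]
  split_ifs <;> first | rfl | (exfalso; omega)

theorem wordSign_swap (l : List (Fin n)) (a : Fin n ⊕ Fin n) :
    wordSign l a.swap = wordSign l a * (side a * side (wordPerm l a)) := by
  induction l with
  | nil => exact (side_mul_self a).symm.trans (one_mul _).symm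
  | cons i l ih =>
    rw [wordPerm_cons, Equiv.Perm.mul_apply]
    change simpleSign i (wordPerm l a.swap) * wordSign l a.swap =
      simpleSign i (wordPerm l a) * wordSign l a * _
    rw [isSigned_wordPerm, simpleSign_swap, ih]
    have h := side_mul_self (wordPerm l a)
    calc _ = simpleSign i (wordPerm l a) * wordSign l a *
        (side a * side (simplePerm i (wordPerm l a))) *
        (side (wordPerm l a) * side (wordPerm l a)) := by ac_rfl
      _ = _ := by rw [h, mul_one]

theorem IsAscending.wordSign_eq {l l' : List (Fin n)} (h : IsAscending l) (h' : IsAscending l')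
    (e : wordPerm l = wordPerm l') : wordSign l = wordSign l' := by
  funext a
  rcases a with j | j
  · rw [h.wordSign_inl, h'.wordSign_inl, e]
  · have h1 := wordSign_swap l (Sum.inl j)
    have h2 := wordSign_swap l' (Sum.inl j)
    rw [h.wordSign_inl, e] at h1
    rw [h'.wordSign_inl, ← h1] at h2
    exact h2.symm

end ReducedWords

section

variable {n : ℕ} {k : Type*} [NontriviallyNormedField k] [ProperSpace k] [MeasurableSpace k]
  [BorelSpace k] [CharZero k]

theorem IsAscending.wordRep_eq {l l' : List (Fin n)} (h : IsAscending l) (h' : IsAscending l')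
    (e : wordPerm l = wordPerm l') : wordRep k l = wordRep k l' :=
  wordRep_eq_of e (h.wordSign_eq h' e)

end

/-! ### The braid relations -/

section Braid

variable {n : ℕ}

theorem wordPerm_symm_cons (i : Fin n) (l : List (Fin n)) (a : Fin n ⊕ Fin n) :
    (wordPerm (i :: l)).symm a = (wordPerm l).symm (simplePerm i a) := by
  rw [wordPerm_cons]
  rfl

theorem wordPerm_symm_nil (a : Fin n ⊕ Fin n) : (wordPerm ([] : List (Fin n))).symm a = a := rfl

theorem simplePerm_mul_self (i : Fin n) : simplePerm i * simplePerm i = 1 := refl_mul_self _ _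

theorem simplePerm_mul_refl (i : Fin n) (x y : Fin n ⊕ Fin n) :
    simplePerm i * refl x y * simplePerm i = refl (simplePerm i x) (simplePerm i y) := by
  rw [(show IsSigned (simplePerm i) from isSigned_refl _ _).mul_refl, mul_assoc,
    simplePerm_mul_self, mul_one]

theorem simplePerm_eq_of_flagPos {i : Fin n} {a b : Fin n ⊕ Fin n}
    (h : flagPos b = if flagPos a = i ∨ flagPos a = 2 * n - 2 - i then flagPos a + 1
    else if flagPos a = i + 1 ∨ flagPos a = 2 * n - 1 - i then flagPos a - 1 else flagPos a) :
    simplePerm i a = b :=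
  flagPos_injective ((flagPos_simplePerm i a).trans h.symm)

theorem simplePerm_inl (i : Fin n) : simplePerm i (Sum.inl i) = nextElt i :=
  simplePerm_eq_of_flagPos (by rw [flagPos_nextElt, flagPos_inl, if_pos (Or.inl rfl)])

theorem simplePerm_nextElt (i : Fin n) : simplePerm i (nextElt i) = Sum.inl i :=
  simplePerm_eq_of_flagPos (by
    have hi := i.2
    rw [flagPos_nextElt, flagPos_inl, if_neg (by omega), if_pos (by omega)]; omega)

theorem braid_two {i j : Fin n} (h : (i : ℕ) + 1 < j) :
    wordPerm [i, j] = wordPerm [j, i] ∧ IsAscending [i, j] ∧ IsAscending [j, i] := by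
  have hj := j.2
  have e1 : simplePerm i (Sum.inl j) = Sum.inl j := simplePerm_eq_of_flagPos (by
    rw [flagPos_inl, if_neg (by omega), if_neg (by omega)])
  have e2 : simplePerm i (nextElt j) = nextElt j := simplePerm_eq_of_flagPos (by
    rw [flagPos_nextElt, if_neg (by omega), if_neg (by omega)])
  have e3 : simplePerm j (Sum.inl i) = Sum.inl i := simplePerm_eq_of_flagPos (by
    rw [flagPos_inl, if_neg (by omega), if_neg (by omega)])
  have e4 : simplePerm j (nextElt i) = nextElt i := simplePerm_eq_of_flagPos (by
    rw [flagPos_nextElt, if_neg (by omega), if_neg (by omega)])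
  refine ⟨?_, ?_, ?_⟩
  · have h1 := (show IsSigned (simplePerm i) from isSigned_refl _ _).mul_refl (Sum.inl j)
      (nextElt j)
    rw [e1, e2] at h1
    exact h1
  · refine ⟨?_, ?_, trivial⟩ <;>
      simp only [wordPerm_symm_cons, wordPerm_symm_nil,
        e3, e4, flagPos_inl, flagPos_nextElt] <;> omega
  · refine ⟨?_, ?_, trivial⟩ <;>
      simp only [wordPerm_symm_cons, wordPerm_symm_nil,
        e1, e2, flagPos_inl, flagPos_nextElt] <;> omega

theorem braid_three {i j : Fin n} (h : (i : ℕ) + 1 = j) (hj : (j : ℕ) + 1 < n) :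
    wordPerm [i, j, i] = wordPerm [j, i, j] ∧ IsAscending [i, j, i] ∧ IsAscending [j, i, j] := by
  have e0 : nextElt i = Sum.inl j := flagPos_injective (by
    rw [flagPos_nextElt, flagPos_inl]; omega)
  have e1 := simplePerm_inl i
  have e2 := simplePerm_nextElt i
  have e3 := simplePerm_inl j
  have e4 := simplePerm_nextElt j
  rw [e0] at e1 e2
  have e5 : simplePerm j (Sum.inl i) = Sum.inl i := simplePerm_eq_of_flagPos (by
    rw [flagPos_inl, if_neg (by omega), if_neg (by omega)])
  have e6 : simplePerm i (nextElt j) = nextElt j := simplePerm_eq_of_flagPos (by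
    rw [flagPos_nextElt, if_neg (by omega), if_neg (by omega)])
  refine ⟨?_, ?_, ?_⟩
  · have h1 := simplePerm_mul_refl i (Sum.inl j) (nextElt j)
    have h2 := simplePerm_mul_refl j (Sum.inl i) (Sum.inl j)
    rw [e2, e6] at h1
    rw [e3, e5] at h2
    have h3 : simplePerm i = refl (Sum.inl i) (Sum.inl j) := by rw [simplePerm, e0]
    change simplePerm i * (simplePerm j * (simplePerm i * 1))
      = simplePerm j * (simplePerm i * (simplePerm j * 1))
    rw [mul_one, mul_one, ← mul_assoc, ← mul_assoc]
    refine Eq.trans h1 (Eq.trans h2.symm ?_)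
    rw [← h3]
  · refine ⟨?_, ?_, ?_, trivial⟩ <;>
      simp only [wordPerm_symm_cons, wordPerm_symm_nil,
        e0, e1, e2, e3, e5, e6, flagPos_inl, flagPos_nextElt] <;> omega
  · refine ⟨?_, ?_, ?_, trivial⟩ <;>
      simp only [wordPerm_symm_cons, wordPerm_symm_nil,
        e0, e2, e3, e4, e5, e6, flagPos_inl, flagPos_nextElt] <;> omega

theorem braid_four {i j : Fin n} (h : (i : ℕ) + 1 = j) (hj : (j : ℕ) + 1 = n) :
    wordPerm [i, j, i, j] = wordPerm [j, i, j, i] ∧ IsAscending [i, j, i, j] ∧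
      IsAscending [j, i, j, i] := by
  have e0 : nextElt i = Sum.inl j := flagPos_injective (by
    rw [flagPos_nextElt, flagPos_inl]; omega)
  have e0' : nextElt j = Sum.inr j := flagPos_injective (by
    rw [flagPos_nextElt, flagPos_inr]; omega)
  have e1 := simplePerm_inl i
  have e2 := simplePerm_nextElt i
  have e3 := simplePerm_inl j
  have e4 := simplePerm_nextElt j
  rw [e0] at e1 e2
  rw [e0'] at e3 e4
  have e5 : simplePerm j (Sum.inl i) = Sum.inl i := simplePerm_eq_of_flagPos (by
    rw [flagPos_inl, if_neg (by omega), if_neg (by omega)])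
  have e6 : simplePerm j (Sum.inr i) = Sum.inr i := simplePerm_eq_of_flagPos (by
    rw [flagPos_inr, if_neg (by omega), if_neg (by omega)])
  have hs : IsSigned (simplePerm i) := isSigned_refl _ _
  have e7 : simplePerm i (Sum.inr i) = Sum.inr j := by
    have := hs (Sum.inl i); rw [e1] at this; exact this
  have e8 : simplePerm i (Sum.inr j) = Sum.inr i := by
    have := hs (Sum.inl j); rw [e2] at this; exact this
  refine ⟨?_, ?_, ?_⟩
  · have h1 := simplePerm_mul_refl i (Sum.inl j) (Sum.inr j)
    rw [e2, e8] at h1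
    have h2 := simplePerm_mul_refl j (Sum.inl i) (Sum.inr i)
    rw [e5, e6, ← h1] at h2
    have h3 : simplePerm j = refl (Sum.inl j) (Sum.inr j) := by rw [simplePerm, e0']
    rw [← h3] at h2
    change simplePerm i * (simplePerm j * (simplePerm i * (simplePerm j * 1)))
      = simplePerm j * (simplePerm i * (simplePerm j * (simplePerm i * 1)))
    have h4 := congrArg (simplePerm j * ·) h2
    simp only [← mul_assoc, simplePerm_mul_self, one_mul] at h4
    simp only [← mul_assoc, mul_one]
    exact h4
  · refine ⟨?_, ?_, ?_, ?_, trivial⟩ <;>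
      simp only [wordPerm_symm_cons, wordPerm_symm_nil,
        e0, e0', e1, e2, e3, e5, e6, e8, flagPos_inl, flagPos_inr] <;> omega
  · refine ⟨?_, ?_, ?_, ?_, trivial⟩ <;>
      simp only [wordPerm_symm_cons, wordPerm_symm_nil,
        e0, e0', e1, e2, e3, e5, e6, e7, e8, flagPos_inl, flagPos_inr] <;> omega

theorem braid_of_lt {i j : Fin n} (h : i < j) :
    wordPerm (CoxeterSystem.alternatingWord i j (CoxeterMatrix.B n i j))
        = wordPerm (CoxeterSystem.alternatingWord j i (CoxeterMatrix.B n i j)) ∧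
      IsAscending (CoxeterSystem.alternatingWord i j (CoxeterMatrix.B n i j)) ∧
      IsAscending (CoxeterSystem.alternatingWord j i (CoxeterMatrix.B n i j)) := by
  have h' : (i : ℕ) < j := h
  have hj := j.2
  have hB : CoxeterMatrix.B n i j = if i = j then 1
      else (if (i : ℕ) = n - 1 ∧ (j : ℕ) = n - 2 ∨ (j : ℕ) = n - 1 ∧ (i : ℕ) = n - 2 then 4
        else (if (j : ℕ) + 1 = i ∨ (i : ℕ) + 1 = j then 3 else 2)) := rfl
  rw [if_neg h.ne, ] at hB
  by_cases h1 : (i : ℕ) + 1 = j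
  · by_cases h2 : (j : ℕ) + 1 = n
    · rw [if_pos (by omega)] at hB
      rw [hB]
      exact braid_four h1 h2
    · rw [if_neg (by omega), if_pos (by omega)] at hB
      rw [hB]
      have h3 := braid_three h1 (by omega)
      exact ⟨h3.1.symm, h3.2.2, h3.2.1⟩
  · rw [if_neg (by omega), if_neg (by omega)] at hB
    rw [hB]
    exact braid_two (by omega)

end Braid

/-! ### Lifts of words -/

section Lifts

variable {n : ℕ} {k : Type*} [NontriviallyNormedField k] [ProperSpace k] [MeasurableSpace k]
  [BorelSpace k] [CharZero k]

theorem braid_wordRep {i j : Fin n} (h : i ≠ j) :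
    wordRep k (CoxeterSystem.alternatingWord i j (CoxeterMatrix.B n i j))
      = wordRep k (CoxeterSystem.alternatingWord j i (CoxeterMatrix.B n i j)) := by
  rcases lt_or_gt_of_ne h with h | h
  · obtain ⟨h1, h2, h3⟩ := braid_of_lt h
    exact h2.wordRep_eq h3 h1
  · obtain ⟨h1, h2, h3⟩ := braid_of_lt h
    rw [CoxeterMatrix.symmetric] at h1 h2 h3
    exact (h2.wordRep_eq h3 h1).symm

variable {ψ : AddChar k Circle} (hψ : Continuous ψ) {s : ℝ} (hs : IsSelfDualScale ψ s)

theorem siegelForm_simpleRep {i : Fin n} (hi : ¬ IsLong i) :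
    siegelForm (simpleRep i : Sp n k) = 0 := by
  rw [siegelForm, simpleRep_short (lt_of_not_isLong hi), toBlocks_fromBlocks₁₂, Matrix.zero_mul]

theorem simpleRep_transpose_mulVec {i : Fin n} (h : (i : ℕ) + 1 < n) (u : Fin n → k) (j : Fin n) :
    ((simpleRep i : Sp n k).1.toBlocks₁₁ᵀ *ᵥ u) j = u (Equiv.swap i ⟨i + 1, h⟩ j) ∨
    ((simpleRep i : Sp n k).1.toBlocks₁₁ᵀ *ᵥ u) j = -u (Equiv.swap i ⟨i + 1, h⟩ j) := by
  have hne : (⟨i + 1, h⟩ : Fin n) ≠ i := by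
    intro e; have := congrArg Fin.val e; simp at this
  rw [simpleRep_short h, toBlocks_fromBlocks₁₁]
  generalize (⟨i + 1, h⟩ : Fin n) = m at *
  simp only [transpose_sub, transpose_add, transpose_one, transpose_single, sub_mulVec, add_mulVec,
    one_mulVec, single_mulVec, Pi.sub_apply, Pi.add_apply]
  by_cases h1 : j = i
  · subst h1
    right
    simp [hne.symm]
  · by_cases h2 : j = m
    · subst h2
      left
      simp [h1]
    · left
      rw [Equiv.swap_apply_of_ne_of_ne h1 h2]
      simp [h1, h2]

theorem siegelHom_simpleRep_vac {i : Fin n} (hi : ¬ IsLong i) {h : k → ℝ}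
    (hh : IsSelfDual ψ s h) :
    (siegelHom hψ ⟨simpleRep i, simpleRep_mem_siegel hi⟩).2 (vac n hh) = vac n hh := by
  set g : siegel n k := ⟨simpleRep i, simpleRep_mem_siegel hi⟩ with hg
  set c : ℝ := (√(siegelScale g : ℝ))⁻¹ with hc
  have hc0 : 0 < c := inv_pos.2 (Real.sqrt_pos.2 (siegelScale_pos g))
  have h1 : (siegelHom hψ g).2 (vac n hh) = (c : ℂ) • vac n hh := by
    ext1
    refine (siegelOp_ae hψ g _).trans (EventuallyEq.trans ?_ (Lp.coeFn_smul _ _).symm)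
    filter_upwards [(quasiMeasurePreserving_siegelSubst g).ae (vac_ae hh), vac_ae (n := n) hh]
      with u hu hu'
    rw [Pi.smul_apply, hu', smul_eq_mul]
    rw [siegelSubst_apply] at hu
    rw [hu, siegelForm_simpleRep hi, zero_mulVec, dotProduct_zero, mul_zero, AddChar.map_zero_eq_one,
      Circle.coe_one, one_mul]
    congr 2
    have hlt := lt_of_not_isLong hi
    rw [← Equiv.prod_comp (Equiv.swap i ⟨i + 1, hlt⟩) (fun j => h (u j))]
    refine Finset.prod_congr rfl fun j _ => ?_
    rcases simpleRep_transpose_mulVec hlt u j with e | e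
    · exact congrArg h e
    · exact (congrArg h e).trans (hh.even _)
  have h2 := congrArg norm h1
  rw [LinearIsometryEquiv.norm_map, norm_smul, Complex.norm_real, Real.norm_of_nonneg hc0.le] at h2
  have h3 : ‖vac n hh‖ ≠ 0 := norm_ne_zero_iff.2 (vac_ne_zero hh)
  have h4 : c = 1 := by
    have := mul_right_cancel₀ h3 ((one_mul _).trans h2)
    exact this.symm
  rw [h1, h4, Complex.ofReal_one, one_smul]

theorem simpleLift_vac (i : Fin n) {h : k → ℝ} (hh : IsSelfDual ψ s h) :
    (simpleLift hψ hs i).2 (vac n hh) = vac n hh := by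
  unfold simpleLift
  split_ifs with hi
  · exact fourierEl_vac hψ hs hh i
  · exact siegelHom_simpleRep_vac hψ hi hh

variable {hψ}

theorem wordLift_cons (wt : Fin n → metaplectic n ψ hψ) (i : Fin n) (l : List (Fin n)) :
    wordLift wt (i :: l) = wt i * wordLift wt l := by
  simp [wordLift]

include hs in
theorem wordLift_fst (hψ₁ : ψ ≠ 1) {wt : Fin n → metaplectic n ψ hψ}
    (hwt : ∀ i, IsSimpleLift i (wt i)) (l : List (Fin n)) :
    (wordLift wt l).1.1 = wordRep k l := by
  induction l with
  | nil => rfl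
  | cons i l ih =>
    rw [wordLift_cons]
    change (wt i).1.1 * (wordLift wt l).1.1 = _
    rw [ih, (hwt i).eq hψ hs hψ₁, simpleLift_fst]
    simp [wordRep]

include hs in
theorem wordLift_vac (hψ₁ : ψ ≠ 1) {wt : Fin n → metaplectic n ψ hψ}
    (hwt : ∀ i, IsSimpleLift i (wt i)) {h : k → ℝ} (hh : IsSelfDual ψ s h) (l : List (Fin n)) :
    (wordLift wt l).1.2 (vac n hh) = vac n hh := by
  induction l with
  | nil => rfl
  | cons i l ih =>
    rw [wordLift_cons]
    change (wt i).1.2 ((wordLift wt l).1.2 _) = _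
    rw [ih, (hwt i).eq hψ hs hψ₁, simpleLift_vac]

theorem wordLift_eq (hψ₁ : ψ ≠ 1) {wt : Fin n → metaplectic n ψ hψ}
    (hwt : ∀ i, IsSimpleLift i (wt i)) {l l' : List (Fin n)} (e : wordRep k l = wordRep k l') :
    wordLift wt l = wordLift wt l' := by
  obtain ⟨s, hs⟩ := exists_isSelfDualScale hψ hψ₁
  obtain ⟨h, hh⟩ := exists_isSelfDual hψ hψ₁ hs
  refine Subtype.ext (eq_of_fst_eq_of_apply_eq hψ hψ₁ (metaplectic_le hψ (wordLift wt l).2)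
    (metaplectic_le hψ (wordLift wt l').2) ?_ (vac_ne_zero hh) ?_)
  · rw [wordLift_fst hs hψ₁ hwt, wordLift_fst hs hψ₁ hwt, e]
  · rw [wordLift_vac hs hψ₁ hwt, wordLift_vac hs hψ₁ hwt]

theorem existsUnique_isSimpleLift (hψ₁ : ψ ≠ 1) (i : Fin n) :
    ∃! z : metaplectic n ψ hψ, IsSimpleLift i z := by
  obtain ⟨s, hs⟩ := exists_isSelfDualScale hψ hψ₁
  exact ⟨_, isSimpleLift_simpleLift hψ hs hψ₁ i, fun z hz => Subtype.ext (hz.eq hψ hs hψ₁)⟩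

theorem IsSimpleLift.exists_mul_eq (hψ₁ : ψ ≠ 1) {i : Fin n} (hi : IsLong i)
    {z : metaplectic n ψ hψ} (hz : IsSimpleLift i z) :
    ∃ c y : metaplectic n ψ hψ, c.1 ∈ mu8 n k ∧ IsSpringerElement i y ∧ z = c * y := by
  obtain ⟨s, hs⟩ := exists_isSelfDualScale hψ hψ₁
  obtain ⟨h, γ, hh, hγ, h8⟩ := exists_weilIndex_pow_eight hψ hs hψ₁
  obtain ⟨y, hy⟩ := exists_isSpringerElement (n := n) hψ hs hψ₁ i
  have h1 := hy.eq_long hψ hs hψ₁ hi hh hγ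
  have h2 := hz.eq hψ hs hψ₁
  rw [simpleLift, dif_pos hi] at h2
  have h3 : scalarEl n k γ ∈ mu8 n k := ⟨γ, h8, rfl⟩
  refine ⟨⟨(scalarEl n k γ)⁻¹, Subgroup.mem_sup_right (inv_mem h3)⟩, y, inv_mem h3, hy,
    Subtype.ext ?_⟩
  change z.1 = (scalarEl n k γ)⁻¹ * y.1
  rw [h1, inv_mul_cancel_left, h2]

theorem IsSimpleLift.isNegOne_sq (hψ₁ : ψ ≠ 1) {i : Fin n} (hi : IsLong i)
    {z : metaplectic n ψ hψ} (hz : IsSimpleLift i z) : IsNegOne i (z ^ 2) := by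
  obtain ⟨s, hs⟩ := exists_isSelfDualScale hψ hψ₁
  have h2 := hz.eq hψ hs hψ₁
  rw [simpleLift, dif_pos hi] at h2
  have h3 : ∀ f, weilRep (z ^ 2) f = parityOp i f := fun f => by
    rw [pow_two]
    change z.1.2 (z.1.2 f) = _
    rw [h2]
    exact fourierOp_fourierOp hψ hs i f
  refine ⟨?_, fun f => ⟨fun hf => ?_, fun hf => ?_⟩⟩
  · rw [pow_two]
    change z.1.1.1 * z.1.1.1 = _
    rw [h2]
    change fourierMatrix i * fourierMatrix i = _
    rw [fourierMatrix_eq, fromBlocks_multiply]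
    simp only [diagonal_mul_diagonal, diagonal_add]
    have h4 : (diagonal fun a : Fin n ⊕ Fin n => if a = Sum.inl i ∨ a = Sum.inr i then (-1 : k) else 1)
      = fromBlocks (diagonal fun j => if j = i then -1 else 1) 0 0
        (diagonal fun j => if j = i then -1 else 1) := by
      rw [fromBlocks_diagonal]
      congr 1
      ext (j | j) <;> simp
    rw [h4, ← diagonal_zero]
    congr 1 <;> congr 1 <;> funext j <;> by_cases hj : j = i <;> simp [hj]
  · rw [h3]
    ext1
    exact (parityOp_ae i f).trans hf.symm
  · rw [h3]
    ext1
    refine (parityOp_ae i f).trans (EventuallyEq.trans ?_ (Lp.coeFn_neg _).symm)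
    filter_upwards [hf] with u hu
    rw [Pi.neg_apply, hu, neg_neg]

end Lifts

/-! ### Generation by simple reflections -/

section Generation

variable {n : ℕ}

theorem IsSigned.one : IsSigned (1 : Equiv.Perm (Fin n ⊕ Fin n)) := fun _ => rfl

theorem exists_wordPerm_fix_succ {p : ℕ} (hp : p < n) (m : ℕ) {w : Equiv.Perm (Fin n ⊕ Fin n)}
    (hw : IsSigned w) (h : ∀ a, flagPos a < p → w a = a)
    (hm : flagPos (w (Sum.inl ⟨p, hp⟩)) = p + m) :
    ∃ l : List (Fin n), ∀ a : Fin n ⊕ Fin n, flagPos a < p + 1 → (wordPerm l * w) a = a := by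
  induction m generalizing w with
  | zero =>
    refine ⟨[], fun a ha => ?_⟩
    rw [wordPerm_nil, one_mul]
    rcases lt_or_eq_of_le (Int.lt_add_one_iff.1 ha) with h1 | h1
    · exact h a h1
    · have h2 : a = Sum.inl ⟨p, hp⟩ := flagPos_injective h1
      refine flagPos_injective ?_
      rw [h2, hm, flagPos_inl]
      simp
  | succ m ih =>
    set r := p + m + 1 with hr
    have hr1 : (r : ℤ) ≤ 2 * n - 1 - p := by
      by_contra hcon
      have h0 := flagPos_lt (w (Sum.inl ⟨p, hp⟩))
      obtain ⟨a, ha⟩ := exists_flagPos_eq (n := n) (p := 2 * n - 1 - r) (by omega) (by omega)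
      have h1 := hw a
      rw [h a (by omega)] at h1
      have h2 : w a.swap = w (Sum.inl ⟨p, hp⟩) := flagPos_injective (by
        rw [h1, hm, flagPos_swap]; omega)
      have h3 := congrArg flagPos (w.injective h2)
      rw [flagPos_swap, flagPos_inl] at h3
      simp only at h3
      omega
    obtain ⟨i, hi⟩ : ∃ i : Fin n, ((r ≤ n ∧ (i : ℕ) + 1 = r) ∨ (n < r ∧ (i : ℕ) + r + 1 = 2 * n)) := by
      by_cases hrn : r ≤ n
      · exact ⟨⟨r - 1, by omega⟩, Or.inl ⟨hrn, by simp only; omega⟩⟩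
      · exact ⟨⟨2 * n - 1 - r, by omega⟩, Or.inr ⟨by omega, by simp only; omega⟩⟩
    obtain ⟨l, hl⟩ := ih (w := simplePerm i * w) ((isSigned_refl _ _).mul hw) (fun a ha => by
        refine flagPos_injective ?_
        rw [Equiv.Perm.mul_apply, h a ha, flagPos_simplePerm, if_neg (by omega), if_neg (by omega)])
      (by
        rw [Equiv.Perm.mul_apply, flagPos_simplePerm, hm, if_neg (by omega), if_pos (by omega)]
        omega)
    refine ⟨l ++ [i], fun a ha => ?_⟩
    rw [wordPerm_append, wordPerm_cons, wordPerm_nil, mul_one, mul_assoc]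
    exact hl a ha

theorem exists_wordPerm_fix {w : Equiv.Perm (Fin n ⊕ Fin n)} (hw : IsSigned w) :
    ∀ p ≤ n, ∃ l : List (Fin n), ∀ a : Fin n ⊕ Fin n, flagPos a < p → (wordPerm l * w) a = a
  | 0, _ => ⟨[], fun a ha => absurd ha (not_lt.2 (flagPos_nonneg a))⟩
  | p + 1, hp => by
    obtain ⟨l, hl⟩ := exists_wordPerm_fix hw p (by omega)
    have hs := (isSigned_wordPerm l).mul hw
    have h0 : (p : ℤ) ≤ flagPos ((wordPerm l * w) (Sum.inl ⟨p, hp⟩)) := by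
      by_contra hcon
      have h1 := hl _ (not_le.1 hcon)
      have h2 := congrArg flagPos ((wordPerm l * w).injective h1)
      rw [h2, flagPos_inl] at hcon
      simp at hcon
    obtain ⟨l', hl'⟩ := exists_wordPerm_fix_succ hp
      (flagPos ((wordPerm l * w) (Sum.inl ⟨p, hp⟩)) - p).toNat hs hl (by omega)
    refine ⟨l' ++ l, fun a ha => ?_⟩
    rw [wordPerm_append, mul_assoc]
    exact hl' a (by push_cast at ha; exact ha)

theorem IsSigned.ext {v w : Equiv.Perm (Fin n ⊕ Fin n)} (hv : IsSigned v) (hw : IsSigned w)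
    (h : ∀ j, v (Sum.inl j) = w (Sum.inl j)) : v = w := by
  ext1 a
  rcases a with j | j
  · exact h j
  · rw [show (Sum.inr j : Fin n ⊕ Fin n) = (Sum.inl j : Fin n ⊕ Fin n).swap from rfl, hv, hw, h]

theorem wordPerm_reverse (l : List (Fin n)) : wordPerm l.reverse = (wordPerm l)⁻¹ := by
  induction l with
  | nil => rfl
  | cons i l ih =>
    rw [List.reverse_cons, wordPerm_append, wordPerm_cons, wordPerm_cons, ih, wordPerm_nil, mul_one,
      _root_.mul_inv_rev, inv_eq_of_mul_eq_one_right (simplePerm_mul_self i)]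

/-- Every signed permutation is a product of simple reflections. -/
theorem IsSigned.exists_wordPerm {w : Equiv.Perm (Fin n ⊕ Fin n)} (hw : IsSigned w) :
    ∃ l, wordPerm l = w := by
  obtain ⟨l, hl⟩ := exists_wordPerm_fix hw n le_rfl
  refine ⟨l.reverse, ?_⟩
  have h1 : wordPerm l * w = 1 := ((isSigned_wordPerm l).mul hw).ext IsSigned.one fun j =>
    hl _ (by rw [flagPos_inl]; exact_mod_cast j.2)
  rw [wordPerm_reverse]
  exact inv_eq_of_mul_eq_one_right h1

end Generation

/-! ### The normalizer of the torus -/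

section Monomial

variable {n : ℕ} {k : Type*} [Field k]

/-- The sign of a basis vector in the symplectic form. -/
def formSign (k : Type*) [Field k] : Fin n ⊕ Fin n → k := Sum.elim (fun _ => 1) (fun _ => -1)

theorem formSign_mul_self (a : Fin n ⊕ Fin n) : formSign k a * formSign k a = 1 := by
  rcases a with a | a <;> simp [formSign]

theorem formSign_ne_zero (a : Fin n ⊕ Fin n) : formSign k a ≠ 0 := fun h => by
  have := formSign_mul_self (k := k) a
  rw [h, mul_zero] at this
  exact zero_ne_one this

theorem inv_apply_eq (g : Sp n k) (a b : Fin n ⊕ Fin n) :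
    (g⁻¹).1 a b = formSign k a * formSign k b * g.1 b.swap a.swap := by
  have h1 : (g⁻¹).1 = -Matrix.J (Fin n) k * g.1ᵀ * Matrix.J (Fin n) k := SymplecticGroup.coe_inv g
  have h2 : Matrix.J (Fin n) k = fromBlocks 0 (-1) 1 0 := rfl
  rw [h1, h2, ← fromBlocks_toBlocks g.1, fromBlocks_transpose, fromBlocks_neg, fromBlocks_multiply,
    fromBlocks_multiply]
  rcases a with a | a <;> rcases b with b | b <;> simp [formSign]

theorem exists_ne_zero_col (g : Sp n k) (a : Fin n ⊕ Fin n) : ∃ b, g.1 b a ≠ 0 := by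
  by_contra! hcon
  have h1 : ((g⁻¹).1 * g.1) a a = 1 := by
    have h2 := congrArg Subtype.val (inv_mul_cancel g)
    change (g⁻¹).1 * g.1 = 1 at h2
    rw [h2, Matrix.one_apply_eq]
  rw [Matrix.mul_apply, Finset.sum_eq_zero fun b _ => by rw [hcon b, mul_zero]] at h1
  exact zero_ne_one h1

/-- `g` permutes the coordinate lines by the permutation `w`. -/
def HasSupport (g : Sp n k) (w : Equiv.Perm (Fin n ⊕ Fin n)) : Prop :=
  ∀ a b, g.1 b a ≠ 0 → w a = b

theorem HasSupport.ne_zero {g : Sp n k} {w : Equiv.Perm (Fin n ⊕ Fin n)} (h : HasSupport g w)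
    (a : Fin n ⊕ Fin n) : g.1 (w a) a ≠ 0 := by
  obtain ⟨b, hb⟩ := exists_ne_zero_col g a
  rwa [h a b hb]

theorem HasSupport.unique {g : Sp n k} {v w : Equiv.Perm (Fin n ⊕ Fin n)} (hv : HasSupport g v)
    (hw : HasSupport g w) : v = w :=
  Equiv.ext fun a => hv a _ (hw.ne_zero a)

theorem HasSupport.isSigned {g : Sp n k} {w : Equiv.Perm (Fin n ⊕ Fin n)} (h : HasSupport g w) :
    IsSigned w := fun a => by
  have h1 : ((g⁻¹).1 * g.1) a a = 1 := by
    have h2 := congrArg Subtype.val (inv_mul_cancel g)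
    change (g⁻¹).1 * g.1 = 1 at h2
    rw [h2, Matrix.one_apply_eq]
  rw [Matrix.mul_apply, Finset.sum_eq_single (w a), inv_apply_eq] at h1
  · refine h _ _ fun h2 => ?_
    rw [h2, mul_zero, zero_mul] at h1
    exact zero_ne_one h1
  · intro b _ hb
    rw [show g.1 b a = 0 from by_contra fun h2 => hb (h a b h2).symm, mul_zero]
  · simp

theorem HasSupport.mul {g h : Sp n k} {v w : Equiv.Perm (Fin n ⊕ Fin n)} (hg : HasSupport g v)
    (hh : HasSupport h w) : HasSupport (g * h) (v * w) := fun a b hab => by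
  change (g.1 * h.1) b a ≠ 0 at hab
  rw [Matrix.mul_apply] at hab
  obtain ⟨c, -, hc⟩ := Finset.exists_ne_zero_of_sum_ne_zero hab
  rw [Equiv.Perm.mul_apply, hh a c (right_ne_zero_of_mul hc), hg c b (left_ne_zero_of_mul hc)]

theorem HasSupport.inv {g : Sp n k} {w : Equiv.Perm (Fin n ⊕ Fin n)} (h : HasSupport g w) :
    HasSupport g⁻¹ w⁻¹ := fun a b hab => by
  rw [inv_apply_eq] at hab
  have h1 := h _ _ (right_ne_zero_of_mul hab)
  rw [h.isSigned] at h1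
  rw [Equiv.Perm.inv_eq_iff_eq]
  simpa using (congrArg Sum.swap h1).symm

theorem hasSupport_one_iff {g : Sp n k} : HasSupport g 1 ↔ g ∈ torus n k :=
  ⟨fun h a b hab => by_contra fun h1 => hab (h b a h1).symm,
    fun h a b hab => by_contra fun h1 => hab (h b a (Ne.symm h1))⟩

theorem hasSupport_mem_normalizer {g : Sp n k} {w : Equiv.Perm (Fin n ⊕ Fin n)}
    (h : HasSupport g w) : g ∈ Subgroup.normalizer (torus n k : Set (Sp n k)) := by
  rw [Subgroup.mem_normalizer_iff]
  intro t
  constructor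
  · intro ht
    have h1 := (h.mul (hasSupport_one_iff.2 ht)).mul h.inv
    rw [mul_one, mul_inv_cancel] at h1
    exact hasSupport_one_iff.1 h1
  · intro ht
    have h1 := (h.inv.mul (hasSupport_one_iff.2 ht)).mul h
    rw [mul_one, inv_mul_cancel] at h1
    have h2 := hasSupport_one_iff.1 h1
    have h3 : g⁻¹ * (g * t * g⁻¹) * g = t := by group
    rwa [h3] at h2

/-- The diagonal matrix with entries `2 ^ e a`. -/
def powTorus (k : Type*) [Field k] [CharZero k] (e : Fin n ⊕ Fin n → ℤ)
    (he : ∀ a, e a.swap = -e a) : Sp n k :=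
  ⟨diagonal fun a => (2 : k) ^ e a, by
    have h1 : (diagonal fun a => (2 : k) ^ e a) = fromBlocks
        (diagonal fun j => (2 : k) ^ e (Sum.inl j)) 0 0 (diagonal fun j => (2 : k) ^ e (Sum.inr j)) := by
      rw [fromBlocks_diagonal]
      congr 1
      ext (j | j) <;> rfl
    rw [h1, SymplecticGroup.fromBlocks_mem_iff]
    refine ⟨by simp, by simp, ?_⟩
    rw [diagonal_transpose, diagonal_mul_diagonal, Matrix.transpose_zero, Matrix.zero_mul, sub_zero,
      ← diagonal_one]
    congr 1
    funext j
    rw [show (Sum.inr j : Fin n ⊕ Fin n) = (Sum.inl j : Fin n ⊕ Fin n).swap from rfl, he,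
      ← zpow_add₀ two_ne_zero, add_neg_cancel, zpow_zero]⟩

variable [CharZero k]

theorem two_zpow_injective : Function.Injective fun m : ℤ => (2 : k) ^ m := fun a b h => by
  have h1 : ((2 : ℚ) ^ a : ℚ) = (2 : ℚ) ^ b := by
    have h2 : (((2 : ℚ) ^ a : ℚ) : k) = (((2 : ℚ) ^ b : ℚ) : k) := by
      push_cast
      exact h
    exact_mod_cast h2
  exact zpow_right_injective₀ (by norm_num) (by norm_num) h1

theorem powTorus_mem (e : Fin n ⊕ Fin n → ℤ) (he : ∀ a, e a.swap = -e a) :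
    powTorus k e he ∈ torus n k := fun _ _ hab => diagonal_apply_ne _ hab

theorem exists_hasSupport {g : Sp n k}
    (hg : g ∈ Subgroup.normalizer (torus n k : Set (Sp n k))) : ∃ w, HasSupport g w := by
  have he : ∀ a : Fin n ⊕ Fin n, 2 * flagPos a.swap - (2 * n - 1) = -(2 * flagPos a - (2 * n - 1)) :=
    fun a => by rw [flagPos_swap]; ring
  set z : Sp n k := powTorus k (fun a => 2 * flagPos a - (2 * n - 1)) he with hz
  have h1 : g * z * g⁻¹ ∈ torus n k := (Subgroup.mem_normalizer_iff.1 hg z).1 (powTorus_mem _ he)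
  set t := g * z * g⁻¹ with ht
  have h2 : g * z = t * g := by rw [ht]; group
  have h3 : ∀ a b, g.1 b a * (2 : k) ^ (2 * flagPos a - (2 * n - 1)) = t.1 b b * g.1 b a :=
    fun a b => by
    have h4 : (g.1 * z.1) b a = (t.1 * g.1) b a := congrFun (congrFun (congrArg Subtype.val h2) b) a
    rw [show (g.1 * z.1) b a = g.1 b a * (2 : k) ^ (2 * flagPos a - (2 * n - 1)) from
      mul_diagonal _ _ _ _] at h4
    rw [h4, Matrix.mul_apply]
    refine Finset.sum_eq_single b (fun c _ hc => ?_) (by simp)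
    rw [h1 b c (Ne.symm hc), zero_mul]
  have h5 : ∀ a a' b, g.1 b a ≠ 0 → g.1 b a' ≠ 0 → a = a' := fun a a' b ha ha' => by
    have e1 : (2 : k) ^ (2 * flagPos a - (2 * n - 1)) = t.1 b b :=
      mul_left_cancel₀ ha ((h3 a b).trans (mul_comm _ _))
    have e2 : (2 : k) ^ (2 * flagPos a' - (2 * n - 1)) = t.1 b b :=
      mul_left_cancel₀ ha' ((h3 a' b).trans (mul_comm _ _))
    have e3 := two_zpow_injective (e1.trans e2.symm)
    exact flagPos_injective (by omega)
  choose p hp using exists_ne_zero_col g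
  have hpi : Function.Injective p := fun a a' h => h5 a a' (p a) (hp a) (by rw [h]; exact hp a')
  have hpb := Finite.injective_iff_bijective.1 hpi
  refine ⟨Equiv.ofBijective p hpb, fun a b hab => ?_⟩
  obtain ⟨c, rfl⟩ := hpb.2 b
  exact congrArg p (h5 a c (p c) hab (hp c))

end Monomial

section WeylGroup

variable {n : ℕ} {k : Type*} [NontriviallyNormedField k] [ProperSpace k] [MeasurableSpace k]
  [BorelSpace k] [CharZero k]

theorem hasSupport_wordRep (l : List (Fin n)) : HasSupport (wordRep k l) (wordPerm l) :=
  fun a b hab => by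
  rw [wordRep_eq_signedMatrix] at hab
  by_contra h
  exact hab (if_neg h)

theorem represents_torus_iff {g h : Sp n k} {v u : Equiv.Perm (Fin n ⊕ Fin n)}
    {w : weyl (torus n k)} (hg : Represents (torus n k) g w) (hv : HasSupport g v)
    (hu : HasSupport h u) : Represents (torus n k) h w ↔ u = v := by
  obtain ⟨hgn, rfl⟩ := hg
  have h1 : ∀ hh : h ∈ Subgroup.normalizer (torus n k : Set (Sp n k)),
      ((QuotientGroup.mk ⟨h, hh⟩ : weyl (torus n k)) = QuotientGroup.mk ⟨g, hgn⟩ ↔ u = v) :=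
    fun hh => by
    rw [QuotientGroup.eq, Subgroup.mem_subgroupOf]
    change h⁻¹ * g ∈ torus n k ↔ _
    rw [← hasSupport_one_iff]
    constructor
    · intro h2
      have h3 := (hu.inv.mul hv).unique h2
      exact (inv_mul_eq_one.1 h3)
    · rintro rfl
      have h2 := hu.inv.mul hv
      rwa [inv_mul_cancel] at h2
  exact ⟨fun ⟨hh, h2⟩ => (h1 hh).1 h2, fun h2 => ⟨hasSupport_mem_normalizer hu, (h1 _).2 h2⟩⟩

theorem exists_represents_torus (w : weyl (torus n k)) :
    ∃ g v, Represents (torus n k) g w ∧ HasSupport g v := by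
  obtain ⟨⟨g, hg⟩, rfl⟩ := QuotientGroup.mk_surjective w
  obtain ⟨v, hv⟩ := exists_hasSupport hg
  exact ⟨g, v, ⟨hg, rfl⟩, hv⟩

theorem isDecomposition_iff {g : Sp n k} {v : Equiv.Perm (Fin n ⊕ Fin n)}
    {w : weyl (torus n k)} (hg : Represents (torus n k) g w) (hv : HasSupport g v)
    (l : List (Fin n)) : IsDecomposition l w ↔ wordPerm l = v :=
  represents_torus_iff hg hv (hasSupport_wordRep l)

theorem exists_isReducedDecomposition (w : weyl (torus n k)) :
    ∃ l, IsReducedDecomposition l w := by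
  obtain ⟨g, v, hg, hv⟩ := exists_represents_torus w
  obtain ⟨l₀, hl₀⟩ := hv.isSigned.exists_wordPerm
  obtain ⟨l, hl, hmin⟩ := WellFounded.has_min (measure (List.length (α := Fin n))).wf
    {l | IsDecomposition l w} ⟨l₀, (isDecomposition_iff hg hv l₀).2 hl₀⟩
  exact ⟨l, hl, fun l' hl' => not_lt.1 (hmin l' hl')⟩

theorem IsReducedDecomposition.isReducedWord {l : List (Fin n)} {w : weyl (torus n k)}
    (h : IsReducedDecomposition l w) : IsReducedWord l := fun l' hl' => by
  obtain ⟨g, v, hg, hv⟩ := exists_represents_torus w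
  refine h.2 l' ?_
  rw [isDecomposition_iff hg hv, hl']
  exact (isDecomposition_iff hg hv l).1 h.1

theorem IsReducedDecomposition.wordRep_eq {l l' : List (Fin n)} {w : weyl (torus n k)}
    (h : IsReducedDecomposition l w) (h' : IsReducedDecomposition l' w) :
    wordRep k l = wordRep k l' := by
  obtain ⟨g, v, hg, hv⟩ := exists_represents_torus w
  exact h.isReducedWord.isAscending.wordRep_eq h'.isReducedWord.isAscending
    (((isDecomposition_iff hg hv l).1 h.1).trans ((isDecomposition_iff hg hv l').1 h'.1).symm)

end WeylGroup

/-! ### The blocks of a standard Levi subgroup -/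

section Blocks

variable {n : ℕ}

/-- The basis vectors at the positions `p` and `p + 1` are exchanged by a simple reflection
in `Δ`. -/
def Linked (Δ : Set (Fin n)) (p : ℤ) : Prop := ∃ i ∈ Δ, p = i ∨ p = 2 * n - 2 - i

theorem linked_reflect (Δ : Set (Fin n)) (p : ℤ) : Linked Δ (2 * n - 2 - p) ↔ Linked Δ p := by
  unfold Linked
  refine exists_congr fun i => and_congr_right fun _ => ?_
  omega

open scoped Classical in
/-- The index of the block that contains `a`. -/
def blk (Δ : Set (Fin n)) (a : Fin n ⊕ Fin n) : ℤ :=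
  ((Finset.Ico 0 (flagPos a)).filter fun p => ¬ Linked Δ p).card

variable {Δ : Set (Fin n)}

theorem blk_mono {a b : Fin n ⊕ Fin n} (h : flagPos a ≤ flagPos b) : blk Δ a ≤ blk Δ b := by
  classical
  unfold blk
  exact_mod_cast Finset.card_le_card
    (Finset.filter_subset_filter _ (Finset.Ico_subset_Ico_right h))

theorem flagPos_lt_of_blk_lt {a b : Fin n ⊕ Fin n} (h : blk Δ a < blk Δ b) :
    flagPos a < flagPos b := by
  by_contra hcon
  exact absurd (blk_mono (Δ := Δ) (not_lt.1 hcon)) (not_le.2 h)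

theorem blk_eq_iff_linked {a b : Fin n ⊕ Fin n} (h : flagPos b = flagPos a + 1) :
    blk Δ a = blk Δ b ↔ Linked Δ (flagPos a) := by
  classical
  have h0 := flagPos_nonneg a
  have h1 : Finset.Ico 0 (flagPos b) = insert (flagPos a) (Finset.Ico 0 (flagPos a)) := by
    ext p
    simp only [Finset.mem_insert, Finset.mem_Ico]
    omega
  unfold blk
  rw [h1, Finset.filter_insert]
  split_ifs with h2
  · exact ⟨fun _ => h2, fun _ => rfl⟩
  · rw [Finset.card_insert_of_notMem (by simp)]
    push_cast
    exact ⟨fun h3 => by omega, fun h3 => absurd h3 h2⟩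

variable (Δ) in
theorem exists_blk_swap : ∃ K : ℤ, ∀ a : Fin n ⊕ Fin n, blk Δ a.swap = K - blk Δ a := by
  classical
  refine ⟨((Finset.Ico 0 (2 * n - 1 : ℤ)).filter fun p => ¬ Linked Δ p).card, fun a => ?_⟩
  have h0 := flagPos_nonneg a
  have h1 := flagPos_lt a
  have h2 : ((Finset.Ico 0 (flagPos a.swap)).filter fun p => ¬ Linked Δ p).card
      = ((Finset.Ico (flagPos a) (2 * n - 1)).filter fun p => ¬ Linked Δ p).card := by
    refine Finset.card_bij (fun p _ => 2 * n - 2 - p) (fun p hp => ?_) (fun p _ q _ h => ?_)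
      (fun p hp => ?_)
    · rw [flagPos_swap, Finset.mem_filter, Finset.mem_Ico] at hp
      rw [Finset.mem_filter, Finset.mem_Ico, linked_reflect]
      exact ⟨by omega, hp.2⟩
    · omega
    · rw [Finset.mem_filter, Finset.mem_Ico] at hp
      refine ⟨2 * n - 2 - p, ?_, by omega⟩
      rw [flagPos_swap, Finset.mem_filter, Finset.mem_Ico, linked_reflect]
      exact ⟨by omega, hp.2⟩
  have h3 : Finset.Ico 0 (2 * n - 1 : ℤ)
      = Finset.Ico 0 (flagPos a) ∪ Finset.Ico (flagPos a) (2 * n - 1) := by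
    ext p
    simp only [Finset.mem_union, Finset.mem_Ico]
    omega
  unfold blk
  rw [h2, h3, Finset.filter_union, Finset.card_union_of_disjoint]
  · push_cast
    ring
  · refine Finset.disjoint_left.2 fun p hp hp' => ?_
    simp only [Finset.mem_filter, Finset.mem_Ico] at hp hp'
    omega

theorem blk_swap_eq_iff {a b : Fin n ⊕ Fin n} :
    blk Δ a.swap = blk Δ b.swap ↔ blk Δ a = blk Δ b := by
  obtain ⟨K, hK⟩ := exists_blk_swap Δ
  rw [hK, hK]
  omega

theorem blk_simplePerm {i : Fin n} (hi : i ∈ Δ) (a : Fin n ⊕ Fin n) :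
    blk Δ (simplePerm i a) = blk Δ a := by
  have h := flagPos_simplePerm i a
  have hi' := i.2
  split_ifs at h with h1 h2
  · refine ((blk_eq_iff_linked h).2 ⟨i, hi, ?_⟩).symm
    omega
  · refine (blk_eq_iff_linked (by omega)).2 ⟨i, hi, ?_⟩
    omega
  · rw [flagPos_injective h]

end Blocks

section RootEntries

variable {n : ℕ} {k : Type*} [Field k]

theorem rootMatrix_eq (i : Fin n) (t : k) : rootMatrix i t = 1 + Matrix.single (Sum.inl i)
    (nextElt i) t - if (i : ℕ) + 1 < n then Matrix.single (nextElt i).swap (Sum.inr i) t else 0 := by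
  unfold rootMatrix nextElt
  split_ifs with h
  · ext (a | a) (b | b) <;> simp [Matrix.single_apply, Matrix.one_apply]
  · ext (a | a) (b | b) <;> simp [Matrix.single_apply, Matrix.one_apply]

/-- The matrices that differ from `1` at most at the places `(a, b)` and `(b.swap, a.swap)`. -/
def rootSet (k : Type*) [Field k] (a b : Fin n ⊕ Fin n) : Set (Sp n k) :=
  {g | ∀ c d, (g.1 - 1) c d ≠ 0 → (c = a ∧ d = b) ∨ (c = b.swap ∧ d = a.swap)}

theorem rootSet_swap (a b : Fin n ⊕ Fin n) : rootSet k b.swap a.swap = rootSet k a b := by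
  ext g
  unfold rootSet
  simp only [Set.mem_ofPred_eq, Sum.swap_swap]
  exact forall_congr' fun c => forall_congr' fun d => by rw [or_comm]

theorem rootSet_apply {g : Sp n k} {a b : Fin n ⊕ Fin n} (hg : g ∈ rootSet k a b)
    {c d : Fin n ⊕ Fin n} (h1 : ¬ (c = a ∧ d = b)) (h2 : ¬ (c = b.swap ∧ d = a.swap)) :
    g.1 c d = (1 : Matrix (Fin n ⊕ Fin n) (Fin n ⊕ Fin n) k) c d := by
  by_contra h
  rcases hg c d (fun h3 => h (sub_eq_zero.1 h3)) with h3 | h3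
  · exact h1 h3
  · exact h2 h3

theorem inl_ne_nextElt (i : Fin n) : Sum.inl i ≠ nextElt i := fun h => by
  have := congrArg flagPos h
  rw [flagPos_inl, flagPos_nextElt] at this
  omega

theorem xPos_mem_rootSet (i : Fin n) (t : k) : xPos i t ∈ rootSet k (Sum.inl i) (nextElt i) := by
  intro c d h
  have e : rootMatrix i t - 1 = Matrix.single (Sum.inl i) (nextElt i) t -
      if (i : ℕ) + 1 < n then Matrix.single (nextElt i).swap (Sum.inr i) t else 0 := by
    rw [rootMatrix_eq]
    abel
  change (rootMatrix i t - 1) c d ≠ 0 at h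
  rw [e] at h
  by_contra hcon
  rw [not_or] at hcon
  refine h ?_
  split_ifs
  · rw [Matrix.sub_apply, Matrix.single_apply, Matrix.single_apply, if_neg, if_neg, sub_zero]
    · rintro ⟨rfl, rfl⟩; exact hcon.2 ⟨rfl, rfl⟩
    · rintro ⟨rfl, rfl⟩; exact hcon.1 ⟨rfl, rfl⟩
  · rw [sub_zero, Matrix.single_apply, if_neg]
    rintro ⟨rfl, rfl⟩; exact hcon.1 ⟨rfl, rfl⟩

theorem xPos_apply (i : Fin n) (t : k) : (xPos i t).1 (Sum.inl i) (nextElt i) = t := by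
  change rootMatrix i t _ _ = t
  rw [rootMatrix_eq, Matrix.sub_apply, Matrix.add_apply, Matrix.single_apply_same,
    Matrix.one_apply_ne (inl_ne_nextElt i), zero_add]
  split_ifs with h
  · rw [Matrix.single_apply, if_neg, sub_zero]
    rintro ⟨-, h2⟩
    have := congrArg flagPos h2
    rw [flagPos_inr, flagPos_nextElt] at this
    omega
  · simp

theorem xPos_apply_swap {i : Fin n} (h : (i : ℕ) + 1 < n) (t : k) :
    (xPos i t).1 (nextElt i).swap (Sum.inr i) = -t := by
  change rootMatrix i t _ _ = -t
  have h1 : (nextElt i).swap ≠ Sum.inr i := fun e => by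
    have := congrArg flagPos e
    rw [flagPos_swap, flagPos_inr, flagPos_nextElt] at this
    omega
  rw [rootMatrix_eq, if_pos h, Matrix.sub_apply, Matrix.add_apply, Matrix.single_apply_same,
    Matrix.one_apply_ne h1, zero_add, Matrix.single_apply, if_neg, zero_sub]
  rintro ⟨-, h2⟩
  have := congrArg flagPos h2
  rw [flagPos_inr, flagPos_nextElt] at this
  omega

theorem xNeg_mem_rootSet (i : Fin n) (t : k) : xNeg i t ∈ rootSet k (nextElt i) (Sum.inl i) := by
  intro c d h
  have h1 := xPos_mem_rootSet i t d c (by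
    have e : (1 : Matrix (Fin n ⊕ Fin n) (Fin n ⊕ Fin n) k) d c
        = (1 : Matrix (Fin n ⊕ Fin n) (Fin n ⊕ Fin n) k) c d := by
      rw [Matrix.one_apply, Matrix.one_apply]
      exact if_congr eq_comm rfl rfl
    rw [Matrix.sub_apply] at h ⊢
    rw [e]
    exact h)
  rcases h1 with ⟨rfl, rfl⟩ | ⟨rfl, rfl⟩
  · exact Or.inl ⟨rfl, rfl⟩
  · exact Or.inr ⟨rfl, rfl⟩

theorem mem_rootSet_iff {i : Fin n} {g : Sp n k} :
    g ∈ rootSet k (Sum.inl i) (nextElt i) ↔ g ∈ Set.range (xPos (k := k) i) := by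
  refine ⟨fun hg => ?_, ?_⟩
  · set t := g.1 (Sum.inl i) (nextElt i) with ht
    refine ⟨t, Subtype.ext ?_⟩
    ext c d
    by_cases h1 : c = Sum.inl i ∧ d = nextElt i
    · rw [h1.1, h1.2, xPos_apply]
    · by_cases h2 : c = (nextElt i).swap ∧ d = Sum.inr i
      · by_cases hi : (i : ℕ) + 1 < n
        · rw [h2.1, h2.2, xPos_apply_swap hi]
          have hb : nextElt i = Sum.inl ⟨i + 1, hi⟩ := dif_pos hi
          have h3 : (g.1 * (g⁻¹).1) (Sum.inl i) (nextElt i) = 0 := by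
            have h4 := congrArg Subtype.val (mul_inv_cancel g)
            change g.1 * (g⁻¹).1 = 1 at h4
            rw [h4, Matrix.one_apply_ne (inl_ne_nextElt i)]
          have h5 : ∀ c ∈ Finset.univ, c ≠ Sum.inl i ∧ c ≠ nextElt i →
              g.1 (Sum.inl i) c * (g⁻¹).1 c (nextElt i) = 0 := fun c _ hc => by
            rw [rootSet_apply hg (fun h => hc.2 h.2) (by rw [hb]; rintro ⟨h, -⟩; exact Sum.inl_ne_inr h),
              Matrix.one_apply_ne (Ne.symm hc.1), zero_mul]
          rw [Matrix.mul_apply, Finset.sum_eq_add (Sum.inl i) (nextElt i) (inl_ne_nextElt i) h5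
            (by simp) (by simp), inv_apply_eq, inv_apply_eq, ← ht,
            rootSet_apply hg (c := Sum.inl i) (d := Sum.inl i) (fun h => inl_ne_nextElt i h.2)
              (by rw [hb]; rintro ⟨h, -⟩; exact Sum.inl_ne_inr h),
            rootSet_apply hg (c := (nextElt i).swap) (d := (nextElt i).swap)
              (by rw [hb]; rintro ⟨h, -⟩; exact Sum.inr_ne_inl h)
              (fun h => inl_ne_nextElt i (by simpa using (congrArg Sum.swap h.2).symm)),
            Matrix.one_apply_eq, Matrix.one_apply_eq, hb] at h3
          simp [formSign] at h3
          rw [hb]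
          exact neg_eq_of_add_eq_zero_left h3
        · have hb : nextElt i = Sum.inr i := dif_neg hi
          refine absurd ⟨?_, ?_⟩ h1
          · rw [h2.1, hb]; rfl
          · rw [h2.2, hb]
      · rw [rootSet_apply hg h1 h2, rootSet_apply (xPos_mem_rootSet i t) h1 h2]
  · rintro ⟨t, rfl⟩
    exact xPos_mem_rootSet i t

theorem HasSupport.conj_mem_rootSet {g x : Sp n k} {w : Equiv.Perm (Fin n ⊕ Fin n)}
    (hg : HasSupport g w) {a b : Fin n ⊕ Fin n} (hx : x ∈ rootSet k a b) :
    g * x * g⁻¹ ∈ rootSet k (w a) (w b) := by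
  intro c d h
  have h1 : (g * x * g⁻¹).1 - 1 = g.1 * (x.1 - 1) * (g⁻¹).1 := by
    have h2 := congrArg Subtype.val (mul_inv_cancel g)
    change g.1 * (g⁻¹).1 = 1 at h2
    rw [Matrix.mul_sub, Matrix.mul_one, Matrix.sub_mul, h2]
    rfl
  rw [h1, Matrix.mul_apply] at h
  obtain ⟨d', -, hd⟩ := Finset.exists_ne_zero_of_sum_ne_zero h
  have h2 := left_ne_zero_of_mul hd
  rw [Matrix.mul_apply] at h2
  obtain ⟨c', -, hc⟩ := Finset.exists_ne_zero_of_sum_ne_zero h2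
  have h3 := hg _ _ (left_ne_zero_of_mul hc)
  have h4 := hg.inv _ _ (right_ne_zero_of_mul hd)
  rw [Equiv.Perm.inv_eq_iff_eq] at h4
  rw [← h3, h4, ← hg.isSigned, ← hg.isSigned]
  rcases hx c' d' (right_ne_zero_of_mul hc) with ⟨rfl, rfl⟩ | ⟨rfl, rfl⟩
  · exact Or.inl ⟨rfl, rfl⟩
  · exact Or.inr ⟨rfl, rfl⟩

theorem HasSupport.conj_apply {g x : Sp n k} {w : Equiv.Perm (Fin n ⊕ Fin n)}
    (hg : HasSupport g w) (a b : Fin n ⊕ Fin n) :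
    (g * x * g⁻¹).1 (w a) (w b) = g.1 (w a) a * (g⁻¹).1 b (w b) * x.1 a b := by
  change (g.1 * x.1 * (g⁻¹).1) (w a) (w b) = _
  rw [Matrix.mul_apply, Finset.sum_eq_single b, Matrix.mul_apply, Finset.sum_eq_single a]
  · ring
  · intro c _ hc
    rw [show g.1 (w a) c = 0 from by_contra fun h => hc (w.injective (hg _ _ h)), zero_mul]
  · simp
  · intro c _ hc
    have : (g⁻¹).1 c (w b) = 0 := by_contra fun h => hc (by
      have h1 := hg.inv _ _ h
      rw [Equiv.Perm.inv_eq_iff_eq] at h1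
      exact (w.injective h1).symm)
    rw [this, mul_zero]
  · simp

theorem HasSupport.conj_coeff_ne_zero {g : Sp n k} {w : Equiv.Perm (Fin n ⊕ Fin n)}
    (hg : HasSupport g w) (a b : Fin n ⊕ Fin n) : g.1 (w a) a * (g⁻¹).1 b (w b) ≠ 0 := by
  refine mul_ne_zero (hg.ne_zero a) ?_
  have h := hg.inv.ne_zero (w b)
  rwa [show w⁻¹ (w b) = b from w.symm_apply_apply b] at h

end RootEntries

section Transvections

variable {n : ℕ} {k : Type*} [NontriviallyNormedField k] [ProperSpace k] [MeasurableSpace k]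
  [BorelSpace k] [CharZero k] {Δ : Set (Fin n)}

theorem simpleRep_mem_levi {i : Fin n} (hi : i ∈ Δ) : (simpleRep i : Sp n k) ∈ levi k Δ := by
  have h1 : ∀ t : k, xPos i t ∈ levi k Δ := fun t =>
    Subgroup.subset_closure (Or.inr ⟨i, hi, t, Or.inl rfl⟩)
  exact mul_mem (mul_mem (h1 1) (Subgroup.subset_closure (Or.inr ⟨i, hi, _, Or.inr rfl⟩))) (h1 1)

theorem torus_le_levi : torus n k ≤ levi k Δ := fun _ h => Subgroup.subset_closure (Or.inl h)

variable (k Δ) in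
/-- The Levi subgroup contains all elementary matrices with places `(a, b)`, `(b, a)`. -/
def HasTransvections (a b : Fin n ⊕ Fin n) : Prop :=
  ∀ t : k, (∃ h ∈ levi k Δ, h ∈ rootSet k a b ∧ h.1 a b = t) ∧
    ∃ h ∈ levi k Δ, h ∈ rootSet k b a ∧ h.1 b a = t

theorem HasTransvections.conj {i : Fin n} (hi : i ∈ Δ) {a b : Fin n ⊕ Fin n}
    (h : HasTransvections k Δ a b) : HasTransvections k Δ (simplePerm i a) (simplePerm i b) := by
  have hg : HasSupport (simpleRep i : Sp n k) (simplePerm i) := fun c d hcd => by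
    rw [simpleRep_eq_signedMatrix] at hcd
    by_contra h
    exact hcd (if_neg h)
  have hm := simpleRep_mem_levi (k := k) hi
  have h1 : ∀ a b : Fin n ⊕ Fin n, ∀ t : k,
      (∀ t : k, ∃ h ∈ levi k Δ, h ∈ rootSet k a b ∧ h.1 a b = t) →
      ∃ h ∈ levi k Δ, h ∈ rootSet k (simplePerm i a) (simplePerm i b) ∧
        h.1 (simplePerm i a) (simplePerm i b) = t := fun a b t h => by
    set c := (simpleRep i : Sp n k).1 (simplePerm i a) a *
      ((simpleRep i : Sp n k)⁻¹).1 b (simplePerm i b) with hc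
    have hc0 : c ≠ 0 := hg.conj_coeff_ne_zero a b
    obtain ⟨x, hx, hx1, hx2⟩ := h (c⁻¹ * t)
    refine ⟨simpleRep i * x * (simpleRep i)⁻¹, mul_mem (mul_mem hm hx) (inv_mem hm),
      hg.conj_mem_rootSet hx1, ?_⟩
    rw [hg.conj_apply, hx2, ← hc, mul_inv_cancel_left₀ hc0]
  exact fun t => ⟨h1 a b t fun t => (h t).1, h1 b a t fun t => (h t).2⟩

theorem HasTransvections.of_simple {i : Fin n} (hi : i ∈ Δ) :
    HasTransvections k Δ (Sum.inl i) (nextElt i) := fun t =>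
  ⟨⟨xPos i t, Subgroup.subset_closure (Or.inr ⟨i, hi, t, Or.inl rfl⟩), xPos_mem_rootSet i t,
    xPos_apply i t⟩,
  ⟨xNeg i t, Subgroup.subset_closure (Or.inr ⟨i, hi, t, Or.inr rfl⟩), xNeg_mem_rootSet i t,
    xPos_apply i t⟩⟩

theorem HasTransvections.of_simple_swap {i : Fin n} (hi : i ∈ Δ) :
    HasTransvections k Δ (nextElt i).swap (Sum.inr i) := by
  by_cases h : (i : ℕ) + 1 < n
  · refine fun t => ⟨⟨xPos i (-t), Subgroup.subset_closure (Or.inr ⟨i, hi, _, Or.inl rfl⟩), ?_, ?_⟩,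
      ⟨xNeg i (-t), Subgroup.subset_closure (Or.inr ⟨i, hi, _, Or.inr rfl⟩), ?_, ?_⟩⟩
    · have h1 := xPos_mem_rootSet i (-t)
      rw [← rootSet_swap] at h1
      exact h1
    · rw [xPos_apply_swap h, neg_neg]
    · have h1 := xNeg_mem_rootSet i (-t)
      rw [← rootSet_swap] at h1
      exact h1
    · exact (xPos_apply_swap h (-t)).trans (neg_neg t)
  · have hb : nextElt i = Sum.inr i := dif_neg h
    have h1 := HasTransvections.of_simple (k := k) hi
    rwa [hb] at h1 ⊢

theorem hasTransvections_of_lt (m : ℕ) : ∀ {a b : Fin n ⊕ Fin n},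
    flagPos b = flagPos a + m + 1 → blk Δ a = blk Δ b → HasTransvections k Δ a b := by
  induction m using Nat.strong_induction_on with
  | _ m ih =>
    intro a b hab hblk
    have ha0 := flagPos_nonneg a
    have hb1 := flagPos_lt b
    obtain ⟨b', hb'⟩ := exists_flagPos_eq (n := n) (p := flagPos b - 1) (by omega) (by omega)
    have h1 : blk Δ b' = blk Δ b := le_antisymm (blk_mono (by omega)) (by
      rw [← hblk]; exact blk_mono (by omega))
    obtain ⟨i, hi, hip⟩ := (blk_eq_iff_linked (by omega)).1 h1
    have hin := i.2
    rcases Nat.eq_zero_or_pos m with rfl | hm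
    · rcases hip with hip | hip
      · have e1 : a = Sum.inl i := flagPos_injective (by rw [flagPos_inl]; omega)
        have e2 : b = nextElt i := flagPos_injective (by rw [flagPos_nextElt]; omega)
        rw [e1, e2]
        exact HasTransvections.of_simple hi
      · have e1 : a = (nextElt i).swap := flagPos_injective (by
          rw [flagPos_swap, flagPos_nextElt]; omega)
        have e2 : b = Sum.inr i := flagPos_injective (by rw [flagPos_inr]; omega)
        rw [e1, e2]
        exact HasTransvections.of_simple_swap hi
    · have key : ∀ j ∈ Δ, ∀ m' < m,
          flagPos (simplePerm j b) = flagPos (simplePerm j a) + m' + 1 →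
          HasTransvections k Δ a b := fun j hj m' hm' h2 => by
        have h3 := (ih m' hm' h2 (by rw [blk_simplePerm hj, blk_simplePerm hj, hblk])).conj hj
        have h4 : ∀ c, simplePerm j (simplePerm j c) = c := fun c =>
          Equiv.congr_fun (simplePerm_mul_self j) c
        rwa [h4, h4] at h3
      by_cases hsum : flagPos a + flagPos b = 2 * n
      · obtain ⟨a', ha'⟩ := exists_flagPos_eq (n := n) (p := flagPos a + 1) (by omega) (by omega)
        have h2 : blk Δ a = blk Δ a' := le_antisymm (blk_mono (by omega)) (by
          rw [hblk]; exact blk_mono (by omega))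
        obtain ⟨j, hj, hjp⟩ := (blk_eq_iff_linked ha').1 h2
        have hjn := j.2
        refine key j hj (m - 1) (by omega) ?_
        rw [flagPos_simplePerm, flagPos_simplePerm, if_neg (by omega), if_neg (by omega),
          if_pos (by omega)]
        omega
      · by_cases h2 : flagPos a = i ∧ flagPos b = 2 * n - 1 - i
        · refine key i hi (m - 2) (by omega) ?_
          rw [flagPos_simplePerm, flagPos_simplePerm, if_neg (by omega), if_pos (by omega),
            if_pos (by omega)]
          omega
        · refine key i hi (m - 1) (by omega) ?_
          rw [flagPos_simplePerm, flagPos_simplePerm, if_neg (by omega), if_pos (by omega),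
            if_neg (by omega), if_neg (by omega)]
          omega

theorem exists_transvection {a b : Fin n ⊕ Fin n} (hab : a ≠ b) (hblk : blk Δ a = blk Δ b) (t : k) :
    ∃ h ∈ levi k Δ, h ∈ rootSet k a b ∧ h.1 a b = t := by
  rcases lt_or_gt_of_ne (flagPos_injective.ne hab) with h | h
  · exact (hasTransvections_of_lt (flagPos b - flagPos a - 1).toNat (by omega) hblk t).1
  · exact (hasTransvections_of_lt (flagPos a - flagPos b - 1).toNat (by omega) hblk.symm t).2

end Transvections

/-! ### Levi subgroups are block diagonal -/

section BlockDiagonal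

variable {n : ℕ} {k : Type*} [NontriviallyNormedField k] [ProperSpace k] [MeasurableSpace k]
  [BorelSpace k] [CharZero k] {Δ : Set (Fin n)}

/-- The symplectic matrices that are block diagonal for the blocks of `Δ`. -/
def IsBlockDiagonal (Δ : Set (Fin n)) (g : Sp n k) : Prop :=
  ∀ a b, g.1 a b ≠ 0 → blk Δ a = blk Δ b

theorem IsBlockDiagonal.mul {g h : Sp n k} (hg : IsBlockDiagonal Δ g) (hh : IsBlockDiagonal Δ h) :
    IsBlockDiagonal Δ (g * h) := fun a b hab => by
  change (g.1 * h.1) a b ≠ 0 at hab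
  rw [Matrix.mul_apply] at hab
  obtain ⟨c, -, hc⟩ := Finset.exists_ne_zero_of_sum_ne_zero hab
  exact (hg _ _ (left_ne_zero_of_mul hc)).trans (hh _ _ (right_ne_zero_of_mul hc))

theorem IsBlockDiagonal.inv {g : Sp n k} (hg : IsBlockDiagonal Δ g) : IsBlockDiagonal Δ g⁻¹ :=
  fun a b hab => by
  rw [inv_apply_eq] at hab
  exact (blk_swap_eq_iff.1 (hg _ _ (right_ne_zero_of_mul hab))).symm

theorem isBlockDiagonal_of_mem_torus {g : Sp n k} (hg : g ∈ torus n k) : IsBlockDiagonal Δ g :=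
  fun a b hab => by
  by_cases h : a = b
  · rw [h]
  · exact absurd (hg a b h) hab

theorem isBlockDiagonal_of_mem_rootSet {g : Sp n k} {a b : Fin n ⊕ Fin n} (h : blk Δ a = blk Δ b)
    (hg : g ∈ rootSet k a b) : IsBlockDiagonal Δ g := fun c d hcd => by
  by_cases h1 : c = a ∧ d = b
  · rw [h1.1, h1.2, h]
  · by_cases h2 : c = b.swap ∧ d = a.swap
    · rw [h2.1, h2.2, blk_swap_eq_iff, h]
    · rw [rootSet_apply hg h1 h2] at hcd
      by_cases h : c = d
      · rw [h]
      · exact absurd (Matrix.one_apply_ne h) hcd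

theorem isBlockDiagonal_of_mem_levi {g : Sp n k} (hg : g ∈ levi k Δ) : IsBlockDiagonal Δ g := by
  induction hg using Subgroup.closure_induction with
  | mem x hx =>
    rcases hx with hx | ⟨i, hi, t, rfl | rfl⟩
    · exact isBlockDiagonal_of_mem_torus hx
    · exact isBlockDiagonal_of_mem_rootSet ((blk_eq_iff_linked (by
        rw [flagPos_nextElt, flagPos_inl])).2 ⟨i, hi, Or.inl rfl⟩) (xPos_mem_rootSet i t)
    · exact isBlockDiagonal_of_mem_rootSet ((blk_eq_iff_linked (by
        rw [flagPos_nextElt, flagPos_inl])).2 ⟨i, hi, Or.inl rfl⟩).symm (xNeg_mem_rootSet i t)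
  | one => exact isBlockDiagonal_of_mem_torus (one_mem _)
  | mul x y _ _ hx hy => exact hx.mul hy
  | inv x _ hx => exact hx.inv

/-- `g` fixes the basis vector `c`. -/
def FixesCol (g : Sp n k) (c : Fin n ⊕ Fin n) : Prop := g.1 *ᵥ Pi.single c 1 = Pi.single c 1

theorem fixesCol_iff {g : Sp n k} {c : Fin n ⊕ Fin n} :
    FixesCol g c ↔ ∀ b, g.1 b c = (1 : Matrix (Fin n ⊕ Fin n) (Fin n ⊕ Fin n) k) b c := by
  unfold FixesCol
  rw [mulVec_single_one, funext_iff]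
  refine forall_congr' fun b => ?_
  rw [Matrix.col_apply, Matrix.one_apply, Pi.single_apply]

theorem FixesCol.mul {g h : Sp n k} {c : Fin n ⊕ Fin n} (hg : FixesCol g c) (hh : FixesCol h c) :
    FixesCol (g * h) c := by
  change (g.1 * h.1) *ᵥ _ = _
  rw [← mulVec_mulVec, hh, hg]

theorem fixesCol_one (c : Fin n ⊕ Fin n) : FixesCol (1 : Sp n k) c := one_mulVec _

theorem FixesCol.inv {g : Sp n k} {c : Fin n ⊕ Fin n} (hg : FixesCol g c) : FixesCol g⁻¹ c := by
  have h1 : (g⁻¹).1 * g.1 = 1 := congrArg Subtype.val (inv_mul_cancel g)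
  unfold FixesCol
  conv_lhs => rw [← hg]
  rw [mulVec_mulVec, h1, one_mulVec]

/-- If a basis vector is fixed, the row of its partner is that of the identity matrix. -/
theorem FixesCol.row {g : Sp n k} {c : Fin n ⊕ Fin n} (hg : FixesCol g c) (d : Fin n ⊕ Fin n) :
    g.1 c.swap d = (1 : Matrix (Fin n ⊕ Fin n) (Fin n ⊕ Fin n) k) c.swap d := by
  have h1 := fixesCol_iff.1 hg.inv d.swap
  rw [inv_apply_eq, Sum.swap_swap] at h1
  by_cases h : d.swap = c
  · rw [← h, Sum.swap_swap, Matrix.one_apply_eq]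
    rw [← h, Matrix.one_apply_eq, formSign_mul_self, one_mul, Sum.swap_swap] at h1
    exact h1
  · rw [Matrix.one_apply_ne h] at h1
    rw [Matrix.one_apply_ne (fun e => h (by rw [← e, Sum.swap_swap]))]
    exact (mul_eq_zero.1 h1).resolve_left (mul_ne_zero (formSign_ne_zero _) (formSign_ne_zero _))

theorem rootSet_fixesCol {h : Sp n k} {b x : Fin n ⊕ Fin n} (hh : h ∈ rootSet k b x)
    {c : Fin n ⊕ Fin n} (h1 : c ≠ x) (h2 : c ≠ b.swap) : FixesCol h c :=
  fixesCol_iff.2 fun _ => rootSet_apply hh (fun e => h1 e.2) (fun e => h2 e.2)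

theorem rootSet_mulVec_of_ne {h : Sp n k} {b x : Fin n ⊕ Fin n} (hh : h ∈ rootSet k b x)
    (v : Fin n ⊕ Fin n → k) {c : Fin n ⊕ Fin n} (h1 : c ≠ b) (h2 : c ≠ x.swap) :
    (h.1 *ᵥ v) c = v c := by
  change ∑ d, h.1 c d * v d = v c
  rw [Finset.sum_eq_single c]
  · rw [rootSet_apply hh (fun e => h1 e.1) (fun e => h2 e.1), Matrix.one_apply_eq, one_mul]
  · intro d _ hd
    rw [rootSet_apply hh (fun e => h1 e.1) (fun e => h2 e.1), Matrix.one_apply_ne (Ne.symm hd),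
      zero_mul]
  · simp

theorem rootSet_mulVec {h : Sp n k} {b x : Fin n ⊕ Fin n} (hh : h ∈ rootSet k b x) (hbx : b ≠ x)
    (v : Fin n ⊕ Fin n → k) : (h.1 *ᵥ v) b = v b + h.1 b x * v x := by
  have h0 : ∀ d, d ≠ x → ¬ (b = x.swap ∧ d = b.swap) := fun d hd e => hd (by
    rw [e.2, e.1, Sum.swap_swap])
  change ∑ d, h.1 b d * v d = _
  rw [Finset.sum_eq_add b x hbx]
  · rw [rootSet_apply hh (fun e => hbx e.2) (h0 b hbx), Matrix.one_apply_eq, one_mul]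
  · intro d _ hd
    rw [rootSet_apply hh (fun e => hd.2 e.2) (h0 d hd.2), Matrix.one_apply_ne (Ne.symm hd.1),
      zero_mul]
  · simp
  · simp

theorem IsBlockDiagonal.mulVec_apply_eq_zero {g : Sp n k} (hg : IsBlockDiagonal Δ g)
    {v : Fin n ⊕ Fin n → k} {x : Fin n ⊕ Fin n} (hv : ∀ b, v b ≠ 0 → blk Δ b = blk Δ x) :
    ∀ b, (g.1 *ᵥ v) b ≠ 0 → blk Δ b = blk Δ x := fun b hb => by
  change ∑ d, g.1 b d * v d ≠ 0 at hb
  obtain ⟨c, -, hc⟩ := Finset.exists_ne_zero_of_sum_ne_zero hb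
  exact (hg _ _ (left_ne_zero_of_mul hc)).trans (hv _ (right_ne_zero_of_mul hc))

theorem mulVec_mul_apply (g h : Sp n k) (v : Fin n ⊕ Fin n → k) :
    (g * h).1 *ᵥ v = g.1 *ᵥ (h.1 *ᵥ v) := (mulVec_mulVec _ _ _).symm

open scoped Classical in
/-- The vector `v` is brought to two coordinates by the Levi subgroup. -/
theorem exists_levi_clear (x : Fin n ⊕ Fin n) (m : ℕ) : ∀ v : Fin n ⊕ Fin n → k,
    (Finset.univ.filter fun b => b ≠ x ∧ b ≠ x.swap ∧ v b ≠ 0).card = m → v x = 1 →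
    (∀ b, v b ≠ 0 → blk Δ b = blk Δ x) →
    ∃ h ∈ levi k Δ, (h.1 *ᵥ v) x = 1 ∧ (∀ b, b ≠ x → b ≠ x.swap → (h.1 *ᵥ v) b = 0) ∧
      ∀ c, c ≠ x → c = x.swap ∨ v c.swap = 0 → FixesCol h c := by
  induction m with
  | zero =>
    intro v hm hx hv
    refine ⟨1, one_mem _, ?_, fun b h1 h2 => ?_, fun c _ _ => fixesCol_one c⟩
    · exact (congrFun (one_mulVec v) x).trans hx
    · refine (congrFun (one_mulVec v) b).trans (by_contra fun h3 => ?_)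
      have h4 : b ∈ (∅ : Finset (Fin n ⊕ Fin n)) := by
        rw [← Finset.card_eq_zero.1 hm, Finset.mem_filter]
        exact ⟨Finset.mem_univ _, h1, h2, h3⟩
      exact absurd h4 (Finset.notMem_empty b)
  | succ m ih =>
    intro v hm hx hv
    obtain ⟨b, hb⟩ := Finset.card_pos.1 (show
      0 < (Finset.univ.filter fun b => b ≠ x ∧ b ≠ x.swap ∧ v b ≠ 0).card by rw [hm]; omega)
    have hb' := hb
    rw [Finset.mem_filter] at hb'
    obtain ⟨-, hbx, hbs, hb0⟩ := hb'
    obtain ⟨h, hh, hr, ht⟩ := exists_transvection hbx (hv b hb0) (-v b)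
    have e1 : ∀ c, c ≠ b → c ≠ x.swap → (h.1 *ᵥ v) c = v c := fun c h1 h2 =>
      rootSet_mulVec_of_ne hr v h1 h2
    have e2 : (h.1 *ᵥ v) b = 0 := by
      rw [rootSet_mulVec hr hbx, ht, hx, mul_one, add_neg_cancel]
    obtain ⟨h', hh', i1, i2, i3⟩ := ih (h.1 *ᵥ v) (by
        have e : (Finset.univ.filter fun c => c ≠ x ∧ c ≠ x.swap ∧ (h.1 *ᵥ v) c ≠ 0)
            = (Finset.univ.filter fun c => c ≠ x ∧ c ≠ x.swap ∧ v c ≠ 0).erase b := by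
          ext c
          rw [Finset.mem_erase, Finset.mem_filter, Finset.mem_filter]
          by_cases hc : c = b
          · rw [hc, e2]; simp
          · constructor
            · rintro ⟨h0, h1, h2, h3⟩
              exact ⟨hc, h0, h1, h2, by rwa [e1 c hc h2] at h3⟩
            · rintro ⟨-, h0, h1, h2, h3⟩
              exact ⟨h0, h1, h2, by rwa [e1 c hc h2]⟩
        rw [e, Finset.card_erase_of_mem hb, hm, Nat.add_sub_cancel])
      ((e1 x (Ne.symm hbx) (Ne.symm (swap_ne x))).trans hx)
      ((isBlockDiagonal_of_mem_levi hh).mulVec_apply_eq_zero hv)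
    refine ⟨h' * h, mul_mem hh' hh, ?_, ?_, fun c hc hc' => ?_⟩
    · rw [mulVec_mul_apply]; exact i1
    · rw [mulVec_mul_apply]; exact i2
    · refine (i3 c hc ?_).mul (rootSet_fixesCol hr hc ?_)
      · refine hc'.imp_right fun h1 => ?_
        by_cases h2 : c.swap = b
        · rw [h2, e2]
        · rw [e1 _ h2 (fun h3 => hc (by rw [← c.swap_swap, h3, Sum.swap_swap])), h1]
      · rintro rfl
        rcases hc' with h1 | h1
        · exact hbx (by rw [← b.swap_swap, h1, Sum.swap_swap])
        · rw [Sum.swap_swap] at h1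
          exact hb0 h1

theorem exists_levi_single (x : Fin n ⊕ Fin n) {v : Fin n ⊕ Fin n → k} (hx : v x = 1)
    (hv : ∀ b, v b ≠ 0 → blk Δ b = blk Δ x) :
    ∃ h ∈ levi k Δ, h.1 *ᵥ v = Pi.single x 1 ∧
      ∀ c, c ≠ x → c = x.swap ∨ v c.swap = 0 → FixesCol h c := by
  obtain ⟨h, hh, h1, h2, h3⟩ := exists_levi_clear x _ v rfl hx hv
  have hv' := (isBlockDiagonal_of_mem_levi hh).mulVec_apply_eq_zero hv
  by_cases h0 : (h.1 *ᵥ v) x.swap = 0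
  · refine ⟨h, hh, funext fun b => ?_, h3⟩
    by_cases hb : b = x
    · rw [hb, h1, Pi.single_eq_same]
    · rw [Pi.single_eq_of_ne hb]
      by_cases hb' : b = x.swap
      · rw [hb', h0]
      · exact h2 b hb hb'
  · obtain ⟨h', hh', hr, ht⟩ := exists_transvection (swap_ne x) (hv' _ h0) (-(h.1 *ᵥ v) x.swap)
    refine ⟨h' * h, mul_mem hh' hh, funext fun b => ?_, fun c hc hc' =>
      (rootSet_fixesCol hr hc (by rwa [Sum.swap_swap])).mul (h3 c hc hc')⟩
    rw [mulVec_mul_apply]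
    by_cases hb : b = x.swap
    · rw [hb, rootSet_mulVec hr (swap_ne x), ht, h1, mul_one, add_neg_cancel,
        Pi.single_eq_of_ne (swap_ne x)]
    · rw [rootSet_mulVec_of_ne hr _ hb hb]
      by_cases hb' : b = x
      · rw [hb', h1, Pi.single_eq_same]
      · rw [Pi.single_eq_of_ne hb', h2 b hb' hb]

theorem exists_levi_scale (i : Fin n) {v : Fin n ⊕ Fin n → k} (h0 : v ≠ 0)
    (hv : ∀ b, v b ≠ 0 → blk Δ b = blk Δ (Sum.inl i)) :
    ∃ h ∈ levi k Δ, (h.1 *ᵥ v) (Sum.inl i) = 1 ∧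
      ∀ c, c ≠ Sum.inl i → c ≠ Sum.inr i → v c = 0 → FixesCol h c := by
  have key : ∀ u : Fin n ⊕ Fin n → k, u (Sum.inl i) ≠ 0 → ∃ h ∈ levi k Δ,
      (h.1 *ᵥ u) (Sum.inl i) = 1 ∧ ∀ c, c ≠ Sum.inl i → c ≠ Sum.inr i → FixesCol h c := by
    intro u hu
    have ht : cochar i (Units.mk0 _ hu)⁻¹ ∈ torus n k := fun a b hab => by
      rw [cochar_coe, fromBlocks_diagonal, diagonal_apply_ne _ hab]
    refine ⟨_, torus_le_levi ht, ?_, fun c h1 h2 => ?_⟩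
    · rw [cochar_coe, fromBlocks_diagonal, mulVec_diagonal]
      simp [hu]
    · unfold FixesCol
      rw [cochar_coe, fromBlocks_diagonal, diagonal_mulVec_single]
      rcases c with c | c
      · have h3 : c ≠ i := fun e => h1 (congrArg _ e)
        simp [h3]
      · have h3 : c ≠ i := fun e => h2 (congrArg _ e)
        simp [h3]
  by_cases hx : v (Sum.inl i) = 0
  · obtain ⟨a, ha⟩ := Function.ne_iff.1 h0
    have hax : Sum.inl i ≠ a := fun e => ha (by rw [← e]; exact hx)
    obtain ⟨h, hh, hr, ht⟩ := exists_transvection (k := k) hax (hv a ha).symm 1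
    obtain ⟨h', hh', h1, h2⟩ := key (h.1 *ᵥ v) (by
      rw [rootSet_mulVec hr hax, ht, hx, one_mul, zero_add]
      exact ha)
    refine ⟨h' * h, mul_mem hh' hh, by rw [mulVec_mul_apply]; exact h1, fun c hc hc' hc0 =>
      (h2 c hc hc').mul (rootSet_fixesCol hr ?_ hc')⟩
    rintro rfl
    exact ha hc0
  · obtain ⟨h, hh, h1, h2⟩ := key v hx
    exact ⟨h, hh, h1, fun c hc hc' _ => h2 c hc hc'⟩

theorem exists_levi_mul_fixesCol {g : Sp n k} (hg : IsBlockDiagonal Δ g) : ∀ p ≤ n,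
    ∃ h ∈ levi k Δ, ∀ j : Fin n, (j : ℕ) < p →
      FixesCol (h * g) (Sum.inl j) ∧ FixesCol (h * g) (Sum.inr j)
  | 0, _ => ⟨1, one_mem _, fun _ hj => absurd hj (Nat.not_lt_zero _)⟩
  | p + 1, hp => by
    obtain ⟨h, hh, hfix⟩ := exists_levi_mul_fixesCol hg p (by omega)
    set x : Fin n ⊕ Fin n := Sum.inl ⟨p, hp⟩ with hx
    have hlow : ∀ (q : Sp n k), IsBlockDiagonal Δ q → (∀ j : Fin n, (j : ℕ) < p →
        FixesCol q (Sum.inl j) ∧ FixesCol q (Sum.inr j)) → ∀ j : Fin n, (j : ℕ) < p →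
        ∀ d, d ≠ Sum.inl j → d ≠ Sum.inr j → q.1 (Sum.inl j) d = 0 ∧ q.1 (Sum.inr j) d = 0 :=
      fun q _ hq j hj d h1 h2 =>
      ⟨((hq j hj).2.row d).trans (Matrix.one_apply_ne (Ne.symm h1)),
        ((hq j hj).1.row d).trans (Matrix.one_apply_ne (Ne.symm h2))⟩
    have hne : ∀ j : Fin n, (j : ℕ) < p → j ≠ ⟨p, hp⟩ := fun j hj e => by
      rw [e] at hj; simp at hj
    set q := h * g with hq
    have hqb : IsBlockDiagonal Δ q := (isBlockDiagonal_of_mem_levi hh).mul hg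
    have hcol : ∀ (q : Sp n k) (x b : Fin n ⊕ Fin n), (q.1 *ᵥ Pi.single x 1) b = q.1 b x :=
      fun q x b => by rw [mulVec_single_one, Matrix.col_apply]
    obtain ⟨h₁, hh₁, h₁x, h₁f⟩ := exists_levi_scale (k := k) (Δ := Δ) ⟨p, hp⟩
      (v := q.1 *ᵥ Pi.single x 1) (by
        obtain ⟨b, hb⟩ := exists_ne_zero_col q x
        intro e
        exact hb (by rw [← hcol q x b, e]; rfl))
      (fun b hb => hqb b x (by rwa [hcol] at hb))
    have hq₁ : ∀ j : Fin n, (j : ℕ) < p →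
        FixesCol (h₁ * q) (Sum.inl j) ∧ FixesCol (h₁ * q) (Sum.inr j) := fun j hj => by
      have h2 := hlow q hqb hfix j hj x (fun e => hne j hj (Sum.inl_injective e).symm)
        Sum.inl_ne_inr
      exact ⟨(h₁f _ (fun e => hne j hj (Sum.inl_injective e)) Sum.inl_ne_inr
          ((hcol q x _).trans h2.1)).mul (hfix j hj).1,
        (h₁f _ Sum.inr_ne_inl (fun e => hne j hj (Sum.inr_injective e))
          ((hcol q x _).trans h2.2)).mul (hfix j hj).2⟩
    have hq₁b : IsBlockDiagonal Δ (h₁ * q) := (isBlockDiagonal_of_mem_levi hh₁).mul hqb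
    have step : ∀ (q : Sp n k), IsBlockDiagonal Δ q → (∀ j : Fin n, (j : ℕ) < p →
        FixesCol q (Sum.inl j) ∧ FixesCol q (Sum.inr j)) → ∀ y : Fin n ⊕ Fin n,
        y = Sum.inl ⟨p, hp⟩ ∨ y = Sum.inr ⟨p, hp⟩ → q.1 y y = 1 →
        ∃ h ∈ levi k Δ, FixesCol (h * q) y ∧ FixesCol h y.swap ∧ ∀ j : Fin n, (j : ℕ) < p →
          FixesCol (h * q) (Sum.inl j) ∧ FixesCol (h * q) (Sum.inr j) := by
      intro q hqb hfix y hy hyy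
      obtain ⟨h, hh, h1, h2⟩ := exists_levi_single (k := k) (Δ := Δ) y
        (v := q.1 *ᵥ Pi.single y 1) ((hcol q y y).trans hyy)
        (fun b hb => hqb b y (by rwa [hcol] at hb))
      refine ⟨h, hh, ?_, h2 _ (swap_ne y) (Or.inl rfl), fun j hj => ?_⟩
      · unfold FixesCol
        rw [mulVec_mul_apply, h1]
      · have e1 : y ≠ Sum.inl j := by
          rintro rfl
          rcases hy with e | e
          · exact hne j hj (Sum.inl_injective e)
          · exact Sum.inl_ne_inr e
        have e2 : y ≠ Sum.inr j := by
          rintro rfl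
          rcases hy with e | e
          · exact Sum.inr_ne_inl e
          · exact hne j hj (Sum.inr_injective e)
        have h3 := hlow q hqb hfix j hj y e1 e2
        exact ⟨(h2 _ (Ne.symm e1) (Or.inr ((hcol q y _).trans h3.2))).mul (hfix j hj).1,
          (h2 _ (Ne.symm e2) (Or.inr ((hcol q y _).trans h3.1))).mul (hfix j hj).2⟩
    obtain ⟨h₂, hh₂, f2, -, hq₂⟩ := step (h₁ * q) hq₁b hq₁ x (Or.inl rfl) (by
      rw [← hcol, mulVec_mul_apply]
      exact h₁x)
    obtain ⟨h₃, hh₃, f3, f3', hq₃⟩ := step (h₂ * (h₁ * q))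
      ((isBlockDiagonal_of_mem_levi hh₂).mul hq₁b) hq₂ x.swap (Or.inr rfl)
      ((f2.row _).trans (Matrix.one_apply_eq _))
    refine ⟨h₃ * h₂ * h₁ * h, mul_mem (mul_mem (mul_mem hh₃ hh₂) hh₁) hh, fun j hj => ?_⟩
    have e : h₃ * h₂ * h₁ * h * g = h₃ * (h₂ * (h₁ * q)) := by rw [hq]; group
    rw [e]
    rcases Nat.lt_succ_iff_lt_or_eq.1 hj with hj' | hj'
    · exact hq₃ j hj'
    · have e2 : j = ⟨p, hp⟩ := Fin.ext hj'
      rw [e2]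
      exact ⟨(by rwa [Sum.swap_swap] at f3' : FixesCol h₃ x).mul f2, f3⟩

theorem mem_levi_iff {g : Sp n k} : g ∈ levi k Δ ↔ IsBlockDiagonal Δ g := by
  refine ⟨isBlockDiagonal_of_mem_levi, fun hg => ?_⟩
  obtain ⟨h, hh, hfix⟩ := exists_levi_mul_fixesCol hg n le_rfl
  have h1 : h * g = 1 := by
    refine Subtype.ext ?_
    ext b (j | j)
    · exact fixesCol_iff.1 (hfix j j.2).1 b
    · exact fixesCol_iff.1 (hfix j j.2).2 b
  rw [eq_inv_of_mul_eq_one_right h1]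
  exact inv_mem hh

end BlockDiagonal

section BlockPositions

variable {n : ℕ} {Δ : Set (Fin n)}

theorem card_filter_flagPos_lt {m : ℕ} (hm : m ≤ 2 * n) :
    (Finset.univ.filter fun b : Fin n ⊕ Fin n => flagPos b < m).card = m :=
  card_flagPos_lt 1 hm

variable (Δ) in
/-- The number of basis vectors in the blocks before that of `b`. -/
def blkStart (b : Fin n ⊕ Fin n) : ℕ := (Finset.univ.filter fun c => blk Δ c < blk Δ b).card

variable (Δ) in
/-- The number of basis vectors in the block of `b`. -/
def blkSize (b : Fin n ⊕ Fin n) : ℕ := (Finset.univ.filter fun c => blk Δ c = blk Δ b).card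

theorem blkStart_add_blkSize (b : Fin n ⊕ Fin n) : blkStart Δ b + blkSize Δ b
    = (Finset.univ.filter fun c => blk Δ c ≤ blk Δ b).card := by
  unfold blkStart blkSize
  rw [← Finset.card_union_of_disjoint]
  · congr 1
    ext c
    simp only [Finset.mem_union, Finset.mem_filter, Finset.mem_univ, true_and]
    omega
  · refine Finset.disjoint_left.2 fun c h1 h2 => ?_
    simp only [Finset.mem_filter, Finset.mem_univ, true_and] at h1 h2
    omega

theorem blkStart_add_blkSize_le (b : Fin n ⊕ Fin n) : blkStart Δ b + blkSize Δ b ≤ 2 * n := by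
  rw [blkStart_add_blkSize]
  refine (Finset.card_le_univ _).trans ?_
  rw [Fintype.card_sum, Fintype.card_fin]
  omega

theorem flagPos_mem_block (b : Fin n ⊕ Fin n) :
    blkStart Δ b ≤ flagPos b ∧ flagPos b < blkStart Δ b + blkSize Δ b := by
  have h0 := flagPos_nonneg b
  have h1 := flagPos_lt b
  constructor
  · have h2 := card_filter_flagPos_lt (n := n) (m := (flagPos b).toNat) (by omega)
    have h3 : blkStart Δ b ≤ (flagPos b).toNat := by
      rw [← h2]
      refine Finset.card_le_card fun c hc => ?_
      simp only [Finset.mem_filter, Finset.mem_univ, true_and] at hc ⊢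
      have := flagPos_lt_of_blk_lt hc
      omega
    omega
  · have h2 := card_filter_flagPos_lt (n := n) (m := (flagPos b).toNat + 1) (by omega)
    have h3 : (flagPos b).toNat + 1 ≤ blkStart Δ b + blkSize Δ b := by
      rw [← h2, blkStart_add_blkSize]
      refine Finset.card_le_card fun c hc => ?_
      simp only [Finset.mem_filter, Finset.mem_univ, true_and] at hc ⊢
      exact blk_mono (by omega)
    omega

theorem blk_eq_of_flagPos_mem {b c : Fin n ⊕ Fin n} (h : blkStart Δ b ≤ flagPos c)
    (h' : flagPos c < blkStart Δ b + blkSize Δ b) : blk Δ c = blk Δ b := by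
  have h0 := flagPos_nonneg c
  have h1 := flagPos_lt c
  rcases lt_trichotomy (blk Δ c) (blk Δ b) with h2 | h2 | h2
  · have h3 := card_filter_flagPos_lt (n := n) (m := (flagPos c).toNat + 1) (by omega)
    have h4 : (flagPos c).toNat + 1 ≤ blkStart Δ b := by
      rw [← h3]
      refine Finset.card_le_card fun d hd => ?_
      simp only [Finset.mem_filter, Finset.mem_univ, true_and] at hd ⊢
      exact (blk_mono (by omega)).trans_lt h2
    omega
  · exact h2
  · have h3 := card_filter_flagPos_lt (n := n) (m := (flagPos c).toNat) (by omega)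
    have h4 : blkStart Δ b + blkSize Δ b ≤ (flagPos c).toNat := by
      rw [← h3, blkStart_add_blkSize]
      refine Finset.card_le_card fun d hd => ?_
      simp only [Finset.mem_filter, Finset.mem_univ, true_and] at hd ⊢
      have := flagPos_lt_of_blk_lt (hd.trans_lt h2)
      omega
    omega

theorem blkStart_congr {a b : Fin n ⊕ Fin n} (h : blk Δ a = blk Δ b) :
    blkStart Δ a = blkStart Δ b := by
  rw [blkStart, blkStart, h]

theorem blkStart_swap (b : Fin n ⊕ Fin n) :
    blkStart Δ b.swap + (blkStart Δ b + blkSize Δ b) = 2 * n := by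
  obtain ⟨K, hK⟩ := exists_blk_swap Δ
  have h1 : blkStart Δ b.swap = (Finset.univ.filter fun c => ¬ blk Δ c ≤ blk Δ b).card := by
    refine Finset.card_bij' (fun c _ => c.swap) (fun c _ => c.swap) ?_ ?_ (fun c _ => c.swap_swap)
      (fun c _ => c.swap_swap) <;>
    · intro c hc
      simp only [Finset.mem_filter, Finset.mem_univ, true_and, hK] at hc ⊢
      omega
  rw [h1, blkStart_add_blkSize, add_comm, Finset.card_filter_add_card_filter_not, Finset.card_univ,
    Fintype.card_sum, Fintype.card_fin]
  omega

theorem flagPos_sub_of_adjacent {f : Fin n ⊕ Fin n → ℤ}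
    (h : ∀ a b, flagPos b = flagPos a + 1 → blk Δ a = blk Δ b → f b = f a + 1) (m : ℕ) :
    ∀ a b, flagPos b = flagPos a + m → blk Δ a = blk Δ b → f b = f a + m := by
  induction m with
  | zero =>
    intro a b hab _
    have e : b = a := flagPos_injective (by rw [hab]; simp)
    rw [e]
    simp
  | succ m ih =>
    intro a b hab hblk
    have ha := flagPos_nonneg a
    have hb := flagPos_lt b
    obtain ⟨c, hc⟩ := exists_flagPos_eq (n := n) (p := flagPos a + m) (by omega) (by omega)
    have h1 : blk Δ a = blk Δ c := le_antisymm (blk_mono (by omega)) (by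
      rw [hblk]; exact blk_mono (by omega))
    rw [h c b (by omega) (h1.symm.trans hblk), ih a c hc h1]
    push_cast
    ring

end BlockPositions

/-! ### The normalizer of a Levi subgroup -/

section Normalizer

variable {n : ℕ} {k : Type*} [NontriviallyNormedField k] [ProperSpace k] [MeasurableSpace k]
  [BorelSpace k] [CharZero k] {Δ : Set (Fin n)}

theorem torus_mul_apply {t : Sp n k} (ht : t ∈ torus n k) (g : Sp n k) (a b : Fin n ⊕ Fin n) :
    (t * g).1 a b = t.1 a a * g.1 a b := by
  change (t.1 * g.1) a b = _
  rw [Matrix.mul_apply]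
  refine Finset.sum_eq_single a (fun c _ hc => ?_) (by simp)
  rw [ht a c (Ne.symm hc), zero_mul]

theorem mul_torus_apply {t : Sp n k} (ht : t ∈ torus n k) (g : Sp n k) (a b : Fin n ⊕ Fin n) :
    (g * t).1 a b = g.1 a b * t.1 b b := by
  change (g.1 * t.1) a b = _
  rw [Matrix.mul_apply]
  refine Finset.sum_eq_single b (fun c _ hc => ?_) (by simp)
  rw [ht c b hc, mul_zero]

theorem powTorus_apply (e : Fin n ⊕ Fin n → ℤ) (he : ∀ a, e a.swap = -e a) (c : Fin n ⊕ Fin n) :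
    (powTorus k e he).1 c c = (2 : k) ^ e c := diagonal_apply_eq _ c

theorem mem_torus_of_commute {z : Sp n k} (h : ∀ t ∈ torus n k, z * t = t * z) : z ∈ torus n k := by
  intro a b hab
  have he : ∀ a : Fin n ⊕ Fin n, 2 * flagPos a.swap - (2 * n - 1) = -(2 * flagPos a - (2 * n - 1)) :=
    fun a => by rw [flagPos_swap]; ring
  have ht := powTorus_mem (k := k) (fun a : Fin n ⊕ Fin n => 2 * flagPos a - (2 * n - 1)) he
  have h1 := congrFun (congrFun (congrArg Subtype.val (h _ ht)) a) b
  change (z * powTorus k _ he).1 a b = (powTorus k _ he * z).1 a b at h1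
  rw [torus_mul_apply ht, mul_torus_apply ht] at h1
  by_contra h0
  have h2 := mul_right_cancel₀ h0 ((mul_comm _ _).trans h1)
  rw [powTorus_apply, powTorus_apply] at h2
  have h4 := two_zpow_injective h2
  exact hab (flagPos_injective (by omega))

variable (k Δ) in
theorem exists_blk_torus : ∃ z ∈ torus n k, ∀ a b, z.1 a a = z.1 b b ↔ blk Δ a = blk Δ b := by
  obtain ⟨K, hK⟩ := exists_blk_swap Δ
  have he : ∀ a, 2 * blk Δ a.swap - K = -(2 * blk Δ a - K) := fun a => by rw [hK]; ring
  refine ⟨powTorus k (fun a => 2 * blk Δ a - K) he, powTorus_mem _ he, fun a b => ?_⟩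
  rw [powTorus_apply, powTorus_apply]
  constructor
  · intro h
    have := two_zpow_injective h
    omega
  · intro h
    rw [h]

theorem blk_eq_of_mem_normalizer {g : Sp n k}
    (hg : g ∈ Subgroup.normalizer (levi k Δ : Set (Sp n k))) {a a' b b' : Fin n ⊕ Fin n}
    (h : g.1 a b ≠ 0) (h' : g.1 a' b' ≠ 0) (e : blk Δ a = blk Δ a') : blk Δ b = blk Δ b' := by
  obtain ⟨z, hz, hzb⟩ := exists_blk_torus k Δ
  have hzc : ∀ m ∈ levi k Δ, z * m = m * z := fun m hm => by
    refine Subtype.ext ?_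
    ext c d
    rw [torus_mul_apply hz, mul_torus_apply hz]
    by_cases hcd : m.1 c d = 0
    · rw [hcd, mul_zero, zero_mul]
    · rw [(hzb c d).2 (isBlockDiagonal_of_mem_levi hm c d hcd), mul_comm]
  set y := g * z * g⁻¹ with hy
  have hyc : ∀ m ∈ levi k Δ, y * m = m * y := fun m hm => by
    have h1 : g⁻¹ * m * g ∈ levi k Δ := by
      refine (Subgroup.mem_normalizer_iff.1 hg _).2 ?_
      have : g * (g⁻¹ * m * g) * g⁻¹ = m := by group
      rwa [this]
    calc y * m = g * (z * (g⁻¹ * m * g)) * g⁻¹ := by rw [hy]; group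
      _ = g * ((g⁻¹ * m * g) * z) * g⁻¹ := by rw [hzc _ h1]
      _ = m * y := by rw [hy]; group
  have hyt : y ∈ torus n k := mem_torus_of_commute fun t ht => hyc t (torus_le_levi ht)
  have h1 : y.1 a a = y.1 a' a' := by
    by_cases haa : a = a'
    · rw [haa]
    · obtain ⟨x, hx, -, hx1⟩ := exists_transvection (k := k) haa e 1
      have h2 := congrFun (congrFun (congrArg Subtype.val (hyc x hx)) a) a'
      rwa [torus_mul_apply hyt, mul_torus_apply hyt, hx1, mul_one, one_mul] at h2
  have h2 : ∀ c d, y.1 c c * g.1 c d = g.1 c d * z.1 d d := fun c d => by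
    rw [← torus_mul_apply hyt, ← mul_torus_apply hz, hy, inv_mul_cancel_right]
  have h3 : ∀ c d, g.1 c d ≠ 0 → y.1 c c = z.1 d d := fun c d hcd =>
    mul_left_cancel₀ hcd ((mul_comm _ _).trans (h2 c d))
  rw [← hzb, ← h3 a b h, ← h3 a' b' h', h1]

theorem blk_eq_of_mem_normalizer' {g : Sp n k}
    (hg : g ∈ Subgroup.normalizer (levi k Δ : Set (Sp n k))) {a a' b b' : Fin n ⊕ Fin n}
    (h : g.1 a b ≠ 0) (h' : g.1 a' b' ≠ 0) (e : blk Δ b = blk Δ b') : blk Δ a = blk Δ a' := by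
  have key : ∀ c d, g.1 c d ≠ 0 → (g⁻¹).1 d.swap c.swap ≠ 0 := fun c d hcd => by
    rw [inv_apply_eq, Sum.swap_swap, Sum.swap_swap]
    exact mul_ne_zero (mul_ne_zero (formSign_ne_zero _) (formSign_ne_zero _)) hcd
  exact blk_swap_eq_iff.1 (blk_eq_of_mem_normalizer (inv_mem hg) (key _ _ h) (key _ _ h')
    (blk_swap_eq_iff.2 e))

theorem exists_perm_ne_zero (g : Sp n k) : ∃ r : Equiv.Perm (Fin n ⊕ Fin n), ∀ b, g.1 (r b) b ≠ 0 := by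
  by_contra! hcon
  have h1 : g.1.det = 0 := by
    rw [Matrix.det_apply]
    refine Finset.sum_eq_zero fun r _ => ?_
    obtain ⟨b, hb⟩ := hcon r
    refine (congrArg (Equiv.Perm.sign r • ·)
      (Finset.prod_eq_zero (f := fun j => g.1 (r j) j) (Finset.mem_univ b) hb)).trans ?_
    exact smul_zero _
  exact (SymplecticGroup.symplectic_det g.2).ne_zero h1

theorem exists_blockShift {g : Sp n k} (hg : g ∈ Subgroup.normalizer (levi k Δ : Set (Sp n k))) :
    ∃ w : Equiv.Perm (Fin n ⊕ Fin n), IsSigned w ∧ (∀ a b, g.1 a b ≠ 0 → blk Δ (w b) = blk Δ a) ∧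
      ∀ a b, blk Δ a = blk Δ b → flagPos (w b) - flagPos b = flagPos (w a) - flagPos a := by
  obtain ⟨r, hr⟩ := exists_perm_ne_zero g
  have hrb : ∀ a b, blk Δ (r a) = blk Δ (r b) ↔ blk Δ a = blk Δ b := fun a b =>
    ⟨blk_eq_of_mem_normalizer hg (hr a) (hr b), blk_eq_of_mem_normalizer' hg (hr a) (hr b)⟩
  have hsize : ∀ b, blkSize Δ (r b) = blkSize Δ b := fun b => by
    refine (Finset.card_bij' (fun c _ => r c) (fun c _ => r.symm c) (fun c hc => ?_) (fun c hc => ?_)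
      (fun c _ => r.symm_apply_apply c) (fun c _ => r.apply_symm_apply c)).symm
    · simp only [Finset.mem_filter, Finset.mem_univ, true_and] at hc ⊢
      rw [hrb, hc]
    · simp only [Finset.mem_filter, Finset.mem_univ, true_and] at hc ⊢
      rw [← hrb, r.apply_symm_apply, hc]
  have hswap : ∀ b, blk Δ (r b.swap) = blk Δ (r b).swap := fun b => by
    have h1 : ((g⁻¹).1 * g.1) b b = 1 := by
      have h2 : (g⁻¹).1 * g.1 = 1 := congrArg Subtype.val (inv_mul_cancel g)
      rw [h2, Matrix.one_apply_eq]
    rw [Matrix.mul_apply] at h1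
    obtain ⟨a, -, ha⟩ := Finset.exists_ne_zero_of_sum_ne_zero (by rw [h1]; exact one_ne_zero)
    have h3 := left_ne_zero_of_mul ha
    rw [inv_apply_eq] at h3
    rw [blk_eq_of_mem_normalizer' hg (hr b.swap) (right_ne_zero_of_mul h3) rfl, blk_swap_eq_iff]
    exact blk_eq_of_mem_normalizer' hg (right_ne_zero_of_mul ha) (hr b) rfl
  have hf : ∀ b, ∃ c : Fin n ⊕ Fin n, flagPos c = blkStart Δ (r b) - blkStart Δ b + flagPos b := fun b => by
    have h1 := flagPos_mem_block (Δ := Δ) b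
    have h2 := hsize b
    have h3 := blkStart_add_blkSize_le (Δ := Δ) (r b)
    exact exists_flagPos_eq (by omega) (by omega)
  choose f hf using hf
  have hfb : ∀ b, blk Δ (f b) = blk Δ (r b) := fun b => by
    have h1 := flagPos_mem_block (Δ := Δ) b
    have h2 := hsize b
    have h3 := hf b
    exact blk_eq_of_flagPos_mem (by omega) (by omega)
  have hinj : Function.Injective f := fun a b hab => by
    have h1 : blk Δ (r a) = blk Δ (r b) := by rw [← hfb, ← hfb, hab]
    have h2 := blkStart_congr h1
    have h3 := blkStart_congr ((hrb a b).1 h1)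
    have h4 := hf a
    have h5 := hf b
    rw [hab] at h4
    exact flagPos_injective (by omega)
  refine ⟨Equiv.ofBijective f (Finite.injective_iff_bijective.1 hinj), fun b => ?_, fun a b hab => ?_,
    fun a b hab => ?_⟩
  · refine flagPos_injective ?_
    change flagPos (f b.swap) = flagPos (f b).swap
    have h1 := blkStart_swap (Δ := Δ) b
    have h2 := blkStart_swap (Δ := Δ) (r b)
    have h3 := blkStart_congr (hswap b)
    have h4 := hsize b
    rw [hf, flagPos_swap, flagPos_swap, hf]
    omega
  · exact (hfb b).trans (blk_eq_of_mem_normalizer' hg (hr b) hab rfl)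
  · change flagPos (f b) - flagPos b = flagPos (f a) - flagPos a
    have h1 := blkStart_congr ((hrb a b).2 hab)
    have h2 := blkStart_congr hab
    rw [hf, hf]
    omega

theorem HasSupport.image_range_xPos {g : Sp n k} {w : Equiv.Perm (Fin n ⊕ Fin n)}
    (hg : HasSupport g w) {i j : Fin n}
    (h : (w (Sum.inl i) = Sum.inl j ∧ w (nextElt i) = nextElt j) ∨
      (w (Sum.inl i) = (nextElt j).swap ∧ w (nextElt i) = Sum.inr j)) :
    (fun x => g * x * g⁻¹) '' Set.range (xPos (k := k) i) = Set.range (xPos (k := k) j) := by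
  have h1 : rootSet k (w (Sum.inl i)) (w (nextElt i)) = rootSet k (Sum.inl j) (nextElt j) := by
    rcases h with ⟨e1, e2⟩ | ⟨e1, e2⟩
    · rw [e1, e2]
    · rw [e1, e2]
      exact rootSet_swap (Sum.inl j) (nextElt j)
  ext y
  rw [← mem_rootSet_iff, ← h1]
  constructor
  · rintro ⟨x, hx, rfl⟩
    exact hg.conj_mem_rootSet (mem_rootSet_iff.2 hx)
  · intro hy
    refine ⟨g⁻¹ * y * g, mem_rootSet_iff.1 ?_, by group⟩
    have h2 := hg.inv.conj_mem_rootSet hy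
    rw [inv_inv] at h2
    rwa [show w⁻¹ (w (Sum.inl i)) = Sum.inl i from w.symm_apply_apply _,
      show w⁻¹ (w (nextElt i)) = nextElt i from w.symm_apply_apply _] at h2

theorem blk_nextElt {i : Fin n} (hi : i ∈ Δ) : blk Δ (Sum.inl i) = blk Δ (nextElt i) :=
  (blk_eq_iff_linked (by rw [flagPos_nextElt, flagPos_inl])).2 ⟨i, hi, Or.inl rfl⟩

theorem exists_isLeviRepresentative (w : weyl (levi k Δ)) :
    ∃ w₀, IsLeviRepresentative Δ w₀ w := by
  obtain ⟨⟨g, hg⟩, rfl⟩ := QuotientGroup.mk_surjective w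
  obtain ⟨v, hv, hgv, hshift⟩ := exists_blockShift hg
  obtain ⟨l, rfl⟩ := hv.exists_wordPerm
  set m : Sp n k := wordRep k l with hm
  have hs : HasSupport m (wordPerm l) := hasSupport_wordRep l
  have hblk : ∀ a b, blk Δ (wordPerm l a) = blk Δ (wordPerm l b) → blk Δ a = blk Δ b :=
    fun a b hab => by
    obtain ⟨c, hc⟩ := exists_ne_zero_col g a
    obtain ⟨d, hd⟩ := exists_ne_zero_col g b
    refine blk_eq_of_mem_normalizer hg hc hd ?_
    rw [← hgv c a hc, ← hgv d b hd, hab]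
  have h1 : m⁻¹ * g ∈ levi k Δ := by
    rw [mem_levi_iff]
    intro a b hab
    change ((m⁻¹).1 * g.1) a b ≠ 0 at hab
    rw [Matrix.mul_apply] at hab
    obtain ⟨c, -, hc⟩ := Finset.exists_ne_zero_of_sum_ne_zero hab
    have h2 := hs.inv _ _ (left_ne_zero_of_mul hc)
    rw [Equiv.Perm.inv_eq_iff_eq] at h2
    refine hblk a b ?_
    rw [← h2, hgv _ _ (right_ne_zero_of_mul hc)]
  have h2 : m ∈ Subgroup.normalizer (levi k Δ : Set (Sp n k)) := by
    have h3 : m = g * (m⁻¹ * g)⁻¹ := by group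
    rw [h3]
    exact mul_mem hg (inv_mem (Subgroup.le_normalizer h1))
  refine ⟨QuotientGroup.mk ⟨m, hasSupport_mem_normalizer hs⟩, m, ⟨_, rfl⟩, ⟨h2, ?_⟩, fun i hi => ?_⟩
  · rw [QuotientGroup.eq, Subgroup.mem_subgroupOf]
    exact h1
  · have h3 := hshift _ _ (blk_nextElt hi)
    rw [flagPos_nextElt, flagPos_inl] at h3
    have h4 : blk Δ (wordPerm l (Sum.inl i)) = blk Δ (wordPerm l (nextElt i)) := by
      obtain ⟨c, hc⟩ := exists_ne_zero_col g (Sum.inl i)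
      obtain ⟨d, hd⟩ := exists_ne_zero_col g (nextElt i)
      rw [hgv _ _ hc, hgv _ _ hd]
      exact blk_eq_of_mem_normalizer' hg hc hd (blk_nextElt hi)
    obtain ⟨j, hj, hp⟩ := (blk_eq_iff_linked (by omega)).1 h4
    refine ⟨j, hj, hs.image_range_xPos ?_⟩
    rcases hp with hp | hp
    · exact Or.inl ⟨flagPos_injective hp, flagPos_injective (by rw [flagPos_nextElt]; omega)⟩
    · exact Or.inr ⟨flagPos_injective (by rw [flagPos_swap, flagPos_nextElt]; omega),
        flagPos_injective (by rw [flagPos_inr]; omega)⟩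

theorem HasSupport.adjacent_of_image_eq {g : Sp n k} {w : Equiv.Perm (Fin n ⊕ Fin n)}
    (hg : HasSupport g w) {i j : Fin n}
    (h : (fun x => g * x * g⁻¹) '' Set.range (xPos (k := k) i) = Set.range (xPos (k := k) j)) :
    flagPos (w (nextElt i)) = flagPos (w (Sum.inl i)) + 1 := by
  have h1 : g * xPos i 1 * g⁻¹ ∈ rootSet k (Sum.inl j) (nextElt j) := by
    rw [mem_rootSet_iff, ← h]
    exact ⟨_, ⟨1, rfl⟩, rfl⟩
  have h2 := hg.conj_apply (x := xPos i 1) (Sum.inl i) (nextElt i)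
  rw [xPos_apply, mul_one] at h2
  have h3 := h1 (w (Sum.inl i)) (w (nextElt i)) (by
    rw [Matrix.sub_apply, h2, Matrix.one_apply_ne (w.injective.ne (inl_ne_nextElt i)), sub_zero]
    exact hg.conj_coeff_ne_zero _ _)
  rcases h3 with ⟨e1, e2⟩ | ⟨e1, e2⟩
  · rw [e1, e2, flagPos_nextElt, flagPos_inl]
  · rw [e1, e2, flagPos_swap, flagPos_swap, flagPos_nextElt, flagPos_inl]
    ring

theorem HasSupport.shift_of_image_eq {g : Sp n k} {w : Equiv.Perm (Fin n ⊕ Fin n)}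
    (hg : HasSupport g w) (h : ∀ i ∈ Δ, ∃ j ∈ Δ,
      (fun x => g * x * g⁻¹) '' Set.range (xPos (k := k) i) = Set.range (xPos (k := k) j))
    {a b : Fin n ⊕ Fin n} (hab : blk Δ a = blk Δ b) :
    flagPos (w b) - flagPos b = flagPos (w a) - flagPos a := by
  have hadj : ∀ a b, flagPos b = flagPos a + 1 → blk Δ a = blk Δ b →
      flagPos (w b) = flagPos (w a) + 1 := fun a b hpos hblk => by
    obtain ⟨i, hi, hp⟩ := (blk_eq_iff_linked hpos).1 hblk
    obtain ⟨j, -, hj⟩ := h i hi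
    have h1 := hg.adjacent_of_image_eq hj
    rcases hp with hp | hp
    · have e1 : a = Sum.inl i := flagPos_injective (by rw [flagPos_inl]; omega)
      have e2 : b = nextElt i := flagPos_injective (by rw [flagPos_nextElt]; omega)
      rw [e1, e2, h1]
    · have e1 : a = (nextElt i).swap := flagPos_injective (by
        rw [flagPos_swap, flagPos_nextElt]; omega)
      have e2 : b = (Sum.inl i : Fin n ⊕ Fin n).swap := flagPos_injective (by
        rw [flagPos_swap, flagPos_inl]; omega)
      rw [e1, e2, hg.isSigned, hg.isSigned, flagPos_swap, flagPos_swap, h1]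
      ring
  have key := flagPos_sub_of_adjacent hadj
  rcases le_total (flagPos a) (flagPos b) with h1 | h1
  · have h2 := key (flagPos b - flagPos a).toNat a b (by omega) hab
    omega
  · have h2 := key (flagPos a - flagPos b).toNat b a (by omega) hab.symm
    omega

theorem perm_eq_of_shift {v w : Equiv.Perm (Fin n ⊕ Fin n)}
    (hv : ∀ a b, blk Δ a = blk Δ b → flagPos (v b) - flagPos b = flagPos (v a) - flagPos a)
    (hw : ∀ a b, blk Δ a = blk Δ b → flagPos (w b) - flagPos b = flagPos (w a) - flagPos a)
    (h : ∀ a, blk Δ ((v⁻¹ * w) a) = blk Δ a) : v = w := by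
  have h1 : ∀ a b, blk Δ a = blk Δ b →
      flagPos ((v⁻¹ * w) b) - flagPos b = flagPos ((v⁻¹ * w) a) - flagPos a := fun a b hab => by
    have e : ∀ c, v ((v⁻¹ * w) c) = w c := fun c => v.apply_symm_apply (w c)
    have h2 := hv a ((v⁻¹ * w) a) (h a).symm
    have h3 := hv b ((v⁻¹ * w) b) (h b).symm
    have h4 := hv a b hab
    have h5 := hw a b hab
    rw [e] at h2 h3
    omega
  have h2 : ∀ a, (v⁻¹ * w) a = a := fun a => by
    have hne : (Finset.univ.filter fun b => blk Δ b = blk Δ a).Nonempty := ⟨a, by simp⟩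
    obtain ⟨b, hb, hmax⟩ := Finset.exists_max_image _ flagPos hne
    obtain ⟨c, hc, hmin⟩ := Finset.exists_min_image _ flagPos hne
    simp only [Finset.mem_filter, Finset.mem_univ, true_and] at hb hc hmax hmin
    have k1 := hmax _ ((h b).trans hb)
    have k2 := hmin _ ((h c).trans hc)
    have k3 := h1 a b hb.symm
    have k4 := h1 a c hc.symm
    exact flagPos_injective (by omega)
  exact inv_mul_eq_one.1 (Equiv.ext h2)

theorem IsLeviRepresentative.unique {w : weyl (levi k Δ)} {w₀ w₁ : weyl (torus n k)}
    (h₀ : IsLeviRepresentative Δ w₀ w) (h₁ : IsLeviRepresentative Δ w₁ w) : w₀ = w₁ := by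
  obtain ⟨g, hg, ⟨hgn, hgw⟩, hgi⟩ := h₀
  obtain ⟨g', hg', ⟨hgn', hgw'⟩, hgi'⟩ := h₁
  obtain ⟨v, hv⟩ := exists_hasSupport hg.1
  obtain ⟨v', hv'⟩ := exists_hasSupport hg'.1
  have h1 : g⁻¹ * g' ∈ levi k Δ := by
    have h2 := hgw.trans hgw'.symm
    rw [QuotientGroup.eq, Subgroup.mem_subgroupOf] at h2
    exact h2
  have h2 : v = v' := by
    refine perm_eq_of_shift (Δ := Δ) (fun a b => hv.shift_of_image_eq hgi)
      (fun a b => hv'.shift_of_image_eq hgi') fun a => ?_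
    exact isBlockDiagonal_of_mem_levi h1 _ _ ((hv.inv.mul hv').ne_zero a)
  have h3 := (represents_torus_iff hg hv hv').2 h2.symm
  exact h3.2.symm.trans hg'.2

theorem existsUnique_isLeviRepresentative (w : weyl (levi k Δ)) :
    ∃! w₀ : weyl (torus n k), IsLeviRepresentative Δ w₀ w := by
  obtain ⟨w₀, h⟩ := exists_isLeviRepresentative w
  exact ⟨w₀, h, fun w₁ h₁ => h₁.unique h⟩

end Normalizer

end SpringerMp

end

theorem mainTheorem7 {k : Type*} [NontriviallyNormedField k] [ProperSpace k] [CharZero k]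
    [MeasurableSpace k] [BorelSpace k] (ψ : AddChar k Circle) (hψ : Continuous ψ) (hψ₁ : ψ ≠ 1)
    (n : ℕ) (hn : 1 ≤ n) :
    -- the lifts of the simple reflections are well defined
    (∀ i : Fin n, ∃! z : SpringerMp.metaplectic n ψ hψ, SpringerMp.IsSimpleLift i z) ∧
    ∀ wt : Fin n → SpringerMp.metaplectic n ψ hψ, (∀ i, SpringerMp.IsSimpleLift i (wt i)) →
      -- for a long simple root, the lift differs from `x_α(1) x_{-α}(-1) x_α(1)` by an element
      -- of `μ₈`, and its square is `-1`
      (∀ i, SpringerMp.IsLong i →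
        (∃ c z : SpringerMp.metaplectic n ψ hψ, c.1 ∈ SpringerMp.mu8 n k ∧
          SpringerMp.IsSpringerElement i z ∧ wt i = c * z) ∧
        SpringerMp.IsNegOne i (wt i ^ 2)) ∧
      -- the braid relations
      (∀ i j : Fin n, i ≠ j →
        SpringerMp.wordLift wt (CoxeterSystem.alternatingWord i j (CoxeterMatrix.B n i j)) =
          SpringerMp.wordLift wt (CoxeterSystem.alternatingWord j i (CoxeterMatrix.B n i j))) ∧
      -- independence of the reduced decomposition, for the Weyl group
      (∀ w : SpringerMp.weyl (SpringerMp.torus n k),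
        (∃ l, SpringerMp.IsReducedDecomposition l w) ∧
        ∀ l l', SpringerMp.IsReducedDecomposition l w → SpringerMp.IsReducedDecomposition l' w →
          SpringerMp.wordLift wt l = SpringerMp.wordLift wt l') ∧
      -- the lift of `w ∈ W(M)` is well defined, for every standard Levi subgroup `M`
      (∀ (Δ : Set (Fin n)) (w : SpringerMp.weyl (SpringerMp.levi k Δ)),
        (∃! w₀ : SpringerMp.weyl (SpringerMp.torus n k),
          SpringerMp.IsLeviRepresentative Δ w₀ w) ∧
        ∃! z : SpringerMp.metaplectic n ψ hψ,
          ∃ (w₀ : SpringerMp.weyl (SpringerMp.torus n k)) (l : List (Fin n)),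
            SpringerMp.IsLeviRepresentative Δ w₀ w ∧ SpringerMp.IsReducedDecomposition l w₀ ∧
            z = SpringerMp.wordLift wt l) := by
  refine ⟨SpringerMp.existsUnique_isSimpleLift hψ₁, fun wt hwt => ⟨fun i hi =>
    ⟨(hwt i).exists_mul_eq hψ₁ hi, (hwt i).isNegOne_sq hψ₁ hi⟩, fun i j hij =>
    SpringerMp.wordLift_eq hψ₁ hwt (SpringerMp.braid_wordRep hij), fun w =>
    ⟨SpringerMp.exists_isReducedDecomposition w, fun l l' hl hl' =>
      SpringerMp.wordLift_eq hψ₁ hwt (hl.wordRep_eq hl')⟩, fun Δ w =>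
    ⟨SpringerMp.existsUnique_isLeviRepresentative w, ?_⟩⟩⟩
  obtain ⟨w₀, hw₀⟩ := SpringerMp.exists_isLeviRepresentative w
  obtain ⟨l, hl⟩ := SpringerMp.exists_isReducedDecomposition w₀
  refine ⟨SpringerMp.wordLift wt l, ⟨w₀, l, hw₀, hl, rfl⟩, ?_⟩
  rintro _ ⟨w₁, l', hw₁, hl', rfl⟩
  rw [hw₁.unique hw₀] at hl'
  exact SpringerMp.wordLift_eq hψ₁ hwt (hl'.wordRep_eq hl)
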